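/- Let $M$ be a sphere with a Euclidean polyhedral metric, that is, every point has a neighbourhood isometric either to a plane disc (regular point) or to a neighbourhood of the apex of a cone of angle $\neq 2\pi$ (singular point); let $\Sigma$ be the (finite) set of singular points. A geodesic triangulation $T$ of $M$ is a decomposition of $M$ into finitely many Euclidean triangles with vertex set $\Sigma$; loops, multiple edges and self-identified triangles are allowed. A pair $(T,r)$ with $r=(r_i)_{i\in\Sigma}$, $r_i>0$, is a generalized polytope with boundary $M$ if over every triangle $ijk$ of $T$ there is a non-degenerate pyramid with side edges $r_i,r_j,r_k$; these pyramids are glued along $T$, with common apex $a$. For an oriented edge $e$ of $T$ with reverse $-e$, let $i=a(e)$ and $j=b(e)$ be its initial and terminal vertex, $\ell_e$ its length, $\alpha_e,\alpha_{-e}$ the dihedral angles at $e$ of the two pyramids adjacent to $e$, $\theta_e=\alpha_e+\alpha_{-e}$, $\rho_e$ the angle at $a(e)$ and $\varphi_e$ the angle at the apex in the triangle spanned by the apex and $e$. Let $\omega_i$ be the sum of the dihedral angles of the pyramids at the edge from the apex to $i$, let $\kappa_i=2\pi-\omega_i$, and $$H=\sum_{i\in\Sigma} r_i\kappa_i+\sum_{e}\ell_e(\pi-\theta_e),$$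 the second sum being over the unoriented edges of $T$. The generalized polytope is convex if $\theta_e\le\pi$ for all $e$. Let $\mathcal P(M)\subset\mathbb R^\Sigma$ be the set of all $r$ such that $(T,r)$ is a generalized convex polytope for some $T$. Derivatives on $\mathcal P(M)$ are (total) derivatives relative to $\mathcal P(M)$. Then $H$ and the $\kappa_i$ depend only on $r\in\mathcal P(M)$ and not on $T$, the function $H$ is of class $C^2$ on $\mathcal P(M)$, and $$\frac{\partial H}{\partial r_i}=\kappa_i .$$ For every generalized convex polytope $(T,r)$ the function $\kappa_i$ is differentiable at $r$ with $$\frac{\partial\kappa_i}{\partial r_j}=\sum_{e:\,a(e)=i}\frac{\cot\alpha_e+\cot\alpha_{-e}}{\sin\rho_e}\,\frac{\partial\rho_e}{\partial r_j},\qquad \frac{\partial\rho_e}{\partial r_j}=\begin{cases}\dfrac{1}{\ell_e\sin\rho_{-e}}& a(e)\ne j=b(e),\\[2mm]-\dfrac{\cos\varphi_e}{\ell_e\sin\rho_{-e}}& a(e)=j\neq b(e),\\[2mm]\dfrac{\ell_e}{2r_j^2\sin\rho_e}& a(e)=j=b(e),\\[2mm]0&\text{otherwise.}\end{cases}$$ In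 particular, if $T$ has neither loops nor multiple edges, so that an edge from $i$ to $j$ may be denoted $ij$, then $$\frac{\partial\kappa_i}{\partial r_j}=\frac{\cot\alpha_{ij}+\cot\alpha_{ji}}{\ell_{ij}\sin\rho_{ij}\sin\rho_{ji}}\ \text{ if } ij \text{ is an edge of } T,\qquad \frac{\partial\kappa_i}{\partial r_j}=0\ \text{ if } i\ne j \text{ and } ij \text{ is not an edge of } T,$$ $$\frac{\partial\kappa_i}{\partial r_i}=-\sum_{j}\cos\varphi_{ij}\,\frac{\partial\kappa_i}{\partial r_j},$$ the last sum being over the $j$ for which $ij$ is an edge of $T$. -/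

import Mathlib

noncomputable section

/-- The Euclidean plane. -/
abbrev Plane : Type := EuclideanSpace ℝ (Fin 2)

/-- Euclidean three-space. -/
abbrev Space : Type := EuclideanSpace ℝ (Fin 3)

/-! ### Euclidean polyhedral metrics -/

/-- The distance, in the cone with total angle `α`, between the points with polar coordinates
`(s, a)` and `(t, b)`; `s`, `t` are distances to the apex, and the angles are read modulo `α`.
The norm of `AddCircle α` is the distance to the nearest multiple of `α`. -/
def coneDist (α s a t b : ℝ) : ℝ :=
  Real.sqrt (s ^ 2 + t ^ 2 -
    2 * s * t * Real.cos (min Real.pi ‖((a - b : ℝ) : AddCircle α)‖))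

/-- `x` has a neighbourhood isometric to a disc of the Euclidean plane. -/
def IsRegularPoint {M : Type*} [MetricSpace M] (x : M) : Prop :=
  ∃ ε > 0, Nonempty (Metric.ball x ε ≃ᵢ Metric.ball (0 : Plane) ε)

/-- `x` has a neighbourhood isometric to the ball around the apex of the cone with angle `α`,
by an isometry that takes `x` to the apex. The isometry is written in polar coordinates `c`. -/
def IsConePoint {M : Type*} [MetricSpace M] (x : M) (α : ℝ) : Prop :=
  ∃ ε > 0, ∃ c : ℝ → ℝ → M, c 0 0 = x ∧
    (∀ y, y ∈ Metric.ball x ε ↔ ∃ s ∈ Set.Ico 0 ε, ∃ a, c s a = y) ∧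
    ∀ s ∈ Set.Ico 0 ε, ∀ t ∈ Set.Ico 0 ε, ∀ a b, dist (c s a) (c t b) = coneDist α s a t b

/-- The metric of `M` is a Euclidean polyhedral metric. -/
def IsEuclideanPolyhedral (M : Type*) [MetricSpace M] : Prop :=
  ∀ x : M, IsRegularPoint x ∨ ∃ α : ℝ, 0 < α ∧ α ≠ 2 * Real.pi ∧ IsConePoint x α

/-- The set `Σ` of singular points. -/
def singularSet (M : Type*) [MetricSpace M] : Set M := {x | ¬ IsRegularPoint x}

/-! ### Geodesic triangulations -/

/-- A geodesic triangulation of a (coherently orientable) polyhedral surface `M`: a decomposition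
of `M` into finitely many Euclidean triangles whose vertex set is the singular set.
Each face `f` is a plane triangle with a map to `M`, isometric near every point except the
corners; points of `M` in the interior of a face have only one preimage. Sides may be
identified within one face, and different edges may have the same ends.
The pair `(f, k)` stands for the side of `f` that goes from the `k`-th to the `(k+1)`-st corner
(indices mod 3); corners are numbered coherently with an orientation of `M`, so these pairs are
the oriented edges, `(f, k)` having `f` on a given side, and `opp` reverses an oriented edge. -/
structure GeodesicTriangulation (M : Type*) [MetricSpace M] where
  faceCount : ℕ
  corner : Fin faceCount → Fin 3 → Plane
  nondegenerate : ∀ f, AffineIndependent ℝ (corner f)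
  toSurface : Fin faceCount → Plane → M
  continuousOn : ∀ f, ContinuousOn (toSurface f) (convexHull ℝ (Set.range (corner f)))
  locallyIsometric : ∀ f, ∀ x ∈ convexHull ℝ (Set.range (corner f)) \ Set.range (corner f),
    ∃ ε > 0, ∀ y ∈ convexHull ℝ (Set.range (corner f)) ∩ Metric.ball x ε,
      ∀ z ∈ convexHull ℝ (Set.range (corner f)) ∩ Metric.ball x ε,
        dist (toSurface f y) (toSurface f z) = dist y z
  corner_mem : ∀ f k, toSurface f (corner f k) ∈ singularSet M
  not_mem : ∀ f, ∀ x ∈ convexHull ℝ (Set.range (corner f)) \ Set.range (corner f),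
    toSurface f x ∉ singularSet M
  covers : ∀ y : M, ∃ f, ∃ x ∈ convexHull ℝ (Set.range (corner f)), toSurface f x = y
  interior_inj : ∀ f g, ∀ x ∈ interior (convexHull ℝ (Set.range (corner f))),
    ∀ y ∈ convexHull ℝ (Set.range (corner g)), toSurface f x = toSurface g y → f = g ∧ x = y
  opp : Fin faceCount × Fin 3 → Fin faceCount × Fin 3
  opp_ne : ∀ e, opp e ≠ e
  opp_opp : ∀ e, opp (opp e) = e
  glue : ∀ e, ∀ t ∈ Set.Icc (0 : ℝ) 1,
    toSurface e.1 (AffineMap.lineMap (corner e.1 e.2) (corner e.1 (e.2 + 1)) t) =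
      toSurface (opp e).1
        (AffineMap.lineMap (corner (opp e).1 ((opp e).2 + 1)) (corner (opp e).1 (opp e).2) t)

/-- The plane as the horizontal coordinate plane of three-space. -/
def planeToSpace (x : Plane) : Space := !₂[x 0, x 1, 0]

/-- The component of `w` orthogonal to `d`. -/
def orthComponent (d w : Space) : Space := w - (inner ℝ d w / inner ℝ d d) • d

/-- The dihedral angle at the line `xy` between the half-planes through `u` and through `v`. -/
def dihedralAngle (x y u v : Space) : ℝ :=
  InnerProductGeometry.angle (orthComponent (y - x) (u - x)) (orthComponent (y - x) (v - x))

namespace GeodesicTriangulation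

variable {M : Type*} [MetricSpace M] (T : GeodesicTriangulation M) (r : singularSet M → ℝ)

/-- Oriented edges. -/
abbrev OrientedEdge : Type := Fin T.faceCount × Fin 3

/-- Initial vertex of an oriented edge; also the vertex at the corner `e.2` of the face `e.1`. -/
def src (e : T.OrientedEdge) : singularSet M :=
  ⟨T.toSurface e.1 (T.corner e.1 e.2), T.corner_mem e.1 e.2⟩

/-- Terminal vertex of an oriented edge. -/
def tgt (e : T.OrientedEdge) : singularSet M := T.src (e.1, e.2 + 1)

/-- Length of an edge. -/
def len (e : T.OrientedEdge) : ℝ := dist (T.corner e.1 e.2) (T.corner e.1 (e.2 + 1))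

/-- The triangulation has neither loops nor multiple edges. -/
def IsSimple : Prop :=
  (∀ e, T.src e ≠ T.tgt e) ∧ ∀ e e', T.src e = T.src e' → T.tgt e = T.tgt e' → e = e'

/-- The base of the pyramid over the face `f`, placed in three-space. -/
def base (f : Fin T.faceCount) (k : Fin 3) : Space := planeToSpace (T.corner f k)

/-- `a` is the apex of a (non-degenerate) pyramid with base `f` whose side edges have lengths
given by the radii. Such a point of the upper half-space is unique if it exists. -/
def IsApex (f : Fin T.faceCount) (a : Space) : Prop :=
  0 < a 2 ∧ ∀ k, dist a (T.base f k) = r (T.src (f, k))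

/-- The couple `(T, r)` defines a generalized polytope. -/
def IsGeneralizedPolytope : Prop := (∀ i, 0 < r i) ∧ ∀ f, ∃ a, T.IsApex r f a

/-- The apex of the pyramid over `f`. -/
def apex (f : Fin T.faceCount) : Space := Classical.epsilon (T.IsApex r f)

/-- Dihedral angle `α_e`, at the boundary edge `e`, of the pyramid over the face `e.1`. -/
def alpha (e : T.OrientedEdge) : ℝ :=
  dihedralAngle (T.base e.1 e.2) (T.base e.1 (e.2 + 1)) (T.apex r e.1) (T.base e.1 (e.2 + 2))

/-- Dihedral angle of the pyramid over the face `e.1` at its side edge from the apex to the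
corner `e.2`. -/
def omega (e : T.OrientedEdge) : ℝ :=
  dihedralAngle (T.apex r e.1) (T.base e.1 e.2) (T.base e.1 (e.2 + 1)) (T.base e.1 (e.2 + 2))

/-- Angle `ρ_e` at the initial vertex of `e` in the triangle spanned by the apex and `e`. -/
def rho (e : T.OrientedEdge) : ℝ :=
  EuclideanGeometry.angle (T.apex r e.1) (T.base e.1 e.2) (T.base e.1 (e.2 + 1))

/-- Angle `φ_e` at the apex in the triangle spanned by the apex and `e`. -/
def phi (e : T.OrientedEdge) : ℝ :=
  EuclideanGeometry.angle (T.base e.1 e.2) (T.apex r e.1) (T.base e.1 (e.2 + 1))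

/-- Total dihedral angle `θ_e` at a boundary edge. -/
def theta (e : T.OrientedEdge) : ℝ := T.alpha r e + T.alpha r (T.opp e)

/-- The couple `(T, r)` defines a generalized convex polytope. -/
def IsConvexPolytope : Prop := T.IsGeneralizedPolytope r ∧ ∀ e, T.theta r e ≤ Real.pi

open scoped Classical in
/-- The oriented edges with initial vertex `i`. They also enumerate the corners of faces at `i`. -/
def edgesFrom (i : singularSet M) : Finset T.OrientedEdge :=
  Finset.univ.filter fun e => T.src e = i

/-- Curvature `κ_i = 2π - ω_i` at the side edge from the apex to `i`. -/
def curvature (i : singularSet M) : ℝ :=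
  2 * Real.pi - ∑ e ∈ T.edgesFrom i, T.omega r e

/-- Total scalar curvature of the polytope `(T, r)`. Every edge carries two orientations,
hence the factor `1 / 2` in front of the sum over oriented edges. -/
def totalScalarCurvature [Fintype (singularSet M)] : ℝ :=
  ∑ i, r i * T.curvature r i +
    (1 / 2) * ∑ e : T.OrientedEdge, T.len e * (Real.pi - T.theta r e)

open scoped Classical in
/-- The expression for `∂ρ_e / ∂r_j`, where `ρ_e` is the angle at the initial vertex in a
triangle with side lengths `r (src e)`, `r (tgt e)` and (fixed) `len e`. -/
def rhoDeriv (e : T.OrientedEdge) (j : singularSet M) : ℝ :=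
  if T.src e = j then
    if T.tgt e = j then T.len e / (2 * r j ^ 2 * Real.sin (T.rho r e))
    else -(Real.cos (T.phi r e) / (T.len e * Real.sin (T.rho r (T.opp e))))
  else
    if T.tgt e = j then 1 / (T.len e * Real.sin (T.rho r (T.opp e))) else 0

/-- The expression for `∂κ_i / ∂r_j` that is valid for every triangulation, with or without
loops and multiple edges. -/
def curvatureDeriv (i j : singularSet M) : ℝ :=
  ∑ e ∈ T.edgesFrom i,
    (Real.cot (T.alpha r e) + Real.cot (T.alpha r (T.opp e))) / Real.sin (T.rho r e) *
      T.rhoDeriv r e j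

end GeodesicTriangulation

/-! ### The space of generalized convex polytopes -/

/-- The space `P(M)` of generalized convex polytopes with boundary `M`, in the coordinates given
by the radii. -/
def polytopeSpace (M : Type*) [MetricSpace M] : Set (singularSet M → ℝ) :=
  {r | ∃ T : GeodesicTriangulation M, T.IsConvexPolytope r}

open scoped Classical in
/-- The curvature `κ_i` as a function on `P(M)` (zero outside). -/
def polytopeCurvature (M : Type*) [MetricSpace M] (i : singularSet M)
    (r : singularSet M → ℝ) : ℝ :=
  if h : r ∈ polytopeSpace M then h.choose.curvature r i else 0

open scoped Classical in
/-- The total scalar curvature `H` as a function on `P(M)` (zero outside). -/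
def polytopeTotalCurvature (M : Type*) [MetricSpace M] [Fintype (singularSet M)]
    (r : singularSet M → ℝ) : ℝ :=
  if h : r ∈ polytopeSpace M then h.choose.totalScalarCurvature r else 0

end

open Set Metric Filter Topology

/-! ### Functions on an interval that are locally midpoint concave -/

/-! The central object is `q`, the squared distance to the apex, regarded as a function on the
surface. On every face it is a quadratic polynomial with leading part ‖x‖², so it is fixed by its
values r_i² at the corners. Across an edge it has a crease, measured by `edgeD r e + edgeD r (opp
e)`, where `edgeD` is the signed distance from the edge to the foot of the altitude. The condition
θ_e ≤ π says exactly that q − ‖x‖² bends concavely at e (`theta_le_pi_iff`). Let T₁ be convex at r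
and T₂ arbitrary. Along a segment in a face of T₂ the difference q₁ − q₂ is locally midpoint
concave, so its minimum is attained at an end. Going from the vertices, where both functions are
r_i², to the sides and from there to the faces gives q₂ ≤ q₁ (`q_le_q`). Two convex triangulations
therefore have the same q (`q_eq_q`).

The invariants are then read off from q. The angle ω_i is the integral, over the directions at i, of
a density computed from q on a small circle around i (`sum_omega_eq`). An edge with θ_e < π is a
crease of q, hence an edge of every other convex triangulation, with the same data up to an exchange
of sides (`exists_corresponds`). Edges with θ_e = π contribute π − θ_e = 0 to H and cot α_e + cot
α_{-e} = 0 to the formula for the derivatives. So neither H nor that formula depends on T.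

For a fixed T all angles are explicit functions of r. At a corner of a face, ω is an angle of a
spherical triangle whose opposite side is constant, so its differential is a sum of two terms, one
for each adjacent boundary edge (`hasDerivAt_arccos_link`, `omega_facts`). Regrouping around the
vertex gives the formula for ∂κ_i/∂r_j. The equation ∂H/∂r_i = κ_i is Schläfli's formula Σ r_i dκ_i
= Σ ℓ_e dθ_e. After cancellation it reduces to Σ ℓ_e d(`edgeD`) = 0 over the sides of a face
(`sum_len_mul_dD`).

To pass from a fixed T to P(M), finitely many triangulations must suffice for bounded radii. Edges
are shorter than r_i + r_j, and only finitely many directions at a vertex carry edges of bounded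
length. Indeed, on either side of a limit direction a long thin wedge can be immersed into the
regular part of M (`exists_isImmersedWedge`), and an edge that starts inside it would end at a
regular point. Near r only triangulations that are convex at r itself occur, because a locally
convex triangulation with the function q of a convex polytope is convex (`of_isLocallyConvex`,
`exists_finite_cover`). On each of the finitely many pieces of P(M) near r, the functions H and κ_i
agree with functions differentiable in the ambient space, and the derivatives at r coincide. -/

theorem le_of_locally_midpoint_concave {f : ℝ → ℝ} {a b m : ℝ}
    (hf : ContinuousOn f (Icc a b))
    (hloc : ∀ t ∈ Ioo a b, ∃ η > 0, ∀ δ ∈ Ioo 0 η, f (t - δ) + f (t + δ) ≤ 2 * f t)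
    (ha : m ≤ f a) (hb : m ≤ f b) : ∀ t ∈ Icc a b, m ≤ f t := by
  intro t ht
  obtain ⟨t₀, ht₀, hmin⟩ := isCompact_Icc.exists_isMinOn ⟨t, ht⟩ hf
  refine le_trans ?_ (hmin ht)
  by_contra! hlt
  -- Take the rightmost minimum point: the value just to its right is strictly larger, which
  -- midpoint concavity forbids.
  have hS : IsCompact {s ∈ Icc a b | f s = f t₀} := by
    have : {s ∈ Icc a b | f s = f t₀} = Icc a b ∩ f ⁻¹' {f t₀} := rfl
    rw [this]
    exact isCompact_Icc.of_isClosed_subset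
      (hf.preimage_isClosed_of_isClosed isClosed_Icc isClosed_singleton) inter_subset_left
  obtain ⟨s, ⟨hs, hfs⟩, hmax⟩ := hS.exists_isGreatest ⟨t₀, ht₀, rfl⟩
  have hsa : a < s := lt_of_le_of_ne hs.1 (by rintro rfl; linarith)
  have hsb : s < b := lt_of_le_of_ne hs.2 (by rintro rfl; linarith)
  obtain ⟨η, hη, h⟩ := hloc s ⟨hsa, hsb⟩
  set δ := min (η / 2) (min (s - a) (b - s)) with hδ
  have hδ0 : 0 < δ := by
    simp only [hδ, lt_min_iff]; exact ⟨by linarith, by linarith, by linarith⟩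
  have hδ1 : δ ≤ η / 2 := min_le_left _ _
  have hδ2 : δ ≤ s - a := (min_le_right _ _).trans (min_le_left _ _)
  have hδ3 : δ ≤ b - s := (min_le_right _ _).trans (min_le_right _ _)
  have h1 := h δ ⟨hδ0, by linarith⟩
  have hp : s + δ ∈ Icc a b := ⟨by linarith, by linarith⟩
  have hq : s - δ ∈ Icc a b := ⟨by linarith, by linarith⟩
  have h2 : f t₀ ≤ f (s + δ) := hmin hp
  have h3 : f t₀ ≤ f (s - δ) := hmin hq
  have h4 : f (s + δ) ≠ f t₀ := fun h4 => by
    have := hmax ⟨hp, h4⟩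
    linarith
  have : f t₀ < f (s + δ) := lt_of_le_of_ne h2 (Ne.symm h4)
  linarith

theorem eq_chord_of_locally_midpoint_affine {f : ℝ → ℝ} {a b : ℝ} (hab : a < b)
    (hf : ContinuousOn f (Icc a b))
    (hloc : ∀ t ∈ Ioo a b, ∃ η > 0, ∀ δ ∈ Ioo 0 η, f (t - δ) + f (t + δ) = 2 * f t) :
    ∀ t ∈ Icc a b, f t = f a + (t - a) / (b - a) * (f b - f a) := by
  intro t ht
  have hba : b - a ≠ 0 := by linarith
  set c : ℝ → ℝ := fun t => f a + (t - a) / (b - a) * (f b - f a) with hc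
  have hcc : Continuous c := by fun_prop
  have hca : c a = f a := by simp [hc]
  have hcb : c b = f b := by simp only [hc]; field_simp; ring
  have hmid : ∀ t δ, c (t - δ) + c (t + δ) = 2 * c t := by intro t δ; simp only [hc]; ring
  -- Both f − c and c − f vanish at the ends and are locally midpoint concave, so both are
  -- nonnegative.
  have h1 := le_of_locally_midpoint_concave (f := fun t => f t - c t) (m := 0)
    (hf.sub hcc.continuousOn) (fun t ht => by
      obtain ⟨η, hη, h⟩ := hloc t ht
      exact ⟨η, hη, fun δ hδ => by have := h δ hδ; have := hmid t δ; linarith⟩)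
    (by simp [hca]) (by simp [hcb]) t ht
  have h2 := le_of_locally_midpoint_concave (f := fun t => c t - f t) (m := 0)
    (hcc.continuousOn.sub hf) (fun t ht => by
      obtain ⟨η, hη, h⟩ := hloc t ht
      exact ⟨η, hη, fun δ hδ => by have := h δ hδ; have := hmid t δ; linarith⟩)
    (by simp [hca]) (by simp [hcb]) t ht
  simp only [hc] at h1 h2 ⊢
  linarith

/-! ### Isometric maps on subsets of a plane -/

theorem inner_sub_sub_eq_of_dist_eq {V W : Type*} [NormedAddCommGroup V] [InnerProductSpace ℝ V]
    [NormedAddCommGroup W] [InnerProductSpace ℝ W] {x y z : V} {x' y' z' : W}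
    (h1 : dist x' z' = dist x z) (h2 : dist y' z' = dist y z) (h3 : dist x' y' = dist x y) :
    inner ℝ (x' - z') (y' - z') = inner ℝ (x - z) (y - z) := by
  rw [real_inner_eq_norm_mul_self_add_norm_mul_self_sub_norm_sub_mul_self_div_two,
    real_inner_eq_norm_mul_self_add_norm_mul_self_sub_norm_sub_mul_self_div_two,
    sub_sub_sub_cancel_right, sub_sub_sub_cancel_right, ← dist_eq_norm, ← dist_eq_norm,
    ← dist_eq_norm, ← dist_eq_norm, ← dist_eq_norm, ← dist_eq_norm, h1, h2, h3]

/-- Distances determine inner products of differences from z. The images of the points z + η b_k,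
rescaled by 1/η, form an orthonormal basis, and every φ x − φ z has the coordinates of x − z in it.
Besides z only these two points are required to lie in `s`, so half-discs are allowed as well as
discs. -/
theorem exists_linearIsometryEquiv_of_isometricOn {V W : Type*}
    [NormedAddCommGroup V] [InnerProductSpace ℝ V] [NormedAddCommGroup W] [InnerProductSpace ℝ W]
    (b : OrthonormalBasis (Fin 2) ℝ V) (hW : Module.finrank ℝ W = 2)
    {s : Set V} {φ : V → W} {z : V} (hz : z ∈ s) {η : ℝ} (hη : 0 < η)
    (hb : ∀ k, z + η • b k ∈ s) (hφ : ∀ x ∈ s, ∀ y ∈ s, dist (φ x) (φ y) = dist x y) :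
    ∃ G : V ≃ₗᵢ[ℝ] W, ∀ x ∈ s, φ x = φ z + G (x - z) := by
  have hin : ∀ x ∈ s, ∀ y ∈ s, inner ℝ (φ x - φ z) (φ y - φ z) = inner ℝ (x - z) (y - z) :=
    fun x hx y hy => inner_sub_sub_eq_of_dist_eq (hφ x hx z hz) (hφ y hy z hz) (hφ x hx y hy)
  have : FiniteDimensional ℝ W := Module.finite_of_finrank_pos (by omega)
  set c : Fin 2 → W := fun k => η⁻¹ • (φ (z + η • b k) - φ z) with hc
  have hco : Orthonormal ℝ c := by
    rw [orthonormal_iff_ite]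
    intro i j
    simp only [hc, inner_smul_left, inner_smul_right, hin _ (hb i) _ (hb j), add_sub_cancel_left]
    have := orthonormal_iff_ite.1 b.orthonormal i j
    rw [this]
    simp only [map_inv₀, conj_trivial]
    field_simp
  obtain ⟨c', hc'⟩ : ∃ c' : OrthonormalBasis (Fin 2) ℝ W, ∀ k, c' k = c k := by
    have hsp : ⊤ ≤ Submodule.span ℝ (Set.range c) := by
      rw [hco.linearIndependent.span_eq_top_of_card_eq_finrank' (by simp [hW])]
    exact ⟨OrthonormalBasis.mk hco hsp, fun k => by simp⟩
  refine ⟨b.equiv c' (Equiv.refl _), fun x hx => ?_⟩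
  have h1 : φ x - φ z = ∑ k, inner ℝ (c' k) (φ x - φ z) • c' k := (c'.sum_repr' _).symm
  have h2 : x - z = ∑ k, inner ℝ (b k) (x - z) • b k := (b.sum_repr' _).symm
  rw [← sub_eq_iff_eq_add', h1]
  conv_rhs => rw [h2]
  rw [map_sum]
  refine Finset.sum_congr rfl fun k _ => ?_
  rw [map_smul]
  congr 1
  · rw [hc' k]
    simp only [hc, inner_smul_left, hin _ (hb k) _ hx, add_sub_cancel_left]
    simp only [map_inv₀, conj_trivial]
    field_simp
  · simp

/-- An isometric map of an interval into an inner product space is affine. -/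
theorem eq_add_smul_of_isometric {W : Type*} [NormedAddCommGroup W] [InnerProductSpace ℝ W]
    {x y z : W} {s t u : ℝ} (hxy : dist x y = |s - t|) (hyz : dist z y = |u - t|)
    (hxz : dist x z = |s - u|) (hut : u ≠ t) : x = y + ((s - t) / (u - t)) • (z - y) := by
  have h := inner_sub_sub_eq_of_dist_eq (x := s) (y := u) (z := t) (x' := x) (y' := z) (z' := y)
    (by rw [hxy, Real.dist_eq]) (by rw [hyz, Real.dist_eq]) (by rw [hxz, Real.dist_eq])
  have hut' : u - t ≠ 0 := sub_ne_zero.2 hut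
  rw [dist_eq_norm] at hxy hyz
  have h1 : ‖(x - y) - ((s - t) / (u - t)) • (z - y)‖ ^ 2 = 0 := by
    rw [norm_sub_sq_real, inner_smul_right, h, norm_smul, mul_pow, hxy, hyz, sq_abs, sq_abs,
      Real.norm_eq_abs, sq_abs]
    simp only [RCLike.inner_apply, conj_trivial]
    field_simp
    ring
  have h2 := norm_eq_zero.1 (pow_eq_zero_iff (two_ne_zero) |>.1 h1)
  rw [← sub_eq_iff_eq_add']
  exact sub_eq_zero.1 h2

/-! ### Local isometries and plane charts -/

/-- `E` is isometric near every point of `s`. -/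
def LocIsoOn {V M : Type*} [PseudoMetricSpace V] [PseudoMetricSpace M] (E : V → M) (s : Set V) :
    Prop :=
  ∀ z ∈ s, ∃ η > 0, ∀ u ∈ s ∩ ball z η, ∀ v ∈ s ∩ ball z η, dist (E u) (E v) = dist u v

section LocIsoOn

variable {V M : Type*} [PseudoMetricSpace V] [PseudoMetricSpace M] {E : V → M} {s t : Set V}

theorem LocIsoOn.mono (h : LocIsoOn E s) (hst : t ⊆ s) : LocIsoOn E t := fun z hz => by
  obtain ⟨η, hη, h⟩ := h z (hst hz)
  exact ⟨η, hη, fun u hu v hv => h u ⟨hst hu.1, hu.2⟩ v ⟨hst hv.1, hv.2⟩⟩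

theorem LocIsoOn.continuousOn (h : LocIsoOn E s) : ContinuousOn E s := by
  intro z hz
  obtain ⟨η, hη, h⟩ := h z hz
  rw [Metric.continuousWithinAt_iff]
  intro ε hε
  refine ⟨min ε η, lt_min hε hη, fun x hx hxz => ?_⟩
  rw [h x ⟨hx, hxz.trans_le (min_le_right _ _)⟩ z ⟨hz, mem_ball_self hη⟩]
  exact hxz.trans_le (min_le_left _ _)

theorem LocIsoOn.comp {U : Type*} [PseudoMetricSpace U] {g : U → V} {r : Set U}
    (h : LocIsoOn E s) (hg : ∀ x y, dist (g x) (g y) = dist x y) (hr : MapsTo g r s) :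
    LocIsoOn (E ∘ g) r := fun z hz => by
  obtain ⟨η, hη, h⟩ := h (g z) (hr hz)
  exact ⟨η, hη, fun u hu v hv => by
    rw [Function.comp_apply, Function.comp_apply, h _ ⟨hr hu.1, by
      rw [mem_ball, hg]; exact hu.2⟩ _ ⟨hr hv.1, by rw [mem_ball, hg]; exact hv.2⟩, hg]⟩

end LocIsoOn

/-- `ψ` maps the plane disc of radius `ε` isometrically onto the `ε`-neighbourhood of `x`. -/
structure IsPlaneChart {M : Type*} [MetricSpace M] (ψ : Plane → M) (x : M) (ε : ℝ) : Prop where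
  pos : 0 < ε
  map_zero : ψ 0 = x
  dist_eq : ∀ u ∈ ball (0 : Plane) ε, ∀ v ∈ ball (0 : Plane) ε, dist (ψ u) (ψ v) = dist u v
  surj : ∀ y, dist y x < ε → ∃ u, ψ u = y ∧ ‖u‖ = dist y x

section PlaneChart

variable {M : Type*} [MetricSpace M] {ψ : Plane → M} {x : M} {ε : ℝ}

theorem IsRegularPoint.exists_chart (h : IsRegularPoint x) :
    ∃ ε, ∃ ψ : Plane → M, IsPlaneChart ψ x ε := by
  obtain ⟨ε, hε, ⟨Φ⟩⟩ := h
  -- The given isometry need not take x to the centre; the chart is recentred at the image p of x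
  -- and shrunk by ‖p‖.
  set p : Plane := (Φ ⟨x, mem_ball_self hε⟩).1 with hp
  have hpε : ‖p‖ < ε := mem_ball_zero_iff.1 (Φ ⟨x, mem_ball_self hε⟩).2
  have hx : Φ.symm ⟨p, by simpa using hpε⟩ = ⟨x, mem_ball_self hε⟩ := by
    rw [IsometryEquiv.symm_apply_eq]
  have hmem : ∀ u : Plane, ‖u‖ < ε - ‖p‖ → p + u ∈ ball (0 : Plane) ε := fun u hu => by
    rw [mem_ball_zero_iff]
    exact (norm_add_le _ _).trans_lt (by linarith)
  classical
  refine ⟨ε - ‖p‖, fun u => if hu : p + u ∈ ball (0 : Plane) ε then Φ.symm ⟨p + u, hu⟩ else x,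
    by linarith, ?_, fun u hu v hv => ?_, fun y hy => ?_⟩
  · have h0 : p ∈ ball (0 : Plane) ε := by simpa using hpε
    simp only [add_zero, h0, dite_true]
    rw [hx]
  · rw [mem_ball_zero_iff] at hu hv
    simp only [hmem u hu, hmem v hv, dite_true]
    rw [← Subtype.dist_eq, Φ.symm.dist_eq, Subtype.dist_eq, dist_add_left]
  · have hyε : y ∈ ball x ε := by
      rw [mem_ball]; have := norm_nonneg p; linarith
    refine ⟨(Φ ⟨y, hyε⟩).1 - p, ?_, ?_⟩
    · simp only [add_sub_cancel, Subtype.coe_eta, Subtype.coe_prop, dite_true,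
        IsometryEquiv.symm_apply_apply]
    · rw [← dist_eq_norm, hp, ← Subtype.dist_eq, Φ.dist_eq, Subtype.dist_eq]

theorem IsPlaneChart.dist_map_zero (h : IsPlaneChart ψ x ε) {u : Plane} (hu : ‖u‖ < ε) :
    dist (ψ u) x = ‖u‖ := by
  rw [← h.map_zero, h.dist_eq u (by simpa) 0 (by simpa using h.pos), dist_zero_right]

theorem IsPlaneChart.injOn (h : IsPlaneChart ψ x ε) : InjOn ψ (ball 0 ε) := fun u hu v hv huv => by
  rw [← dist_eq_zero, ← h.dist_eq u hu v hv, huv, dist_self]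

/-- A map isometric near `z` becomes linear in a chart. -/
theorem IsPlaneChart.exists_lift {V : Type*} [NormedAddCommGroup V] [InnerProductSpace ℝ V]
    (h : IsPlaneChart ψ x ε) (b : OrthonormalBasis (Fin 2) ℝ V) {s : Set V} {E : V → M} {z : V}
    (hz : z ∈ s) (hEz : E z = x) {η : ℝ} (hη : 0 < η) (hb : ∀ k, z + η • b k ∈ s)
    (hs : s ⊆ ball z ε) (hE : ∀ u ∈ s, ∀ v ∈ s, dist (E u) (E v) = dist u v) :
    ∃ G : V ≃ₗᵢ[ℝ] Plane, ∀ u ∈ s, E u = ψ (G (u - z)) := by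
  have key : ∀ u : V, ∃ w : Plane, u ∈ s → ψ w = E u ∧ ‖w‖ = dist u z := fun u => by
    by_cases hu : u ∈ s
    · obtain ⟨w, hw, hw'⟩ := h.surj (E u) (by rw [← hEz, hE u hu z hz]; exact hs hu)
      exact ⟨w, fun _ => ⟨hw, by rw [hw', ← hEz, hE u hu z hz]⟩⟩
    · exact ⟨0, fun h => absurd h hu⟩
  choose φ hφ using key
  have hφε : ∀ u ∈ s, φ u ∈ ball (0 : Plane) ε := fun u hu => by
    rw [mem_ball_zero_iff, (hφ u hu).2]; exact hs hu
  obtain ⟨G, hG⟩ := exists_linearIsometryEquiv_of_isometricOn (W := Plane) (φ := φ) b (by simp) hz hη hb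
    (fun u hu v hv => by
      rw [← h.dist_eq _ (hφε u hu) _ (hφε v hv), (hφ u hu).1, (hφ v hv).1, hE u hu v hv])
  have h0 : φ z = 0 := by
    rw [← norm_eq_zero, (hφ z hz).2, dist_self]
  exact ⟨G, fun u hu => by rw [← (hφ u hu).1, hG u hu, h0, zero_add]⟩

end PlaneChart

/-- Two local geodesics that agree near one time agree. -/
theorem geodesic_unique {M : Type*} [MetricSpace M] {g₁ g₂ : ℝ → M} {a b : ℝ}
    (h₁ : LocIsoOn g₁ (Ioo a b)) (h₂ : LocIsoOn g₂ (Ioo a b))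
    (hreg : ∀ t ∈ Ioo a b, IsRegularPoint (g₁ t)) {t₀ : ℝ} (ht₀ : t₀ ∈ Ioo a b)
    (h : g₁ =ᶠ[𝓝 t₀] g₂) : ∀ t ∈ Ioo a b, g₁ t = g₂ t := by
  -- Connectedness argument: the set of times at which the germs agree is open, and it remains to
  -- see that it is closed in the interval.
  set A : Set ℝ := {t | g₁ =ᶠ[𝓝 t] g₂} with hA
  have hAo : IsOpen A := isOpen_setOfPred_eventually_nhds
  have hsub : Ioo a b ⊆ A := by
    refine isPreconnected_Ioo.subset_of_closure_inter_subset hAo ⟨t₀, ht₀, h⟩ ?_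
    rintro t ⟨htA, ht⟩
    obtain ⟨η₁, hη₁, hi₁⟩ := h₁ t ht
    obtain ⟨η₂, hη₂, hi₂⟩ := h₂ t ht
    obtain ⟨η₃, hη₃, hi₃⟩ := Metric.isOpen_iff.1 isOpen_Ioo t ht
    by_cases htm : t ∈ A
    · exact htm
    obtain ⟨ε, ψ, hψ⟩ := (hreg t ht).exists_chart
    set η := min (min η₁ η₂) (min η₃ ε) with hη
    have hη0 : 0 < η := lt_min (lt_min hη₁ hη₂) (lt_min hη₃ hψ.pos)
    have e1 : η ≤ η₁ := (min_le_left _ _).trans (min_le_left _ _)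
    have e2 : η ≤ η₂ := (min_le_left _ _).trans (min_le_right _ _)
    have e3 : η ≤ η₃ := (min_le_right _ _).trans (min_le_left _ _)
    have e4 : η ≤ ε := (min_le_right _ _).trans (min_le_right _ _)
    have m1 : ∀ u ∈ ball t η, u ∈ Ioo a b ∩ ball t η₁ := fun u hu =>
      ⟨hi₃ (ball_subset_ball e3 hu), ball_subset_ball e1 hu⟩
    have m2 : ∀ u ∈ ball t η, u ∈ Ioo a b ∩ ball t η₂ := fun u hu =>
      ⟨hi₃ (ball_subset_ball e3 hu), ball_subset_ball e2 hu⟩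
    have d1 : ∀ u ∈ ball t η, ∀ v ∈ ball t η, dist (g₁ u) (g₁ v) = |u - v| :=
      fun u hu v hv => hi₁ u (m1 u hu) v (m1 v hv)
    have d2 : ∀ u ∈ ball t η, ∀ v ∈ ball t η, dist (g₂ u) (g₂ v) = |u - v| :=
      fun u hu v hv => hi₂ u (m2 u hu) v (m2 v hv)
    have htt := mem_ball_self hη0 (x := t)
    have hgt : g₁ t = g₂ t := by
      by_contra hne
      have c1 := (h₁.continuousOn.continuousAt (isOpen_Ioo.mem_nhds ht))
      have c2 := (h₂.continuousOn.continuousAt (isOpen_Ioo.mem_nhds ht))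
      have hev : ∀ᶠ s in 𝓝 t, g₁ s ≠ g₂ s := (c1.ne_iff_eventually_ne c2).1 hne
      obtain ⟨s, hs, hsA⟩ := mem_closure_iff_nhds.1 htA _ hev
      exact hs hsA.self_of_nhds
    -- In a chart at the common point of time t both geodesics lift to affine paths through 0;
    -- agreement at one further time u determines the lifts.
    obtain ⟨u, hu, huA⟩ := mem_closure_iff_nhds.1 htA _ (ball_mem_nhds t hη0)
    have hut : u ≠ t := fun h => htm (h ▸ huA)
    have hgu : g₁ u = g₂ u := huA.self_of_nhds
    refine Filter.mem_of_superset (ball_mem_nhds t hη0) fun s hs => ?_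
    obtain ⟨P, hP, hP'⟩ := hψ.surj (g₁ s) (by rw [d1 s hs t htt]; exact hs.trans_le e4)
    obtain ⟨Q, hQ, hQ'⟩ := hψ.surj (g₂ s) (by rw [hgt, d2 s hs t htt]; exact hs.trans_le e4)
    obtain ⟨R, hR, hR'⟩ := hψ.surj (g₁ u) (by rw [d1 u hu t htt]; exact hu.trans_le e4)
    have bP : P ∈ ball (0 : Plane) ε := by
      rw [mem_ball_zero_iff, hP', d1 s hs t htt]; exact hs.trans_le e4
    have bQ : Q ∈ ball (0 : Plane) ε := by
      rw [mem_ball_zero_iff, hQ', hgt, d2 s hs t htt]; exact hs.trans_le e4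
    have bR : R ∈ ball (0 : Plane) ε := by
      rw [mem_ball_zero_iff, hR', d1 u hu t htt]; exact hu.trans_le e4
    have k1 := eq_add_smul_of_isometric (x := P) (y := 0) (z := R) (s := s) (t := t) (u := u)
      (by rw [dist_zero_right, hP', d1 s hs t htt]) (by rw [dist_zero_right, hR', d1 u hu t htt])
      (by rw [← hψ.dist_eq P bP R bR, hP, hR, d1 s hs u hu]) hut
    have k2 := eq_add_smul_of_isometric (x := Q) (y := 0) (z := R) (s := s) (t := t) (u := u)
      (by rw [dist_zero_right, hQ', hgt, d2 s hs t htt])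
      (by rw [dist_zero_right, hR', d1 u hu t htt])
      (by rw [← hψ.dist_eq Q bQ R bR, hQ, hR, hgu, d2 s hs u hu]) hut
    change g₁ s = g₂ s
    rw [← hP, ← hQ, k1, k2]
  exact fun t ht => (hsub ht).self_of_nhds

/-! ### Frames of a triangle adapted to its sides -/

theorem Plane.inner_eq (v w : Plane) : inner ℝ v w = v 0 * w 0 + v 1 * w 1 := by
  simp [PiLp.inner_apply, Fin.sum_univ_two, mul_comm]

theorem Plane.norm_sq (v : Plane) : ‖v‖ ^ 2 = v 0 ^ 2 + v 1 ^ 2 := by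
  simp [EuclideanSpace.norm_sq_eq, Fin.sum_univ_two]

theorem Fin3.sum_eq {A : Type*} [AddCommMonoid A] (g : Fin 3 → A) (k : Fin 3) :
    ∑ j, g j = g k + g (k + 1) + g (k + 2) := by
  fin_cases k <;> simp [Fin.sum_univ_three] <;> abel_nf

theorem Fin3.forall_iff (P : Fin 3 → Prop) (k : Fin 3) :
    (∀ j, P j) ↔ P k ∧ P (k + 1) ∧ P (k + 2) := by
  fin_cases k <;> simp [Fin.forall_fin_succ] <;> tauto

namespace GeodesicTriangulation

variable {M : Type*} [MetricSpace M] (T : GeodesicTriangulation M)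

/-- The closed triangle of a face. -/
def tri (f : Fin T.faceCount) : Set Plane := convexHull ℝ (Set.range (T.corner f))

/-- Twice the signed area of the face to which an oriented edge belongs. -/
noncomputable def area (e : T.OrientedEdge) : ℝ :=
  (T.corner e.1 (e.2 + 1) - T.corner e.1 e.2) 0 * (T.corner e.1 (e.2 + 2) - T.corner e.1 e.2) 1 -
  (T.corner e.1 (e.2 + 1) - T.corner e.1 e.2) 1 * (T.corner e.1 (e.2 + 2) - T.corner e.1 e.2) 0

/-- Unit vector along an oriented edge. -/
noncomputable def dir (e : T.OrientedEdge) : Plane :=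
  (T.len e)⁻¹ • (T.corner e.1 (e.2 + 1) - T.corner e.1 e.2)

/-- Inward unit normal of a side. -/
noncomputable def nrm (e : T.OrientedEdge) : Plane :=
  (|T.area e| / T.area e) • !₂[-(T.dir e 1), T.dir e 0]

/-- The point with coordinates `(a, b)` in the frame adapted to `e`. -/
noncomputable def fr (e : T.OrientedEdge) (a b : ℝ) : Plane :=
  T.corner e.1 e.2 + (a • T.dir e + b • T.nrm e)

/-- First coordinate of the corner opposite to a side. -/
noncomputable def cx (e : T.OrientedEdge) : ℝ := inner ℝ (T.dir e) (T.corner e.1 (e.2 + 2) - T.corner e.1 e.2)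

/-- Second coordinate of the corner opposite to a side. -/
noncomputable def cy (e : T.OrientedEdge) : ℝ := inner ℝ (T.nrm e) (T.corner e.1 (e.2 + 2) - T.corner e.1 e.2)

/-- The preceding side of the same face. -/
def prev (e : T.OrientedEdge) : T.OrientedEdge := (e.1, e.2 + 2)

/-- The affine basis of the plane formed by the corners of a face. -/
noncomputable def bary (f : Fin T.faceCount) : AffineBasis (Fin 3) ℝ Plane :=
  ⟨T.corner f, T.nondegenerate f, by
    rw [(T.nondegenerate f).affineSpan_eq_top_iff_card_eq_finrank_add_one]; simp⟩

@[simp] theorem bary_apply (f : Fin T.faceCount) (k : Fin 3) : T.bary f k = T.corner f k := rfl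

theorem corner_injective (f : Fin T.faceCount) : Function.Injective (T.corner f) :=
  (T.nondegenerate f).injective

theorem area_ne_zero (e : T.OrientedEdge) : T.area e ≠ 0 := by
  intro h
  have hli := (affineIndependent_iff_linearIndependent_vsub ℝ (T.corner e.1) e.2).1
    (T.nondegenerate e.1)
  set v : Plane := T.corner e.1 (e.2 + 1) - T.corner e.1 e.2 with hv
  set w : Plane := T.corner e.1 (e.2 + 2) - T.corner e.1 e.2 with hw
  have h1 : e.2 + 1 ≠ e.2 := by generalize e.2 = k; revert k; decide
  have h2 : e.2 + 2 ≠ e.2 := by generalize e.2 = k; revert k; decide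
  have h12 : (⟨e.2 + 1, h1⟩ : {x // x ≠ e.2}) ≠ ⟨e.2 + 2, h2⟩ := by
    intro hh
    have : e.2 + 1 = e.2 + 2 := congrArg Subtype.val hh
    revert this; generalize e.2 = k; revert k; decide
  have hpair : LinearIndependent ℝ ![v, w] := by
    have := hli.comp ![⟨e.2 + 1, h1⟩, ⟨e.2 + 2, h2⟩] (by
      intro i j hij
      fin_cases i <;> fin_cases j <;> simp_all)
    have heq : ![v, w] = (fun i : {x // x ≠ e.2} => T.corner e.1 i -ᵥ T.corner e.1 e.2) ∘
        ![⟨e.2 + 1, h1⟩, ⟨e.2 + 2, h2⟩] := by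
      ext i j
      fin_cases i <;> simp [hv, hw]
    rw [heq]
    exact this
  rw [LinearIndependent.pair_iff] at hpair
  have ha : v 0 * w 1 - v 1 * w 0 = 0 := h
  have k1 := hpair (w 1) (-(v 1)) (by ext i; fin_cases i <;> simp <;> linarith)
  have k2 := hpair (w 0) (-(v 0)) (by ext i; fin_cases i <;> simp <;> linarith)
  have hv0 : v = 0 := by
    ext i; fin_cases i
    · simpa using k2.2
    · simpa using k1.2
  exact h1 (T.corner_injective e.1 (sub_eq_zero.1 hv0))

theorem len_pos (e : T.OrientedEdge) : 0 < T.len e := by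
  refine dist_pos.2 fun h => ?_
  have := T.corner_injective e.1 h
  revert this; generalize e.2 = k; revert k; decide

theorem norm_dir (e : T.OrientedEdge) : ‖T.dir e‖ = 1 := by
  rw [dir, norm_smul, ← dist_eq_norm, dist_comm]
  change ‖(T.len e)⁻¹‖ * T.len e = 1
  have := T.len_pos e
  rw [Real.norm_of_nonneg (by positivity)]
  field_simp

theorem dir_sq (e : T.OrientedEdge) : T.dir e 0 ^ 2 + T.dir e 1 ^ 2 = 1 := by
  rw [← Plane.norm_sq, norm_dir, one_pow]

theorem sgn_sq (e : T.OrientedEdge) : (|T.area e| / T.area e) ^ 2 = 1 := by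
  have := T.area_ne_zero e
  rw [div_pow, sq_abs, div_self (by positivity)]

theorem norm_nrm (e : T.OrientedEdge) : ‖T.nrm e‖ = 1 := by
  have h : ‖T.nrm e‖ ^ 2 = 1 := by
    rw [Plane.norm_sq]
    simp only [nrm, PiLp.smul_apply, smul_eq_mul]
    have := T.sgn_sq e
    have := T.dir_sq e
    simp
    linear_combination (T.dir e 0 ^ 2 + T.dir e 1 ^ 2) * T.sgn_sq e + this
  rw [← sq_eq_sq₀ (norm_nonneg _) zero_le_one, h, one_pow]

theorem inner_dir_nrm (e : T.OrientedEdge) : inner ℝ (T.dir e) (T.nrm e) = 0 := by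
  rw [Plane.inner_eq]
  simp [nrm]
  ring

theorem inner_dir_dir (e : T.OrientedEdge) : inner ℝ (T.dir e) (T.dir e) = 1 := by
  rw [real_inner_self_eq_norm_sq, norm_dir, one_pow]

theorem inner_nrm_nrm (e : T.OrientedEdge) : inner ℝ (T.nrm e) (T.nrm e) = 1 := by
  rw [real_inner_self_eq_norm_sq, norm_nrm, one_pow]

theorem inner_nrm_dir (e : T.OrientedEdge) : inner ℝ (T.nrm e) (T.dir e) = 0 := by
  rw [real_inner_comm, inner_dir_nrm]

/-- Base times height. The corners of a face may run around it in either sense in the plane, and the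
sign in `nrm` makes the height positive in both cases. -/
theorem len_mul_cy (e : T.OrientedEdge) : T.len e * T.cy e = |T.area e| := by
  have h1 := T.area_ne_zero e
  have h2 := (T.len_pos e).ne'
  rw [cy, Plane.inner_eq]
  simp only [nrm, dir, PiLp.smul_apply, smul_eq_mul]
  have : T.area e = (T.corner e.1 (e.2 + 1) - T.corner e.1 e.2) 0 *
      (T.corner e.1 (e.2 + 2) - T.corner e.1 e.2) 1 - (T.corner e.1 (e.2 + 1) -
      T.corner e.1 e.2) 1 * (T.corner e.1 (e.2 + 2) - T.corner e.1 e.2) 0 := rfl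
  set v : Plane := T.corner e.1 (e.2 + 1) - T.corner e.1 e.2
  set w : Plane := T.corner e.1 (e.2 + 2) - T.corner e.1 e.2
  simp
  field_simp
  rw [this]; ring

theorem cy_pos (e : T.OrientedEdge) : 0 < T.cy e := by
  have h1 := T.len_mul_cy e
  have h2 := abs_pos.2 (T.area_ne_zero e)
  rw [← h1] at h2
  exact pos_of_mul_pos_right h2 (T.len_pos e).le

theorem area_prev (e : T.OrientedEdge) : T.area (T.prev e) = T.area e := by
  obtain ⟨f, k⟩ := e
  have h1 : k + 2 + 1 = k := by revert k; decide
  have h2 : k + 2 + 2 = k + 1 := by revert k; decide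
  simp only [area, prev, h1, h2, PiLp.sub_apply]
  ring

theorem prev_prev_prev (e : T.OrientedEdge) : T.prev (T.prev (T.prev e)) = e := by
  obtain ⟨f, k⟩ := e
  simp only [prev, Prod.mk.injEq, true_and]
  revert k; decide

theorem tgt_prev (e : T.OrientedEdge) : T.tgt (T.prev e) = T.src e := by
  obtain ⟨f, k⟩ := e
  have : k + 2 + 1 = k := by revert k; decide
  simp only [tgt, prev, this]

theorem decomp (e : T.OrientedEdge) (v : Plane) :
    v = inner ℝ (T.dir e) v • T.dir e + inner ℝ (T.nrm e) v • T.nrm e := by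
  have h1 := T.dir_sq e
  have h2 := T.sgn_sq e
  simp only [Plane.inner_eq]
  ext i
  fin_cases i
  · simp [nrm]
    linear_combination (-(T.dir e 0) ^ 2 * v 0 - T.dir e 0 * T.dir e 1 * v 1) * (h2 - h2)
      - v 0 * h1 - T.dir e 1 * (T.dir e 1 * v 0 - T.dir e 0 * v 1) * h2
  · simp [nrm]
    linear_combination - v 1 * h1 - T.dir e 0 * (T.dir e 0 * v 1 - T.dir e 1 * v 0) * h2

theorem fr_coords (e : T.OrientedEdge) (z : Plane) :
    T.fr e (inner ℝ (T.dir e) (z - T.corner e.1 e.2)) (inner ℝ (T.nrm e) (z - T.corner e.1 e.2))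
      = z := by
  rw [fr, ← T.decomp e, add_sub_cancel]

theorem exists_fr (e : T.OrientedEdge) (z : Plane) : ∃ a b, z = T.fr e a b :=
  ⟨_, _, (T.fr_coords e z).symm⟩

theorem corner_zero (e : T.OrientedEdge) : T.corner e.1 e.2 = T.fr e 0 0 := by simp [fr]

theorem corner_one (e : T.OrientedEdge) : T.corner e.1 (e.2 + 1) = T.fr e (T.len e) 0 := by
  simp [fr, dir, smul_smul, (T.len_pos e).ne']

theorem corner_two (e : T.OrientedEdge) :
    T.corner e.1 (e.2 + 2) = T.fr e (T.cx e) (T.cy e) := (T.fr_coords e _).symm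

theorem norm_frame_sq (e : T.OrientedEdge) (a b : ℝ) :
    ‖a • T.dir e + b • T.nrm e‖ ^ 2 = a ^ 2 + b ^ 2 := by
  rw [norm_add_sq_real, norm_smul, norm_smul, norm_dir, norm_nrm, inner_smul_left,
    inner_smul_right, inner_dir_nrm]
  simp

theorem dist_fr_sq (e : T.OrientedEdge) (a b a' b' : ℝ) :
    dist (T.fr e a b) (T.fr e a' b') ^ 2 = (a - a') ^ 2 + (b - b') ^ 2 := by
  rw [fr, fr, dist_add_left, dist_eq_norm, ← T.norm_frame_sq e]
  congr 2
  module

theorem dist_fr (e : T.OrientedEdge) (a b a' b' : ℝ) :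
    dist (T.fr e a b) (T.fr e a' b') = √((a - a') ^ 2 + (b - b') ^ 2) := by
  rw [← T.dist_fr_sq, Real.sqrt_sq dist_nonneg]

theorem fr_injective (e : T.OrientedEdge) {a b a' b' : ℝ} (h : T.fr e a b = T.fr e a' b') :
    a = a' ∧ b = b' := by
  have := T.dist_fr_sq e a b a' b'
  rw [h, dist_self] at this
  constructor <;> nlinarith [sq_nonneg (a - a'), sq_nonneg (b - b')]

theorem continuous_fr (e : T.OrientedEdge) : Continuous fun p : ℝ × ℝ => T.fr e p.1 p.2 := by
  unfold fr; fun_prop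

theorem norm_fr_sq (e : T.OrientedEdge) (a b : ℝ) :
    ‖T.fr e a b‖ ^ 2 = ‖T.corner e.1 e.2‖ ^ 2 + 2 * (a * inner ℝ (T.corner e.1 e.2) (T.dir e) +
      b * inner ℝ (T.corner e.1 e.2) (T.nrm e)) + (a ^ 2 + b ^ 2) := by
  rw [fr, norm_add_sq_real, norm_frame_sq, inner_add_right, inner_smul_right, inner_smul_right]

/-- Obtained by solving the linear system for the barycentric coordinates with corners (0, 0),
(`len`, 0), (`cx`, `cy`). It turns membership in the triangle into linear inequalities in a and b.
-/
theorem coord_fr (e : T.OrientedEdge) (a b : ℝ) :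
    (T.bary e.1).coord (e.2 + 2) (T.fr e a b) = b / T.cy e ∧
    (T.bary e.1).coord (e.2 + 1) (T.fr e a b) = (a * T.cy e - b * T.cx e) / (T.len e * T.cy e) ∧
    (T.bary e.1).coord e.2 (T.fr e a b) =
      1 - (a * T.cy e - b * T.cx e) / (T.len e * T.cy e) - b / T.cy e := by
  have hs := (T.bary e.1).sum_coord_apply_eq_one (T.fr e a b)
  have hl := (T.bary e.1).linear_combination_coord_eq_self (T.fr e a b)
  rw [Fin3.sum_eq _ e.2] at hs hl
  simp only [bary_apply, T.corner_one, T.corner_two] at hl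
  set c0 := (T.bary e.1).coord e.2 (T.fr e a b)
  set c1 := (T.bary e.1).coord (e.2 + 1) (T.fr e a b)
  set c2 := (T.bary e.1).coord (e.2 + 2) (T.fr e a b)
  have hfr : T.fr e (c1 * T.len e + c2 * T.cx e) (c2 * T.cy e) = T.fr e a b := by
    rw [← hl]
    simp only [fr]
    have : c0 = 1 - c1 - c2 := by linarith
    rw [this]
    module
  obtain ⟨h1, h2⟩ := T.fr_injective e hfr
  have hc := (T.cy_pos e).ne'
  have hL := (T.len_pos e).ne'
  have hc2 : c2 = b / T.cy e := by rw [← h2]; field_simp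
  have hc1 : c1 = (a * T.cy e - b * T.cx e) / (T.len e * T.cy e) := by
    rw [← h2, ← h1]; field_simp; ring
  exact ⟨hc2, hc1, by rw [← hc2, ← hc1]; linarith⟩

theorem tri_eq (f : Fin T.faceCount) : T.tri f = {x | ∀ i, 0 ≤ (T.bary f).coord i x} :=
  (T.bary f).convexHull_eq_nonneg_coord

theorem interior_tri_eq (f : Fin T.faceCount) :
    interior (T.tri f) = {x | ∀ i, 0 < (T.bary f).coord i x} :=
  (T.bary f).interior_convexHull

/-- The inequalities are the nonnegativity of the barycentric coordinates at the corners `e.2 + 2`,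
`e.2 + 1`, `e.2`, in this order, with positive denominators cleared. -/
theorem fr_mem_tri (e : T.OrientedEdge) (a b : ℝ) : T.fr e a b ∈ T.tri e.1 ↔
    0 ≤ b ∧ 0 ≤ a * T.cy e - b * T.cx e ∧
      a * T.cy e - b * T.cx e + b * T.len e ≤ T.len e * T.cy e := by
  obtain ⟨h2, h1, h0⟩ := T.coord_fr e a b
  have hc := T.cy_pos e
  have hL := T.len_pos e
  rw [tri_eq, mem_ofPred_eq, Fin3.forall_iff _ e.2, h0, h1, h2]
  have : 1 - (a * T.cy e - b * T.cx e) / (T.len e * T.cy e) - b / T.cy e =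
      (T.len e * T.cy e - (a * T.cy e - b * T.cx e + b * T.len e)) / (T.len e * T.cy e) := by
    field_simp; ring
  have hdn : ∀ x y : ℝ, 0 < y → (0 ≤ x / y ↔ 0 ≤ x) := fun x y hy =>
    ⟨fun h => by rwa [le_div_iff₀ hy, zero_mul] at h, fun h => div_nonneg h hy.le⟩
  rw [this, hdn _ _ (by positivity), hdn _ _ (by positivity),
    hdn _ _ hc, sub_nonneg]
  tauto

theorem fr_mem_interior (e : T.OrientedEdge) (a b : ℝ) : T.fr e a b ∈ interior (T.tri e.1) ↔
    0 < b ∧ 0 < a * T.cy e - b * T.cx e ∧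
      a * T.cy e - b * T.cx e + b * T.len e < T.len e * T.cy e := by
  obtain ⟨h2, h1, h0⟩ := T.coord_fr e a b
  have hc := T.cy_pos e
  have hL := T.len_pos e
  rw [interior_tri_eq, mem_ofPred_eq, Fin3.forall_iff _ e.2, h0, h1, h2]
  have : 1 - (a * T.cy e - b * T.cx e) / (T.len e * T.cy e) - b / T.cy e =
      (T.len e * T.cy e - (a * T.cy e - b * T.cx e + b * T.len e)) / (T.len e * T.cy e) := by
    field_simp; ring
  rw [this, div_pos_iff_of_pos_right (by positivity), div_pos_iff_of_pos_right (by positivity),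
    div_pos_iff_of_pos_right hc, sub_pos]
  tauto

theorem isCompact_tri (f : Fin T.faceCount) : IsCompact (T.tri f) :=
  (Set.finite_range _).isCompact_convexHull _

theorem convex_tri (f : Fin T.faceCount) : Convex ℝ (T.tri f) := convex_convexHull _ _

theorem corner_mem_tri (f : Fin T.faceCount) (k : Fin 3) : T.corner f k ∈ T.tri f :=
  subset_convexHull _ _ (Set.mem_range_self k)

theorem corner_notMem_interior (f : Fin T.faceCount) (k : Fin 3) :
    T.corner f k ∉ interior (T.tri f) := by
  have := T.fr_mem_interior (f, k) 0 0
  rw [← T.corner_zero] at this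
  rw [this]
  simp

/-- A point of a triangle is interior, a corner, or in the relative interior of a side. -/
theorem tri_cases {f : Fin T.faceCount} {x : Plane} (hx : x ∈ T.tri f) :
    x ∈ interior (T.tri f) ∨ (∃ k, x = T.corner f k) ∨
      ∃ k, ∃ s ∈ Ioo 0 (T.len (f, k)), x = T.fr (f, k) s 0 := by
  by_cases hi : x ∈ interior (T.tri f)
  · exact Or.inl hi
  right
  have hi' : ∃ j, (T.bary f).coord j x ≤ 0 := by
    by_contra! h
    exact hi (by rw [interior_tri_eq]; exact h)
  obtain ⟨j, hj⟩ := hi'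
  -- Indices are mod 3: the corner j = k + 2 is opposite to the side k, so its coordinate is b
  -- divided by the height in the frame of that side.
  obtain ⟨k, rfl⟩ : ∃ k : Fin 3, j = k + 2 := ⟨j + 1, by clear hj; revert j; decide⟩
  obtain ⟨a, b, rfl⟩ := T.exists_fr (f, k) x
  obtain ⟨h2, -, -⟩ := T.coord_fr (f, k) a b
  have hc := T.cy_pos (f, k)
  obtain ⟨m1, m2, m3⟩ := (T.fr_mem_tri (f, k) a b).1 hx
  have hb : b = 0 := by
    simp only at h2
    rw [h2] at hj
    have : b ≤ 0 := by
      by_contra! hb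
      have := div_pos hb hc
      linarith
    linarith
  subst hb
  have ha0 : 0 ≤ a := by
    by_contra! h
    nlinarith
  have ha1 : a ≤ T.len (f, k) := by
    by_contra! h
    nlinarith
  rcases ha0.eq_or_lt with h | h
  · exact Or.inl ⟨k, by rw [← h, T.corner_zero (f, k)]⟩
  rcases ha1.eq_or_lt with h' | h'
  · exact Or.inl ⟨k + 1, by rw [h', T.corner_one (f, k)]⟩
  · exact Or.inr ⟨k, a, ⟨h, h'⟩, rfl⟩

theorem edge_mem_tri (e : T.OrientedEdge) {s : ℝ} (hs : s ∈ Icc 0 (T.len e)) :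
    T.fr e s 0 ∈ T.tri e.1 := by
  have hc := T.cy_pos e
  rw [fr_mem_tri]
  exact ⟨le_rfl, by nlinarith [hs.1], by nlinarith [hs.2]⟩

/-- The relative interiors of different sides are disjoint. -/
theorem edge_point_inj {f : Fin T.faceCount} {k k' : Fin 3} {s s' : ℝ}
    (hs : s ∈ Ioo 0 (T.len (f, k))) (hs' : s' ∈ Ioo 0 (T.len (f, k')))
    (h : T.fr (f, k) s 0 = T.fr (f, k') s' 0) : k = k' ∧ s = s' := by
  have hk : k = k' := by
    by_contra hne
    obtain ⟨-, h1, h0⟩ := T.coord_fr (f, k) s 0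
    obtain ⟨h2', -, -⟩ := T.coord_fr (f, k') s' 0
    have hc := T.cy_pos (f, k)
    have hL := T.len_pos (f, k)
    simp only [zero_div, zero_mul, sub_zero] at h2' h1 h0
    rw [← h] at h2'
    have hq : s * T.cy (f, k) / (T.len (f, k) * T.cy (f, k)) = s / T.len (f, k) := by
      field_simp
    rw [hq] at h1 h0
    have p1 : 0 < s / T.len (f, k) := div_pos hs.1 hL
    have p2 : s / T.len (f, k) < 1 := (div_lt_one hL).2 hs.2
    -- The corner opposite to the side k' is an end of the side k; a point inside the side k has
    -- positive coordinate there, a point of the side k' has coordinate zero.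
    have hkk : ∀ k k' : Fin 3, k ≠ k' → k' + 2 = k ∨ k' + 2 = k + 1 := by decide
    have := hkk k k' hne
    rcases this with hh | hh
    · rw [hh] at h2'; linarith
    · rw [hh] at h2'; linarith
  subst hk
  exact ⟨rfl, (T.fr_injective _ h).1⟩

theorem edge_notMem_corners (e : T.OrientedEdge) {s : ℝ} (hs : s ∈ Ioo 0 (T.len e)) :
    T.fr e s 0 ∉ Set.range (T.corner e.1) := by
  rintro ⟨j, hj⟩
  obtain ⟨-, h1, h0⟩ := T.coord_fr e s 0
  have hc := T.cy_pos e
  have hL := T.len_pos e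
  simp only [zero_mul, sub_zero, zero_div] at h1 h0
  have hq : s * T.cy e / (T.len e * T.cy e) = s / T.len e := by field_simp
  rw [hq] at h1 h0
  have p1 : 0 < s / T.len e := div_pos hs.1 hL
  have p2 : s / T.len e < 1 := (div_lt_one hL).2 hs.2
  rw [← hj, ← T.bary_apply, AffineBasis.coord_apply] at h1 h0
  split_ifs at h1 h0 <;> linarith

theorem edge_notMem_interior (e : T.OrientedEdge) (s : ℝ) : T.fr e s 0 ∉ interior (T.tri e.1) := by
  rw [fr_mem_interior]; simp

theorem interior_sub_corners {f : Fin T.faceCount} {x : Plane} (hx : x ∈ interior (T.tri f)) :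
    x ∈ T.tri f \ Set.range (T.corner f) :=
  ⟨interior_subset hx, by rintro ⟨k, rfl⟩; exact T.corner_notMem_interior f k hx⟩

theorem edge_sub_corners (e : T.OrientedEdge) {s : ℝ} (hs : s ∈ Ioo 0 (T.len e)) :
    T.fr e s 0 ∈ T.tri e.1 \ Set.range (T.corner e.1) :=
  ⟨T.edge_mem_tri e ⟨hs.1.le, hs.2.le⟩, T.edge_notMem_corners e hs⟩

/-! ### Side lengths of a face in a frame -/

theorem cx_sq_add_cy_sq (e : T.OrientedEdge) :
    T.cx e ^ 2 + T.cy e ^ 2 = T.len (T.prev e) ^ 2 := by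
  obtain ⟨f, k⟩ := e
  have h : k + 2 + 1 = k := by revert k; decide
  simp only [len, prev, h]
  have h1 := T.corner_two (f, k)
  have h0 := T.corner_zero (f, k)
  simp only at h1 h0
  rw [h1, h0, dist_fr_sq, sub_zero, sub_zero]

theorem len_next_sq (e : T.OrientedEdge) :
    (T.cx e - T.len e) ^ 2 + T.cy e ^ 2 = T.len (T.prev (T.prev e)) ^ 2 := by
  obtain ⟨f, k⟩ := e
  have h : k + 2 + 2 = k + 1 := by revert k; decide
  have h' : k + 1 + 1 = k + 2 := by revert k; decide
  simp only [prev, h]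
  have h1 := T.corner_two (f, k)
  have h0 := T.corner_one (f, k)
  simp only at h1 h0
  conv_rhs => rw [len]
  simp only [h']
  rw [h1, h0, dist_comm, dist_fr_sq, sub_zero]

theorem len_prev_mul_cy_prev (e : T.OrientedEdge) :
    T.len (T.prev e) * T.cy (T.prev e) = T.len e * T.cy e := by
  rw [len_mul_cy, len_mul_cy, area_prev]

/-- Both products `len * cx` are inner products of sides at a corner; those at the two ends of a
side add up to the square of its length. -/
theorem len_prev_mul_cx_prev (e : T.OrientedEdge) :
    T.len (T.prev e) * T.cx (T.prev e) = T.len (T.prev e) ^ 2 - T.len e * T.cx e := by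
  have h1 := T.cx_sq_add_cy_sq (T.prev e)
  have h2 := T.len_next_sq (T.prev e)
  have h3 := T.cx_sq_add_cy_sq e
  have h4 := T.len_next_sq e
  rw [prev_prev_prev] at h2
  nlinarith

end GeodesicTriangulation

theorem Plane.decomp_of_orthonormal {U N : Plane} (hU : ‖U‖ = 1) (hN : ‖N‖ = 1)
    (hUN : inner ℝ U N = 0) (v : Plane) : v = inner ℝ U v • U + inner ℝ N v • N := by
  have ho : Orthonormal ℝ ![U, N] := by
    rw [orthonormal_iff_ite]
    intro i j
    fin_cases i <;> fin_cases j <;> simp [hU, hN, hUN, real_inner_comm]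
  have hsp : ⊤ ≤ Submodule.span ℝ (Set.range ![U, N]) := by
    rw [ho.linearIndependent.span_eq_top_of_card_eq_finrank' (by simp)]
  have := ((OrthonormalBasis.mk ho hsp).sum_repr' v).symm
  simpa [Fin.sum_univ_two] using this

theorem norm_frame_of_orthonormal {U N : Plane} (hU : ‖U‖ = 1) (hN : ‖N‖ = 1)
    (hUN : inner ℝ U N = 0) (a b : ℝ) : ‖a • U + b • N‖ ^ 2 = a ^ 2 + b ^ 2 := by
  rw [norm_add_sq_real, norm_smul, norm_smul, hU, hN, inner_smul_left, inner_smul_right, hUN]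
  simp

theorem norm_lt_of_sq_lt {E : Type*} [SeminormedAddGroup E] {v : E} {ε x : ℝ} (hε : 0 < ε)
    (h : ‖v‖ ^ 2 = x) (hx : x < ε ^ 2) : ‖v‖ < ε := by
  rw [← h] at hx
  exact lt_of_pow_lt_pow_left₀ 2 hε.le hx

theorem eq_of_forall_small_dist {E : Type*} [MetricSpace E] {x y : E} {ε : ℝ} (hε : 0 < ε)
    (h : ∀ b ∈ Ioo 0 ε, dist x y ≤ 2 * b) : x = y := by
  by_contra hne
  have hd := dist_pos.2 hne
  have := h (min (ε / 2) (dist x y / 4)) ⟨by positivity,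
    (min_le_left _ _).trans_lt (by linarith)⟩
  have := min_le_right (ε / 2) (dist x y / 4)
  linarith

/-! ### Sides as local geodesics, and their gluing -/

namespace GeodesicTriangulation

variable {M : Type*} [MetricSpace M] (T : GeodesicTriangulation M)

/-- The point of the surface with coordinates `(a, b)` in the frame adapted to `e`. -/
noncomputable def pos (e : T.OrientedEdge) (a b : ℝ) : M := T.toSurface e.1 (T.fr e a b)

theorem regular_of_mem {f : Fin T.faceCount} {x : Plane} (hx : x ∈ T.tri f \ range (T.corner f)) :
    IsRegularPoint (T.toSurface f x) := by
  have := T.not_mem f x hx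
  simpa [singularSet] using this

theorem locIsoOn (f : Fin T.faceCount) :
    LocIsoOn (T.toSurface f) (T.tri f \ range (T.corner f)) := fun x hx => by
  obtain ⟨ε, hε, h⟩ := T.locallyIsometric f x hx
  exact ⟨ε, hε, fun u hu v hv => h u ⟨hu.1.1, hu.2⟩ v ⟨hv.1.1, hv.2⟩⟩

theorem pos_regular (e : T.OrientedEdge) {s : ℝ} (hs : s ∈ Ioo 0 (T.len e)) :
    IsRegularPoint (T.pos e s 0) := T.regular_of_mem (T.edge_sub_corners e hs)

/-- The sides of the faces are local geodesics. -/
theorem locIsoOn_pos (e : T.OrientedEdge) :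
    LocIsoOn (fun s => T.pos e s 0) (Ioo 0 (T.len e)) := by
  refine (T.locIsoOn e.1).comp (g := fun s => T.fr e s 0) (fun x y => ?_)
    fun s hs => T.edge_sub_corners e hs
  rw [dist_fr, sub_zero, zero_pow two_ne_zero, add_zero, Real.sqrt_sq_eq_abs, Real.dist_eq]

theorem continuousOn_pos (e : T.OrientedEdge) :
    ContinuousOn (fun s => T.pos e s 0) (Icc 0 (T.len e)) :=
  (T.continuousOn e.1).comp
    ((T.continuous_fr e).comp (by fun_prop : Continuous fun s : ℝ => (s, (0 : ℝ)))).continuousOn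
    fun s hs => T.edge_mem_tri e hs

theorem lineMap_corner (e : T.OrientedEdge) (t : ℝ) :
    AffineMap.lineMap (T.corner e.1 e.2) (T.corner e.1 (e.2 + 1)) t = T.fr e (t * T.len e) 0 := by
  rw [AffineMap.lineMap_apply_module', T.corner_zero, T.corner_one]
  simp only [fr]
  module

theorem lineMap_corner' (e : T.OrientedEdge) (t : ℝ) :
    AffineMap.lineMap (T.corner e.1 (e.2 + 1)) (T.corner e.1 e.2) t =
      T.fr e (T.len e - t * T.len e) 0 := by
  rw [AffineMap.lineMap_apply_module', T.corner_zero, T.corner_one]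
  simp only [fr]
  module

theorem glue_aux (e : T.OrientedEdge) {t : ℝ} (ht : t ∈ Icc (0 : ℝ) 1) :
    T.pos e (t * T.len e) 0 = T.pos (T.opp e) (T.len (T.opp e) - t * T.len (T.opp e)) 0 := by
  have := T.glue e t ht
  rwa [lineMap_corner, lineMap_corner'] at this

/-- The gluing is affine and both sides are isometric near their midpoints, so moving the common
parameter by a small δ covers the same distance δ · `len` on both. -/
theorem len_opp (e : T.OrientedEdge) : T.len (T.opp e) = T.len e := by
  have hL := T.len_pos e
  have hL' := T.len_pos (T.opp e)
  obtain ⟨η, hη, h⟩ := T.locIsoOn_pos e (T.len e / 2) ⟨by linarith, by linarith⟩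
  obtain ⟨η', hη', h'⟩ := T.locIsoOn_pos (T.opp e) (T.len (T.opp e) / 2)
    ⟨by linarith, by linarith⟩
  set L := T.len e
  set L' := T.len (T.opp e)
  set δ : ℝ := min (1 / 4) (min (η / (2 * L)) (η' / (2 * L'))) with hδ
  have hδ0 : 0 < δ := by positivity
  have d1 : δ ≤ 1 / 4 := min_le_left _ _
  have d2 : δ * L < η := by
    have : δ ≤ η / (2 * L) := (min_le_right _ _).trans (min_le_left _ _)
    rw [le_div_iff₀ (by positivity)] at this
    nlinarith
  have d3 : δ * L' < η' := by
    have : δ ≤ η' / (2 * L') := (min_le_right _ _).trans (min_le_right _ _)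
    rw [le_div_iff₀ (by positivity)] at this
    nlinarith
  have g1 := T.glue_aux e (t := 1 / 2) ⟨by norm_num, by norm_num⟩
  have g2 := T.glue_aux e (t := 1 / 2 + δ) ⟨by linarith, by linarith⟩
  have k1 := h (1 / 2 * L) ⟨⟨by linarith, by linarith⟩, by
    rw [mem_ball, Real.dist_eq, show 1 / 2 * L - L / 2 = 0 by ring, abs_zero]; exact hη⟩
    ((1 / 2 + δ) * L) ⟨⟨by positivity, by nlinarith⟩, by
    rw [mem_ball, Real.dist_eq, show (1 / 2 + δ) * L - L / 2 = δ * L by ring,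
      abs_of_pos (by positivity)]; exact d2⟩
  have k2 := h' (L' - 1 / 2 * L') ⟨⟨by linarith, by linarith⟩, by
    rw [mem_ball, Real.dist_eq, show L' - 1 / 2 * L' - L' / 2 = 0 by ring, abs_zero]; exact hη'⟩
    (L' - (1 / 2 + δ) * L') ⟨⟨by nlinarith, by nlinarith⟩, by
    rw [mem_ball, Real.dist_eq, show L' - (1 / 2 + δ) * L' - L' / 2 = -(δ * L') by ring, abs_neg,
      abs_of_pos (by positivity)]; exact d3⟩
  simp only at k1 k2
  rw [← g1, ← g2, k1, Real.dist_eq, Real.dist_eq,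
    show 1 / 2 * L - (1 / 2 + δ) * L = -(δ * L) by ring,
    show L' - 1 / 2 * L' - (L' - (1 / 2 + δ) * L') = δ * L' by ring, abs_neg,
    abs_of_pos (by positivity), abs_of_pos (by positivity)] at k2
  exact (mul_left_cancel₀ hδ0.ne' k2).symm

theorem pos_opp (e : T.OrientedEdge) {s : ℝ} (hs : s ∈ Icc 0 (T.len e)) :
    T.pos e s 0 = T.pos (T.opp e) (T.len e - s) 0 := by
  have hL := T.len_pos e
  have := T.glue_aux e (t := s / T.len e) ⟨div_nonneg hs.1 hL.le, (div_le_one hL).2 hs.2⟩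
  rwa [len_opp, div_mul_cancel₀ _ hL.ne'] at this

theorem pos_zero (e : T.OrientedEdge) : T.pos e 0 0 = T.src e := by
  rw [pos, ← corner_zero]; rfl

theorem pos_len (e : T.OrientedEdge) : T.pos e (T.len e) 0 = T.tgt e := by
  rw [pos, ← corner_one]; rfl

theorem src_opp (e : T.OrientedEdge) : T.src (T.opp e) = T.tgt e := by
  have := T.pos_opp e (s := T.len e) ⟨(T.len_pos e).le, le_rfl⟩
  rw [sub_self, pos_zero, pos_len] at this
  exact Subtype.ext this.symm

theorem tgt_opp (e : T.OrientedEdge) : T.tgt (T.opp e) = T.src e := by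
  rw [← src_opp, T.opp_opp]

/-! ### The surface near a point that is not singular -/

/-- Near an interior point of a face the surface is given by the face. -/
theorem exists_interior_form {f : Fin T.faceCount} {x : Plane} (hx : x ∈ interior (T.tri f))
    {ψ : Plane → M} {ε : ℝ} (hψ : IsPlaneChart ψ (T.toSurface f x) ε) :
    ∃ ε', 0 < ε' ∧ ε' ≤ ε ∧ ∃ G : Plane ≃ₗᵢ[ℝ] Plane, ∀ v : Plane, ‖v‖ < ε' →
      x + v ∈ interior (T.tri f) ∧ T.toSurface f (x + v) = ψ (G v) := by
  obtain ⟨η, hη, h⟩ := T.locIsoOn f x (T.interior_sub_corners hx)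
  obtain ⟨η', hη', h'⟩ := Metric.isOpen_iff.1 isOpen_interior x hx
  set ε' := min (min η η') ε with hε'
  have hε0 : 0 < ε' := lt_min (lt_min hη hη') hψ.pos
  have e1 : ε' ≤ η := (min_le_left _ _).trans (min_le_left _ _)
  have e2 : ε' ≤ η' := (min_le_left _ _).trans (min_le_right _ _)
  have e3 : ε' ≤ ε := min_le_right _ _
  have hin : ∀ u ∈ ball x ε', u ∈ interior (T.tri f) := fun u hu => h' (ball_subset_ball e2 hu)
  obtain ⟨G, hG⟩ := hψ.exists_lift (EuclideanSpace.basisFun (Fin 2) ℝ) (s := ball x ε')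
    (E := T.toSurface f) (mem_ball_self hε0) rfl (half_pos hε0)
    (fun k => by
      rw [mem_ball, dist_eq_norm, add_sub_cancel_left, norm_smul, OrthonormalBasis.norm_eq_one,
        mul_one, Real.norm_of_nonneg (by positivity)]
      linarith) (ball_subset_ball e3)
    (fun u hu v hv => h u ⟨T.interior_sub_corners (hin u hu), ball_subset_ball e1 hu⟩
      v ⟨T.interior_sub_corners (hin v hv), ball_subset_ball e1 hv⟩)
  refine ⟨ε', hε0, e3, G, fun v hv => ?_⟩
  have hm : x + v ∈ ball x ε' := by simpa using hv
  exact ⟨hin _ hm, by rw [hG _ hm, add_sub_cancel_left]⟩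

/-- At an interior point of a side only the inequality 0 ≤ b of `fr_mem_tri` is an equality; the
other two are strict and persist nearby. -/
theorem exists_half_disc (e : T.OrientedEdge) {s : ℝ} (hs : s ∈ Ioo 0 (T.len e)) :
    ∃ η > 0, ∀ a b : ℝ, a ^ 2 + b ^ 2 < η ^ 2 → 0 ≤ b →
      T.fr e (s + a) b ∈ T.tri e.1 ∧ (0 < b → T.fr e (s + a) b ∈ interior (T.tri e.1)) := by
  have hc := T.cy_pos e
  have hev : ∀ᶠ p : ℝ × ℝ in 𝓝 (0, 0), 0 < (s + p.1) * T.cy e - p.2 * T.cx e ∧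
      (s + p.1) * T.cy e - p.2 * T.cx e + p.2 * T.len e < T.len e * T.cy e := by
    refine (ContinuousAt.eventually_lt (by fun_prop) (by fun_prop) ?_).and
      (ContinuousAt.eventually_lt (by fun_prop) (by fun_prop) ?_)
    · simpa using mul_pos hs.1 hc
    · simpa using mul_lt_mul_of_pos_right hs.2 hc
  obtain ⟨η, hη, h⟩ := Metric.eventually_nhds_iff.1 hev
  refine ⟨η, hη, fun a b hab hb => ?_⟩
  have ha' : |a| < η := abs_lt_of_sq_lt_sq (by nlinarith [sq_nonneg b]) hη.le
  have hb' : |b| < η := abs_lt_of_sq_lt_sq (by nlinarith [sq_nonneg a]) hη.le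
  obtain ⟨h1, h2⟩ := h (y := (a, b)) (by
    rw [Prod.dist_eq, max_lt_iff, Real.dist_eq, Real.dist_eq, sub_zero, sub_zero]
    exact ⟨ha', hb'⟩)
  exact ⟨(T.fr_mem_tri e _ _).2 ⟨hb, h1.le, h2.le⟩,
    fun hb => (T.fr_mem_interior e _ _).2 ⟨hb, h1, h2⟩⟩

/-- The orthonormal basis formed by the direction and the normal of a side. -/
noncomputable def sideBasis (e : T.OrientedEdge) : OrthonormalBasis (Fin 2) ℝ Plane :=
  have ho : Orthonormal ℝ ![T.dir e, T.nrm e] := by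
    rw [orthonormal_iff_ite]
    intro i j
    fin_cases i <;> fin_cases j <;> simp [norm_dir, norm_nrm, inner_dir_nrm, inner_nrm_dir]
  OrthonormalBasis.mk ho
    (by rw [ho.linearIndependent.span_eq_top_of_card_eq_finrank' (by simp)])

theorem sideBasis_zero (e : T.OrientedEdge) : T.sideBasis e 0 = T.dir e := by simp [sideBasis]

theorem sideBasis_one (e : T.OrientedEdge) : T.sideBasis e 1 = T.nrm e := by simp [sideBasis]

/-- A half-disc contains its centre and the multiples of the direction and of the inward normal that
`exists_lift` needs. The vectors U and N are the images of this direction and this normal in the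
chart. -/
theorem exists_half_form (e : T.OrientedEdge) {s : ℝ} (hs : s ∈ Ioo 0 (T.len e))
    {ψ : Plane → M} {ε : ℝ} (hψ : IsPlaneChart ψ (T.pos e s 0) ε) :
    ∃ ε', 0 < ε' ∧ ε' ≤ ε ∧ ∃ U N : Plane, ‖U‖ = 1 ∧ ‖N‖ = 1 ∧ inner ℝ U N = 0 ∧
      ∀ a b : ℝ, a ^ 2 + b ^ 2 < ε' ^ 2 → 0 ≤ b → T.fr e (s + a) b ∈ T.tri e.1 ∧
        (0 < b → T.fr e (s + a) b ∈ interior (T.tri e.1)) ∧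
        T.pos e (s + a) b = ψ (a • U + b • N) := by
  obtain ⟨η, hη, h⟩ := T.locallyIsometric e.1 _ (T.edge_sub_corners e hs)
  obtain ⟨η', hη', h'⟩ := T.exists_half_disc e hs
  set ε' := min (min η η') ε with hε'
  have hε0 : 0 < ε' := lt_min (lt_min hη hη') hψ.pos
  have e1 : ε' ≤ η := (min_le_left _ _).trans (min_le_left _ _)
  have e2 : ε' ≤ η' := (min_le_left _ _).trans (min_le_right _ _)
  have e3 : ε' ≤ ε := min_le_right _ _
  have hsub : ∀ a b, T.fr e (s + a) b - T.fr e s 0 = a • T.dir e + b • T.nrm e := fun a b => by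
    simp only [fr]; module
  have hdist : ∀ a b, a ^ 2 + b ^ 2 < ε' ^ 2 → dist (T.fr e (s + a) b) (T.fr e s 0) < ε' :=
    fun a b hab => by
      rw [dist_eq_norm, hsub]
      exact norm_lt_of_sq_lt hε0 (T.norm_frame_sq e a b) hab
  have hm : ∀ a b, a ^ 2 + b ^ 2 < ε' ^ 2 → 0 ≤ b → T.fr e (s + a) b ∈ T.tri e.1 ∧
        (0 < b → T.fr e (s + a) b ∈ interior (T.tri e.1)) := fun a b hab hb =>
    h' a b (hab.trans_le (pow_le_pow_left₀ hε0.le e2 2)) hb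
  set S : Set Plane := {x | ∃ a b, a ^ 2 + b ^ 2 < ε' ^ 2 ∧ 0 ≤ b ∧ x = T.fr e (s + a) b} with hS
  have hSb : ∀ x ∈ S, x ∈ T.tri e.1 ∧ x ∈ ball (T.fr e s 0) ε' := by
    rintro x ⟨a, b, hab, hb, rfl⟩
    exact ⟨(hm a b hab hb).1, hdist a b hab⟩
  obtain ⟨G, hG⟩ := hψ.exists_lift (T.sideBasis e) (s := S) (E := T.toSurface e.1)
    (z := T.fr e s 0) ⟨0, 0, by simpa using by positivity, le_rfl, by simp⟩ rfl (half_pos hε0)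
    (fun k => by
      have hh : (ε' / 2) ^ 2 < ε' ^ 2 := by nlinarith
      fin_cases k
      · refine ⟨ε' / 2, 0, by simpa using hh, le_rfl, ?_⟩
        simp only [Fin.zero_eta, sideBasis_zero, fr]; module
      · refine ⟨0, ε' / 2, by simpa using hh, by positivity, ?_⟩
        simp only [Fin.mk_one, sideBasis_one, fr]; module)
    (fun x hx => ball_subset_ball e3 (hSb x hx).2)
    (fun u hu v hv => h u ⟨(hSb u hu).1, ball_subset_ball e1 (hSb u hu).2⟩
      v ⟨(hSb v hv).1, ball_subset_ball e1 (hSb v hv).2⟩)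
  refine ⟨ε', hε0, e3, G (T.dir e), G (T.nrm e), by simp [norm_dir], by simp [norm_nrm],
    by rw [G.inner_map_map, inner_dir_nrm], fun a b hab hb => ⟨(hm a b hab hb).1,
      (hm a b hab hb).2, ?_⟩⟩
  rw [pos, hG _ ⟨a, b, hab, hb, rfl⟩, hsub]
  simp

theorem dist_fr_normal (e : T.OrientedEdge) (s : ℝ) {b : ℝ} (hb : 0 ≤ b) :
    dist (T.fr e s b) (T.fr e s 0) = b := by
  rw [dist_fr, sub_self, sub_zero, zero_pow two_ne_zero, zero_add, Real.sqrt_sq hb]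

theorem eq_opp_of_fr_eq {e e' : T.OrientedEdge} (h : e.1 = e'.1) {s s' : ℝ}
    (hs : s ∈ Ioo 0 (T.len e)) (hs' : s' ∈ Ioo 0 (T.len e')) (hf : T.fr e s 0 = T.fr e' s' 0) :
    e = e' ∧ s = s' := by
  obtain ⟨f, k⟩ := e
  obtain ⟨f', k'⟩ := e'
  obtain rfl : f = f' := h
  obtain ⟨rfl, h2⟩ := T.edge_point_inj hs hs' hf
  exact ⟨rfl, h2⟩

/-- Near an interior point of an edge the surface consists of two half-discs. -/
theorem exists_edge_form (e : T.OrientedEdge) {s : ℝ} (hs : s ∈ Ioo 0 (T.len e))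
    {ψ : Plane → M} {ε : ℝ} (hψ : IsPlaneChart ψ (T.pos e s 0) ε) :
    ∃ ε', 0 < ε' ∧ ε' ≤ ε ∧ ∃ U N : Plane, ‖U‖ = 1 ∧ ‖N‖ = 1 ∧ inner ℝ U N = 0 ∧
      ∀ a b : ℝ, a ^ 2 + b ^ 2 < ε' ^ 2 → (0 ≤ b → T.fr e (s + a) b ∈ T.tri e.1 ∧
        (0 < b → T.fr e (s + a) b ∈ interior (T.tri e.1)) ∧
        T.pos e (s + a) b = ψ (a • U + b • N)) ∧
      (b ≤ 0 → T.fr (T.opp e) (T.len e - s - a) (-b) ∈ T.tri (T.opp e).1 ∧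
        (b < 0 → T.fr (T.opp e) (T.len e - s - a) (-b) ∈ interior (T.tri (T.opp e).1)) ∧
        T.pos (T.opp e) (T.len e - s - a) (-b) = ψ (a • U + b • N)) := by
  have hs' : T.len e - s ∈ Ioo 0 (T.len (T.opp e)) := by
    rw [len_opp]; exact ⟨by linarith [hs.2], by linarith [hs.1]⟩
  have hψ' : IsPlaneChart ψ (T.pos (T.opp e) (T.len e - s) 0) ε := by
    rw [← T.pos_opp e ⟨hs.1.le, hs.2.le⟩]; exact hψ
  obtain ⟨ε₁, hε₁, hε₁ε, U, N, hU, hN, hUN, h₁⟩ := T.exists_half_form e hs hψ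
  obtain ⟨ε₂, hε₂, hε₂ε, U', N', hU', hN', hUN', h₂⟩ := T.exists_half_form (T.opp e) hs' hψ'
  set ε' := min ε₁ ε₂ with hε'
  have hε0 : 0 < ε' := lt_min hε₁ hε₂
  have l1 : ε' ^ 2 ≤ ε₁ ^ 2 := pow_le_pow_left₀ hε0.le (min_le_left _ _) 2
  have l2 : ε' ^ 2 ≤ ε₂ ^ 2 := pow_le_pow_left₀ hε0.le (min_le_right _ _) 2
  have hmem : ∀ {U N : Plane}, ‖U‖ = 1 → ‖N‖ = 1 → inner ℝ U N = 0 → ∀ a b : ℝ,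
      a ^ 2 + b ^ 2 < ε' ^ 2 → a • U + b • N ∈ ball (0 : Plane) ε := fun hU hN hUN a b hab => by
    rw [mem_ball_zero_iff]
    exact (norm_lt_of_sq_lt hε0 (norm_frame_of_orthonormal hU hN hUN a b) hab).trans_le
      ((min_le_left _ _).trans hε₁ε)
  -- the two sides run in opposite directions
  have hUU : U' = -U := by
    set a := min (ε' / 2) (min (s / 2) ((T.len e - s) / 2)) with ha
    have ha0 : 0 < a := by
      have := hs.1; have := hs.2
      exact lt_min (by positivity) (lt_min (by linarith) (by linarith))
    have a1 : a ≤ ε' / 2 := min_le_left _ _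
    have a2 : a ≤ (T.len e - s) / 2 := (min_le_right _ _).trans (min_le_right _ _)
    have hlt : a ^ 2 + 0 ^ 2 < ε' ^ 2 := by nlinarith
    have hlt' : (-a) ^ 2 + 0 ^ 2 < ε' ^ 2 := by nlinarith
    obtain ⟨-, -, k1⟩ := h₁ a 0 (hlt.trans_le l1) le_rfl
    obtain ⟨-, -, k2⟩ := h₂ (-a) 0 (hlt'.trans_le l2) le_rfl
    rw [T.pos_opp e ⟨by linarith [hs.1], by linarith [hs.2]⟩] at k1
    rw [show T.len e - s + -a = T.len e - (s + a) by ring, k1] at k2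
    have := hψ.injOn (hmem hU hN hUN a 0 hlt) (hmem hU' hN' hUN' (-a) 0 hlt') k2
    simp only [zero_smul, add_zero, neg_smul] at this
    rw [← smul_neg] at this
    have h3 := smul_right_injective Plane ha0.ne' this
    rw [h3, neg_neg]
  subst hUU
  -- Being orthogonal to U, the vector N' is ±N. If it were N, the two half-discs would have the
  -- same image, and injectivity on face interiors would force `opp e = e`.
  have hNN : N' = -N := by
    have hUN2 : inner ℝ U N' = 0 := by simpa [inner_neg_left] using hUN'
    have hd := Plane.decomp_of_orthonormal hU hN hUN N'
    rw [hUN2, zero_smul, zero_add] at hd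
    have habs : |inner ℝ N N'| = 1 := by
      have := congrArg norm hd
      rw [norm_smul, hN, hN', mul_one, Real.norm_eq_abs] at this
      exact this.symm
    rcases (abs_eq zero_le_one).1 habs with h | h
    swap
    · rw [hd, h]; simp
    exfalso
    rw [h, one_smul] at hd
    subst hd
    have key : ∀ b ∈ Ioo 0 ε', e.1 = (T.opp e).1 ∧ T.fr e s b = T.fr (T.opp e) (T.len e - s) b := by
      intro b hb
      have hlt : (0 : ℝ) ^ 2 + b ^ 2 < ε' ^ 2 := by nlinarith [hb.1, hb.2]
      obtain ⟨-, m1, k1⟩ := h₁ 0 b (hlt.trans_le l1) hb.1.le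
      obtain ⟨m2, -, k2⟩ := h₂ 0 b (hlt.trans_le l2) hb.1.le
      simp only [add_zero, zero_smul, zero_add] at m1 k1 k2 m2
      exact T.interior_inj _ _ _ (m1 hb.1) _ m2 (k1.trans k2.symm)
    have hpt : T.fr e s 0 = T.fr (T.opp e) (T.len e - s) 0 := by
      refine eq_of_forall_small_dist hε0 fun b hb => ?_
      have := dist_triangle (T.fr e s 0) (T.fr e s b) (T.fr (T.opp e) (T.len e - s) 0)
      rw [dist_comm (T.fr e s 0) (T.fr e s b), T.dist_fr_normal e s hb.1.le, (key b hb).2,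
        T.dist_fr_normal _ _ hb.1.le] at this
      linarith
    have hf := (key (ε' / 2) ⟨by positivity, by linarith⟩).1
    exact T.opp_ne e (T.eq_opp_of_fr_eq hf hs hs' hpt).1.symm
  subst hNN
  refine ⟨ε', hε0, (min_le_left _ _).trans hε₁ε, U, N, hU, hN, hUN, fun a b hab => ⟨fun hb =>
    h₁ a b (hab.trans_le l1) hb, fun hb => ?_⟩⟩
  obtain ⟨k1, k2, k3⟩ := h₂ (-a) (-b) (by simpa using hab.trans_le l2) (by linarith)
  rw [← sub_eq_add_neg] at k1 k2 k3
  refine ⟨k1, fun hb => k2 (by linarith), ?_⟩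
  rw [k3]
  congr 1
  module

theorem toSurface_cases_edge {e : T.OrientedEdge} {s : ℝ} (hs : s ∈ Ioo 0 (T.len e))
    {g : Fin T.faceCount} {x : Plane} (hx : x ∈ T.tri g) (h : T.toSurface g x = T.pos e s 0) :
    ∃ k, ∃ s' ∈ Ioo 0 (T.len (g, k)), x = T.fr (g, k) s' 0 := by
  rcases T.tri_cases hx with hi | ⟨k, rfl⟩ | h'
  · obtain ⟨rfl, rfl⟩ := T.interior_inj g e.1 x hi _ (T.edge_mem_tri e ⟨hs.1.le, hs.2.le⟩) h
    exact absurd hi (T.edge_notMem_interior e s)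
  · have h1 := T.corner_mem g k
    rw [h] at h1
    exact absurd h1 (T.not_mem _ _ (T.edge_sub_corners e hs))
  · exact h'

/-- The preimages of an interior point of an edge are the two points on the two sides. -/
theorem preimage_edge {e : T.OrientedEdge} {s : ℝ} (hs : s ∈ Ioo 0 (T.len e))
    {g : Fin T.faceCount} {x : Plane} (hx : x ∈ T.tri g) (h : T.toSurface g x = T.pos e s 0) :
    (g = e.1 ∧ x = T.fr e s 0) ∨ (g = (T.opp e).1 ∧ x = T.fr (T.opp e) (T.len e - s) 0) := by
  obtain ⟨k, s', hs', rfl⟩ := T.toSurface_cases_edge hs hx h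
  obtain ⟨ε, ψ, hψ⟩ := (T.pos_regular e hs).exists_chart
  have hψ' : IsPlaneChart ψ (T.pos (g, k) s' 0) ε := by
    have : T.pos (g, k) s' 0 = T.pos e s 0 := h
    rw [this]; exact hψ
  obtain ⟨ε₁, hε₁, hε₁ε, U, N, hU, hN, hUN, h₁⟩ := T.exists_edge_form e hs hψ
  obtain ⟨ε₂, hε₂, hε₂ε, U', N', hU', hN', hUN', h₂⟩ := T.exists_half_form (g, k) hs' hψ'
  have hd := Plane.decomp_of_orthonormal hU hN hUN N'
  set α := inner ℝ U N'
  set β := inner ℝ N N'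
  have hαβ : α ^ 2 + β ^ 2 = 1 := by
    rw [← norm_frame_of_orthonormal hU hN hUN, ← hd, hN', one_pow]
  set ε' := min ε₁ ε₂ with hε'
  have hε0 : 0 < ε' := lt_min hε₁ hε₂
  have l1 : ε' ^ 2 ≤ ε₁ ^ 2 := pow_le_pow_left₀ hε0.le (min_le_left _ _) 2
  have l2 : ε' ^ 2 ≤ ε₂ ^ 2 := pow_le_pow_left₀ hε0.le (min_le_right _ _) 2
  have hb2 : ∀ b ∈ Ioo 0 ε', (0 : ℝ) ^ 2 + b ^ 2 < ε' ^ 2 ∧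
      (b * α) ^ 2 + (b * β) ^ 2 < ε' ^ 2 := fun b hb => by
    have : (b * α) ^ 2 + (b * β) ^ 2 = b ^ 2 := by linear_combination b ^ 2 * hαβ
    rw [this]
    constructor <;> nlinarith [hb.1, hb.2]
  have hq : ∀ b ∈ Ioo 0 ε', T.fr (g, k) s' b ∈ interior (T.tri g) ∧
      T.toSurface g (T.fr (g, k) s' b) = ψ ((b * α) • U + (b * β) • N) := fun b hb => by
    obtain ⟨-, m, k⟩ := h₂ 0 b ((hb2 b hb).1.trans_le l2) hb.1.le
    rw [add_zero] at m k
    refine ⟨m hb.1, ?_⟩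
    rw [pos] at k
    rw [k, hd]
    congr 1
    module
  -- Points approaching the side along its inward normal are located in the face of e'; letting b
  -- tend to 0 locates the point on the side.
  have hfin : ∀ e' : T.OrientedEdge, ∀ t c γ : ℝ, (∀ b ∈ Ioo 0 ε', g = e'.1 ∧
      T.fr (g, k) s' b = T.fr e' (t + b * c) (b * γ)) → c ^ 2 + γ ^ 2 = 1 →
      g = e'.1 ∧ T.fr (g, k) s' 0 = T.fr e' t 0 := by
    intro e' t c γ hall hcγ
    refine ⟨(hall (ε' / 2) ⟨by positivity, by linarith⟩).1,
      eq_of_forall_small_dist hε0 fun b hb => ?_⟩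
    have h3 := dist_triangle (T.fr (g, k) s' 0) (T.fr (g, k) s' b) (T.fr e' t 0)
    have h4 : dist (T.fr e' (t + b * c) (b * γ)) (T.fr e' t 0) = b := by
      rw [dist_fr, show (t + b * c - t) ^ 2 + (b * γ - 0) ^ 2 = b ^ 2 by
        linear_combination b ^ 2 * hcγ, Real.sqrt_sq hb.1.le]
    rw [dist_comm (T.fr (g, k) s' 0) (T.fr (g, k) s' b), T.dist_fr_normal _ _ hb.1.le,
      (hall b hb).2, h4] at h3
    linarith
  -- The inward normal of the side `(g, k)` points into the half-disc of `opp e` or into that of e.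
  -- It cannot be tangent to the edge, since interior points of g would then be points of a side.
  rcases lt_trichotomy β 0 with hβ | hβ | hβ
  · right
    refine hfin (T.opp e) (T.len e - s) (-α) (-β) (fun b hb => ?_) (by simpa using hαβ)
    obtain ⟨m, -, k⟩ := (h₁ (b * α) (b * β) ((hb2 b hb).2.trans_le l1)).2
      (by nlinarith [hb.1])
    have := T.interior_inj _ _ _ (hq b hb).1 _ m ((hq b hb).2.trans k.symm)
    rw [show T.len e - s + b * -α = T.len e - s - b * α by ring, mul_neg]
    exact this
  · exfalso
    have hb : ε' / 2 ∈ Ioo 0 ε' := ⟨by positivity, by linarith⟩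
    obtain ⟨m, -, k'⟩ := (h₁ (ε' / 2 * α) (ε' / 2 * β) ((hb2 _ hb).2.trans_le l1)).1
      (by rw [hβ, mul_zero])
    have h5 := T.interior_inj _ _ _ (hq _ hb).1 _ m ((hq _ hb).2.trans k'.symm)
    have h6 := (hq _ hb).1
    rw [h5.2, hβ, mul_zero, h5.1] at h6
    exact T.edge_notMem_interior e _ h6
  · left
    refine hfin e s α β (fun b hb => ?_) hαβ
    obtain ⟨m, -, k⟩ := (h₁ (b * α) (b * β) ((hb2 b hb).2.trans_le l1)).1
      (by nlinarith [hb.1])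
    exact T.interior_inj _ _ _ (hq b hb).1 _ m ((hq b hb).2.trans k.symm)

end GeodesicTriangulation

/-! ### The squared distance to the apex as a function on the surface -/

theorem eq_neg_of_dist_eq {V : Type*} [NormedAddCommGroup V] [InnerProductSpace ℝ V] {u v : V}
    (h1 : ‖v‖ = ‖u‖) (h2 : dist u v = 2 * ‖u‖) : v = -u := by
  rw [dist_eq_norm] at h2
  have h := parallelogram_law_with_norm ℝ u v
  rw [h1, h2] at h
  have h3 : ‖u + v‖ ^ 2 = 0 := by nlinarith
  have h4 := norm_eq_zero.1 (pow_eq_zero_iff two_ne_zero |>.1 h3)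
  exact (neg_eq_of_add_eq_zero_right h4).symm

namespace GeodesicTriangulation

variable {M : Type*} [MetricSpace M] (T : GeodesicTriangulation M) (r : singularSet M → ℝ)

/-- Coordinate along `e` of the foot of the altitude from the apex. -/
noncomputable def edgeX (e : T.OrientedEdge) : ℝ :=
  (r (T.src e) ^ 2 - r (T.tgt e) ^ 2 + T.len e ^ 2) / (2 * T.len e)

/-- Signed distance to `e` of the foot of the altitude from the apex. -/
noncomputable def edgeD (e : T.OrientedEdge) : ℝ :=
  (T.cx e ^ 2 + T.cy e ^ 2 - 2 * T.edgeX r e * T.cx e - r (T.src (T.prev e)) ^ 2 +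
    r (T.src e) ^ 2) / (2 * T.cy e)

/-- The quadratic function on a face with Hessian `2` and values `r ^ 2` at the corners: the
squared distance to the apex. -/
noncomputable def faceQ (f : Fin T.faceCount) (z : Plane) : ℝ :=
  ‖z‖ ^ 2 + ∑ j, (T.bary f).coord j z * (r (T.src (f, j)) ^ 2 - ‖T.corner f j‖ ^ 2)

/-- A triangulation is locally convex at `r` if the foots of the altitudes of adjacent pyramids
are in the right order at each edge. -/
def IsLocallyConvex : Prop := ∀ e, 0 ≤ T.edgeD r e + T.edgeD r (T.opp e)

theorem faceQ_fr (e : T.OrientedEdge) (a b : ℝ) : T.faceQ r e.1 (T.fr e a b) =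
    a ^ 2 + b ^ 2 + r (T.src e) ^ 2 - 2 * T.edgeX r e * a - 2 * T.edgeD r e * b := by
  obtain ⟨h2, h1, h0⟩ := T.coord_fr e a b
  have hc := (T.cy_pos e).ne'
  have hL := (T.len_pos e).ne'
  rw [faceQ, Fin3.sum_eq _ e.2, h0, h1, h2, T.corner_one, T.corner_two, norm_fr_sq, norm_fr_sq,
    norm_fr_sq]
  have e1 : T.src (e.1, e.2 + 1) = T.tgt e := rfl
  have e2 : T.src (T.prev e) = T.src (e.1, e.2 + 2) := rfl
  simp only [edgeX, edgeD, e1, e2]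
  field_simp
  ring

theorem faceQ_corner (f : Fin T.faceCount) (k : Fin 3) :
    T.faceQ r f (T.corner f k) = r (T.src (f, k)) ^ 2 := by
  have := T.faceQ_fr r (f, k) 0 0
  rw [← T.corner_zero] at this
  simpa using this

theorem continuous_faceQ (f : Fin T.faceCount) : Continuous (T.faceQ r f) := by
  unfold faceQ
  have : ∀ j, Continuous ((T.bary f).coord j) := fun j => continuous_barycentric_coord _ _
  fun_prop

/-- The parallelogram identity of a quadratic polynomial with leading part ‖z‖²: this second
difference is the only trace of the Hessian used in the comparison of triangulations. -/
theorem faceQ_add_sub (f : Fin T.faceCount) (z v : Plane) :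
    T.faceQ r f (z - v) + T.faceQ r f (z + v) = 2 * T.faceQ r f z + 2 * ‖v‖ ^ 2 := by
  obtain ⟨a, b, rfl⟩ := T.exists_fr (f, 0) z
  have hv := T.decomp (f, 0) v
  set a' := inner ℝ (T.dir (f, 0)) v
  set b' := inner ℝ (T.nrm (f, 0)) v
  have h1 : T.fr (f, 0) a b - v = T.fr (f, 0) (a - a') (b - b') := by
    rw [hv]; simp only [fr]; module
  have h2 : T.fr (f, 0) a b + v = T.fr (f, 0) (a + a') (b + b') := by
    rw [hv]; simp only [fr]; module
  have h3 : ‖v‖ ^ 2 = a' ^ 2 + b' ^ 2 := by rw [hv, norm_frame_sq]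
  rw [h1, h2, h3]
  have := fun a b => T.faceQ_fr r (f, 0) a b
  simp only at this
  rw [this, this, this]
  ring

theorem edgeX_opp (e : T.OrientedEdge) : T.edgeX r (T.opp e) = T.len e - T.edgeX r e := by
  have := (T.len_pos e).ne'
  simp only [edgeX, src_opp, tgt_opp, len_opp]
  field_simp
  ring

theorem sq_tgt (e : T.OrientedEdge) :
    r (T.tgt e) ^ 2 = r (T.src e) ^ 2 + T.len e ^ 2 - 2 * T.edgeX r e * T.len e := by
  have := (T.len_pos e).ne'
  simp only [edgeX]
  field_simp
  ring

theorem faceQ_opp (e : T.OrientedEdge) (s b : ℝ) :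
    T.faceQ r (T.opp e).1 (T.fr (T.opp e) (T.len e - s) b) =
      s ^ 2 + b ^ 2 + r (T.src e) ^ 2 - 2 * T.edgeX r e * s - 2 * T.edgeD r (T.opp e) * b := by
  rw [faceQ_fr, edgeX_opp, src_opp, sq_tgt]
  ring

/-- This makes `q` well defined. Identified points are equal interior points, corners over the same
vertex, or points of a side, whose preimages are given by `preimage_edge`. -/
theorem faceQ_eq_of_toSurface_eq {f g : Fin T.faceCount} {x y : Plane} (hx : x ∈ T.tri f)
    (hy : y ∈ T.tri g) (h : T.toSurface f x = T.toSurface g y) :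
    T.faceQ r f x = T.faceQ r g y := by
  rcases T.tri_cases hx with hi | ⟨k, rfl⟩ | ⟨k, s, hs, rfl⟩
  · obtain ⟨rfl, rfl⟩ := T.interior_inj _ _ _ hi _ hy h
    rfl
  · have hmem := T.corner_mem f k
    rcases T.tri_cases hy with hi | ⟨k', rfl⟩ | ⟨k', s, hs, rfl⟩
    · obtain ⟨rfl, rfl⟩ := T.interior_inj _ _ _ hi _ hx h.symm
      rfl
    · rw [faceQ_corner, faceQ_corner]
      have : T.src (f, k) = T.src (g, k') := Subtype.ext h
      rw [this]
    · rw [h] at hmem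
      exact absurd hmem (T.not_mem _ _ (T.edge_sub_corners (g, k') hs))
  · rcases T.preimage_edge hs hy h.symm with ⟨rfl, rfl⟩ | ⟨rfl, rfl⟩
    · rfl
    · rw [faceQ_opp, T.faceQ_fr r (f, k)]
      ring

/-- The squared distance to the apex, as a function on the surface. -/
noncomputable def q (y : M) : ℝ := T.faceQ r (T.covers y).choose (T.covers y).choose_spec.choose

theorem q_toSurface {f : Fin T.faceCount} {x : Plane} (hx : x ∈ T.tri f) :
    T.q r (T.toSurface f x) = T.faceQ r f x :=
  T.faceQ_eq_of_toSurface_eq r (T.covers _).choose_spec.choose_spec.1 hx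
    (T.covers (T.toSurface f x)).choose_spec.choose_spec.2

theorem q_singular (i : singularSet M) : T.q r i = r i ^ 2 := by
  obtain ⟨f, x, hx, h⟩ := T.covers i
  rcases T.tri_cases hx with hi | ⟨k, rfl⟩ | ⟨k, s, hs, rfl⟩
  · exact absurd (h ▸ i.2) (T.not_mem _ _ (T.interior_sub_corners hi))
  · rw [← h, T.q_toSurface r hx, faceQ_corner]
    have : T.src (f, k) = i := Subtype.ext h
    rw [this]
  · exact absurd (h ▸ i.2) (T.not_mem _ _ (T.edge_sub_corners (f, k) hs))

/-- The surface is a finite union of compact images of faces, so preimages of closed sets can be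
tested face by face. -/
theorem continuous_q : Continuous (T.q r) := by
  rw [continuous_iff_isClosed]
  intro C hC
  have : T.q r ⁻¹' C = ⋃ f, T.toSurface f '' (T.tri f ∩ T.faceQ r f ⁻¹' C) := by
    ext y
    simp only [mem_preimage, mem_iUnion, mem_image, mem_inter_iff]
    constructor
    · intro hy
      obtain ⟨f, x, hx, rfl⟩ := T.covers y
      exact ⟨f, x, ⟨hx, by rwa [T.q_toSurface r hx] at hy⟩, rfl⟩
    · rintro ⟨f, x, ⟨hx, hq⟩, rfl⟩
      rwa [T.q_toSurface r hx]
  rw [this]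
  refine isClosed_iUnion_of_finite fun f => IsCompact.isClosed ?_
  exact ((T.isCompact_tri f).inter_right (hC.preimage (T.continuous_faceQ r f))).image_of_continuousOn
    ((T.continuousOn f).mono inter_subset_left)

/-- Position of a point that is not singular: in the interior of a face or of an edge. -/
theorem regular_cases {y : M} (hy : IsRegularPoint y) :
    (∃ f, ∃ x ∈ interior (T.tri f), T.toSurface f x = y) ∨
      ∃ e, ∃ s ∈ Ioo 0 (T.len e), T.pos e s 0 = y := by
  obtain ⟨f, x, hx, rfl⟩ := T.covers y
  rcases T.tri_cases hx with hi | ⟨k, rfl⟩ | ⟨k, s, hs, rfl⟩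
  · exact Or.inl ⟨f, x, hi, rfl⟩
  · exact absurd hy (T.corner_mem f k)
  · exact Or.inr ⟨(f, k), s, hs, rfl⟩

/-- The function `q` in a chart around an interior point of an edge. -/
theorem exists_q_edge_form (e : T.OrientedEdge) {s : ℝ} (hs : s ∈ Ioo 0 (T.len e))
    {ψ : Plane → M} {ε : ℝ} (hψ : IsPlaneChart ψ (T.pos e s 0) ε) :
    ∃ ε', 0 < ε' ∧ ε' ≤ ε ∧ ∃ U N : Plane, ‖U‖ = 1 ∧ ‖N‖ = 1 ∧ inner ℝ U N = 0 ∧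
      ∀ a b : ℝ, a ^ 2 + b ^ 2 < ε' ^ 2 → T.q r (ψ (a • U + b • N)) =
        (s + a) ^ 2 + b ^ 2 + r (T.src e) ^ 2 - 2 * T.edgeX r e * (s + a)
          - 2 * T.edgeD r e * max b 0 - 2 * T.edgeD r (T.opp e) * max (-b) 0 := by
  obtain ⟨ε', h0, h1, U, N, hU, hN, hUN, h⟩ := T.exists_edge_form e hs hψ
  refine ⟨ε', h0, h1, U, N, hU, hN, hUN, fun a b hab => ?_⟩
  rcases le_total 0 b with hb | hb
  · obtain ⟨k1, -, k2⟩ := (h a b hab).1 hb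
    rw [← k2, pos, T.q_toSurface r k1, faceQ_fr, max_eq_left hb, max_eq_right (by linarith)]
    ring
  · obtain ⟨k1, -, k2⟩ := (h a b hab).2 hb
    rw [← k2, pos, T.q_toSurface r k1, show T.len e - s - a = T.len e - (s + a) by ring,
      faceQ_opp, max_eq_right hb, max_eq_left (by linarith)]
    ring

/-- Two points equally far from y, at twice that distance from each other, are antipodal in the
chart. Midpoint inequalities can thus be stated by distances alone and do not refer to a chart. -/
theorem exists_midpoint_of_chart {ψ : Plane → M} {y : M} {ε : ℝ} (hψ : IsPlaneChart ψ y ε)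
    {y₁ y₂ : M} (h1 : dist y₁ y < ε) (h2 : dist y₂ y = dist y₁ y)
    (h12 : dist y₁ y₂ = 2 * dist y₁ y) :
    ∃ u, ‖u‖ = dist y₁ y ∧ y₁ = ψ u ∧ y₂ = ψ (-u) := by
  obtain ⟨u, hu, hu'⟩ := hψ.surj y₁ h1
  obtain ⟨v, hv, hv'⟩ := hψ.surj y₂ (h2 ▸ h1)
  have : v = -u := by
    refine eq_neg_of_dist_eq (by rw [hv', hu', h2]) ?_
    rw [← hψ.dist_eq u (by simpa [hu'] using h1) v (by rw [mem_ball_zero_iff, hv', h2]; exact h1),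
      hu, hv, h12, hu']
  exact ⟨u, hu', hu.symm, by rw [← this, hv]⟩

/-- At points that are not singular the function `q` is at most as convex as `‖x‖ ^ 2`. -/
theorem q_midpoint_le (hr : T.IsLocallyConvex r) {y : M} (hy : IsRegularPoint y) :
    ∃ η > 0, ∀ y₁ y₂ : M, dist y₁ y < η → dist y₂ y = dist y₁ y →
      dist y₁ y₂ = 2 * dist y₁ y → T.q r y₁ + T.q r y₂ ≤ 2 * T.q r y + 2 * dist y₁ y ^ 2 := by
  obtain ⟨ε, ψ, hψ⟩ := hy.exists_chart
  rcases T.regular_cases hy with ⟨f, x, hx, rfl⟩ | ⟨e, s, hs, rfl⟩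
  · obtain ⟨ε', h0, h1, G, hG⟩ := T.exists_interior_form hx hψ
    refine ⟨ε', h0, fun y₁ y₂ k1 k2 k3 => ?_⟩
    obtain ⟨u, hu, rfl, rfl⟩ := exists_midpoint_of_chart hψ (k1.trans_le h1) k2 k3
    have hu' : ‖G.symm u‖ < ε' := by rw [G.symm.norm_map, hu]; exact k1
    obtain ⟨m1, e1⟩ := hG (G.symm u) hu'
    obtain ⟨m2, e2⟩ := hG (-G.symm u) (by rwa [norm_neg])
    rw [map_neg, G.apply_symm_apply] at e2
    rw [G.apply_symm_apply] at e1
    rw [← hu, ← e1, ← e2, T.q_toSurface r (interior_subset m1), T.q_toSurface r (interior_subset m2),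
      T.q_toSurface r (interior_subset hx), ← sub_eq_add_neg, add_comm, faceQ_add_sub,
      G.symm.norm_map]
  · obtain ⟨ε', h0, h1, U, N, hU, hN, hUN, h⟩ := T.exists_q_edge_form r e hs hψ
    refine ⟨ε', h0, fun y₁ y₂ k1 k2 k3 => ?_⟩
    obtain ⟨u, hu, rfl, rfl⟩ := exists_midpoint_of_chart hψ (k1.trans_le h1) k2 k3
    have hd := Plane.decomp_of_orthonormal hU hN hUN u
    set a := inner ℝ U u
    set b := inner ℝ N u
    have hab : a ^ 2 + b ^ 2 = ‖u‖ ^ 2 := by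
      rw [← norm_frame_of_orthonormal hU hN hUN, ← hd]
    have hlt : a ^ 2 + b ^ 2 < ε' ^ 2 := by
      rw [hab]; exact pow_lt_pow_left₀ (hu ▸ k1) (norm_nonneg _) two_ne_zero
    have q1 := h a b hlt
    have q2 := h (-a) (-b) (by simpa using hlt)
    have q0 := h 0 0 (by simpa using by positivity)
    rw [show -a • U + -b • N = -(a • U + b • N) by module, ← hd] at q2
    rw [← hd] at q1
    rw [zero_smul, zero_smul, add_zero, hψ.map_zero] at q0
    rw [q1, q2, q0, ← hu, ← hab]
    -- The second difference exceeds that of ‖x‖² by the crease term −2 (D_e + D_{−e}) |b|, which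
    -- local convexity makes nonpositive.
    have := hr e
    rcases le_total 0 b with hb | hb
    · simp only [neg_neg, max_eq_left hb, max_eq_right (show -b ≤ 0 by linarith), neg_zero, max_self]
      nlinarith [mul_nonneg this hb]
    · simp only [neg_neg, max_eq_right hb, max_eq_left (show 0 ≤ -b by linarith), neg_zero, max_self]
      nlinarith [mul_nonneg this (neg_nonneg.2 hb)]

/-- Comparison along a segment in a face of another triangulation. -/
theorem q_le_q_segment {T₁ T₂ : GeodesicTriangulation M} (h₁ : T₁.IsLocallyConvex r)
    {f : Fin T₂.faceCount} {x y : Plane} (hx : x ∈ T₂.tri f) (hy : y ∈ T₂.tri f)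
    (hxy : x ≠ y)
    (hseg : ∀ t ∈ Ioo (0 : ℝ) 1, AffineMap.lineMap x y t ∉ range (T₂.corner f))
    (hqx : T₂.q r (T₂.toSurface f x) ≤ T₁.q r (T₂.toSurface f x))
    (hqy : T₂.q r (T₂.toSurface f y) ≤ T₁.q r (T₂.toSurface f y)) :
    ∀ t ∈ Icc (0 : ℝ) 1, T₂.q r (T₂.toSurface f (AffineMap.lineMap x y t)) ≤
      T₁.q r (T₂.toSurface f (AffineMap.lineMap x y t)) := by
  set z : ℝ → Plane := fun t => AffineMap.lineMap x y t with hz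
  have hzc : Continuous z := AffineMap.lineMap_continuous
  have hzm : ∀ t ∈ Icc (0 : ℝ) 1, z t ∈ T₂.tri f := fun t ht =>
    (T₂.convex_tri f).segment_subset hx hy (by
      rw [segment_eq_image_lineMap]; exact ⟨t, ht, rfl⟩)
  have hcont : ContinuousOn (fun t => T₂.toSurface f (z t)) (Icc 0 1) :=
    (T₂.continuousOn f).comp hzc.continuousOn hzm
  have hd0 : 0 < dist x y := dist_pos.2 hxy
  have hdist : ∀ s t, dist (z s) (z t) = |s - t| * dist x y := fun s t => by
    rw [hz]; simp only [dist_lineMap_lineMap, Real.dist_eq]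
  intro t ht
  -- The second difference of `T₁.q` at regular points is at most that of ‖x‖², while that of `T₂.q`
  -- along a segment in a face equals it; the difference is midpoint concave.
  have key := le_of_locally_midpoint_concave (m := 0)
    (f := fun t => T₁.q r (T₂.toSurface f (z t)) - T₂.q r (T₂.toSurface f (z t)))
    (((T₁.continuous_q r).comp_continuousOn hcont).sub ((T₂.continuous_q r).comp_continuousOn hcont))
    (fun t ht => ?_) (by simpa [hz] using hqx) (by simpa [hz] using hqy) t ht
  · exact sub_nonneg.1 key
  have hmem : z t ∈ T₂.tri f \ range (T₂.corner f) := ⟨hzm t ⟨ht.1.le, ht.2.le⟩, hseg t ht⟩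
  obtain ⟨η, hη, h⟩ := T₁.q_midpoint_le r h₁ (T₂.regular_of_mem hmem)
  obtain ⟨ε, hε, hiso⟩ := T₂.locallyIsometric f _ hmem
  -- The segment has speed `dist x y`, so bounds on distances are divided by it; the last two
  -- entries keep t ± δ in the unit interval.
  refine ⟨min (min (η / dist x y) (ε / dist x y)) (min t (1 - t)), lt_min (lt_min (by positivity)
    (by positivity)) (lt_min ht.1 (by linarith [ht.2])), fun δ hδ => ?_⟩
  simp only [mem_Ioo, lt_min_iff] at hδ
  obtain ⟨hδ0, ⟨hδη, hδε⟩, hδt, hδt'⟩ := hδ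
  rw [lt_div_iff₀ hd0] at hδη hδε
  have m1 : z (t - δ) ∈ T₂.tri f := hzm _ ⟨by linarith, by linarith [ht.2]⟩
  have m2 : z (t + δ) ∈ T₂.tri f := hzm _ ⟨by linarith [ht.1], by linarith⟩
  have b1 : z (t - δ) ∈ ball (z t) ε := by
    rw [mem_ball, hdist, show t - δ - t = -δ by ring, abs_neg, abs_of_pos hδ0]; exact hδε
  have b2 : z (t + δ) ∈ ball (z t) ε := by
    rw [mem_ball, hdist, add_sub_cancel_left, abs_of_pos hδ0]; exact hδε
  have d1 : dist (T₂.toSurface f (z (t - δ))) (T₂.toSurface f (z t)) = δ * dist x y := by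
    rw [hiso _ ⟨m1, b1⟩ _ ⟨hmem.1, mem_ball_self hε⟩, hdist, show t - δ - t = -δ by ring, abs_neg,
      abs_of_pos hδ0]
  have d2 : dist (T₂.toSurface f (z (t + δ))) (T₂.toSurface f (z t)) = δ * dist x y := by
    rw [hiso _ ⟨m2, b2⟩ _ ⟨hmem.1, mem_ball_self hε⟩, hdist, add_sub_cancel_left, abs_of_pos hδ0]
  have d3 : dist (T₂.toSurface f (z (t - δ))) (T₂.toSurface f (z (t + δ))) =
      2 * (δ * dist x y) := by
    rw [hiso _ ⟨m1, b1⟩ _ ⟨m2, b2⟩, hdist, show t - δ - (t + δ) = -(2 * δ) by ring, abs_neg,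
      abs_of_pos (by linarith)]
    ring
  have k := h (T₂.toSurface f (z (t - δ))) (T₂.toSurface f (z (t + δ))) (by rw [d1]; exact hδη)
    (by rw [d1, d2]) (by rw [d1, d3])
  rw [d1] at k
  have k2 : T₂.q r (T₂.toSurface f (z (t - δ))) + T₂.q r (T₂.toSurface f (z (t + δ))) =
      2 * T₂.q r (T₂.toSurface f (z t)) + 2 * (δ * dist x y) ^ 2 := by
    rw [T₂.q_toSurface r m1, T₂.q_toSurface r m2, T₂.q_toSurface r hmem.1]
    have e1 : z (t - δ) = z t - δ • (y - x) := by
      simp only [hz, AffineMap.lineMap_apply_module']; module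
    have e2 : z (t + δ) = z t + δ • (y - x) := by
      simp only [hz, AffineMap.lineMap_apply_module']; module
    rw [e1, e2, faceQ_add_sub, norm_smul, Real.norm_of_nonneg hδ0.le, ← dist_eq_norm, dist_comm]
  linarith

/-- Both functions are r² at the vertices. `q_le_q_segment` carries the inequality along the sides
of T₂ and then along segments from a corner to the opposite side, which sweep out the face. -/
theorem q_le_q {T₁ T₂ : GeodesicTriangulation M} (h₁ : T₁.IsLocallyConvex r) (y : M) :
    T₂.q r y ≤ T₁.q r y := by
  have hcorner : ∀ f k, T₂.q r (T₂.toSurface f (T₂.corner f k)) ≤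
      T₁.q r (T₂.toSurface f (T₂.corner f k)) := fun f k =>
    le_of_eq ((T₂.q_singular r (T₂.src (f, k))).trans (T₁.q_singular r (T₂.src (f, k))).symm)
  have hedge : ∀ f k, ∀ s ∈ Icc 0 (T₂.len (f, k)),
      T₂.q r (T₂.toSurface f (T₂.fr (f, k) s 0)) ≤ T₁.q r (T₂.toSurface f (T₂.fr (f, k) s 0)) := by
    intro f k s hs
    have hL := T₂.len_pos (f, k)
    have hlm : ∀ t, AffineMap.lineMap (T₂.corner f k) (T₂.corner f (k + 1)) t =
        T₂.fr (f, k) (t * T₂.len (f, k)) 0 := fun t => T₂.lineMap_corner (f, k) t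
    have := q_le_q_segment r h₁ (T₂.corner_mem_tri f k) (T₂.corner_mem_tri f (k + 1))
      (fun h => by
        have := T₂.corner_injective f h
        revert this; clear * -; revert k; decide)
      (fun t ht => by
        rw [hlm]
        exact T₂.edge_notMem_corners (f, k) ⟨mul_pos ht.1 hL, by nlinarith [ht.2]⟩)
      (hcorner f k) (hcorner f (k + 1)) (s / T₂.len (f, k))
      ⟨div_nonneg hs.1 hL.le, (div_le_one hL).2 hs.2⟩
    rwa [hlm, div_mul_cancel₀ _ hL.ne'] at this
  obtain ⟨f, x, hx, rfl⟩ := T₂.covers y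
  rcases T₂.tri_cases hx with hi | ⟨k, rfl⟩ | ⟨k, s, hs, rfl⟩
  · obtain ⟨a, b, rfl⟩ := T₂.exists_fr (f, 0) x
    obtain ⟨hb, h2, h3⟩ := (T₂.fr_mem_interior (f, 0) a b).1 hi
    have hc := T₂.cy_pos (f, 0)
    have hL := T₂.len_pos (f, 0)
    -- the segment from the opposite corner through the point
    set e : T₂.OrientedEdge := (f, 0) with he
    have hby : b < T₂.cy e := by
      by_contra! hle
      nlinarith
    set t := b / T₂.cy e with ht
    have ht0 : 0 < t := div_pos hb hc
    have ht1 : t < 1 := (div_lt_one hc).2 hby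
    -- The line from the corner (cx, cy) through (a, b) meets the side at (s, 0): solve a = s + t
    -- (cx − s) with t = b / cy.
    set s := (a - t * T₂.cx e) / (1 - t) with hs
    have ht1' : 0 < 1 - t := by linarith
    have hbt : b = t * T₂.cy e := by rw [ht]; field_simp
    have hs0 : 0 < s := by
      refine div_pos ?_ ht1'
      rw [hbt] at h2
      have : 0 < (a - t * T₂.cx e) * T₂.cy e := by linarith
      exact pos_of_mul_pos_left this hc.le
    have hs1 : s < T₂.len e := by
      rw [hs, div_lt_iff₀ ht1']
      rw [hbt] at h3
      have : (a - t * T₂.cx e) * T₂.cy e < (T₂.len e * (1 - t)) * T₂.cy e := by linarith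
      exact lt_of_mul_lt_mul_right this hc.le
    have hlm : ∀ t, AffineMap.lineMap (T₂.fr e s 0) (T₂.corner f (0 + 2)) t =
        T₂.fr e (s + t * (T₂.cx e - s)) (t * T₂.cy e) := fun t => by
      rw [AffineMap.lineMap_apply_module', show T₂.corner f (0 + 2) = T₂.corner e.1 (e.2 + 2) from rfl,
        T₂.corner_two]
      simp only [fr]; module
    have hint : ∀ u ∈ Ioo (0 : ℝ) 1,
        T₂.fr e (s + u * (T₂.cx e - s)) (u * T₂.cy e) ∈ interior (T₂.tri e.1) := fun u hu => by
      rw [fr_mem_interior]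
      refine ⟨mul_pos hu.1 hc, ?_, ?_⟩
      · have : 0 < (1 - u) * s * T₂.cy e := by
          have := hu.2
          have : 0 < 1 - u := by linarith
          positivity
        linarith
      · have : 0 < (1 - u) * (T₂.len e - s) * T₂.cy e := by
          have := hu.2
          have h1 : 0 < 1 - u := by linarith
          have h2 : 0 < T₂.len e - s := by linarith
          positivity
        linarith
    have := q_le_q_segment r h₁ (T₂.edge_mem_tri e ⟨hs0.le, hs1.le⟩) (T₂.corner_mem_tri f (0 + 2))
      (fun h => by
        rw [show T₂.corner f (0 + 2) = T₂.corner e.1 (e.2 + 2) from rfl, T₂.corner_two] at h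
        exact hc.ne (T₂.fr_injective e h).2)
      (fun u hu => by
        rw [hlm]; exact (T₂.interior_sub_corners (hint u hu)).2)
      (hedge f 0 s ⟨hs0.le, hs1.le⟩) (hcorner f (0 + 2)) t ⟨ht0.le, ht1.le⟩
    rw [hlm, ← hbt] at this
    have ha : s + t * (T₂.cx e - s) = a := by
      rw [hs]; field_simp; ring
    rwa [ha] at this
  · exact hcorner f k
  · exact hedge f k s ⟨hs.1.le, hs.2.le⟩

/-- The function `q` depends only on the radii. -/
theorem q_eq_q {T₁ T₂ : GeodesicTriangulation M} (h₁ : T₁.IsLocallyConvex r)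
    (h₂ : T₂.IsLocallyConvex r) (y : M) : T₁.q r y = T₂.q r y :=
  le_antisymm (q_le_q r h₂ y) (q_le_q r h₁ y)

end GeodesicTriangulation

/-! ### Polar coordinates around a cone point -/

/-- `c` are polar coordinates on the `ε`-neighbourhood of a cone point `x` of angle `α`. -/
structure IsConeChart {M : Type*} [MetricSpace M] (c : ℝ → ℝ → M) (x : M) (α ε : ℝ) : Prop where
  pos : 0 < ε
  angle_pos : 0 < α
  map_zero : c 0 0 = x
  surj : ∀ y, dist y x < ε → ∃ s ∈ Ico 0 ε, ∃ a, c s a = y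
  dist_eq : ∀ s ∈ Ico 0 ε, ∀ t ∈ Ico 0 ε, ∀ a b, dist (c s a) (c t b) = coneDist α s a t b

theorem coneDist_eq {α s a t b : ℝ} (hα : 0 < α) (h1 : |a - b| ≤ Real.pi) (h2 : |a - b| ≤ α / 2) :
    coneDist α s a t b = √(s ^ 2 + t ^ 2 - 2 * s * t * Real.cos (a - b)) := by
  rw [coneDist, (AddCircle.norm_coe_eq_abs_iff α hα.ne').2 (by rwa [abs_of_pos hα]),
    min_eq_right h1, Real.cos_abs]

theorem coneDist_same (α s t a : ℝ) : coneDist α s a t a = |s - t| := by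
  rw [coneDist, sub_self, AddCircle.coe_zero, norm_zero, min_eq_right Real.pi_pos.le, Real.cos_zero,
    ← Real.sqrt_sq_eq_abs]
  congr 1; ring

theorem Complex.dist_sq_polar (u v : ℂ) :
    dist u v ^ 2 = ‖u‖ ^ 2 + ‖v‖ ^ 2 - 2 * ‖u‖ * ‖v‖ * Real.cos (u.arg - v.arg) := by
  have h1 := Complex.norm_mul_cos_arg u
  have h2 := Complex.norm_mul_sin_arg u
  have h3 := Complex.norm_mul_cos_arg v
  have h4 := Complex.norm_mul_sin_arg v
  rw [Complex.dist_eq, ← Complex.normSq_eq_norm_sq, ← Complex.normSq_eq_norm_sq,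
    ← Complex.normSq_eq_norm_sq, Real.cos_sub, Complex.normSq_apply, Complex.normSq_apply,
    Complex.normSq_apply, Complex.sub_re, Complex.sub_im]
  rw [← h1, ← h2, ← h3, ← h4]
  ring

namespace IsConeChart

variable {M : Type*} [MetricSpace M] {c : ℝ → ℝ → M} {x : M} {α ε : ℝ}

theorem dist_apex (h : IsConeChart c x α ε) {s : ℝ} (hs : s ∈ Ico 0 ε) (a : ℝ) :
    dist (c s a) x = s := by
  rw [← h.map_zero, h.dist_eq s hs 0 ⟨le_rfl, h.pos⟩, coneDist]
  simp [Real.sqrt_sq hs.1]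

theorem mono (h : IsConeChart c x α ε) {ε' : ℝ} (h0 : 0 < ε') (h1 : ε' ≤ ε) :
    IsConeChart c x α ε' where
  pos := h0
  angle_pos := h.angle_pos
  map_zero := h.map_zero
  surj y hy := by
    obtain ⟨s, hs, a, rfl⟩ := h.surj y (hy.trans_le h1)
    rw [h.dist_apex hs] at hy
    exact ⟨s, ⟨hs.1, hy⟩, a, rfl⟩
  dist_eq s hs t ht a b := h.dist_eq s ⟨hs.1, hs.2.trans_le h1⟩ t ⟨ht.1, ht.2.trans_le h1⟩ a b

theorem reflect (h : IsConeChart c x α ε) : IsConeChart (fun s a => c s (-a)) x α ε where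
  pos := h.pos
  angle_pos := h.angle_pos
  map_zero := by simpa using h.map_zero
  surj y hy := by
    obtain ⟨s, hs, a, rfl⟩ := h.surj y hy
    exact ⟨s, hs, -a, by simp⟩
  dist_eq s hs t ht a b := by
    rw [h.dist_eq s hs t ht, coneDist, coneDist, show -a - -b = -(a - b) by ring, AddCircle.coe_neg,
      norm_neg]

theorem eq_of_norm_eq_zero (h : IsConeChart c x α ε) {s : ℝ} (hs : s ∈ Ico 0 ε) {a b : ℝ}
    (hab : ‖((a - b : ℝ) : AddCircle α)‖ = 0) : c s a = c s b := by
  rw [← dist_eq_zero, h.dist_eq s hs s hs, coneDist, hab, min_eq_right Real.pi_pos.le,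
    Real.cos_zero]
  simp only [Real.sqrt_eq_zero']
  nlinarith

/-- The distance |s − t| forces the cosine in `coneDist` to be 1, so the truncated angle is 0; it is
not the truncation value π, hence it is the true angle. -/
theorem norm_eq_zero_of_coneDist (h : IsConeChart c x α ε) {s t : ℝ} (hs : s ∈ Ioo 0 ε)
    (ht : t ∈ Ioo 0 ε) {a b : ℝ} (hab : dist (c s a) (c t b) = |s - t|) :
    ‖((a - b : ℝ) : AddCircle α)‖ = 0 := by
  rw [h.dist_eq s ⟨hs.1.le, hs.2⟩ t ⟨ht.1.le, ht.2⟩, coneDist] at hab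
  set β := min Real.pi ‖((a - b : ℝ) : AddCircle α)‖ with hβ
  have hβ0 : 0 ≤ β := le_min Real.pi_pos.le (norm_nonneg _)
  have h1 : 0 ≤ s ^ 2 + t ^ 2 - 2 * s * t * Real.cos β := by
    have := Real.cos_le_one β
    have h0 : 0 ≤ s * t := mul_nonneg hs.1.le ht.1.le
    nlinarith [sq_nonneg (s - t)]
  have h2 := congrArg (· ^ 2) hab
  simp only [Real.sq_sqrt h1, sq_abs] at h2
  have hst : 0 < s * t := mul_pos hs.1 ht.1
  have h3 : Real.cos β = 1 := by
    have : s * t * (1 - Real.cos β) = 0 := by linarith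
    rcases mul_eq_zero.1 this with h | h <;> linarith
  have hβπ : β ≤ Real.pi := min_le_left _ _
  have h4 : β = 0 := by
    rw [Real.cos_eq_one_iff_of_lt_of_lt (by linarith [Real.pi_pos]) (by linarith [Real.pi_pos])] at h3
    exact h3
  rcases min_choice Real.pi ‖((a - b : ℝ) : AddCircle α)‖ with h5 | h5
  · rw [← hβ, h4] at h5; exact absurd h5.symm Real.pi_pos.ne'
  · rw [← hβ, h4] at h5; exact h5.symm

theorem eq_of_coneDist (h : IsConeChart c x α ε) {s t : ℝ} (hs : s ∈ Ioo 0 ε) (ht : t ∈ Ioo 0 ε)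
    {a b : ℝ} (hab : dist (c s a) (c t b) = |s - t|) : c s a = c s b :=
  h.eq_of_norm_eq_zero ⟨hs.1.le, hs.2⟩ (h.norm_eq_zero_of_coneDist hs ht hab)

theorem exists_int_of_eq (h : IsConeChart c x α ε) {s : ℝ} (hs : s ∈ Ioo 0 ε) {a b : ℝ}
    (hab : c s a = c s b) : ∃ n : ℤ, n * α = a - b := by
  have h1 := h.norm_eq_zero_of_coneDist hs hs (a := a) (b := b) (by simp [hab])
  rw [norm_eq_zero, AddCircle.coe_eq_zero_iff] at h1
  obtain ⟨n, hn⟩ := h1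
  exact ⟨n, by rw [← hn, zsmul_eq_mul]⟩

theorem eq_add_int_mul (h : IsConeChart c x α ε) {s : ℝ} (hs : s ∈ Ico 0 ε) (a : ℝ) (n : ℤ) :
    c s (a + n * α) = c s a := by
  refine h.eq_of_norm_eq_zero hs ?_
  rw [add_sub_cancel_left, ← zsmul_eq_mul, AddCircle.coe_zsmul, AddCircle.coe_period, smul_zero,
    norm_zero]

/-- Away from the cut, polar coordinates are isometric. -/
theorem polar_isometric (h : IsConeChart c x α ε) (a₀ : ℝ) {w : ℂ} (hw : w ∈ Complex.slitPlane)
    (hwε : ‖w‖ < ε) : ∃ η > 0, ∀ u ∈ ball w η, ‖u‖ < ε ∧ ∀ v ∈ ball w η,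
      dist (c ‖u‖ (a₀ + u.arg)) (c ‖v‖ (a₀ + v.arg)) = dist u v := by
  have hα := h.angle_pos
  -- Two arguments this close to that of w differ by less than π and by less than α/2, so neither
  -- the truncation nor the period affects `coneDist`.
  have hκ : 0 < min (Real.pi / 2) (α / 4) := by have := Real.pi_pos; positivity
  obtain ⟨η₁, hη₁, h₁⟩ := Metric.continuousAt_iff.1 (Complex.continuousAt_arg hw) _ hκ
  refine ⟨min η₁ (ε - ‖w‖), lt_min hη₁ (by linarith), fun u hu => ?_⟩
  have hn : ∀ u ∈ ball w (min η₁ (ε - ‖w‖)), ‖u‖ < ε := fun u hu => by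
    have h1 : dist u w < ε - ‖w‖ := hu.trans_le (min_le_right _ _)
    rw [dist_eq_norm] at h1
    have := norm_add_le (u - w) w
    rw [sub_add_cancel] at this
    linarith
  have ha : ∀ u ∈ ball w (min η₁ (ε - ‖w‖)), |u.arg - w.arg| < min (Real.pi / 2) (α / 4) :=
    fun u hu => h₁ (hu.trans_le (min_le_left _ _))
  refine ⟨hn u hu, fun v hv => ?_⟩
  have hd : |u.arg - v.arg| < min (Real.pi / 2) (α / 4) + min (Real.pi / 2) (α / 4) := by
    have := abs_sub_le u.arg w.arg v.arg
    have h1 := ha u hu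
    have h2 := ha v hv
    rw [abs_sub_comm] at h2
    linarith
  have k1 := min_le_left (Real.pi / 2) (α / 4)
  have k2 := min_le_right (Real.pi / 2) (α / 4)
  rw [h.dist_eq _ ⟨norm_nonneg _, hn u hu⟩ _ ⟨norm_nonneg _, hn v hv⟩, coneDist_eq hα
    (by rw [add_sub_add_left_eq_sub]; linarith) (by rw [add_sub_add_left_eq_sub]; linarith),
    add_sub_add_left_eq_sub, ← Complex.dist_sq_polar, Real.sqrt_sq dist_nonneg]

/-- Choose the angle b' of y nearest to a₀ modulo α. Since y is closer to the centre than the apex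
is, the distance is not realized through the apex, so |b' − a₀| < π and b' − a₀ is the argument of a
complex number. -/
theorem polar_surj (h : IsConeChart c x α ε) (a₀ : ℝ) {s₀ : ℝ} (hs₀ : s₀ ∈ Ioo 0 ε) {y : M}
    (hy : dist y (c s₀ a₀) < min s₀ (ε - s₀)) :
    ∃ z : ℂ, dist z (s₀ : ℂ) = dist y (c s₀ a₀) ∧ c ‖z‖ (a₀ + z.arg) = y := by
  have hα := h.angle_pos
  have hs₀' : s₀ ∈ Ico 0 ε := ⟨hs₀.1.le, hs₀.2⟩
  have hy1 := hy.trans_le (min_le_left _ _)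
  have hy2 := hy.trans_le (min_le_right _ _)
  have hyx : dist y x < ε := by
    have := dist_triangle y (c s₀ a₀) x
    rw [h.dist_apex hs₀'] at this
    linarith
  obtain ⟨t, ht, b, rfl⟩ := h.surj y hyx
  set b' := b - round (α⁻¹ * (b - a₀)) * α with hb'
  have hbb : |b' - a₀| = ‖((b - a₀ : ℝ) : AddCircle α)‖ := by
    rw [AddCircle.norm_eq]; congr 1; rw [hb']; ring
  have hcb : c t b = c t b' := by
    refine h.eq_of_norm_eq_zero ht ?_
    rw [hb', sub_sub_cancel, ← zsmul_eq_mul, AddCircle.coe_zsmul, AddCircle.coe_period, smul_zero,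
      norm_zero]
  have hle : |b' - a₀| ≤ α / 2 := by
    rw [hbb]
    have := AddCircle.norm_le_half_period α (x := ((b - a₀ : ℝ) : AddCircle α)) hα.ne'
    rwa [abs_of_pos hα] at this
  have hlt : |b' - a₀| < Real.pi := by
    by_contra! hge
    have hd : dist (c t b) (c s₀ a₀) = t + s₀ := by
      rw [h.dist_eq t ht s₀ hs₀', coneDist, min_eq_left (by rwa [← hbb]), Real.cos_pi,
        ← Real.sqrt_sq (add_nonneg ht.1 hs₀.1.le)]
      congr 1; ring
    rw [hd] at hy1
    linarith [ht.1]
  have ht0 : 0 < t := by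
    rcases ht.1.eq_or_lt with h0 | h0
    · rw [← h0] at hy1
      have : dist (c 0 b) (c s₀ a₀) = s₀ := by
        rw [h.dist_eq 0 ⟨le_rfl, h.pos⟩ s₀ hs₀', coneDist]
        simp [Real.sqrt_sq hs₀.1.le]
      linarith
    · exact h0
  set z : ℂ := t * (Complex.cos ↑(b' - a₀) + Complex.sin ↑(b' - a₀) * Complex.I) with hz
  have hza : z.arg = b' - a₀ := by
    rw [hz]
    exact Complex.arg_mul_cos_add_sin_mul_I ht0 ⟨(abs_lt.1 hlt).1, (abs_lt.1 hlt).2.le⟩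
  have hzn : ‖z‖ = t := by
    rw [hz, norm_mul, Complex.norm_cos_add_sin_mul_I, mul_one, Complex.norm_real,
      Real.norm_of_nonneg ht.1]
  refine ⟨z, ?_, by rw [hzn, hza, add_sub_cancel, hcb]⟩
  rw [hcb, h.dist_eq t ht s₀ hs₀', coneDist_eq hα hlt.le hle]
  rw [← Real.sqrt_sq (dist_nonneg (x := z) (y := (s₀ : ℂ))), Complex.dist_sq_polar, hza, hzn,
    Complex.arg_ofReal_of_nonneg hs₀.1.le, Complex.norm_real, Real.norm_of_nonneg hs₀.1.le, sub_zero]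

/-- The identification of the Euclidean plane with the complex numbers. -/
noncomputable def _root_.planeToComplex : Plane ≃ₗᵢ[ℝ] ℂ := Complex.orthonormalBasisOneI.repr.symm

/-- Polar coordinates as a plane chart around a point different from the apex. -/
theorem exists_planeChart (h : IsConeChart c x α ε) (a₀ : ℝ) {s₀ : ℝ} (hs₀ : s₀ ∈ Ioo 0 ε) :
    ∃ η, η ≤ s₀ ∧ IsPlaneChart (fun p => c ‖(s₀ : ℂ) + planeToComplex p‖
      (a₀ + ((s₀ : ℂ) + planeToComplex p).arg)) (c s₀ a₀) η ∧
      ∀ p, ‖p‖ < η → ‖(s₀ : ℂ) + planeToComplex p‖ < ε := by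
  obtain ⟨η, hη, h1⟩ := h.polar_isometric a₀ (w := s₀)
    (by rw [Complex.ofReal_mem_slitPlane]; exact hs₀.1)
    (by rw [Complex.norm_real, Real.norm_of_nonneg hs₀.1.le]; exact hs₀.2)
  set η' := min η (min s₀ (ε - s₀)) with hη'
  have hη0 : 0 < η' := lt_min hη (lt_min hs₀.1 (by linarith [hs₀.2]))
  have hb : ∀ p : Plane, ‖p‖ < η' → (s₀ : ℂ) + planeToComplex p ∈ ball (s₀ : ℂ) η := fun p hp => by
    rw [mem_ball, dist_eq_norm, add_sub_cancel_left, planeToComplex.norm_map]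
    exact hp.trans_le (min_le_left _ _)
  refine ⟨η', (min_le_right _ _).trans (min_le_left _ _), ⟨hη0, ?_, fun u hu v hv => ?_,
    fun y hy => ?_⟩, fun p hp => (h1 _ (hb p hp)).1⟩
  · simp only [_root_.map_zero, add_zero, Complex.norm_real, Real.norm_of_nonneg hs₀.1.le,
      Complex.arg_ofReal_of_nonneg hs₀.1.le]
  · rw [mem_ball_zero_iff] at hu hv
    rw [(h1 _ (hb u hu)).2 _ (hb v hv), dist_add_left, planeToComplex.dist_map]
  · obtain ⟨z, hz1, hz2⟩ := h.polar_surj a₀ hs₀ (hy.trans_le (min_le_right _ _))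
    refine ⟨planeToComplex.symm (z - s₀), by simpa using hz2, ?_⟩
    rw [planeToComplex.symm.norm_map, ← dist_eq_norm, hz1]

theorem locIsoOn_ray (h : IsConeChart c x α ε) (a : ℝ) : LocIsoOn (fun s => c s a) (Ioo 0 ε) :=
  fun z hz => ⟨1, one_pos, fun u hu v hv => by
    rw [h.dist_eq u ⟨hu.1.1.le, hu.1.2⟩ v ⟨hv.1.1.le, hv.1.2⟩, coneDist_same, Real.dist_eq]⟩

/-- A geodesic that starts at the apex is radial. -/
theorem dist_apex_of_geodesic (h : IsConeChart c x α ε) {g : ℝ → M} {L : ℝ} (hL : 0 < L)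
    (hg : ContinuousOn g (Icc 0 L)) (hg0 : g 0 = x) (hiso : LocIsoOn g (Ioo 0 L))
    (hne : ∀ t ∈ Ioo 0 L, g t ≠ x) (hε : ∀ t ∈ Ioo 0 L, dist (g t) x < ε) :
    ∀ t ∈ Icc 0 L, dist (g t) x = t := by
  -- In the polar plane chart at g t the distance to the apex is ‖s₀ + u‖. By the parallelogram law
  -- its square minus t² is locally midpoint affine, hence affine on the whole interval.
  have hmid : ∀ t ∈ Ioo 0 L, ∃ η > 0, ∀ δ ∈ Ioo 0 η, (dist (g (t - δ)) x ^ 2 - (t - δ) ^ 2) +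
      (dist (g (t + δ)) x ^ 2 - (t + δ) ^ 2) = 2 * (dist (g t) x ^ 2 - t ^ 2) := by
    intro t ht
    obtain ⟨s₀, hs₀, a₀, hc⟩ := h.surj (g t) (hε t ht)
    have hs0 : 0 < s₀ := by
      refine lt_of_le_of_ne hs₀.1 fun h0 => hne t ht ?_
      rw [← dist_eq_zero, ← hc, h.dist_apex hs₀, ← h0]
    obtain ⟨η, hηs, hψ, hn⟩ := h.exists_planeChart a₀ ⟨hs0, hs₀.2⟩
    set ψ : Plane → M := fun p => c ‖(s₀ : ℂ) + planeToComplex p‖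
      (a₀ + ((s₀ : ℂ) + planeToComplex p).arg) with hψdef
    rw [hc] at hψ
    obtain ⟨η₂, hη₂, hi⟩ := hiso t ht
    refine ⟨min (min η η₂) (min t (L - t)), lt_min (lt_min hψ.pos hη₂)
      (lt_min ht.1 (by linarith [ht.2])), fun δ hδ => ?_⟩
    simp only [mem_Ioo, lt_min_iff] at hδ
    obtain ⟨hδ0, ⟨hδη, hδη₂⟩, hδt, hδL⟩ := hδ
    have mt : t ∈ Ioo 0 L ∩ ball t η₂ := ⟨ht, mem_ball_self hη₂⟩
    have m1 : t - δ ∈ Ioo 0 L ∩ ball t η₂ := ⟨⟨by linarith, by linarith [ht.2]⟩, by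
      rw [mem_ball, Real.dist_eq, show t - δ - t = -δ by ring, abs_neg, abs_of_pos hδ0]; exact hδη₂⟩
    have m2 : t + δ ∈ Ioo 0 L ∩ ball t η₂ := ⟨⟨by linarith [ht.1], by linarith⟩, by
      rw [mem_ball, Real.dist_eq, add_sub_cancel_left, abs_of_pos hδ0]; exact hδη₂⟩
    have d1 : dist (g (t - δ)) (g t) = δ := by
      rw [hi _ m1 _ mt, Real.dist_eq, show t - δ - t = -δ by ring, abs_neg, abs_of_pos hδ0]
    have d2 : dist (g (t + δ)) (g t) = δ := by
      rw [hi _ m2 _ mt, Real.dist_eq, add_sub_cancel_left, abs_of_pos hδ0]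
    have d3 : dist (g (t - δ)) (g (t + δ)) = 2 * δ := by
      rw [hi _ m1 _ m2, Real.dist_eq, show t - δ - (t + δ) = -(2 * δ) by ring, abs_neg,
        abs_of_pos (by linarith)]
    obtain ⟨u, hu, hu1, hu2⟩ := GeodesicTriangulation.exists_midpoint_of_chart hψ (d1.symm ▸ hδη)
      (d2.trans d1.symm) (by rw [d3, d1])
    rw [d1] at hu
    have r1 : dist (g (t - δ)) x = ‖(s₀ : ℂ) + planeToComplex u‖ := by
      rw [hu1]; exact h.dist_apex ⟨norm_nonneg _, hn u (hu ▸ hδη)⟩ _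
    have r2 : dist (g (t + δ)) x = ‖(s₀ : ℂ) + planeToComplex (-u)‖ := by
      rw [hu2]; exact h.dist_apex ⟨norm_nonneg _, hn (-u) (by rw [norm_neg, hu]; exact hδη)⟩ _
    have r0 : dist (g t) x = s₀ := by rw [← hc, h.dist_apex hs₀]
    have hp := parallelogram_law_with_norm ℝ (s₀ : ℂ) (planeToComplex u)
    rw [planeToComplex.norm_map, hu, Complex.norm_real, Real.norm_of_nonneg hs0.le] at hp
    rw [r1, r2, r0, map_neg, ← sub_eq_add_neg]
    linarith
  have hcont : ContinuousOn (fun t => dist (g t) x ^ 2 - t ^ 2) (Icc 0 L) := by fun_prop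
  have haff := eq_chord_of_locally_midpoint_affine hL hcont hmid
  set k := (dist (g L) x ^ 2 - L ^ 2) / L with hk
  have hR : ∀ t ∈ Icc 0 L, dist (g t) x ^ 2 = t ^ 2 + k * t := fun t ht => by
    have := haff t ht
    rw [hg0, dist_self] at this
    have h2 : (t - 0) / (L - 0) * (dist (g L) x ^ 2 - L ^ 2 - (0 ^ 2 - 0 ^ 2)) = k * t := by
      rw [hk, show (0 : ℝ) ^ 2 - 0 ^ 2 = 0 by ring, sub_zero, sub_zero, sub_zero]
      field_simp
    rw [h2] at this
    linarith
  -- The distance to the apex is 1-Lipschitz along g. For the squared distance t² + k t at t = L/2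
  -- this yields (L + k)² ≤ L² + 2 k L, that is, k² ≤ 0.
  have hk0 : k = 0 := by
    have ht : L / 2 ∈ Ioo 0 L := ⟨by linarith, by linarith⟩
    obtain ⟨η, hη, hi⟩ := hiso _ ht
    set δ := min (η / 2) (L / 4) with hδ
    have hδ0 : 0 < δ := by positivity
    have l1 : δ ≤ η / 2 := min_le_left _ _
    have l2 : δ ≤ L / 4 := min_le_right _ _
    have mt : L / 2 ∈ Ioo 0 L ∩ ball (L / 2) η := ⟨ht, mem_ball_self hη⟩
    have m1 : L / 2 - δ ∈ Ioo 0 L ∩ ball (L / 2) η := ⟨⟨by linarith, by linarith⟩, by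
      rw [mem_ball, Real.dist_eq, show L / 2 - δ - L / 2 = -δ by ring, abs_neg, abs_of_pos hδ0]
      linarith⟩
    have m2 : L / 2 + δ ∈ Ioo 0 L ∩ ball (L / 2) η := ⟨⟨by linarith, by linarith⟩, by
      rw [mem_ball, Real.dist_eq, add_sub_cancel_left, abs_of_pos hδ0]; linarith⟩
    have d1 : dist (g (L / 2 - δ)) (g (L / 2)) = δ := by
      rw [hi _ m1 _ mt, Real.dist_eq, show L / 2 - δ - L / 2 = -δ by ring, abs_neg, abs_of_pos hδ0]
    have d2 : dist (g (L / 2 + δ)) (g (L / 2)) = δ := by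
      rw [hi _ m2 _ mt, Real.dist_eq, add_sub_cancel_left, abs_of_pos hδ0]
    have t1 := dist_triangle (g (L / 2 - δ)) (g (L / 2)) x
    have t2 := dist_triangle (g (L / 2 + δ)) (g (L / 2)) x
    rw [d1] at t1
    rw [d2] at t2
    have e1 := hR _ ⟨m1.1.1.le, m1.1.2.le⟩
    have e2 := hR _ ⟨m2.1.1.le, m2.1.2.le⟩
    have e0 := hR _ ⟨mt.1.1.le, mt.1.2.le⟩
    set R := dist (g (L / 2)) x
    have hR0 : 0 ≤ R := dist_nonneg
    have s1 := pow_le_pow_left₀ dist_nonneg t1 2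
    have s2 := pow_le_pow_left₀ dist_nonneg t2 2
    rw [e1] at s1
    rw [e2] at s2
    have a1 : L + k ≤ 2 * R := by
      have : δ * (L + k) ≤ δ * (2 * R) := by nlinarith
      exact le_of_mul_le_mul_left this hδ0
    have a2 : -(L + k) ≤ 2 * R := by
      have : δ * (-(L + k)) ≤ δ * (2 * R) := by nlinarith
      exact le_of_mul_le_mul_left this hδ0
    have a3 : (L + k) ^ 2 ≤ (2 * R) ^ 2 := sq_le_sq' (by linarith) a1
    have : k ^ 2 ≤ 0 := by nlinarith
    exact pow_eq_zero_iff two_ne_zero |>.1 (le_antisymm this (sq_nonneg k))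
  intro t ht
  have := hR t ht
  rw [hk0, zero_mul, add_zero] at this
  exact (sq_eq_sq₀ dist_nonneg ht.1).1 this

end IsConeChart

theorem IsConePoint.exists_chart {M : Type*} [MetricSpace M] {x : M} {α : ℝ} (hα : 0 < α)
    (h : IsConePoint x α) : ∃ ε, ∃ c : ℝ → ℝ → M, IsConeChart c x α ε := by
  obtain ⟨ε, hε, c, h0, h1, h2⟩ := h
  exact ⟨ε, c, hε, hα, h0, fun y hy => (h1 y).1 hy, h2⟩

theorem IsEuclideanPolyhedral.exists_coneChart {M : Type*} [MetricSpace M]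
    (hM : IsEuclideanPolyhedral M) (i : singularSet M) :
    ∃ α ε, ∃ c : ℝ → ℝ → M, IsConeChart c (i : M) α ε := by
  rcases hM i with h | ⟨α, hα, -, h⟩
  · exact absurd h i.2
  · obtain ⟨ε, c, hc⟩ := h.exists_chart hα
    exact ⟨α, ε, c, hc⟩

/-! ### The surface near a vertex -/

namespace GeodesicTriangulation

variable {M : Type*} [MetricSpace M] (T : GeodesicTriangulation M)

/-- Within distance `ε` of the singular point `i` the surface consists of the sectors of radius `ε`
at the corners that are mapped to `i`. -/
structure IsVertexRadius (i : singularSet M) (ε : ℝ) : Prop where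
  pos : 0 < ε
  dist_eq : ∀ f k, T.src (f, k) = i → ∀ x ∈ T.tri f, dist x (T.corner f k) < ε →
    dist (T.toSurface f x) i = dist x (T.corner f k)
  exists_corner : ∀ f, ∀ x ∈ T.tri f, dist (T.toSurface f x) i < ε →
    ∃ k, T.src (f, k) = i ∧ dist x (T.corner f k) = dist (T.toSurface f x) i

theorem IsVertexRadius.mono {T : GeodesicTriangulation M} {i : singularSet M} {ε ε' : ℝ}
    (h : T.IsVertexRadius i ε) (h0 : 0 < ε') (h1 : ε' ≤ ε) : T.IsVertexRadius i ε' where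
  pos := h0
  dist_eq f k hk x hx hd := h.dist_eq f k hk x hx (hd.trans_le h1)
  exists_corner f x hx hd := h.exists_corner f x hx (hd.trans_le h1)

/-- The segment from the corner to x maps to a geodesic that starts at the apex of the cone chart
and stays in the chart; such a geodesic is radial by `dist_apex_of_geodesic`. -/
theorem exists_corner_radius {i : singularSet M} {c : ℝ → ℝ → M} {α ε : ℝ}
    (hc : IsConeChart c (i : M) α ε) (f : Fin T.faceCount) (k : Fin 3) (hk : T.src (f, k) = i) :
    ∃ η > 0, ∀ x ∈ T.tri f, dist x (T.corner f k) < η →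
      dist (T.toSurface f x) i = dist x (T.corner f k) := by
  have hτ : T.toSurface f (T.corner f k) = i := congrArg Subtype.val hk
  obtain ⟨η₁, hη₁, h₁⟩ := Metric.continuousWithinAt_iff.1
    (T.continuousOn f _ (T.corner_mem_tri f k)) ε hc.pos
  have hfin : ∀ᶠ x in 𝓝 (T.corner f k), ∀ j, j ≠ k → x ≠ T.corner f j := by
    rw [Filter.eventually_all]
    intro j
    by_cases hj : j = k
    · simp [hj]
    · have : T.corner f k ≠ T.corner f j := fun h => hj (T.corner_injective f h).symm
      filter_upwards [isOpen_ne.mem_nhds this] with x hx _ using hx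
  obtain ⟨η₂, hη₂, h₂⟩ := Metric.eventually_nhds_iff.1 hfin
  refine ⟨min η₁ η₂, lt_min hη₁ hη₂, fun x hx hd => ?_⟩
  rcases eq_or_ne x (T.corner f k) with rfl | hne
  · rw [hτ, dist_self, dist_self]
  set p := T.corner f k with hp
  set L := dist x p with hL
  have hL0 : 0 < L := dist_pos.2 hne
  have hxp : ‖x - p‖ = L := (dist_eq_norm x p).symm
  set z : ℝ → Plane := fun t => p + (t / L) • (x - p) with hz
  have hzd : ∀ s t, dist (z s) (z t) = dist s t := fun s t => by
    rw [hz]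
    simp only [dist_add_left]
    rw [dist_eq_norm, ← sub_smul, norm_smul, hxp, ← sub_div, norm_div,
      Real.norm_of_nonneg hL0.le, div_mul_cancel₀ _ hL0.ne', Real.dist_eq, Real.norm_eq_abs]
  have hz0 : z 0 = p := by simp [hz]
  have hzL : z L = x := by simp [hz, hL0.ne']
  have hzm : ∀ t ∈ Icc 0 L, z t ∈ T.tri f := fun t ht => by
    refine (T.convex_tri f).segment_subset (T.corner_mem_tri f k) hx ?_
    rw [segment_eq_image']
    exact ⟨t / L, ⟨div_nonneg ht.1 hL0.le, (div_le_one hL0).2 ht.2⟩, rfl⟩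
  have hzp : ∀ t, 0 ≤ t → dist (z t) p = t := fun t ht => by
    rw [← hz0, hzd, Real.dist_eq, sub_zero, abs_of_nonneg ht]
  have hreg : ∀ t ∈ Ioo 0 L, z t ∈ T.tri f \ range (T.corner f) := fun t ht => by
    refine ⟨hzm t ⟨ht.1.le, ht.2.le⟩, ?_⟩
    rintro ⟨j, hj⟩
    by_cases hjk : j = k
    · have := hzp t ht.1.le
      rw [← hj, hjk, dist_self] at this
      exact ht.1.ne this
    · exact h₂ (y := z t) (by
        rw [hzp t ht.1.le]; exact (ht.2.trans hd).trans_le (min_le_right _ _)) j hjk hj.symm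
  have key := hc.dist_apex_of_geodesic (g := fun t => T.toSurface f (z t)) hL0
    ((T.continuousOn f).comp (by fun_prop) hzm) (by simp only [hz0, hτ])
    ((T.locIsoOn f).comp hzd hreg)
    (fun t ht h => T.not_mem f _ (hreg t ht) (by rw [h]; exact i.2))
    (fun t ht => by
      have := h₁ (x := z t) (hzm t ⟨ht.1.le, ht.2.le⟩) (by
        rw [hzp t ht.1.le]; exact (ht.2.trans hd).trans_le (min_le_left _ _))
      rwa [hτ] at this) L ⟨hL0.le, le_rfl⟩
  simpa only [hzL] using key

/-- Near its corners a face is controlled by `exists_corner_radius`. The part of a face away from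
the corners over i is compact and its image misses i, hence stays at a positive distance from i. -/
theorem exists_isVertexRadius (hM : IsEuclideanPolyhedral M) (i : singularSet M) :
    ∃ ε, T.IsVertexRadius i ε := by
  obtain ⟨α, ε, c, hc⟩ := hM.exists_coneChart i
  have h1 : ∀ e : T.OrientedEdge, ∃ η > 0, T.src e = i → ∀ x ∈ T.tri e.1,
      dist x (T.corner e.1 e.2) < η → dist (T.toSurface e.1 x) i = dist x (T.corner e.1 e.2) := by
    intro e
    by_cases he : T.src e = i
    · obtain ⟨η, hη, h⟩ := T.exists_corner_radius hc e.1 e.2 he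
      exact ⟨η, hη, fun _ => h⟩
    · exact ⟨1, one_pos, fun h => absurd h he⟩
  choose η hη hη' using h1
  obtain ⟨η₀, hη₀, hη₀'⟩ : ∃ η₀ > 0, ∀ e, η₀ ≤ η e := by
    rcases isEmpty_or_nonempty T.OrientedEdge with hE | hE
    · exact ⟨1, one_pos, fun e => hE.elim e⟩
    · obtain ⟨e, he⟩ := Finite.exists_min η
      exact ⟨η e, hη e, he⟩
  have h2 : ∀ f : Fin T.faceCount, ∃ δ > 0, ∀ x ∈ T.tri f, dist (T.toSurface f x) i < δ →
      ∃ k, T.src (f, k) = i ∧ dist x (T.corner f k) < η₀ := by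
    intro f
    set K := T.tri f ∩ {x | ∀ k, T.src (f, k) = i → η₀ ≤ dist x (T.corner f k)} with hK
    have hKc : IsCompact K := by
      refine (T.isCompact_tri f).inter_right ?_
      simp only [ofPred_forall]
      exact isClosed_iInter fun k => isClosed_iInter fun _ =>
        isClosed_le continuous_const (by fun_prop)
    have hi : (i : M) ∉ T.toSurface f '' K := by
      rintro ⟨x, ⟨hx, hxk⟩, hxi⟩
      by_cases hr : x ∈ range (T.corner f)
      · obtain ⟨k, rfl⟩ := hr
        have := hxk k (Subtype.ext hxi)
        rw [dist_self] at this
        linarith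
      · exact T.not_mem f x ⟨hx, hr⟩ (by rw [hxi]; exact i.2)
    have hcl : IsClosed (T.toSurface f '' K) :=
      (hKc.image_of_continuousOn ((T.continuousOn f).mono inter_subset_left)).isClosed
    obtain ⟨δ, hδ, hb⟩ := Metric.isOpen_iff.1 hcl.isOpen_compl i hi
    refine ⟨δ, hδ, fun x hx hd => ?_⟩
    by_contra! hcon
    exact hb (mem_ball.2 hd) ⟨x, ⟨hx, hcon⟩, rfl⟩
  choose δ hδ hδ' using h2
  obtain ⟨δ₀, hδ₀, hδ₀'⟩ : ∃ δ₀ > 0, ∀ f, δ₀ ≤ δ f := by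
    rcases isEmpty_or_nonempty (Fin T.faceCount) with hE | hE
    · exact ⟨1, one_pos, fun e => hE.elim e⟩
    · obtain ⟨e, he⟩ := Finite.exists_min δ
      exact ⟨δ e, hδ e, he⟩
  refine ⟨min η₀ δ₀, lt_min hη₀ hδ₀, fun f k hk x hx hd => ?_, fun f x hx hd => ?_⟩
  · exact hη' (f, k) hk x hx ((hd.trans_le (min_le_left _ _)).trans_le (hη₀' _))
  · obtain ⟨k, hk, hd'⟩ := hδ' f x hx ((hd.trans_le (min_le_right _ _)).trans_le (hδ₀' _))
    exact ⟨k, hk, (hη' (f, k) hk x hx (hd'.trans_le (hη₀' _))).symm⟩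

theorem IsVertexRadius.dist_pos_eq {T : GeodesicTriangulation M} {e : T.OrientedEdge} {ε : ℝ}
    (h : T.IsVertexRadius (T.src e) ε) {s : ℝ} (hs : s ∈ Icc 0 (T.len e)) (hsε : s < ε) :
    dist (T.pos e s 0) (T.src e) = s := by
  have hd : dist (T.fr e s 0) (T.corner e.1 e.2) = s := by
    rw [T.corner_zero, dist_fr, sub_zero, sub_zero, zero_pow two_ne_zero, add_zero,
      Real.sqrt_sq hs.1]
  rw [GeodesicTriangulation.pos, h.dist_eq e.1 e.2 rfl _ (T.edge_mem_tri e hs) (by rwa [hd]), hd]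

/-- Every oriented edge leaves its initial vertex in a certain direction. -/
theorem exists_direction (hM : IsEuclideanPolyhedral M) {e : T.OrientedEdge} {c : ℝ → ℝ → M}
    {α ε : ℝ} (hc : IsConeChart c (T.src e : M) α ε) :
    ∃ a, ∃ δ > 0, ∀ s ∈ Ioo 0 δ, T.pos e s 0 = c s a := by
  obtain ⟨ε₀, hε₀⟩ := T.exists_isVertexRadius hM (T.src e)
  set δ := min (min ε ε₀) (T.len e) with hδ
  have hδ0 : 0 < δ := lt_min (lt_min hc.pos hε₀.pos) (T.len_pos e)
  have l1 : δ ≤ ε := (min_le_left _ _).trans (min_le_left _ _)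
  have l2 : δ ≤ ε₀ := (min_le_left _ _).trans (min_le_right _ _)
  have l3 : δ ≤ T.len e := min_le_right _ _
  have hdist : ∀ s ∈ Ioo 0 δ, dist (T.pos e s 0) (T.src e) = s := fun s hs =>
    hε₀.dist_pos_eq ⟨hs.1.le, hs.2.le.trans l3⟩ (hs.2.trans_le l2)
  have hex : ∀ s ∈ Ioo 0 δ, ∃ a, T.pos e s 0 = c s a := fun s hs => by
    obtain ⟨s', hs', a, ha⟩ := hc.surj (T.pos e s 0) (by rw [hdist s hs]; exact hs.2.trans_le l1)
    have := hdist s hs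
    rw [← ha, hc.dist_apex hs'] at this
    exact ⟨a, by rw [← ha, this]⟩
  -- The direction is read off at the single time δ/2. Near it the isometry condition between radial
  -- distances keeps the angle fixed modulo the period, and `geodesic_unique` extends this to the
  -- whole interval.
  have ht₀ : δ / 2 ∈ Ioo 0 δ := ⟨by positivity, by linarith⟩
  obtain ⟨a, ha⟩ := hex _ ht₀
  have hi := (T.locIsoOn_pos e).mono (Ioo_subset_Ioo_right l3 : Ioo 0 δ ⊆ _)
  refine ⟨a, δ, hδ0, geodesic_unique hi ((hc.locIsoOn_ray a).mono (Ioo_subset_Ioo_right l1))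
    (fun t ht => T.pos_regular e ⟨ht.1, ht.2.trans_le l3⟩) ht₀ ?_⟩
  obtain ⟨η, hη, hiso⟩ := hi _ ht₀
  filter_upwards [ball_mem_nhds _ hη, isOpen_Ioo.mem_nhds ht₀] with s hs hs'
  obtain ⟨b, hb⟩ := hex s hs'
  have := hiso s ⟨hs', hs⟩ _ ⟨ht₀, mem_ball_self hη⟩
  simp only [hb, ha, Real.dist_eq] at this
  rw [hb]
  exact hc.eq_of_coneDist ⟨hs'.1, hs'.2.trans_le l1⟩ ⟨ht₀.1, ht₀.2.trans_le l1⟩ this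

end GeodesicTriangulation

/-! ### Immersed wedges -/

/-- Locally isometric maps of a star-shaped set that agree near the centre agree. -/
theorem LocIsoOn.eqOn_of_starShaped {M : Type*} [MetricSpace M] {E₁ E₂ : ℂ → M} {U : Set ℂ} {z₁ : ℂ}
    (h₁ : LocIsoOn E₁ U) (h₂ : LocIsoOn E₂ U) (hreg : ∀ z ∈ U, IsRegularPoint (E₁ z))
    (hU : ∀ z ∈ U, segment ℝ z₁ z ⊆ U) {η : ℝ} (hη : 0 < η)
    (h : ∀ z ∈ U ∩ ball z₁ η, E₁ z = E₂ z) : EqOn E₁ E₂ U := by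
  intro z hz
  rcases eq_or_ne z z₁ with rfl | hne
  · exact h z ⟨hz, mem_ball_self hη⟩
  set L := dist z z₁ with hL
  have hL0 : 0 < L := dist_pos.2 hne
  have hxp : ‖z - z₁‖ = L := (dist_eq_norm z z₁).symm
  set γ : ℝ → ℂ := fun t => z₁ + (t / L) • (z - z₁) with hγ
  have hγd : ∀ s t, dist (γ s) (γ t) = dist s t := fun s t => by
    rw [hγ]
    simp only [dist_add_left]
    rw [dist_eq_norm, ← sub_smul, norm_smul, hxp, ← sub_div, norm_div,
      Real.norm_of_nonneg hL0.le, div_mul_cancel₀ _ hL0.ne', Real.dist_eq, Real.norm_eq_abs]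
  have hγL : γ L = z := by simp [hγ, hL0.ne']
  have hγ0 : γ 0 = z₁ := by simp [hγ]
  have hγU : MapsTo γ (Icc 0 L) U := fun t ht => by
    refine hU z hz ?_
    rw [segment_eq_image']
    exact ⟨t / L, ⟨div_nonneg ht.1 hL0.le, (div_le_one hL0).2 ht.2⟩, rfl⟩
  have hγU' : MapsTo γ (Ioo 0 L) U := fun t ht => hγU ⟨ht.1.le, ht.2.le⟩
  set t₀ := min L η / 2 with ht₀
  have hm : 0 < min L η := lt_min hL0 hη
  have hm1 : min L η ≤ L := min_le_left _ _
  have hm2 : min L η ≤ η := min_le_right _ _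
  have ht₀m : t₀ ∈ Ioo 0 L ∩ Iio η := ⟨⟨by positivity, by linarith⟩, by
    rw [mem_Iio]; linarith⟩
  have key : EqOn (E₁ ∘ γ) (E₂ ∘ γ) (Ioo 0 L) := by
    refine geodesic_unique (h₁.comp hγd hγU') (h₂.comp hγd hγU') (fun t ht => hreg _ (hγU' ht))
      ht₀m.1 ?_
    filter_upwards [(isOpen_Ioo.inter isOpen_Iio).mem_nhds ht₀m] with t ht
    refine h _ ⟨hγU' ht.1, ?_⟩
    rw [mem_ball, ← hγ0, hγd, Real.dist_eq, sub_zero, abs_of_pos ht.1.1]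
    exact ht.2
  have := key.of_subset_closure (t := Icc 0 L) ((h₁.comp hγd hγU).continuousOn)
    ((h₂.comp hγd hγU).continuousOn) Ioo_subset_Icc_self (by rw [closure_Ioo hL0.ne])
    (right_mem_Icc.2 hL0.le)
  simpa only [Function.comp_apply, hγL] using this

namespace IsConeChart

variable {M : Type*} [MetricSpace M] {c : ℝ → ℝ → M} {x : M} {α ε : ℝ}

theorem regular (h : IsConeChart c x α ε) (hx : ∀ y, dist y x < ε → y ∈ singularSet M → y = x)
    {s : ℝ} (hs : s ∈ Ioo 0 ε) (a : ℝ) : IsRegularPoint (c s a) := by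
  by_contra hcon
  have hs' : s ∈ Ico 0 ε := ⟨hs.1.le, hs.2⟩
  have := hx (c s a) (by rw [h.dist_apex hs']; exact hs.2) hcon
  have h2 := h.dist_apex hs' a
  rw [this, dist_self] at h2
  exact hs.1.ne h2

/-- The unit factor κ rotates the plane, so that the cut of the argument can be placed along any ray
from z₀. -/
theorem locIsoOn_polar (h : IsConeChart c x α ε) (a₀ : ℝ) (κ : ℂ) (hκ : ‖κ‖ = 1) (z₀ : ℂ) :
    LocIsoOn (fun z => c ‖z - z₀‖ (a₀ + (κ * (z - z₀)).arg))
      {z | ‖z - z₀‖ < ε ∧ κ * (z - z₀) ∈ Complex.slitPlane} := by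
  rintro z ⟨hz, hzs⟩
  have hn : ∀ z, ‖z - z₀‖ = ‖κ * (z - z₀)‖ := fun z => by rw [norm_mul, hκ, one_mul]
  have hd : ∀ u v, dist (κ * (u - z₀)) (κ * (v - z₀)) = dist u v := fun u v => by
    rw [dist_eq_norm, ← mul_sub, sub_sub_sub_cancel_right, norm_mul, hκ, one_mul, dist_eq_norm]
  obtain ⟨η, hη, hiso⟩ := h.polar_isometric a₀ hzs (by rwa [← hn])
  refine ⟨η, hη, fun u hu v hv => ?_⟩
  have := (hiso (κ * (u - z₀)) (by rw [mem_ball, hd]; exact hu.2)).2 (κ * (v - z₀))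
    (by rw [mem_ball, hd]; exact hv.2)
  rw [← hn, ← hn, hd] at this
  exact this

/-- A map of a plane domain that is isometric near `z₁` is given by polar coordinates around some
point `z₀`, with any cut that does not contain `z₁`. -/
theorem exists_polar_form (h : IsConeChart c x α ε) {E : ℂ → M} {z₁ : ℂ} {η : ℝ} (hη : 0 < η)
    (hE : ∀ u ∈ ball z₁ η, ∀ v ∈ ball z₁ η, dist (E u) (E v) = dist u v)
    (hd : dist (E z₁) x ∈ Ioo 0 ε) :
    ∃ z₀ : ℂ, ‖z₁ - z₀‖ = dist (E z₁) x ∧ ∀ κ : ℂ, ‖κ‖ = 1 → κ * (z₁ - z₀) ∈ Complex.slitPlane →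
      ∃ c' : ℝ → ℝ → M, IsConeChart c' x α ε ∧ (c' = c ∨ c' = fun s a => c s (-a)) ∧
        ∃ b, ∃ η' > 0, ∀ z ∈ ball z₁ η',
        E z = c' ‖z - z₀‖ (b + (κ * (z - z₀)).arg) := by
  obtain ⟨d, hd', a₁, hc⟩ := h.surj _ hd.2
  have hdd : dist (E z₁) x = d := by rw [← hc, h.dist_apex hd']
  rw [hdd] at hd ⊢
  obtain ⟨η₁, hη₁d, hψ, -⟩ := h.exists_planeChart a₁ hd
  set η₂ := min η η₁ with hη₂
  have hη₂0 : 0 < η₂ := lt_min hη hψ.pos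
  obtain ⟨G, hG⟩ := hψ.exists_lift (s := ball z₁ η₂) (E := E) (z := z₁) (η := η₂ / 2)
    (Complex.orthonormalBasisOneI) (mem_ball_self hη₂0) hc.symm (by positivity) (fun k => by
      rw [mem_ball, dist_eq_norm, add_sub_cancel_left, norm_smul, OrthonormalBasis.norm_eq_one,
        mul_one, Real.norm_of_nonneg (by positivity)]
      linarith) (ball_subset_ball (min_le_right _ _))
    (fun u hu v hv => hE u (ball_subset_ball (min_le_left _ _) hu) v
      (ball_subset_ball (min_le_left _ _) hv))
  -- it suffices to treat rotations
  have main : ∀ c' : ℝ → ℝ → M, IsConeChart c' x α ε → (c' = c ∨ c' = fun s a => c s (-a)) →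
      ∀ a' : ℝ, ∀ u : ℂ, ‖u‖ = 1 →
      (∃ η₃ > 0, ∀ z ∈ ball z₁ η₃, E z = c' ‖u * (z - z₁) + d‖ (a' + (u * (z - z₁) + d).arg)) →
      ∃ z₀ : ℂ, ‖z₁ - z₀‖ = d ∧ ∀ κ : ℂ, ‖κ‖ = 1 → κ * (z₁ - z₀) ∈ Complex.slitPlane →
      ∃ c' : ℝ → ℝ → M, IsConeChart c' x α ε ∧ (c' = c ∨ c' = fun s a => c s (-a)) ∧
        ∃ b, ∃ η' > 0, ∀ z ∈ ball z₁ η',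
        E z = c' ‖z - z₀‖ (b + (κ * (z - z₀)).arg) := by
    intro c' hc' hcc a' u hu ⟨η₃, hη₃, hE'⟩
    have hu0 : u ≠ 0 := by rw [← norm_ne_zero_iff, hu]; exact one_ne_zero
    refine ⟨z₁ - d / u, ?_, fun κ hκ hs => ⟨c', hc', hcc, ?_⟩⟩
    · rw [sub_sub_cancel, norm_div, hu, div_one, Complex.norm_real, Real.norm_of_nonneg hd.1.le]
    have hw : ∀ z, u * (z - z₁) + d = u * (z - (z₁ - d / u)) := fun z => by field_simp; ring
    set z₀ := z₁ - d / u with hz₀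
    have hκ0 : κ ≠ 0 := by rw [← norm_ne_zero_iff, hκ]; exact one_ne_zero
    have hd0 : (d : ℂ) ≠ 0 := by exact_mod_cast hd.1.ne'
    have hs' : (κ / u) * d ∈ Complex.slitPlane := by
      have : κ * (z₁ - z₀) = (κ / u) * d := by rw [hz₀]; field_simp; ring
      rwa [this] at hs
    -- Arguments of a product add as long as their sum stays in (−π, π). At z₁ the second argument
    -- is 0, and the slit plane condition keeps the first one off π.
    have hv : (κ / u).arg ∈ Ioo (-Real.pi) Real.pi := by
      refine ⟨Complex.neg_pi_lt_arg _, lt_of_le_of_ne (Complex.arg_le_pi _) fun hπ => ?_⟩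
      have := Complex.mem_slitPlane_iff_arg.1 hs'
      rw [mul_comm, Complex.arg_real_mul _ hd.1] at this
      exact this.1 hπ
    have hcont : ContinuousAt (fun z => (κ / u).arg + (u * (z - z₀)).arg) z₁ := by
      have h1 : u * (z₁ - z₀) = d := by rw [hz₀]; field_simp; ring
      have h2 : ContinuousAt Complex.arg (u * (z₁ - z₀)) := by
        rw [h1]
        exact Complex.continuousAt_arg (by rw [Complex.ofReal_mem_slitPlane]; exact hd.1)
      have h3 : ContinuousAt (fun z => u * (z - z₀)) z₁ := by fun_prop
      exact continuousAt_const.add (ContinuousAt.comp (f := fun z => u * (z - z₀)) h2 h3)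
    have h1 : (κ / u).arg + (u * (z₁ - z₀)).arg ∈ Ioo (-Real.pi) Real.pi := by
      have h1 : u * (z₁ - z₀) = d := by rw [hz₀]; field_simp; ring
      rw [h1, Complex.arg_ofReal_of_nonneg hd.1.le, add_zero]
      exact hv
    obtain ⟨η₄, hη₄, h4⟩ := Metric.mem_nhds_iff.1 (hcont (isOpen_Ioo.mem_nhds h1))
    refine ⟨a' - (κ / u).arg, min (min η₃ η₄) d, lt_min (lt_min hη₃ hη₄) hd.1, fun z hz => ?_⟩
    have hz3 := ball_subset_ball ((min_le_left _ _).trans (min_le_left _ _)) hz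
    have hz4 := ball_subset_ball ((min_le_left _ _).trans (min_le_right _ _)) hz
    have hzd := ball_subset_ball (min_le_right _ _) hz
    have hne : u * (z - z₀) ≠ 0 := by
      refine mul_ne_zero hu0 fun h0 => ?_
      rw [sub_eq_zero.1 h0, mem_ball, dist_eq_norm, hz₀, sub_sub_cancel_left, norm_neg, norm_div, hu,
        div_one, Complex.norm_real, Real.norm_of_nonneg hd.1.le] at hzd
      exact lt_irrefl _ hzd
    rw [hE' z hz3, hw, norm_mul, hu, one_mul]
    congr 1
    have h5 := h4 hz4
    have h6 : κ * (z - z₀) = (κ / u) * (u * (z - z₀)) := by field_simp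
    rw [h6, Complex.arg_mul (div_ne_zero hκ0 hu0) hne ⟨h5.1, h5.2.le⟩]
    ring
  -- A linear isometry of the plane is a rotation or a reflection; a reflection is absorbed by
  -- reversing the angular coordinate of the chart.
  have hconj : ∃ u : ℂ, ‖u‖ = 1 ∧ ((∀ w, planeToComplex (G w) = u * w) ∨
      ∀ w, planeToComplex (G w) = u * (starRingEnd ℂ) w) := by
    obtain ⟨u, hu⟩ := linear_isometry_complex (G.trans planeToComplex)
    refine ⟨u, Circle.norm_coe u, hu.imp (fun h w => ?_) fun h w => ?_⟩
    · have := congrArg (fun f : ℂ ≃ₗᵢ[ℝ] ℂ => f w) h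
      simpa using this
    · have := congrArg (fun f : ℂ ≃ₗᵢ[ℝ] ℂ => f w) h
      simpa using this
  obtain ⟨u, hu1, hu | hu⟩ := hconj
  · refine main c h (Or.inl rfl) a₁ u hu1 ⟨η₂, hη₂0, fun z hz => ?_⟩
    rw [hG z hz]
    simp only [hu]
    rw [add_comm]
  · refine main _ h.reflect (Or.inr rfl) (-a₁) (starRingEnd ℂ u) (by rwa [Complex.norm_conj]) ⟨η₂, hη₂0, fun z hz => ?_⟩
    rw [hG z hz]
    have h1 : (d : ℂ) + planeToComplex (G (z - z₁)) =
        (starRingEnd ℂ) ((starRingEnd ℂ) u * (z - z₁) + d) := by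
      rw [hu]; simp only [map_add, map_mul, Complex.conj_conj, Complex.conj_ofReal]; ring
    have h2 : ((starRingEnd ℂ) u * (z - z₁) + d).arg ≠ Real.pi := by
      refine (Complex.mem_slitPlane_iff_arg.1 (Or.inl ?_)).1
      have h3 : ‖(starRingEnd ℂ) u * (z - z₁)‖ < d := by
        rw [norm_mul, Complex.norm_conj, hu1, one_mul, ← dist_eq_norm]
        exact (hz.trans_le (min_le_right _ _)).trans_le hη₁d
      have h4 := Complex.abs_re_le_norm ((starRingEnd ℂ) u * (z - z₁))
      have h5 := (abs_le.1 h4).1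
      rw [Complex.add_re, Complex.ofReal_re]
      linarith
    simp only [h1, Complex.norm_conj, Complex.arg_conj, if_neg h2]
    congr 1
    ring

end IsConeChart

/-- The wedge with vertex `0` of slope `δ` above the real axis. -/
def wedge (δ L : ℝ) : Set ℂ := {z | 0 < z.re ∧ z.re < L ∧ 0 < z.im ∧ z.im < δ * z.re}

theorem convex_wedge (δ L : ℝ) : Convex ℝ (wedge δ L) := by
  have h : wedge δ L = ({z : ℂ | 0 < z.re} ∩ {z | z.re < L}) ∩
      ({z | 0 < z.im} ∩ {z | (z.im - δ * z.re) < 0}) := by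
    ext z; simp only [wedge, mem_inter_iff, mem_ofPred_eq, sub_neg, and_assoc]
  rw [h]
  refine ((convex_halfSpace_re_gt 0).inter (convex_halfSpace_re_lt L)).inter
    ((convex_halfSpace_im_gt 0).inter (convex_halfSpace_lt ⟨fun u v => ?_, fun a u => ?_⟩ 0))
  · simp only [Complex.add_im, Complex.add_re]; ring
  · simp only [Complex.smul_im, Complex.smul_re, smul_eq_mul]; ring

theorem isOpen_wedge (δ L : ℝ) : IsOpen (wedge δ L) := by
  have h : wedge δ L = ({z : ℂ | 0 < z.re} ∩ {z | z.re < L}) ∩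
      ({z | 0 < z.im} ∩ {z | z.im < δ * z.re}) := by
    ext z; simp only [wedge, mem_inter_iff, mem_ofPred_eq, and_assoc]
  rw [h]
  refine ((isOpen_lt ?_ ?_).inter (isOpen_lt ?_ ?_)).inter ((isOpen_lt ?_ ?_).inter
    (isOpen_lt ?_ ?_)) <;> fun_prop

theorem wedge_mono {δ δ' L L' : ℝ} (hδ : δ' ≤ δ) (hL : L' ≤ L) : wedge δ' L' ⊆ wedge δ L :=
  fun _ hz => ⟨hz.1, hz.2.1.trans_le hL, hz.2.2.1,
    hz.2.2.2.trans_le (mul_le_mul_of_nonneg_right hδ hz.1.le)⟩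

/-- A locally isometric map of a wedge into the regular points that starts at the apex of the
cone chart `c`, in the direction `a₀`. -/
structure IsImmersedWedge {M : Type*} [MetricSpace M] (c : ℝ → ℝ → M) (a₀ δ L : ℝ) (E : ℂ → M) :
    Prop where
  pos : 0 < δ
  iso : LocIsoOn E (wedge δ L)
  regular : ∀ z ∈ wedge δ L, IsRegularPoint (E z)
  near : ∃ s > 0, ∀ z ∈ wedge δ L, ‖z‖ < s → E z = c ‖z‖ (a₀ + z.arg)

section Wedge

variable {M : Type*} [MetricSpace M] {c : ℝ → ℝ → M} {x : M} {α ε a₀ δ L : ℝ} {E : ℂ → M}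

/-- Polar coordinates serve as the initial immersion: slope 1 and length ε/2 give ‖z‖ ≤ re z + im z
< ε. -/
theorem IsConeChart.isImmersedWedge (h : IsConeChart c x α ε)
    (hx : ∀ y, dist y x < ε → y ∈ singularSet M → y = x) (a₀ : ℝ) :
    IsImmersedWedge c a₀ 1 (ε / 2) (fun z => c ‖z‖ (a₀ + z.arg)) := by
  have hn : ∀ z ∈ wedge 1 (ε / 2), ‖z‖ < ε := fun z hz => by
    refine (Complex.norm_le_abs_re_add_abs_im z).trans_lt ?_
    rw [abs_of_pos hz.1, abs_of_pos hz.2.2.1]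
    have := hz.2.1
    have := hz.2.2.2
    linarith
  refine ⟨one_pos, ?_, fun z hz => ?_, 1, one_pos, fun _ _ _ => rfl⟩
  · have := h.locIsoOn_polar a₀ 1 norm_one 0
    simp only [one_mul, sub_zero] at this
    exact this.mono fun z hz => ⟨hn z hz, Or.inl hz.1⟩
  · refine h.regular hx ⟨norm_pos_iff.2 fun h0 => ?_, hn z hz⟩ _
    have := hz.1
    rw [h0] at this
    exact lt_irrefl _ this

/-- The map is E for re z ≤ x₁ and E₂ beyond. Around every point one of the two formulas is valid on
a full neighbourhood, because the maps agree on the strip of half-width η about the seam. -/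
theorem IsImmersedWedge.glue (h : IsImmersedWedge c a₀ δ L E) {x₁ η δ' L' : ℝ} {E₂ : ℂ → M}
    (hx₁ : x₁ < L) (hx0 : 0 < x₁) (hη : 0 < η) (hδ' : 0 < δ') (hδδ : δ' ≤ δ)
    (h₂ : LocIsoOn E₂ {z | x₁ - η < z.re ∧ z ∈ wedge δ' L'})
    (hreg : ∀ z, x₁ - η < z.re → z ∈ wedge δ' L' → IsRegularPoint (E₂ z))
    (heq : ∀ z ∈ wedge δ' L, |z.re - x₁| < η → E z = E₂ z) :
    ∃ E', IsImmersedWedge c a₀ δ' L' E' := by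
  classical
  set E' : ℂ → M := fun z => if z.re ≤ x₁ then E z else E₂ z with hE'
  have mem1 : ∀ z ∈ wedge δ' L', z.re < L → z ∈ wedge δ L := fun z hz hzL =>
    ⟨hz.1, hzL, hz.2.2.1, hz.2.2.2.trans_le (mul_le_mul_of_nonneg_right hδδ hz.1.le)⟩
  -- to the left
  have e1 : ∀ z ∈ wedge δ' L', z.re < L → z.re < x₁ + η → E' z = E z := fun z hz hzL hzη => by
    by_cases hle : z.re ≤ x₁
    · simp only [hE', if_pos hle]
    · simp only [hE', if_neg hle]
      push Not at hle
      refine (heq z ⟨hz.1, hzL, hz.2.2⟩ ?_).symm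
      rw [abs_of_pos (by linarith)]; linarith
  have e2 : ∀ z, x₁ < z.re → E' z = E₂ z := fun z hz => by
    simp only [hE', if_neg (not_le.2 hz)]
  refine ⟨E', hδ', fun z hz => ?_, fun z hz => ?_, ?_⟩
  · have hre : ∀ u ρ, u ∈ ball z ρ → |u.re - z.re| < ρ := fun u ρ hu => by
      rw [← Complex.sub_re]
      exact (Complex.abs_re_le_norm _).trans_lt (by rwa [mem_ball, dist_eq_norm] at hu)
    rcases le_or_gt z.re x₁ with hle | hgt
    · obtain ⟨η₁, hη₁, hi⟩ := h.iso z (mem1 z hz (hle.trans_lt hx₁))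
      refine ⟨min η₁ (min η (L - x₁)), lt_min hη₁ (lt_min hη (by linarith)), fun u hu v hv => ?_⟩
      have hlt : ∀ u ∈ ball z (min η₁ (min η (L - x₁))), u.re < L ∧ u.re < x₁ + η := fun u hu => by
        have := (abs_lt.1 (hre u _ hu)).2
        have l1 := min_le_right η₁ (min η (L - x₁))
        have l2 := min_le_left η (L - x₁)
        have l3 := min_le_right η (L - x₁)
        constructor <;> linarith
      rw [e1 u hu.1 (hlt u hu.2).1 (hlt u hu.2).2, e1 v hv.1 (hlt v hv.2).1 (hlt v hv.2).2]
      exact hi u ⟨mem1 u hu.1 (hlt u hu.2).1, ball_subset_ball (min_le_left _ _) hu.2⟩ v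
        ⟨mem1 v hv.1 (hlt v hv.2).1, ball_subset_ball (min_le_left _ _) hv.2⟩
    · obtain ⟨η₁, hη₁, hi⟩ := h₂ z ⟨by linarith, hz⟩
      refine ⟨min η₁ (z.re - x₁), lt_min hη₁ (by linarith), fun u hu v hv => ?_⟩
      have hlt : ∀ u ∈ ball z (min η₁ (z.re - x₁)), x₁ < u.re := fun u hu => by
        have := (abs_lt.1 (hre u _ hu)).1
        have l1 := min_le_right η₁ (z.re - x₁)
        linarith
      have k1 := hlt u hu.2
      have k2 := hlt v hv.2
      rw [e2 u k1, e2 v k2]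
      exact hi u ⟨⟨by linarith, hu.1⟩, ball_subset_ball (min_le_left _ _) hu.2⟩ v
        ⟨⟨by linarith, hv.1⟩, ball_subset_ball (min_le_left _ _) hv.2⟩
  · rcases le_or_gt z.re x₁ with hle | hgt
    · rw [e1 z hz (hle.trans_lt hx₁) (by linarith)]
      exact h.regular z (mem1 z hz (hle.trans_lt hx₁))
    · rw [e2 z hgt]
      exact hreg z (by linarith) hz
  · obtain ⟨s, hs, hn⟩ := h.near
    refine ⟨min s x₁, lt_min hs hx0, fun z hz hzs => ?_⟩
    have h1 : z.re < x₁ := (Complex.re_le_norm z).trans_lt (hzs.trans_le (min_le_right _ _))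
    rw [e1 z hz (h1.trans hx₁) (by linarith)]
    exact hn z (mem1 z hz (h1.trans hx₁)) (hzs.trans_le (min_le_left _ _))

/-- The extension step, for a map `E₂` that continues `E` from a convex set `U`. -/
theorem IsImmersedWedge.extend (h : IsImmersedWedge c a₀ δ L E) {z₁ : ℂ} (hz₁ : z₁ ∈ wedge δ L)
    {η η₀ δ' ρ : ℝ} (hη : 0 < η) (hηη : η ≤ η₀ / 2) (hδ' : 0 < δ') (hδδ : δ' ≤ δ)
    (hy₁ : z₁.im < η₀ / 4) (hδη : δ' * (z₁.re + η₀) ≤ η₀ / 4) {E₂ : ℂ → M} {D H : Set ℂ}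
    (h₂ : LocIsoOn E₂ D) (hreg : ∀ z ∈ D, IsRegularPoint (E₂ z)) (hH : Convex ℝ H) (hzH : z₁ ∈ H)
    (hHD : H ∩ wedge δ L ∩ ball z₁ η₀ ⊆ D) (hρ : 0 < ρ) (heq : ∀ z ∈ ball z₁ ρ, E z = E₂ z)
    (hstrip : ∀ z ∈ wedge δ' (z₁.re + η₀ / 2), |z.re - z₁.re| < η → z ∈ H)
    (hD : ∀ z ∈ wedge δ' (z₁.re + η₀ / 2), z ∈ ball z₁ η₀ → z ∈ D) :
    ∃ E' δ', IsImmersedWedge c a₀ δ' (z₁.re + η₀ / 2) E' := by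
  -- Here z is at most η₀/2 away from z₁ horizontally, and the heights of both points lie between 0
  -- and η₀/4.
  have hball : ∀ z ∈ wedge δ' (z₁.re + η₀ / 2), z₁.re - η < z.re → z ∈ ball z₁ η₀ := by
    intro z hz hzx
    rw [mem_ball, dist_eq_norm]
    refine (Complex.norm_le_abs_re_add_abs_im _).trans_lt ?_
    rw [Complex.sub_re, Complex.sub_im]
    have h1 : |z.re - z₁.re| ≤ η₀ / 2 := abs_le.2 ⟨by linarith, by linarith [hz.2.1]⟩
    have h3 : z.im < η₀ / 4 := by
      refine hz.2.2.2.trans_le (le_trans ?_ hδη)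
      exact mul_le_mul_of_nonneg_left (by linarith [hz.2.1]) hδ'.le
    have h2 : |z.im - z₁.im| < η₀ / 2 :=
      abs_lt.2 ⟨by linarith [hz.2.2.1], by linarith [hz₁.2.2.1]⟩
    linarith
  -- On this convex set E and E₂ are both locally isometric and they agree near z₁, hence
  -- everywhere; U contains the strip along which they are glued.
  set U := H ∩ wedge δ L ∩ ball z₁ η₀ with hU
  have hUc : Convex ℝ U := (hH.inter (convex_wedge δ L)).inter (convex_ball _ _)
  have hz₁U : z₁ ∈ U := ⟨⟨hzH, hz₁⟩, mem_ball_self (by linarith)⟩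
  have key : EqOn E E₂ U := (h.iso.mono fun z hz => hz.1.2).eqOn_of_starShaped (h₂.mono hHD)
    (fun z hz => h.regular z hz.1.2) (fun z hz => hUc.segment_subset hz₁U hz) hρ
    fun z hz => heq z hz.2
  have heq' : ∀ z ∈ wedge δ' L, |z.re - z₁.re| < η → E z = E₂ z := fun z hz hzx => by
    have hz' : z ∈ wedge δ' (z₁.re + η₀ / 2) :=
      ⟨hz.1, by linarith [(abs_lt.1 hzx).2], hz.2.2⟩
    exact key ⟨⟨hstrip z hz' hzx, wedge_mono hδδ le_rfl hz⟩,
      hball z hz' (by linarith [(abs_lt.1 hzx).1])⟩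
  obtain ⟨E', hE'⟩ := h.glue (L' := z₁.re + η₀ / 2) hz₁.2.1 hz₁.1 hη hδ' hδδ
    (h₂.mono fun z hz => hD z hz.2 (hball z hz.2 hz.1))
    (fun z h1 h2 => hreg z (hD z h2 (hball z h2 h1))) heq'
  exact ⟨E', δ', hE'⟩

theorem IsImmersedWedge.mono (h : IsImmersedWedge c a₀ δ L E) {L' : ℝ} (hL : L' ≤ L) :
    IsImmersedWedge c a₀ δ L' E where
  pos := h.pos
  iso := h.iso.mono (wedge_mono le_rfl hL)
  regular z hz := h.regular z (wedge_mono le_rfl hL hz)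
  near := h.near.imp fun _ hs => ⟨hs.1, fun z hz => hs.2 z (wedge_mono le_rfl hL hz)⟩

theorem IsPlaneChart.recenter {ψ : Plane → M} (h : IsPlaneChart ψ x ε) {u : Plane} {η : ℝ}
    (hη : 0 < η) (hu : ‖u‖ + η ≤ ε) : IsPlaneChart (fun v => ψ (u + v)) (ψ u) η where
  pos := hη
  map_zero := by rw [add_zero]
  dist_eq v hv w hw := by
    rw [mem_ball_zero_iff] at hv hw
    rw [h.dist_eq _ (by rw [mem_ball_zero_iff]; exact (norm_add_le _ _).trans_lt (by linarith)) _
      (by rw [mem_ball_zero_iff]; exact (norm_add_le _ _).trans_lt (by linarith)), dist_add_left]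
  surj y hy := by
    have hux := h.dist_map_zero (u := u) (by linarith)
    have hyx : dist y x < ε := (dist_triangle y (ψ u) x).trans_lt (by rw [hux]; linarith)
    obtain ⟨w, rfl, hw⟩ := h.surj y hyx
    refine ⟨w - u, by rw [add_sub_cancel], ?_⟩
    rw [h.dist_eq w (by rw [mem_ball_zero_iff, hw]; exact hyx) u
      (by rw [mem_ball_zero_iff]; linarith), dist_eq_norm]

/-- A Lebesgue number argument: finitely many charts of half the available radius cover M, and η is
smaller than all these half radii. A plane chart can then be recentred at y, and a cone chart
contains the η-ball of y. -/
theorem IsEuclideanPolyhedral.exists_uniform_chart [CompactSpace M] [Finite (singularSet M)]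
    (hM : IsEuclideanPolyhedral M) : ∃ η > 0, ∀ y : M,
      (∃ ψ, IsPlaneChart ψ y η ∧ ∀ y', dist y' y < η → IsRegularPoint y') ∨
      ∃ x ∈ singularSet M, ∃ α ε, ∃ c : ℝ → ℝ → M, IsConeChart c x α ε ∧ dist y x + η ≤ ε ∧
        ∀ y', dist y' x < ε → y' ∈ singularSet M → y' = x := by
  have hiso : ∀ x : M, ∃ ε > 0, ∀ y', dist y' x < ε → y' ∈ singularSet M → y' = x := fun x => by
    have h1 : IsClosed (singularSet M \ {x}) :=
      ((toFinite (singularSet M)).subset sdiff_subset).isClosed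
    obtain ⟨ε, hε, h2⟩ := Metric.isOpen_iff.1 h1.isOpen_compl x (by simp)
    refine ⟨ε, hε, fun y hy hyS => ?_⟩
    by_contra hne
    exact h2 hy ⟨hyS, hne⟩
  have hex : ∀ x : M, ∃ ε > 0, (∃ ψ, IsPlaneChart ψ x ε ∧ ∀ y', dist y' x < ε → IsRegularPoint y') ∨
      ∃ α, ∃ c : ℝ → ℝ → M, x ∈ singularSet M ∧ IsConeChart c x α ε ∧
        ∀ y', dist y' x < ε → y' ∈ singularSet M → y' = x := fun x => by
    obtain ⟨ε₁, hε₁, h1⟩ := hiso x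
    by_cases hx : IsRegularPoint x
    · obtain ⟨ε₂, ψ, hψ⟩ := hx.exists_chart
      refine ⟨min ε₁ ε₂, lt_min hε₁ hψ.pos, Or.inl ⟨ψ, ?_, fun y hy => ?_⟩⟩
      · have := hψ.recenter (u := 0) (lt_min hε₁ hψ.pos) (by simp)
        simpa only [zero_add, hψ.map_zero] using this
      · by_contra hcon
        rw [h1 y (hy.trans_le (min_le_left _ _)) hcon] at hcon
        exact hcon hx
    · obtain ⟨α, ε₂, c, hc⟩ := hM.exists_coneChart ⟨x, hx⟩
      have h0 := lt_min hε₁ hc.pos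
      exact ⟨min ε₁ ε₂, h0, Or.inr ⟨α, c, hx, hc.mono h0 (min_le_right _ _), fun y hy =>
        h1 y (hy.trans_le (min_le_left _ _))⟩⟩
  choose ε hε hch using hex
  obtain ⟨t, -, ht⟩ := isCompact_univ.elim_nhds_subcover (fun x => ball x (ε x / 2))
    fun x _ => ball_mem_nhds x (half_pos (hε x))
  have hev : ∀ᶠ η in 𝓝[>] (0 : ℝ), ∀ x ∈ t, η < ε x / 2 :=
    (Filter.eventually_all_finset t).2 fun x _ =>
      nhdsWithin_le_nhds (Iio_mem_nhds (half_pos (hε x)))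
  obtain ⟨η, hη, hη0⟩ := (hev.and self_mem_nhdsWithin).exists
  refine ⟨η, hη0, fun y => ?_⟩
  obtain ⟨x, hxt, hyx⟩ := mem_iUnion₂.1 (ht (mem_univ y))
  rw [mem_ball] at hyx
  have h1 := hη x hxt
  rcases hch x with ⟨ψ, hψ, hr⟩ | ⟨α, c, hxs, hc, hs⟩
  · obtain ⟨u, rfl, hu⟩ := hψ.surj y (by linarith [hε x])
    exact Or.inl ⟨_, hψ.recenter hη0 (by rw [hu]; linarith), fun y' hy' => hr y'
      ((dist_triangle y' _ x).trans_lt (by linarith))⟩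
  · exact Or.inr ⟨x, hxs, α, ε x, c, hc, by linarith, hs⟩

theorem IsImmersedWedge.exists_slope {x₁ η₀ δ : ℝ} (hx₁ : 0 < x₁) (hη₀ : 0 < η₀) (hδ : 0 < δ) {m : ℝ}
    (hm : 0 < m) : ∃ δ' > 0, δ' ≤ δ ∧ δ' * (x₁ + η₀) ≤ m := by
  refine ⟨min δ (m / (x₁ + η₀)), lt_min hδ (by positivity), min_le_left _ _, ?_⟩
  calc _ ≤ m / (x₁ + η₀) * (x₁ + η₀) := mul_le_mul_of_nonneg_right (min_le_right _ _) (by positivity)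
    _ = m := by field_simp

/-- In a plane chart free of singular points the linear lift of E at z₁ is defined on the whole disc
of radius η₀ and continues E without obstruction. -/
theorem IsImmersedWedge.step_regular (h : IsImmersedWedge c a₀ δ L E) {z₁ : ℂ}
    (hz₁ : z₁ ∈ wedge δ L) {η₀ : ℝ} (hy₁ : z₁.im < η₀ / 4) {ψ : Plane → M}
    (hψ : IsPlaneChart ψ (E z₁) η₀) (hr : ∀ y', dist y' (E z₁) < η₀ → IsRegularPoint y') :
    ∃ E' δ', IsImmersedWedge c a₀ δ' (z₁.re + η₀ / 2) E' := by
  have hη₀ := hψ.pos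
  obtain ⟨η₁, hη₁, hi⟩ := h.iso z₁ hz₁
  obtain ⟨η₂, hη₂, hw⟩ := Metric.isOpen_iff.1 (isOpen_wedge δ L) z₁ hz₁
  set ρ := min (min η₁ η₂) η₀ with hρ
  have hρ0 : 0 < ρ := lt_min (lt_min hη₁ hη₂) hη₀
  have hm : ∀ u ∈ ball z₁ ρ, u ∈ wedge δ L ∩ ball z₁ η₁ := fun u hu =>
    ⟨hw (ball_subset_ball ((min_le_left _ _).trans (min_le_right _ _)) hu),
      ball_subset_ball ((min_le_left _ _).trans (min_le_left _ _)) hu⟩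
  obtain ⟨G, hG⟩ := hψ.exists_lift (s := ball z₁ ρ) (E := E) (z := z₁) (η := ρ / 2)
    (Complex.orthonormalBasisOneI) (mem_ball_self hρ0) rfl (by positivity) (fun k => by
      rw [mem_ball, dist_eq_norm, add_sub_cancel_left, norm_smul, OrthonormalBasis.norm_eq_one,
        mul_one, Real.norm_of_nonneg (by positivity)]
      linarith) (ball_subset_ball (min_le_right _ _))
    (fun u hu v hv => hi u (hm u hu) v (hm v hv))
  have hGn : ∀ z ∈ ball z₁ η₀, G (z - z₁) ∈ ball (0 : Plane) η₀ := fun z hz => by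
    rwa [mem_ball_zero_iff, G.norm_map, ← dist_eq_norm]
  obtain ⟨δ', hδ', hδδ, hδη⟩ := exists_slope hz₁.1 hη₀ h.pos (m := η₀ / 4) (by positivity)
  refine h.extend hz₁ (half_pos hη₀) le_rfl hδ' hδδ hy₁ hδη (E₂ := fun z => ψ (G (z - z₁)))
    (D := ball z₁ η₀) (H := univ) ?_ (fun z hz => hr _ ?_) convex_univ (mem_univ _)
    inter_subset_right hρ0 hG (fun _ _ _ => mem_univ _) (fun _ _ h => h)
  · intro z hz
    refine ⟨1, one_pos, fun u hu v hv => ?_⟩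
    rw [hψ.dist_eq _ (hGn u hu.1) _ (hGn v hv.1), G.dist_map, dist_sub_right]
  · rw [hψ.dist_map_zero (by rw [← mem_ball_zero_iff]; exact hGn z hz), G.norm_map, ← dist_eq_norm]
    exact hz

/-- Developing E at z₁ puts the cone point at some z₀ of the plane, and polar coordinates around z₀
continue E off a cut. If z₀ is not above the real axis the cut is taken downwards and misses the
wedge. Otherwise the wedge is thinned until it passes below z₀, and the cut is taken upwards. -/
theorem IsImmersedWedge.step_cone (h : IsImmersedWedge c a₀ δ L E) {z₁ : ℂ}
    (hz₁ : z₁ ∈ wedge δ L) {η₀ : ℝ} (hη₀ : 0 < η₀) (hy₁ : z₁.im < η₀ / 4) {c₁ : ℝ → ℝ → M}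
    (hc₁ : IsConeChart c₁ x α ε) (hx : x ∈ singularSet M) (hd : dist (E z₁) x + η₀ ≤ ε)
    (hs : ∀ y', dist y' x < ε → y' ∈ singularSet M → y' = x) :
    ∃ E' δ', IsImmersedWedge c a₀ δ' (z₁.re + η₀ / 2) E' := by
  obtain ⟨η₁, hη₁, hi⟩ := h.iso z₁ hz₁
  obtain ⟨η₂, hη₂, hw⟩ := Metric.isOpen_iff.1 (isOpen_wedge δ L) z₁ hz₁
  have hρ0 : 0 < min η₁ η₂ := lt_min hη₁ hη₂
  have hm : ∀ u ∈ ball z₁ (min η₁ η₂), u ∈ wedge δ L ∩ ball z₁ η₁ := fun u hu =>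
    ⟨hw (ball_subset_ball (min_le_right _ _) hu), ball_subset_ball (min_le_left _ _) hu⟩
  have hd0 : 0 < dist (E z₁) x := dist_pos.2 fun h0 => by
    have := h.regular z₁ hz₁
    rw [h0] at this
    exact hx this
  obtain ⟨z₀, hz₀, hpol⟩ := hc₁.exists_polar_form hρ0
    (fun u hu v hv => hi u (hm u hu) v (hm v hv)) ⟨hd0, by linarith⟩
  have hnz : ∀ z ∈ ball z₁ η₀, ‖z - z₀‖ < ε := fun z hz => by
    have := norm_add_le (z - z₁) (z₁ - z₀)
    rw [sub_add_sub_cancel, hz₀] at this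
    rw [mem_ball, dist_eq_norm] at hz
    linarith
  have hregD : ∀ c' : ℝ → ℝ → M, IsConeChart c' x α ε → ∀ (b : ℝ) (κ : ℂ),
      ∀ z ∈ {z | ‖z - z₀‖ < ε ∧ κ * (z - z₀) ∈ Complex.slitPlane},
      IsRegularPoint (c' ‖z - z₀‖ (b + (κ * (z - z₀)).arg)) := fun c' hc' b κ z hz =>
    hc'.regular hs ⟨norm_pos_iff.2 fun h0 => Complex.zero_notMem_slitPlane (by
      have := hz.2
      rwa [h0, mul_zero] at this), hz.1⟩ _
  have hlow : ∀ z : ℂ, z₀.im < z.im → -Complex.I * (z - z₀) ∈ Complex.slitPlane := fun z hz => by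
    refine Or.inl ?_
    simp only [neg_mul, Complex.neg_re, Complex.mul_re, Complex.I_re, zero_mul, Complex.I_im, one_mul,
      zero_sub, neg_neg, Complex.sub_im]
    linarith
  have hup : ∀ z : ℂ, (z.im < z₀.im ∨ z.re ≠ z₀.re) → Complex.I * (z - z₀) ∈ Complex.slitPlane := by
    intro z hz
    refine hz.imp (fun h1 => ?_) fun h1 => ?_
    · simp only [Complex.mul_re, Complex.I_re, zero_mul, Complex.I_im, one_mul, zero_sub,
        Complex.sub_im]
      linarith
    · simp only [Complex.mul_im, Complex.I_re, zero_mul, Complex.I_im, one_mul, zero_add,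
        Complex.sub_re]
      exact sub_ne_zero.2 h1
  rcases le_or_gt z₀.im 0 with hz₀i | hz₀i
  · obtain ⟨c', hc', -, b, ρ, hρ, heq⟩ := hpol (-Complex.I) (by simp)
      (hlow z₁ (hz₀i.trans_lt hz₁.2.2.1))
    obtain ⟨δ', hδ', hδδ, hδη⟩ := exists_slope hz₁.1 hη₀ h.pos (m := η₀ / 4) (by positivity)
    exact h.extend hz₁ (half_pos hη₀) le_rfl hδ' hδδ hy₁ hδη
      (hc'.locIsoOn_polar b (-Complex.I) (by simp) z₀) (hregD c' hc' b _) convex_univ (mem_univ _)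
      (fun z hz => ⟨hnz z hz.2, hlow z (hz₀i.trans_lt hz.1.2.2.2.1)⟩) hρ heq
      (fun _ _ _ => mem_univ _) (fun z hz hzb => ⟨hnz z hzb, hlow z (hz₀i.trans_lt hz.2.2.1)⟩)
  -- The upward cut must not separate z₁ from the strip where E is glued. So H is the side of the
  -- vertical line through z₀ that contains z₁, or the half-plane below z₀ when z₁ lies on that
  -- line.
  · have hcase : ∃ H : Set ℂ, Convex ℝ H ∧ z₁ ∈ H ∧ (∀ z ∈ H, z.im < z₀.im ∨ z.re ≠ z₀.re) ∧
        ∃ η > 0, η ≤ η₀ / 2 ∧ ∀ z : ℂ, |z.re - z₁.re| < η → z.im < z₀.im → z ∈ H := by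
      rcases lt_trichotomy z₁.re z₀.re with h1 | h1 | h1
      · refine ⟨{z | z.re < z₀.re}, convex_halfSpace_re_lt _, h1, fun z hz => Or.inr (ne_of_lt hz),
          min (η₀ / 2) (z₀.re - z₁.re), lt_min (half_pos hη₀) (by linarith), min_le_left _ _,
          fun z hz _ => ?_⟩
        have := (abs_lt.1 hz).2
        have := min_le_right (η₀ / 2) (z₀.re - z₁.re)
        change z.re < z₀.re
        linarith
      · refine ⟨{z | z.im < z₀.im}, convex_halfSpace_im_lt _, ?_, fun z hz => Or.inl hz, η₀ / 2,
          half_pos hη₀, le_rfl, fun z _ hz => hz⟩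
        change z₁.im < z₀.im
        -- If z₀ were below z₁ on the vertical line, it would lie in the old wedge. Approaching it
        -- from above shows that E maps it to the cone point, whereas E takes only regular values.
        by_contra! hle
        have hz₀W : z₀ ∈ wedge δ L := by
          refine ⟨h1 ▸ hz₁.1, h1 ▸ hz₁.2.1, hz₀i, ?_⟩
          rw [← h1]; exact hle.trans_lt hz₁.2.2.2
        have hlt : z₀.im < z₁.im := lt_of_le_of_ne hle fun h2 => by
          have : z₁ = z₀ := Complex.ext h1 h2.symm
          rw [this, sub_self, norm_zero] at hz₀
          rw [this, ← hz₀] at hd0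
          exact lt_irrefl _ hd0
        obtain ⟨c', hc', -, b, ρ, hρ, heq⟩ := hpol (-Complex.I) (by simp) (hlow z₁ hlt)
        set U : Set ℂ := wedge δ L ∩ {z | z₀.im < z.im} ∩ ball z₀ ε with hU
        have hUc : Convex ℝ U := ((convex_wedge δ L).inter (convex_halfSpace_im_gt _)).inter
          (convex_ball _ _)
        have hz₁U : z₁ ∈ U := ⟨⟨hz₁, hlt⟩, by rw [mem_ball, dist_eq_norm, hz₀]; linarith⟩
        have key : EqOn E (fun z => c' ‖z - z₀‖ (b + (-Complex.I * (z - z₀)).arg)) U :=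
          (h.iso.mono fun z hz => hz.1.1).eqOn_of_starShaped
            ((hc'.locIsoOn_polar b (-Complex.I) (by simp) z₀).mono fun z hz =>
              ⟨by rw [← dist_eq_norm]; exact hz.2, hlow z hz.1.2⟩)
            (fun z hz => h.regular z hz.1.1) (fun z hz => hUc.segment_subset hz₁U hz) hρ
            fun z hz => heq z hz.2
        obtain ⟨η₃, hη₃, hi₃⟩ := h.iso z₀ hz₀W
        obtain ⟨η₄, hη₄, hw₄⟩ := Metric.isOpen_iff.1 (isOpen_wedge δ L) z₀ hz₀W
        have hzero : dist (E z₀) x ≤ 0 := by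
          refine le_of_forall_pos_le_add fun κ hκ => ?_
          set t := min (κ / 2) (min (min η₃ η₄) ε) / 2 with ht
          have hm0 : 0 < min (κ / 2) (min (min η₃ η₄) ε) :=
            lt_min (half_pos hκ) (lt_min (lt_min hη₃ hη₄) hc₁.pos)
          have m1 := min_le_left (κ / 2) (min (min η₃ η₄) ε)
          have m2 := min_le_right (κ / 2) (min (min η₃ η₄) ε)
          have m3 := min_le_left (min η₃ η₄) ε
          have m4 := min_le_right (min η₃ η₄) ε
          have m5 := min_le_left η₃ η₄
          have m6 := min_le_right η₃ η₄
          have ht0 : 0 < t := by positivity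
          have hdt : dist (z₀ + t * Complex.I) z₀ = t := by
            rw [dist_eq_norm, add_sub_cancel_left, norm_mul, Complex.norm_I, mul_one,
              Complex.norm_real, Real.norm_of_nonneg ht0.le]
          have hzU : z₀ + t * Complex.I ∈ U := by
            refine ⟨⟨hw₄ (by rw [mem_ball, hdt]; linarith), ?_⟩, by rw [mem_ball, hdt]; linarith⟩
            change z₀.im < (z₀ + t * Complex.I).im
            simp only [Complex.add_im, Complex.mul_im, Complex.ofReal_re, Complex.I_im, mul_one,
              Complex.ofReal_im, Complex.I_re, mul_zero, add_zero]
            linarith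
          have e1 := key hzU
          have e2 := hi₃ _ ⟨hzU.1.1, by rw [mem_ball, hdt]; linarith⟩ z₀ ⟨hz₀W, mem_ball_self hη₃⟩
          have e3 : dist (E (z₀ + t * Complex.I)) x = t := by
            rw [e1]
            simp only
            rw [hc'.dist_apex ⟨norm_nonneg _, by rw [← dist_eq_norm, hdt]; linarith⟩, ← dist_eq_norm,
              hdt]
          have := dist_triangle_left (E z₀) x (E (z₀ + t * Complex.I))
          rw [e2, e3, hdt] at this
          linarith
        have := h.regular z₀ hz₀W
        rw [dist_le_zero.1 hzero] at this
        exact hx this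
      · refine ⟨{z | z₀.re < z.re}, convex_halfSpace_re_gt _, h1, fun z hz => Or.inr (ne_of_gt hz),
          min (η₀ / 2) (z₁.re - z₀.re), lt_min (half_pos hη₀) (by linarith), min_le_left _ _,
          fun z hz _ => ?_⟩
        have := (abs_lt.1 hz).1
        have := min_le_right (η₀ / 2) (z₁.re - z₀.re)
        change z₀.re < z.re
        linarith
    obtain ⟨H, hHc, hzH, hH, η, hη, hηη, hstrip⟩ := hcase
    obtain ⟨c', hc', -, b, ρ, hρ, heq⟩ := hpol Complex.I (by simp) (hup z₁ (hH z₁ hzH))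
    obtain ⟨δ', hδ', hδδ, hδη⟩ := exists_slope hz₁.1 hη₀ h.pos (m := min (η₀ / 4) z₀.im)
      (lt_min (by positivity) hz₀i)
    have him : ∀ z ∈ wedge δ' (z₁.re + η₀ / 2), z.im < z₀.im := fun z hz => by
      refine hz.2.2.2.trans_le (le_trans ?_ (hδη.trans (min_le_right _ _)))
      exact mul_le_mul_of_nonneg_left (by linarith [hz.2.1]) hδ'.le
    exact h.extend hz₁ hη hηη hδ' hδδ hy₁ (hδη.trans (min_le_left _ _))
      (hc'.locIsoOn_polar b Complex.I (by simp) z₀) (hregD c' hc' b _) hHc hzH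
      (fun z hz => ⟨hnz z hz.2, hup z (hH z hz.1.1)⟩) hρ heq
      (fun z hz hzx => hstrip z hzx (him z hz)) (fun z hz hzb => ⟨hnz z hzb, hup z (Or.inl (him z hz))⟩)

/-- Arbitrarily long thin wedges can be immersed into the set of regular points. -/
theorem IsConeChart.exists_isImmersedWedge [CompactSpace M] [Finite (singularSet M)]
    (hM : IsEuclideanPolyhedral M) (h : IsConeChart c x α ε)
    (hx : ∀ y, dist y x < ε → y ∈ singularSet M → y = x) (a₀ L : ℝ) :
    ∃ E δ, IsImmersedWedge c a₀ δ L E := by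
  obtain ⟨η₀, hη₀, hch⟩ := hM.exists_uniform_chart
  have hall : ∀ n : ℕ, ∃ E δ, IsImmersedWedge c a₀ δ (ε / 2 + n * (η₀ / 4)) E := by
    intro n
    induction n with
    | zero => exact ⟨_, 1, by simpa using h.isImmersedWedge hx a₀⟩
    | succ n ih =>
      obtain ⟨E, δ, hE⟩ := ih
      set L := ε / 2 + n * (η₀ / 4) with hL
      have hε := h.pos
      have hL0 : 0 < L := by positivity
      have hδ := hE.pos
      -- The base point of the step is at most η₀/4 from the end of the wedge, so continuing to re
      -- z₁ + η₀/2 gains at least η₀/4 in length, a uniform amount.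
      set x₁ := L - min (η₀ / 4) (L / 2) with hx₁
      have m0 : 0 < min (η₀ / 4) (L / 2) := lt_min (by positivity) (by positivity)
      have m1 := min_le_left (η₀ / 4) (L / 2)
      have m2 := min_le_right (η₀ / 4) (L / 2)
      have hx0 : 0 < x₁ := by linarith
      set y₁ := min (η₀ / 4) (δ * x₁) / 2 with hy₁
      have n0 : 0 < min (η₀ / 4) (δ * x₁) := lt_min (by positivity) (by positivity)
      have n1 := min_le_left (η₀ / 4) (δ * x₁)
      have n2 := min_le_right (η₀ / 4) (δ * x₁)
      have hz₁ : (⟨x₁, y₁⟩ : ℂ) ∈ wedge δ L := by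
        refine ⟨hx0, ?_, ?_, ?_⟩
        · change x₁ < L; linarith
        · change 0 < y₁; linarith
        · change y₁ < δ * x₁; linarith
      have hy : (⟨x₁, y₁⟩ : ℂ).im < η₀ / 4 := by change y₁ < η₀ / 4; linarith
      have hfin : ∃ E' δ', IsImmersedWedge c a₀ δ' ((⟨x₁, y₁⟩ : ℂ).re + η₀ / 2) E' := by
        rcases hch (E ⟨x₁, y₁⟩) with ⟨ψ, hψ, hr⟩ | ⟨p, hp, β, ε₁, c₁, hc₁, hd, hs⟩
        · exact hE.step_regular hz₁ hy hψ hr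
        · exact hE.step_cone hz₁ hη₀ hy hc₁ hp hd hs
      obtain ⟨E', δ', hE'⟩ := hfin
      refine ⟨E', δ', hE'.mono ?_⟩
      change _ ≤ x₁ + η₀ / 2
      push_cast
      linarith
  obtain ⟨n, hn⟩ := exists_nat_gt ((L - ε / 2) / (η₀ / 4))
  obtain ⟨E, δ, hE⟩ := hall n
  refine ⟨E, δ, hE.mono ?_⟩
  rw [div_lt_iff₀ (by positivity)] at hn
  linarith

end Wedge

/-! ### Finiteness of directions and lengths of edges -/

namespace GeodesicTriangulation

variable {M : Type*} [MetricSpace M]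

/-- Edges, possibly of different triangulations, that start together are equal as paths. -/
theorem pos_eq_of_eventuallyEq {T T' : GeodesicTriangulation M} {e : T.OrientedEdge}
    {e' : T'.OrientedEdge} {δ : ℝ} (hδ : 0 < δ)
    (h : ∀ s ∈ Ioo 0 δ, T.pos e s 0 = T'.pos e' s 0) :
    T.len e = T'.len e' ∧ ∀ s ∈ Icc 0 (T.len e), T.pos e s 0 = T'.pos e' s 0 := by
  have key : ∀ (T T' : GeodesicTriangulation M) (e : T.OrientedEdge) (e' : T'.OrientedEdge),
      (∀ s ∈ Ioo 0 δ, T.pos e s 0 = T'.pos e' s 0) → T.len e ≤ T'.len e' →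
      T.len e = T'.len e' ∧ ∀ s ∈ Icc 0 (T.len e), T.pos e s 0 = T'.pos e' s 0 := by
    intro T T' e e' h hle
    have hlen := T.len_pos e
    have hm0 : 0 < min (T.len e) δ := lt_min hlen hδ
    have hm1 := min_le_left (T.len e) δ
    have hm2 := min_le_right (T.len e) δ
    have ht₀ : min (T.len e) δ / 2 ∈ Ioo 0 (T.len e) := ⟨by positivity, by linarith⟩
    have h1 := geodesic_unique (T.locIsoOn_pos e)
      ((T'.locIsoOn_pos e').mono (Ioo_subset_Ioo_right hle)) (fun t ht => T.pos_regular e ht) ht₀ (by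
        filter_upwards [isOpen_Ioo.mem_nhds (show min (T.len e) δ / 2 ∈ Ioo 0 δ from
          ⟨by positivity, by linarith⟩)] with s hs using h s hs)
    have h2 : EqOn (fun s => T.pos e s 0) (fun s => T'.pos e' s 0) (Icc 0 (T.len e)) :=
      EqOn.of_subset_closure (s := Ioo 0 (T.len e)) h1 (T.continuousOn_pos e)
        ((T'.continuousOn_pos e').mono (Icc_subset_Icc_right hle)) Ioo_subset_Icc_self
        (by rw [closure_Ioo hlen.ne])
    refine ⟨hle.antisymm ?_, h2⟩
    -- If the second edge were longer, the terminal vertex of the first would be an interior and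
    -- therefore regular point of it.
    by_contra! hlt
    have h3 := T'.pos_regular e' (s := T.len e) ⟨hlen, hlt⟩
    have h4 := h2 (right_mem_Icc.2 hlen.le)
    simp only at h4
    rw [← h4, T.pos_len] at h3
    exact (T.tgt e).2 h3
  rcases le_total (T.len e) (T'.len e') with hle | hle
  · exact key T T' e e' h hle
  · obtain ⟨h1, h2⟩ := key T' T e' e (fun s hs => (h s hs).symm) hle
    exact ⟨h1.symm, fun s hs => (h2 s (h1 ▸ hs)).symm⟩

variable {c : ℝ → ℝ → M} {α ε : ℝ}

/-- `a` is the direction in which the oriented edge `e` leaves its initial vertex. -/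
def HasDirection (T : GeodesicTriangulation M) (c : ℝ → ℝ → M) (e : T.OrientedEdge) (a : ℝ) : Prop :=
  ∃ δ > 0, ∀ s ∈ Ioo 0 δ, T.pos e s 0 = c s a

theorem HasDirection.pos_eq {T T' : GeodesicTriangulation M} {e : T.OrientedEdge}
    {e' : T'.OrientedEdge} {a : ℝ} (h : T.HasDirection c e a) (h' : T'.HasDirection c e' a) :
    T.len e = T'.len e' ∧ ∀ s ∈ Icc 0 (T.len e), T.pos e s 0 = T'.pos e' s 0 := by
  obtain ⟨δ, hδ, h⟩ := h
  obtain ⟨δ', hδ', h'⟩ := h'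
  exact pos_eq_of_eventuallyEq (lt_min hδ hδ') fun s hs => by
    rw [h s ⟨hs.1, hs.2.trans_le (min_le_left _ _)⟩, h' s ⟨hs.1, hs.2.trans_le (min_le_right _ _)⟩]

theorem exists_hasDirection (hM : IsEuclideanPolyhedral M) (T : GeodesicTriangulation M)
    {e : T.OrientedEdge} (hc : IsConeChart c (T.src e : M) α ε) :
    ∃ a ∈ Ico 0 α, T.HasDirection c e a := by
  obtain ⟨a, δ, hδ, h⟩ := T.exists_direction hM hc
  refine ⟨toIcoMod hc.angle_pos 0 a, ?_, min δ ε, lt_min hδ hc.pos, fun s hs => ?_⟩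
  · simpa using toIcoMod_mem_Ico hc.angle_pos 0 a
  · rw [h s ⟨hs.1, hs.2.trans_le (min_le_left _ _)⟩]
    refine hc.eq_of_norm_eq_zero ⟨hs.1.le, hs.2.trans_le (min_le_right _ _)⟩ ?_
    rw [self_sub_toIcoMod, AddCircle.coe_zsmul, AddCircle.coe_period, smul_zero, norm_zero]

/-- By uniqueness of geodesics the edge is the image of the ray of angle β in the wedge. This ray is
still inside the wedge at time `len e`, so the edge would end at a regular point. -/
theorem HasDirection.false_of_isImmersedWedge {T : GeodesicTriangulation M} {e : T.OrientedEdge}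
    {a₀ β δ L : ℝ} {E : ℂ → M} (hE : IsImmersedWedge c a₀ δ L E)
    (h : T.HasDirection c e (a₀ + β)) (hβ : β ∈ Ioo 0 Real.pi) (hcos : 0 < Real.cos β)
    (hδ : Real.sin β < δ * Real.cos β) (hL : T.len e < L) : False := by
  obtain ⟨η, hη, hdir⟩ := h
  obtain ⟨s₀, hs₀, hnear⟩ := hE.near
  have hsin := Real.sin_pos_of_mem_Ioo hβ
  have hlen := T.len_pos e
  set γ : ℝ → ℂ := fun t => t * (Complex.cos β + Complex.sin β * Complex.I) with hγ
  have hγd : ∀ s t, dist (γ s) (γ t) = dist s t := fun s t => by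
    rw [hγ, dist_eq_norm, ← sub_mul, norm_mul, Complex.norm_cos_add_sin_mul_I, mul_one,
      ← Complex.ofReal_sub, Complex.norm_real, dist_eq_norm]
  have hre : ∀ t, (γ t).re = t * Real.cos β := fun t => by
    rw [hγ]
    simp [Complex.cos_ofReal_re, Complex.sin_ofReal_im]
  have him : ∀ t, (γ t).im = t * Real.sin β := fun t => by
    rw [hγ]
    simp [Complex.cos_ofReal_im, Complex.sin_ofReal_re]
  have hW : ∀ t ∈ Ioc 0 (T.len e), γ t ∈ wedge δ L := fun t ht => by
    refine ⟨?_, ?_, ?_, ?_⟩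
    · rw [hre]; exact mul_pos ht.1 hcos
    · rw [hre]
      have := Real.cos_le_one β
      nlinarith [ht.1, ht.2]
    · rw [him]; exact mul_pos ht.1 hsin
    · rw [him, hre]; nlinarith [ht.1]
  have hnorm : ∀ t, 0 < t → ‖γ t‖ = t := fun t ht => by
    rw [hγ, norm_mul, Complex.norm_cos_add_sin_mul_I, mul_one, Complex.norm_real,
      Real.norm_of_nonneg ht.le]
  have hm0 : 0 < min (min η s₀) (T.len e) := lt_min (lt_min hη hs₀) hlen
  have m1 := min_le_left (min η s₀) (T.len e)
  have m2 := min_le_right (min η s₀) (T.len e)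
  have m3 := min_le_left η s₀
  have m4 := min_le_right η s₀
  have hsub : Ioo 0 (T.len e) ⊆ Ioc 0 (T.len e) := Ioo_subset_Ioc_self
  set t₀ := min (min η s₀) (T.len e) / 2 with ht₀
  have h1 := geodesic_unique (T.locIsoOn_pos e)
    (hE.iso.comp (g := γ) (r := Ioo 0 (T.len e)) hγd fun t ht => hW t (hsub ht))
    (fun t ht => T.pos_regular e ht) (t₀ := t₀) ⟨by positivity, by linarith⟩ (by
      filter_upwards [isOpen_Ioo.mem_nhds (show t₀ ∈ Ioo 0 (min (min η s₀) (T.len e)) from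
        ⟨by positivity, by linarith⟩)] with s hs
      rw [hdir s ⟨hs.1, by linarith [hs.2]⟩, Function.comp_apply,
        hnear (γ s) (hW s ⟨hs.1, by linarith [hs.2]⟩) (by rw [hnorm s hs.1]; linarith [hs.2]),
        hnorm s hs.1]
      rw [hγ]
      simp only
      rw [Complex.arg_mul_cos_add_sin_mul_I hs.1 ⟨by linarith [hβ.1, Real.pi_pos], hβ.2.le⟩])
  have h2 := EqOn.of_subset_closure (f := fun s => T.pos e s 0) (g := E ∘ γ)
    (s := Ioo 0 (T.len e)) (t := Ioc 0 (T.len e)) h1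
    ((T.continuousOn_pos e).mono Ioc_subset_Icc_self)
    (hE.iso.comp (g := γ) hγd hW).continuousOn hsub
    (by rw [closure_Ioo hlen.ne]; exact Ioc_subset_Icc_self) (right_mem_Ioc.2 hlen)
  simp only at h2
  have h3 := hE.regular _ (hW _ (right_mem_Ioc.2 hlen))
  rw [Function.comp_apply] at h2
  rw [← h2, T.pos_len] at h3
  exact (T.tgt e).2 h3

theorem eventually_wedge {δ : ℝ} (hδ : 0 < δ) : ∀ᶠ β in 𝓝[>] (0 : ℝ),
    β ∈ Ioo 0 Real.pi ∧ 0 < Real.cos β ∧ Real.sin β < δ * Real.cos β := by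
  have h1 : ∀ᶠ β in 𝓝 (0 : ℝ), 0 < Real.cos β :=
    Real.continuous_cos.continuousAt.eventually (lt_mem_nhds (by rw [Real.cos_zero]; exact one_pos))
  have h2 : ∀ᶠ β in 𝓝 (0 : ℝ), Real.sin β - δ * Real.cos β < 0 := by
    have : Continuous fun β => Real.sin β - δ * Real.cos β := by fun_prop
    exact this.continuousAt.eventually (gt_mem_nhds (by simpa using hδ))
  filter_upwards [Ioo_mem_nhdsGT Real.pi_pos, nhdsWithin_le_nhds h1, nhdsWithin_le_nhds h2] with
    β h3 h4 h5 using ⟨h3, h4, by linarith⟩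

/-- Infinitely many directions would accumulate at some a₀. Wedges longer than L are immersed along
both sides of a₀, and a direction close enough to a₀ points into one of them. -/
theorem finite_directions [CompactSpace M] [Finite (singularSet M)] (hM : IsEuclideanPolyhedral M)
    {i : singularSet M} (hc : IsConeChart c (i : M) α ε) (L : ℝ) :
    {a | a ∈ Icc 0 α ∧ ∃ T : GeodesicTriangulation M, ∃ e, T.src e = i ∧ T.len e ≤ L ∧
      T.HasDirection c e a}.Finite := by
  obtain ⟨ε₁, hε₁, h1⟩ : ∃ ε > 0, ∀ y', dist y' (i : M) < ε → y' ∈ singularSet M → y' = i := by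
    have h1 : IsClosed (singularSet M \ {(i : M)}) :=
      ((toFinite (singularSet M)).subset sdiff_subset).isClosed
    obtain ⟨ε, hε, h2⟩ := Metric.isOpen_iff.1 h1.isOpen_compl i (by simp)
    refine ⟨ε, hε, fun y hy hyS => ?_⟩
    by_contra hne
    exact h2 hy ⟨hyS, hne⟩
  have hc' := hc.mono (lt_min hc.pos hε₁) (min_le_left _ _)
  have hiso : ∀ y, dist y (i : M) < min ε ε₁ → y ∈ singularSet M → y = i := fun y hy =>
    h1 y (hy.trans_le (min_le_right _ _))
  by_contra hinf
  obtain ⟨a₀, -, hacc⟩ := Set.Infinite.exists_accPt_of_subset_isCompact hinf isCompact_Icc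
    fun a ha => ha.1
  obtain ⟨E₁, δ₁, hE₁⟩ := hc'.exists_isImmersedWedge hM hiso a₀ (L + 1)
  -- The reflected chart provides the wedge on the side of angles smaller than a₀.
  obtain ⟨E₂, δ₂, hE₂⟩ := hc'.reflect.exists_isImmersedWedge hM hiso (-a₀) (L + 1)
  obtain ⟨b, hb, hb'⟩ := mem_nhdsGT_iff_exists_Ioo_subset.1
    ((eventually_wedge hE₁.pos).and (eventually_wedge hE₂.pos))
  obtain ⟨a, ⟨ha, -, T, e, hsrc, hlen, hdir⟩, hne⟩ := (accPt_iff_nhds.1 hacc) (ball a₀ b)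
    (ball_mem_nhds _ hb)
  rw [mem_ball, Real.dist_eq, abs_lt] at ha
  rcases lt_or_gt_of_ne hne with hlt | hgt
  · have h2 := (hb' (show a₀ - a ∈ Ioo 0 b from ⟨by linarith, by linarith⟩)).2
    refine HasDirection.false_of_isImmersedWedge hE₂ ?_ h2.1 h2.2.1 h2.2.2
      (by linarith : T.len e < L + 1)
    obtain ⟨δ, hδ, h⟩ := hdir
    exact ⟨δ, hδ, fun s hs => by rw [h s hs]; congr 1; ring⟩
  · have h2 := (hb' (show a - a₀ ∈ Ioo 0 b from ⟨by linarith, by linarith⟩)).1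
    refine HasDirection.false_of_isImmersedWedge hE₁ ?_ h2.1 h2.2.1 h2.2.2
      (by linarith : T.len e < L + 1)
    rwa [add_sub_cancel]

/-- An initial vertex and a direction determine an edge as a path, and so its length, even across
triangulations. Assigning to each length a direction that realizes it is therefore injective. -/
theorem finite_len [CompactSpace M] [Finite (singularSet M)] (hM : IsEuclideanPolyhedral M)
    (L : ℝ) : {l | l ≤ L ∧ ∃ T : GeodesicTriangulation M, ∃ e, T.len e = l}.Finite := by
  have h : ∀ i : singularSet M,
      {l | l ≤ L ∧ ∃ T : GeodesicTriangulation M, ∃ e, T.src e = i ∧ T.len e = l}.Finite := by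
    intro i
    obtain ⟨α, ε, c, hc⟩ := hM.exists_coneChart i
    have hex : ∀ l : ℝ, ∃ a, (l ≤ L ∧ ∃ T : GeodesicTriangulation M, ∃ e, T.src e = i ∧ T.len e = l) →
        a ∈ Icc 0 α ∧ ∃ T : GeodesicTriangulation M, ∃ e, T.src e = i ∧ T.len e = l ∧
        T.HasDirection c e a := fun l => by
      by_cases hl : l ≤ L ∧ ∃ T : GeodesicTriangulation M, ∃ e, T.src e = i ∧ T.len e = l
      · obtain ⟨-, T, e, he, hel⟩ := id hl
        obtain ⟨a, ha, h⟩ := exists_hasDirection hM T (e := e) (by rw [he]; exact hc)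
        exact ⟨a, fun _ => ⟨Ico_subset_Icc_self ha, T, e, he, hel, h⟩⟩
      · exact ⟨0, fun h => absurd h hl⟩
    choose a ha using hex
    refine Set.Finite.of_injOn (f := a) (t := _) (fun l hl => ?_) (fun l hl l' hl' hll => ?_)
      (finite_directions hM hc L)
    · obtain ⟨h1, T, e, h2, h3, h4⟩ := ha l hl
      exact ⟨h1, T, e, h2, h3.le.trans hl.1, h4⟩
    · obtain ⟨h1, T, e, h2, h3, h4⟩ := ha l hl
      obtain ⟨h1', T', e', h2', h3', h4'⟩ := ha l' hl'
      rw [← hll] at h4'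
      rw [← h3, ← h3']
      exact (h4.pos_eq h4').1
  refine (Set.finite_iUnion h).subset ?_
  rintro l ⟨hl, T, e, he⟩
  exact mem_iUnion.2 ⟨T.src e, hl, T, e, rfl, he⟩

end GeodesicTriangulation

/-! ### The angles of the pyramids -/

theorem inner_orthComponent {d : Space} (hd : d ≠ 0) (u v : Space) :
    inner ℝ (orthComponent d u) (orthComponent d v) =
      inner ℝ u v - inner ℝ d u * inner ℝ d v / inner ℝ d d := by
  have h : inner ℝ d d ≠ 0 := inner_self_ne_zero.2 hd
  simp only [orthComponent, inner_sub_left, inner_sub_right, real_inner_smul_left,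
    real_inner_smul_right, real_inner_comm d u]
  field_simp
  rw [real_inner_comm u d]
  ring

theorem Real.arccos_add_arccos_le_pi_iff {u v : ℝ} (hu : u ∈ Icc (-1) 1) (hv : v ∈ Icc (-1) 1) :
    Real.arccos u + Real.arccos v ≤ Real.pi ↔ 0 ≤ u + v := by
  have h1 : Real.arccos u + Real.arccos v ≤ Real.pi ↔ Real.arccos v ≤ Real.arccos (-u) := by
    rw [Real.arccos_neg]
    constructor <;> intro h <;> linarith
  rw [h1, Real.strictAntiOn_arccos.le_iff_ge hv ⟨by linarith [hu.2], by linarith [hu.1]⟩]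
  constructor <;> intro h <;> linarith

namespace GeodesicTriangulation

variable {M : Type*} [MetricSpace M] (T : GeodesicTriangulation M) (r : singularSet M → ℝ)

/-- The vector of three-space with given coordinates in the frame adapted to `e`. -/
noncomputable def vec (e : T.OrientedEdge) (x y z : ℝ) : Space :=
  !₂[(x • T.dir e + y • T.nrm e) 0, (x • T.dir e + y • T.nrm e) 1, z]

/-- The point of three-space with given coordinates in the frame adapted to `e`. -/
noncomputable def spt (e : T.OrientedEdge) (x y z : ℝ) : Space :=
  !₂[(T.fr e x y) 0, (T.fr e x y) 1, z]

theorem inner_vec (e : T.OrientedEdge) (x y z x' y' z' : ℝ) :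
    inner ℝ (T.vec e x y z) (T.vec e x' y' z') = x * x' + y * y' + z * z' := by
  have h1 := T.inner_dir_dir e
  have h2 := T.inner_nrm_nrm e
  have h3 := T.inner_dir_nrm e
  rw [Plane.inner_eq] at h1 h2 h3
  simp only [vec, PiLp.inner_apply, Fin.sum_univ_three, RCLike.inner_apply, conj_trivial,
    PiLp.add_apply, PiLp.smul_apply, smul_eq_mul, Matrix.cons_val_zero, Matrix.cons_val_one,
    Matrix.cons_val]
  linear_combination x * x' * h1 + y * y' * h2 + (x * y' + x' * y) * h3

theorem norm_vec (e : T.OrientedEdge) (x y z : ℝ) :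
    ‖T.vec e x y z‖ = √(x ^ 2 + y ^ 2 + z ^ 2) := by
  rw [← Real.sqrt_sq (norm_nonneg (T.vec e x y z)), ← real_inner_self_eq_norm_sq, inner_vec]
  congr 1; ring

theorem vec_ne_zero (e : T.OrientedEdge) {x y z : ℝ} (h : 0 < x ^ 2 + y ^ 2 + z ^ 2) :
    T.vec e x y z ≠ 0 := by
  rw [← norm_pos_iff, norm_vec]; exact Real.sqrt_pos.2 h

theorem spt_sub (e : T.OrientedEdge) (x y z x' y' z' : ℝ) :
    T.spt e x y z - T.spt e x' y' z' = T.vec e (x - x') (y - y') (z - z') := by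
  ext k
  fin_cases k <;> simp [spt, vec, fr] <;> ring

theorem dist_spt (e : T.OrientedEdge) (x y z x' y' z' : ℝ) :
    dist (T.spt e x y z) (T.spt e x' y' z') =
      √((x - x') ^ 2 + (y - y') ^ 2 + (z - z') ^ 2) := by
  rw [dist_eq_norm, spt_sub, norm_vec]

theorem base_zero (e : T.OrientedEdge) : T.base e.1 e.2 = T.spt e 0 0 0 := by
  rw [base, T.corner_zero]; rfl

theorem base_one (e : T.OrientedEdge) : T.base e.1 (e.2 + 1) = T.spt e (T.len e) 0 0 := by
  rw [base, T.corner_one]; rfl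

theorem base_two (e : T.OrientedEdge) : T.base e.1 (e.2 + 2) = T.spt e (T.cx e) (T.cy e) 0 := by
  rw [base, T.corner_two]; rfl

theorem exists_spt (e : T.OrientedEdge) (a : Space) : ∃ x y, a = T.spt e x y (a 2) := by
  obtain ⟨x, y, h⟩ := T.exists_fr e !₂[a 0, a 1]
  refine ⟨x, y, ?_⟩
  ext k
  rw [spt, ← h]
  fin_cases k <;> simp

/-- Squared distance from the apex to the line spanned by an edge. -/
noncomputable def edgeP (e : T.OrientedEdge) : ℝ := r (T.src e) ^ 2 - T.edgeX r e ^ 2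

/-- Squared height of the pyramid. -/
noncomputable def hsq (e : T.OrientedEdge) : ℝ := T.edgeP r e - T.edgeD r e ^ 2

theorem sq_src_prev (e : T.OrientedEdge) : r (T.src (T.prev e)) ^ 2 =
    T.cx e ^ 2 + T.cy e ^ 2 - 2 * T.edgeX r e * T.cx e - 2 * T.edgeD r e * T.cy e +
      r (T.src e) ^ 2 := by
  have := (T.cy_pos e).ne'
  rw [edgeD]; field_simp; ring

/-- Subtracting the equations of the spheres around the corners leaves linear equations for the foot
of the altitude; the remaining equation gives the squared height. -/
theorem isApex_iff (hr : ∀ i, 0 < r i) (e : T.OrientedEdge) (a : Space) :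
    T.IsApex r e.1 a ↔ 0 < T.hsq r e ∧ a = T.spt e (T.edgeX r e) (T.edgeD r e) √(T.hsq r e) := by
  have hL := T.len_pos e
  have hc := T.cy_pos e
  have h1 := T.sq_tgt r e
  have h2 := T.sq_src_prev r e
  have e1 : T.src (e.1, e.2 + 1) = T.tgt e := rfl
  have e2 : T.src (e.1, e.2 + 2) = T.src (T.prev e) := rfl
  have hd : ∀ (x y z p w : ℝ) (i : singularSet M), dist (T.spt e x y z) (T.spt e p w 0) = r i ↔
      (x - p) ^ 2 + (y - w) ^ 2 + z ^ 2 = r i ^ 2 := fun x y z p w i => by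
    rw [dist_spt, sub_zero, Real.sqrt_eq_iff_eq_sq (by positivity) (hr i).le]
  obtain ⟨x, y, ha⟩ := T.exists_spt e a
  set z := a 2 with hz
  have h2z : (T.spt e x y z) 2 = z := rfl
  rw [IsApex, Fin3.forall_iff _ e.2, ← hz, ha, T.base_zero, T.base_one, T.base_two, hd, hd, hd, e1, e2]
  constructor
  · rintro ⟨hz0, k0, k1, k2⟩
    have hx : x = T.edgeX r e := by
      have : T.len e * (x - T.edgeX r e) = 0 := by
        linear_combination (1 / 2) * k0 - (1 / 2) * k1 - (1 / 2) * h1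
      exact sub_eq_zero.1 ((mul_eq_zero.1 this).resolve_left hL.ne')
    have hy : y = T.edgeD r e := by
      have : T.cy e * (y - T.edgeD r e) = 0 := by
        rw [hx] at k0 k2
        linear_combination (1 / 2) * k0 - (1 / 2) * k2 - (1 / 2) * h2
      exact sub_eq_zero.1 ((mul_eq_zero.1 this).resolve_left hc.ne')
    have hh : T.hsq r e = z ^ 2 := by
      rw [hsq, edgeP, ← hx, ← hy]; linear_combination -k0
    refine ⟨by rw [hh]; positivity, ?_⟩
    rw [hh, Real.sqrt_sq hz0.le, hx, hy]
  · rintro ⟨hh, he⟩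
    have hz2 : z = √(T.hsq r e) := by
      have := congrArg (fun v : Space => v 2) he
      simpa [spt] using this
    have hfr : T.fr e x y = T.fr e (T.edgeX r e) (T.edgeD r e) := by
      ext k
      fin_cases k
      · have := congrArg (fun v : Space => v 0) he
        simpa [spt] using this
      · have := congrArg (fun v : Space => v 1) he
        simpa [spt] using this
    obtain ⟨hx, hy⟩ := T.fr_injective e hfr
    have hzz : z ^ 2 = T.hsq r e := by rw [hz2, Real.sq_sqrt hh.le]
    rw [hx, hy, hzz]
    refine ⟨by rw [hz2]; exact Real.sqrt_pos.2 hh, ?_, ?_, ?_⟩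
    · rw [hsq, edgeP]; ring
    · rw [h1, hsq, edgeP]; ring
    · rw [h2, hsq, edgeP]; ring

theorem isGeneralizedPolytope_iff : T.IsGeneralizedPolytope r ↔
    (∀ i, 0 < r i) ∧ ∀ e, 0 < T.hsq r e := by
  constructor
  · rintro ⟨hr, h⟩
    refine ⟨hr, fun e => ?_⟩
    obtain ⟨a, ha⟩ := h e.1
    exact ((T.isApex_iff r hr e a).1 ha).1
  · rintro ⟨hr, h⟩
    exact ⟨hr, fun f => ⟨_, (T.isApex_iff r hr (f, 0) _).2 ⟨h _, rfl⟩⟩⟩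

variable {r}

theorem IsGeneralizedPolytope.hsq_pos {T : GeodesicTriangulation M} (h : T.IsGeneralizedPolytope r)
    (e : T.OrientedEdge) : 0 < T.hsq r e := ((T.isGeneralizedPolytope_iff r).1 h).2 e

variable {T}

theorem IsGeneralizedPolytope.apex_eq (h : T.IsGeneralizedPolytope r) (e : T.OrientedEdge) :
    T.apex r e.1 = T.spt e (T.edgeX r e) (T.edgeD r e) √(T.hsq r e) :=
  ((T.isApex_iff r h.1 e _).1 (Classical.epsilon_spec (h.2 e.1))).2

theorem IsGeneralizedPolytope.edgeP_pos (h : T.IsGeneralizedPolytope r) (e : T.OrientedEdge) :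
    0 < T.edgeP r e := by
  have := h.hsq_pos e
  rw [hsq] at this
  nlinarith [sq_nonneg (T.edgeD r e)]

/-- Both are the squared third coordinate of one apex, computed in the frames of two sides of the
same face. -/
theorem IsGeneralizedPolytope.hsq_prev (h : T.IsGeneralizedPolytope r) (e : T.OrientedEdge) :
    T.hsq r (T.prev e) = T.hsq r e := by
  have h1 := h.apex_eq e
  have h2 : T.apex r e.1 = _ := h.apex_eq (T.prev e)
  rw [h1] at h2
  have := congrArg (fun v : Space => v 2) h2
  simp only [spt, Matrix.cons_val] at this
  exact ((Real.sqrt_inj (h.hsq_pos _).le (h.hsq_pos _).le).1 this).symm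

theorem edgeP_opp (T : GeodesicTriangulation M) (r : singularSet M → ℝ) (e : T.OrientedEdge) :
    T.edgeP r (T.opp e) = T.edgeP r e := by
  rw [edgeP, edgeX_opp, edgeP, T.src_opp, T.sq_tgt]; ring

theorem edgeX_prev (T : GeodesicTriangulation M) (r : singularSet M → ℝ) (e : T.OrientedEdge) :
    T.edgeX r (T.prev e) = T.len (T.prev e) -
      (T.cx e * T.edgeX r e + T.cy e * T.edgeD r e) / T.len (T.prev e) := by
  have hm := (T.len_pos (T.prev e)).ne'
  have h1 := T.cx_sq_add_cy_sq e
  rw [edgeX, T.sq_src_prev r e, T.tgt_prev, h1]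
  field_simp
  ring

theorem src_prev_prev (T : GeodesicTriangulation M) (e : T.OrientedEdge) :
    T.src (T.prev (T.prev e)) = T.tgt e := by
  simp only [prev, tgt]
  congr 2
  generalize e.2 = k; revert k; decide

/-- A change of frame: the foot of the altitude is one point of the plane of the face, and this is
its distance from the preceding side in terms of its coordinates along e. -/
theorem edgeD_prev (T : GeodesicTriangulation M) (r : singularSet M → ℝ) (e : T.OrientedEdge) :
    T.edgeD r (T.prev e) = (T.cy e * T.edgeX r e - T.cx e * T.edgeD r e) / T.len (T.prev e) := by
  have hm := (T.len_pos (T.prev e)).ne'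
  have hL := (T.len_pos e).ne'
  have hc := (T.cy_pos e).ne'
  have h1 := T.cx_sq_add_cy_sq e
  have h2 := T.cx_sq_add_cy_sq (T.prev e)
  have h3 := T.len_next_sq e
  have h4 := T.len_prev_mul_cy_prev e
  have h5 := T.len_prev_mul_cx_prev e
  have hc' := (T.cy_pos (T.prev e)).ne'
  -- The factor `len e * cy e`, twice the area, is the same in both frames and clears the
  -- denominators `cy` of both distances.
  have key : 2 * T.len e * T.cy e * (T.len (T.prev e) * T.edgeD r (T.prev e)) =
      2 * T.len e * T.cy e * (T.cy e * T.edgeX r e - T.cx e * T.edgeD r e) := by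
    have h6 : 2 * T.cy (T.prev e) * T.edgeD r (T.prev e) = T.cx (T.prev e) ^ 2 +
        T.cy (T.prev e) ^ 2 - 2 * T.edgeX r (T.prev e) * T.cx (T.prev e) - r (T.tgt e) ^ 2 +
        r (T.src (T.prev e)) ^ 2 := by
      rw [edgeD, T.src_prev_prev]; field_simp
    have h7 : T.len (T.prev e) * T.edgeX r (T.prev e) = T.len (T.prev e) ^ 2 -
        (T.cx e * T.edgeX r e + T.cy e * T.edgeD r e) := by
      rw [T.edgeX_prev]; field_simp
    have h8 := T.sq_tgt r e
    have h9 := T.sq_src_prev r e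
    have ha : 2 * (T.len e * T.cy e) * (T.len (T.prev e) * T.edgeD r (T.prev e)) =
        T.len (T.prev e) ^ 2 * (2 * T.cy (T.prev e) * T.edgeD r (T.prev e)) := by
      rw [← h4]; ring
    rw [mul_assoc 2, ha, h6, h2, ← h3, h8, h9]
    have hb : T.len (T.prev e) ^ 2 * (2 * T.edgeX r (T.prev e) * T.cx (T.prev e)) =
        2 * (T.len (T.prev e) ^ 2 - (T.cx e * T.edgeX r e + T.cy e * T.edgeD r e)) *
          (T.len (T.prev e) ^ 2 - T.len e * T.cx e) := by
      rw [← h7, ← h5]; ring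
    linear_combination (-1) * hb + (2 * T.len (T.prev e) ^ 2 - 2 * T.len e * T.edgeX r e) * h1
  have := mul_left_cancel₀ (mul_ne_zero (mul_ne_zero two_ne_zero hL) hc) key
  rw [eq_div_iff hm, mul_comm, this]

theorem IsGeneralizedPolytope.rho_eq (h : T.IsGeneralizedPolytope r) (e : T.OrientedEdge) :
    T.rho r e = Real.arccos (T.edgeX r e / r (T.src e)) := by
  have hL := T.len_pos e
  have hr := h.1 (T.src e)
  have hh := h.hsq_pos e
  rw [rho, EuclideanGeometry.angle, InnerProductGeometry.angle, vsub_eq_sub, vsub_eq_sub,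
    h.apex_eq e, T.base_zero, T.base_one, spt_sub, spt_sub, inner_vec, norm_vec, norm_vec]
  congr 1
  have e1 : (T.edgeX r e - 0) ^ 2 + (T.edgeD r e - 0) ^ 2 + (√(T.hsq r e) - 0) ^ 2 =
      r (T.src e) ^ 2 := by
    rw [sub_zero, sub_zero, sub_zero, Real.sq_sqrt hh.le, hsq, edgeP]; ring
  have e2 : (T.len e - 0) ^ 2 + (0 - 0) ^ 2 + (0 - 0) ^ 2 = T.len e ^ 2 := by ring
  rw [e1, e2, Real.sqrt_sq hr.le, Real.sqrt_sq hL.le]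
  field_simp
  ring

theorem IsGeneralizedPolytope.phi_eq (h : T.IsGeneralizedPolytope r) (e : T.OrientedEdge) :
    T.phi r e = Real.arccos ((r (T.src e) ^ 2 + r (T.tgt e) ^ 2 - T.len e ^ 2) /
      (2 * r (T.src e) * r (T.tgt e))) := by
  have hr := h.1 (T.src e)
  have hr' := h.1 (T.tgt e)
  have hh := h.hsq_pos e
  have h1 := T.sq_tgt r e
  rw [phi, EuclideanGeometry.angle, InnerProductGeometry.angle, vsub_eq_sub, vsub_eq_sub,
    h.apex_eq e, T.base_zero, T.base_one, spt_sub, spt_sub, inner_vec, norm_vec, norm_vec]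
  congr 1
  have hs : √(T.hsq r e) ^ 2 = r (T.src e) ^ 2 - T.edgeX r e ^ 2 - T.edgeD r e ^ 2 := by
    rw [Real.sq_sqrt hh.le, hsq, edgeP]
  have e1 : (0 - T.edgeX r e) ^ 2 + (0 - T.edgeD r e) ^ 2 + (0 - √(T.hsq r e)) ^ 2 =
      r (T.src e) ^ 2 := by linear_combination hs
  have e2 : (T.len e - T.edgeX r e) ^ 2 + (0 - T.edgeD r e) ^ 2 + (0 - √(T.hsq r e)) ^ 2 =
      r (T.tgt e) ^ 2 := by linear_combination hs - h1
  have e3 : (0 - T.edgeX r e) * (T.len e - T.edgeX r e) + (0 - T.edgeD r e) * (0 - T.edgeD r e) +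
      (0 - √(T.hsq r e)) * (0 - √(T.hsq r e)) =
      (r (T.src e) ^ 2 + r (T.tgt e) ^ 2 - T.len e ^ 2) / 2 := by
    linear_combination hs - (1 / 2) * h1
  rw [e1, e2, e3, Real.sqrt_sq hr.le, Real.sqrt_sq hr'.le]
  field_simp

/-- Orthogonally to the edge, the apex is at (D, h) and the third corner at (`cy`, 0). The cosine is
D over the distance √P from the apex to the line of the edge. -/
theorem IsGeneralizedPolytope.alpha_eq (h : T.IsGeneralizedPolytope r) (e : T.OrientedEdge) :
    T.alpha r e = Real.arccos (T.edgeD r e / √(T.edgeP r e)) := by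
  have hL := T.len_pos e
  have hc := T.cy_pos e
  have hh := h.hsq_pos e
  have hne : T.vec e (T.len e - 0) (0 - 0) (0 - 0) ≠ 0 :=
    T.vec_ne_zero e (by rw [sub_zero]; positivity)
  rw [alpha, dihedralAngle, InnerProductGeometry.angle,
    h.apex_eq e, T.base_zero, T.base_one, T.base_two, spt_sub, spt_sub, spt_sub]
  rw [norm_eq_sqrt_real_inner (orthComponent _ (T.vec e _ _ (√_ - 0))),
    norm_eq_sqrt_real_inner (orthComponent _ (T.vec e _ _ (0 - 0)))]
  simp only [inner_orthComponent hne, inner_vec]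
  congr 1
  have hs : √(T.hsq r e) ^ 2 = r (T.src e) ^ 2 - T.edgeX r e ^ 2 - T.edgeD r e ^ 2 := by
    rw [Real.sq_sqrt hh.le, hsq, edgeP]
  simp only [sub_zero, mul_zero, zero_mul, add_zero]
  have k1 : T.edgeX r e * T.cx e + T.edgeD r e * T.cy e -
      T.len e * T.edgeX r e * (T.len e * T.cx e) / (T.len e * T.len e) = T.edgeD r e * T.cy e := by
    field_simp; ring
  have k2 : T.edgeX r e * T.edgeX r e + T.edgeD r e * T.edgeD r e +
      √(T.hsq r e) * √(T.hsq r e) -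
      T.len e * T.edgeX r e * (T.len e * T.edgeX r e) / (T.len e * T.len e) = T.edgeP r e := by
    rw [edgeP]
    have : T.len e * T.edgeX r e * (T.len e * T.edgeX r e) / (T.len e * T.len e) =
      T.edgeX r e ^ 2 := by field_simp
    rw [this]
    linear_combination hs
  have k3 : T.cx e * T.cx e + T.cy e * T.cy e -
      T.len e * T.cx e * (T.len e * T.cx e) / (T.len e * T.len e) = T.cy e ^ 2 := by
    field_simp; ring
  rw [k1, k2, k3, Real.sqrt_sq hc.le, mul_div_mul_right _ _ hc.ne']

/-- Coordinate, along the side of the face `e.1` that ends at the initial vertex of `e`, of the foot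
of the altitude, measured from that vertex. -/
noncomputable def edgeX' (T : GeodesicTriangulation M) (r : singularSet M → ℝ)
    (e : T.OrientedEdge) : ℝ :=
  (T.cx e * T.edgeX r e + T.cy e * T.edgeD r e) / T.len (T.prev e)

theorem edgeX_opp_prev (T : GeodesicTriangulation M) (r : singularSet M → ℝ) (e : T.OrientedEdge) :
    T.edgeX r (T.opp (T.prev e)) = T.edgeX' r e := by
  rw [edgeX_opp, edgeX_prev, edgeX']; ring

theorem edgeP_prev (T : GeodesicTriangulation M) (r : singularSet M → ℝ) (e : T.OrientedEdge) :
    T.edgeP r (T.prev e) = r (T.src e) ^ 2 - T.edgeX' r e ^ 2 := by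
  rw [← edgeP_opp, edgeP, T.src_opp, T.tgt_prev, T.edgeX_opp_prev]

/-- The spherical law of cosines at the vertex, cos ω = (cos γ − cos ρ cos ρ') / (sin ρ sin ρ'),
with numerator and denominator multiplied by r²; γ is the angle of the face. -/
theorem IsGeneralizedPolytope.omega_eq (h : T.IsGeneralizedPolytope r) (e : T.OrientedEdge) :
    T.omega r e = Real.arccos ((T.cx e / T.len (T.prev e) * r (T.src e) ^ 2 -
      T.edgeX r e * T.edgeX' r e) / (√(T.edgeP r e) * √(T.edgeP r (T.prev e)))) := by
  have hL := T.len_pos e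
  have hm := T.len_pos (T.prev e)
  have hr := h.1 (T.src e)
  have hh := h.hsq_pos e
  have hP := h.edgeP_pos e
  have hP' := h.edgeP_pos (T.prev e)
  have hs : √(T.hsq r e) ^ 2 = r (T.src e) ^ 2 - T.edgeX r e ^ 2 - T.edgeD r e ^ 2 := by
    rw [Real.sq_sqrt hh.le, hsq, edgeP]
  have hne : T.vec e (0 - T.edgeX r e) (0 - T.edgeD r e) (0 - √(T.hsq r e)) ≠ 0 :=
    T.vec_ne_zero e (by
      have : 0 < r (T.src e) ^ 2 := by positivity
      nlinarith)
  rw [omega, dihedralAngle, InnerProductGeometry.angle,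
    h.apex_eq e, T.base_zero, T.base_one, T.base_two, spt_sub, spt_sub, spt_sub]
  set d := T.vec e (0 - T.edgeX r e) (0 - T.edgeD r e) (0 - √(T.hsq r e))
  set u := T.vec e (T.len e - T.edgeX r e) (0 - T.edgeD r e) (0 - √(T.hsq r e))
  set v := T.vec e (T.cx e - T.edgeX r e) (T.cy e - T.edgeD r e) (0 - √(T.hsq r e))
  have hX' : T.cx e * T.edgeX r e + T.cy e * T.edgeD r e = T.len (T.prev e) * T.edgeX' r e := by
    rw [edgeX']; field_simp
  have hm2 := T.cx_sq_add_cy_sq e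
  have dd : inner ℝ d d = r (T.src e) ^ 2 := by rw [inner_vec]; linear_combination hs
  have du : inner ℝ d u = r (T.src e) ^ 2 - T.len e * T.edgeX r e := by
    rw [inner_vec]; linear_combination hs
  have dv : inner ℝ d v = r (T.src e) ^ 2 - T.len (T.prev e) * T.edgeX' r e := by
    rw [inner_vec, ← hX']; linear_combination hs
  have uv : inner ℝ u v = r (T.src e) ^ 2 - T.len e * T.edgeX r e -
      T.len (T.prev e) * T.edgeX' r e + T.len e * T.cx e := by
    rw [inner_vec, ← hX']; linear_combination hs
  have uu : inner ℝ u u = r (T.src e) ^ 2 - 2 * T.len e * T.edgeX r e + T.len e ^ 2 := by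
    rw [inner_vec]; linear_combination hs
  have vv : inner ℝ v v = r (T.src e) ^ 2 - 2 * T.len (T.prev e) * T.edgeX' r e +
      T.len (T.prev e) ^ 2 := by
    rw [inner_vec, mul_assoc, ← hX', ← hm2]; linear_combination hs
  rw [norm_eq_sqrt_real_inner (orthComponent d u), norm_eq_sqrt_real_inner (orthComponent d v)]
  simp only [inner_orthComponent hne, dd, du, dv, uv, uu, vv]
  have k1 : r (T.src e) ^ 2 - 2 * T.len e * T.edgeX r e + T.len e ^ 2 -
      (r (T.src e) ^ 2 - T.len e * T.edgeX r e) * (r (T.src e) ^ 2 - T.len e * T.edgeX r e) /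
        r (T.src e) ^ 2 = (T.len e / r (T.src e)) ^ 2 * T.edgeP r e := by
    rw [edgeP]; field_simp; ring
  have k2 : r (T.src e) ^ 2 - 2 * T.len (T.prev e) * T.edgeX' r e + T.len (T.prev e) ^ 2 -
      (r (T.src e) ^ 2 - T.len (T.prev e) * T.edgeX' r e) *
        (r (T.src e) ^ 2 - T.len (T.prev e) * T.edgeX' r e) / r (T.src e) ^ 2 =
      (T.len (T.prev e) / r (T.src e)) ^ 2 * T.edgeP r (T.prev e) := by
    rw [edgeP_prev]; field_simp; ring
  rw [k1, k2, Real.sqrt_mul (by positivity), Real.sqrt_mul (by positivity),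
    Real.sqrt_sq (by positivity), Real.sqrt_sq (by positivity)]
  congr 1
  have s1 := Real.sqrt_pos.2 hP
  have s2 := Real.sqrt_pos.2 hP'
  field_simp
  ring

theorem IsGeneralizedPolytope.edgeD_div_mem (h : T.IsGeneralizedPolytope r) (e : T.OrientedEdge) :
    T.edgeD r e / √(T.edgeP r e) ∈ Ioo (-1) 1 := by
  have hP := h.edgeP_pos e
  have hh := h.hsq_pos e
  rw [mem_Ioo, ← abs_lt, abs_div, abs_of_pos (Real.sqrt_pos.2 hP), div_lt_one (Real.sqrt_pos.2 hP)]
  refine Real.lt_sqrt_of_sq_lt ?_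
  rw [sq_abs]
  rw [hsq] at hh
  linarith

/-- The two pyramids at an edge have the same distance √P from apex to edge, so comparing arccosines
amounts to comparing the signed distances of the two feet. -/
theorem IsGeneralizedPolytope.theta_le_pi_iff (h : T.IsGeneralizedPolytope r) (e : T.OrientedEdge) :
    T.theta r e ≤ Real.pi ↔ 0 ≤ T.edgeD r e + T.edgeD r (T.opp e) := by
  have hP := Real.sqrt_pos.2 (h.edgeP_pos e)
  have h1 := h.edgeD_div_mem e
  have h2 := h.edgeD_div_mem (T.opp e)
  rw [theta, h.alpha_eq, h.alpha_eq, Real.arccos_add_arccos_le_pi_iff (Ioo_subset_Icc_self h1)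
    (Ioo_subset_Icc_self h2), T.edgeP_opp, ← add_div]
  rw [le_div_iff₀ hP, zero_mul]

/-- Convexity becomes a finite system of inequalities between functions continuous in r: strict ones
for the pyramids to exist, weak ones at the edges. -/
theorem isConvexPolytope_iff : T.IsConvexPolytope r ↔
    (∀ i, 0 < r i) ∧ (∀ e, 0 < T.hsq r e) ∧ T.IsLocallyConvex r := by
  constructor
  · rintro ⟨h, hθ⟩
    exact ⟨h.1, h.hsq_pos, fun e => (h.theta_le_pi_iff e).1 (hθ e)⟩
  · rintro ⟨h1, h2, h3⟩
    have h := (T.isGeneralizedPolytope_iff r).2 ⟨h1, h2⟩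
    exact ⟨h, fun e => (h.theta_le_pi_iff e).2 (h3 e)⟩

end GeodesicTriangulation

/-! ### The curvature is determined by the distance to the apex -/

/-- A dihedral angle as an integral over the directions in a sector. -/
theorem integral_link {r X D γ : ℝ} (hr : 0 < r) (hh : 0 < r ^ 2 - X ^ 2 - D ^ 2)
    (hγ : γ ∈ Ioo 0 Real.pi) :
    ∫ t in (0 : ℝ)..γ, √(r ^ 2 - X ^ 2 - D ^ 2) * r /
        (r ^ 2 - (X * Real.cos t + D * Real.sin t) ^ 2) =
      Real.arccos ((Real.cos γ * r ^ 2 - X * (X * Real.cos γ + D * Real.sin γ)) /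
        (√(r ^ 2 - X ^ 2) * √(r ^ 2 - (X * Real.cos γ + D * Real.sin γ) ^ 2))) := by
  set h := √(r ^ 2 - X ^ 2 - D ^ 2) with hh_def
  have hh2 : h ^ 2 = r ^ 2 - X ^ 2 - D ^ 2 := Real.sq_sqrt hh.le
  have hh0 : 0 < h := Real.sqrt_pos.2 hh
  -- p t is the projection of the side edge to the direction t of the face, p' is its derivative,
  -- and p² + p'² is the squared distance from the vertex to the foot of the altitude.
  set p : ℝ → ℝ := fun t => X * Real.cos t + D * Real.sin t with hp
  set p' : ℝ → ℝ := fun t => D * Real.cos t - X * Real.sin t with hp'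
  have hpp : ∀ t, p t ^ 2 + p' t ^ 2 = X ^ 2 + D ^ 2 := fun t => by
    simp only [hp, hp']
    linear_combination (X ^ 2 + D ^ 2) * Real.sin_sq_add_cos_sq t
  have hpd : ∀ t, HasDerivAt p (p' t) t := fun t => by
    have := ((Real.hasDerivAt_cos t).const_mul X).add ((Real.hasDerivAt_sin t).const_mul D)
    refine this.congr_deriv ?_
    simp only [hp']; ring
  have hPt : ∀ t, 0 < r ^ 2 - p t ^ 2 := fun t => by nlinarith [hpp t, sq_nonneg (p' t)]
  have hP : 0 < r ^ 2 - X ^ 2 := by nlinarith [sq_nonneg D]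
  set g : ℝ → ℝ := fun t => √(r ^ 2 - p t ^ 2) with hg
  have hg0 : ∀ t, 0 < g t := fun t => Real.sqrt_pos.2 (hPt t)
  have hg2 : ∀ t, g t ^ 2 = r ^ 2 - p t ^ 2 := fun t => Real.sq_sqrt (hPt t).le
  set a := √(r ^ 2 - X ^ 2) with ha
  have ha0 : 0 < a := Real.sqrt_pos.2 hP
  have ha2 : a ^ 2 = r ^ 2 - X ^ 2 := Real.sq_sqrt hP.le
  -- f t is the cosine of the dihedral angle, at the side edge, between the half-planes through the
  -- directions 0 and t; the integrand is the derivative of arccos (f t).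
  set f : ℝ → ℝ := fun t => (Real.cos t * r ^ 2 - X * p t) / (a * g t) with hf
  have hgd : ∀ t, HasDerivAt g (-(p t * p' t) / g t) t := fun t => by
    have h1 : HasDerivAt (fun t => r ^ 2 - p t ^ 2) (-(2 * p t * p' t)) t := by
      have := ((hpd t).pow 2).const_sub (r ^ 2)
      refine this.congr_deriv ?_
      simp
    refine (h1.sqrt (hPt t).ne').congr_deriv ?_
    have := (hg0 t).ne'
    change _ / (2 * g t) = _
    field_simp
  have hfd : ∀ t, HasDerivAt f (-(h ^ 2 * r ^ 2 * Real.sin t) / (a * g t ^ 3)) t := fun t => by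
    have h1 : HasDerivAt (fun t => Real.cos t * r ^ 2 - X * p t)
        (-Real.sin t * r ^ 2 - X * p' t) t :=
      ((Real.hasDerivAt_cos t).mul_const _).sub ((hpd t).const_mul X)
    have h2 := h1.div ((hgd t).const_mul a) (mul_pos ha0 (hg0 t)).ne'
    refine h2.congr_deriv ?_
    have h3 := (hg0 t).ne'
    have h4 := ha0.ne'
    rw [div_eq_div_iff (by positivity) (by positivity)]
    have h5 : a * (-(p t * p' t) / g t) * g t = -(a * (p t * p' t)) := by field_simp
    have key : (-Real.sin t * r ^ 2 - X * p' t) * g t ^ 2 +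
        (Real.cos t * r ^ 2 - X * p t) * (p t * p' t) = -(h ^ 2 * r ^ 2 * Real.sin t) := by
      rw [hg2, hh2]
      have e1 : Real.sin t * p t + Real.cos t * p' t = D := by
        simp only [hp, hp']
        linear_combination D * Real.sin_sq_add_cos_sq t
      have e2 : p t * D - X * p' t = Real.sin t * (X ^ 2 + D ^ 2) := by
        simp only [hp, hp']; ring
      linear_combination r ^ 2 * p t * e1 + r ^ 2 * e2
    have : ((-Real.sin t * r ^ 2 - X * p' t) * (a * g t) -
        (Real.cos t * r ^ 2 - X * p t) * (a * (-(p t * p' t) / g t))) * g t =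
        a * -(h ^ 2 * r ^ 2 * Real.sin t) := by
      rw [← key]
      linear_combination -(Real.cos t * r ^ 2 - X * p t) * h5
    calc _ = ((-Real.sin t * r ^ 2 - X * p' t) * (a * g t) -
        (Real.cos t * r ^ 2 - X * p t) * (a * (-(p t * p' t) / g t))) * g t * (a * g t ^ 2) := by ring
      _ = _ := by rw [this]; ring
  have hf1 : ∀ t, 1 - f t ^ 2 = (r * h * Real.sin t / (a * g t)) ^ 2 := fun t => by
    have h3 := (hg0 t).ne'
    have h4 := ha0.ne'
    have key : a ^ 2 * g t ^ 2 - (Real.cos t * r ^ 2 - X * p t) ^ 2 = (r * h * Real.sin t) ^ 2 := by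
      rw [ha2, hg2, mul_pow, mul_pow, hh2]
      have e1 : X ^ 2 + p t ^ 2 - 2 * Real.cos t * X * p t = Real.sin t ^ 2 * (X ^ 2 + D ^ 2) := by
        simp only [hp]
        have := Real.sin_sq_add_cos_sq t
        linear_combination (-X ^ 2) * this
      have := Real.sin_sq_add_cos_sq t
      linear_combination (-(r ^ 2)) * e1 + (-r ^ 4) * this
    rw [div_pow (r * h * Real.sin t), ← key]
    simp only [hf]
    field_simp
  have hsin : ∀ t ∈ Ioo 0 γ, 0 < Real.sin t := fun t ht =>
    Real.sin_pos_of_pos_of_lt_pi ht.1 (ht.2.trans hγ.2)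
  have hcf : Continuous f := continuous_iff_continuousAt.2 fun t => (hfd t).continuousAt
  have hcp : Continuous p := continuous_iff_continuousAt.2 fun t => (hpd t).continuousAt
  -- Only the open interval may be differentiated: f 0 = 1, where arccos has no derivative, and
  -- continuity takes care of the end.
  have hint := intervalIntegral.integral_eq_sub_of_hasDerivAt_of_le (f := fun t => Real.arccos (f t))
    (f' := fun t => h * r / (r ^ 2 - p t ^ 2)) hγ.1.le (Real.continuous_arccos.comp hcf).continuousOn
    (fun t ht => by
      have hs := hsin t ht
      have hpos : 0 < r * h * Real.sin t / (a * g t) := by have := hg0 t; positivity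
      have hsq : 0 < 1 - f t ^ 2 := by rw [hf1]; positivity
      have h1 : f t ≠ -1 := fun h0 => by rw [h0] at hsq; norm_num at hsq
      have h2 : f t ≠ 1 := fun h0 => by rw [h0] at hsq; norm_num at hsq
      refine ((Real.hasDerivAt_arccos h1 h2).comp t (hfd t)).congr_deriv ?_
      rw [hf1, Real.sqrt_sq hpos.le, ← hg2]
      have := (hg0 t).ne'
      have := ha0.ne'
      field_simp)
    (Continuous.intervalIntegrable (by
      refine Continuous.div continuous_const (by fun_prop) fun t => (hPt t).ne') _ _)
  rw [hint]
  have h0 : f 0 = 1 := by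
    simp only [hf, hp, hg, Real.cos_zero, Real.sin_zero, mul_one, mul_zero, add_zero, one_mul]
    rw [← ha, ← sq, ← sq, ha2, div_self hP.ne']
  rw [h0, Real.arccos_one, sub_zero]

namespace GeodesicTriangulation

variable {M : Type*} [MetricSpace M] {T : GeodesicTriangulation M} {r : singularSet M → ℝ}
  {c : ℝ → ℝ → M} {α ε : ℝ}

/-- Angle of a face at the initial vertex of a side. -/
noncomputable def cornerAngle (T : GeodesicTriangulation M) (e : T.OrientedEdge) : ℝ :=
  (⟨T.cx e, T.cy e⟩ : ℂ).arg

theorem norm_cx_cy (T : GeodesicTriangulation M) (e : T.OrientedEdge) :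
    ‖(⟨T.cx e, T.cy e⟩ : ℂ)‖ = T.len (T.prev e) := by
  rw [Complex.norm_def, Complex.normSq_mk, ← sq, ← sq, T.cx_sq_add_cy_sq,
    Real.sqrt_sq (T.len_pos _).le]

theorem cos_cornerAngle (T : GeodesicTriangulation M) (e : T.OrientedEdge) :
    T.len (T.prev e) * Real.cos (T.cornerAngle e) = T.cx e := by
  rw [← norm_cx_cy, cornerAngle, Complex.norm_mul_cos_arg]

theorem sin_cornerAngle (T : GeodesicTriangulation M) (e : T.OrientedEdge) :
    T.len (T.prev e) * Real.sin (T.cornerAngle e) = T.cy e := by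
  rw [← norm_cx_cy, cornerAngle, Complex.norm_mul_sin_arg]

theorem _root_.Complex.arg_mem_Ioo_of_im_pos {z : ℂ} (hz : 0 < z.im) : z.arg ∈ Ioo 0 Real.pi := by
  rw [← Complex.norm_mul_sin_arg] at hz
  have hs : 0 < Real.sin z.arg := pos_of_mul_pos_right hz (norm_nonneg _)
  have h1 : 0 < z.arg := by
    by_contra! h
    exact absurd (Real.sin_nonpos_of_nonpos_of_neg_pi_le h (Complex.neg_pi_lt_arg z).le)
      (not_le.2 hs)
  refine ⟨h1, lt_of_le_of_ne (Complex.arg_le_pi _) fun h => ?_⟩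
  rw [h, Real.sin_pi] at hs
  exact lt_irrefl _ hs

theorem cornerAngle_mem (T : GeodesicTriangulation M) (e : T.OrientedEdge) :
    T.cornerAngle e ∈ Ioo 0 Real.pi := Complex.arg_mem_Ioo_of_im_pos (T.cy_pos e)

theorem polar_cornerAngle (T : GeodesicTriangulation M) (e : T.OrientedEdge) (s t : ℝ) :
    s * Real.cos t * T.cy e - s * Real.sin t * T.cx e =
      s * T.len (T.prev e) * Real.sin (T.cornerAngle e - t) := by
  rw [Real.sin_sub, ← T.cos_cornerAngle, ← T.sin_cornerAngle]; ring

theorem arg_lt_cornerAngle (T : GeodesicTriangulation M) (e : T.OrientedEdge) {z : ℂ}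
    (h1 : 0 < z.im) (h2 : 0 < z.re * T.cy e - z.im * T.cx e) :
    z.arg ∈ Ioo 0 (T.cornerAngle e) := by
  have h3 := Complex.arg_mem_Ioo_of_im_pos h1
  have h4 := T.cornerAngle_mem e
  refine ⟨h3.1, ?_⟩
  by_contra! h
  rw [← Complex.norm_mul_cos_arg, ← Complex.norm_mul_sin_arg, T.polar_cornerAngle] at h2
  have h5 := Real.sin_nonpos_of_nonpos_of_neg_pi_le (x := T.cornerAngle e - z.arg) (by linarith)
    (by linarith [h3.2, h4.1])
  have := mul_nonneg (norm_nonneg z) (T.len_pos (T.prev e)).le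
  nlinarith

/-- The radius `ε` is small compared to the sides of the faces. -/
def IsSmallRadius (T : GeodesicTriangulation M) (ε : ℝ) : Prop :=
  ∀ e : T.OrientedEdge, ε * (T.cy e + |T.cx e| + T.len e) ≤ T.len e * T.cy e ∧ 2 * ε ≤ T.len e

theorem exists_isSmallRadius (T : GeodesicTriangulation M) : ∃ ε > 0, T.IsSmallRadius ε := by
  have h : ∀ᶠ ε in 𝓝[>] (0 : ℝ), ∀ e : T.OrientedEdge,
      ε * (T.cy e + |T.cx e| + T.len e) < T.len e * T.cy e ∧ 2 * ε < T.len e := by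
    refine Filter.eventually_all.2 fun e => nhdsWithin_le_nhds ?_
    have hc := T.cy_pos e
    have hl := T.len_pos e
    refine (((continuous_id.mul continuous_const).continuousAt (x := (0 : ℝ))).eventually
      (gt_mem_nhds (by simpa using mul_pos hl hc))).and
      (((continuous_const.mul continuous_id).continuousAt (x := (0 : ℝ))).eventually
      (gt_mem_nhds (by simpa using hl)))
  obtain ⟨ε, h1, h2⟩ := (h.and self_mem_nhdsWithin).exists
  exact ⟨ε, h2, fun e => ⟨(h1 e).1.le, (h1 e).2.le⟩⟩

theorem IsSmallRadius.mono (h : T.IsSmallRadius ε) {ε' : ℝ} (h' : ε' ≤ ε) : T.IsSmallRadius ε' :=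
  fun e => ⟨le_trans (mul_le_mul_of_nonneg_right h' (by
    have := T.cy_pos e; have := T.len_pos e; positivity)) (h e).1, by linarith [(h e).2]⟩

theorem IsSmallRadius.mem_interior (h : T.IsSmallRadius ε) (e : T.OrientedEdge) {z : ℂ}
    (h1 : 0 < z.im) (h2 : 0 < z.re * T.cy e - z.im * T.cx e) (h3 : ‖z‖ < ε) :
    T.fr e z.re z.im ∈ interior (T.tri e.1) := by
  rw [T.fr_mem_interior]
  refine ⟨h1, h2, ?_⟩
  have hc := T.cy_pos e
  have hl := T.len_pos e
  have k1 := (le_abs_self _).trans (Complex.abs_re_le_norm z)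
  have k2 := (le_abs_self _).trans (Complex.abs_im_le_norm z)
  have k3 : -(z.im * T.cx e) ≤ ‖z‖ * |T.cx e| := by
    refine (neg_le_abs _).trans ?_
    rw [abs_mul]
    exact mul_le_mul_of_nonneg_right (Complex.abs_im_le_norm z) (abs_nonneg _)
  have k4 : z.re * T.cy e ≤ ‖z‖ * T.cy e := mul_le_mul_of_nonneg_right k1 hc.le
  have k5 : z.im * T.len e ≤ ‖z‖ * T.len e := mul_le_mul_of_nonneg_right k2 hl.le
  have k6 : ‖z‖ * (T.cy e + |T.cx e| + T.len e) < ε * (T.cy e + |T.cx e| + T.len e) :=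
    mul_lt_mul_of_pos_right h3 (by positivity)
  have := (h e).1
  nlinarith

theorem dist_fr_complex (T : GeodesicTriangulation M) (e : T.OrientedEdge) (z w : ℂ) :
    dist (T.fr e z.re z.im) (T.fr e w.re w.im) = dist z w := by
  rw [dist_fr, Complex.dist_eq_re_im]

theorem dist_fr_corner (T : GeodesicTriangulation M) (e : T.OrientedEdge) (z : ℂ) :
    dist (T.fr e z.re z.im) (T.corner e.1 e.2) = ‖z‖ := by
  have := T.dist_fr_complex e z 0
  rwa [Complex.zero_re, Complex.zero_im, ← T.corner_zero, dist_zero_right] at this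

/-- Near its corner, a face is a sector in the polar coordinates of a cone chart. -/
theorem exists_sector_polar {e : T.OrientedEdge} (hc : IsConeChart c (T.src e : M) α ε)
    (hv : T.IsVertexRadius (T.src e) ε) (hs : T.IsSmallRadius ε) :
    ∃ b σ : ℝ, (σ = 1 ∨ σ = -1) ∧ ∀ z : ℂ, 0 < z.im → 0 < z.re * T.cy e - z.im * T.cx e → ‖z‖ < ε →
      T.pos e z.re z.im = c ‖z‖ (b + σ * z.arg) := by
  have hε := hc.pos
  have hcy := T.cy_pos e
  have hl := T.len_pos e
  set E : ℂ → M := fun z => T.pos e z.re z.im with hE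
  set U : Set ℂ := {z : ℂ | 0 < z.im} ∩ {z | 0 < z.re * T.cy e - z.im * T.cx e} ∩ ball 0 ε with hU
  have hUc : Convex ℝ U := by
    refine ((convex_halfSpace_im_gt 0).inter
      (convex_halfSpace_gt ⟨fun u v => ?_, fun a u => ?_⟩ 0)).inter (convex_ball _ _)
    · simp only [Complex.add_im, Complex.add_re]; ring
    · simp only [Complex.smul_im, Complex.smul_re, smul_eq_mul]; ring
  have hUo : IsOpen U := by
    refine ((isOpen_lt ?_ ?_).inter (isOpen_lt ?_ ?_)).inter isOpen_ball <;> fun_prop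
  have hUi : ∀ z ∈ U, T.fr e z.re z.im ∈ interior (T.tri e.1) := fun z hz =>
    hs.mem_interior e hz.1.1 hz.1.2 (mem_ball_zero_iff.1 hz.2)
  have hEiso : LocIsoOn E U := (T.locIsoOn e.1).comp (g := fun z : ℂ => T.fr e z.re z.im)
    (T.dist_fr_complex e) fun z hz => T.interior_sub_corners (hUi z hz)
  have hEreg : ∀ z ∈ U, IsRegularPoint (E z) := fun z hz =>
    T.regular_of_mem (T.interior_sub_corners (hUi z hz))
  have hEd : ∀ z ∈ U, dist (E z) (T.src e) = ‖z‖ := fun z hz => by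
    have := hv.dist_eq e.1 e.2 rfl _ (interior_subset (hUi z hz))
      (by rw [T.dist_fr_corner]; exact mem_ball_zero_iff.1 hz.2)
    rwa [T.dist_fr_corner] at this
  obtain ⟨z₁, hz₁⟩ : U.Nonempty := by
    set w : ℂ := ⟨T.len e + T.cx e, T.cy e⟩ with hw
    have hw0 : 0 < ‖w‖ := norm_pos_iff.2 fun h => hcy.ne' (congrArg Complex.im h)
    have hk : 0 < ε / 2 / ‖w‖ := by positivity
    refine ⟨((ε / 2 / ‖w‖ : ℝ) : ℂ) * w, ⟨?_, ?_⟩, ?_⟩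
    · change 0 < (((ε / 2 / ‖w‖ : ℝ) : ℂ) * w).im
      rw [Complex.im_ofReal_mul]
      exact mul_pos hk hcy
    · change 0 < (((ε / 2 / ‖w‖ : ℝ) : ℂ) * w).re * _ - (((ε / 2 / ‖w‖ : ℝ) : ℂ) * w).im * _
      rw [Complex.re_ofReal_mul, Complex.im_ofReal_mul]
      have : 0 < (ε / 2 / ‖w‖) * (T.len e * T.cy e) := by positivity
      simp only [hw] at this ⊢
      linarith
    · rw [mem_ball_zero_iff, norm_mul, Complex.norm_real, Real.norm_of_nonneg hk.le,
        div_mul_cancel₀ _ hw0.ne']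
      linarith
  have hz₁n : 0 < ‖z₁‖ := norm_pos_iff.2 fun h => by
    have := hz₁.1.1
    rw [h] at this
    exact lt_irrefl (0 : ℝ) this
  have hz₁ε : ‖z₁‖ < ε := mem_ball_zero_iff.1 hz₁.2
  obtain ⟨η₁, hη₁, hi⟩ := hEiso z₁ hz₁
  obtain ⟨η₂, hη₂, hw⟩ := Metric.isOpen_iff.1 hUo z₁ hz₁
  have hm : ∀ u ∈ ball z₁ (min η₁ η₂), u ∈ U ∩ ball z₁ η₁ := fun u hu =>
    ⟨hw (ball_subset_ball (min_le_right _ _) hu), ball_subset_ball (min_le_left _ _) hu⟩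
  obtain ⟨z₀, hz₀, hpol⟩ := hc.exists_polar_form (lt_min hη₁ hη₂)
    (fun u hu v hv => hi u (hm u hu) v (hm v hv)) (by rw [hEd z₁ hz₁]; exact ⟨hz₁n, hz₁ε⟩)
  rw [hEd z₁ hz₁] at hz₀
  -- The polar coordinates are centred at the corner. Near z₁ the distance to the vertex is both ‖z‖
  -- and ‖z − z₀‖, so ⟨z, z₀⟩ is locally constant, which fails in the direction of z₀ unless z₀ = 0.
  have hz₀0 : z₀ = 0 := by
    have hne : z₁ - z₀ ≠ 0 := by rw [← norm_pos_iff, hz₀]; exact hz₁n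
    -- This κ rotates z₁ − z₀ onto the positive real axis, away from the cut.
    obtain ⟨c', hc', -, b, η₃, hη₃, h3⟩ := hpol ((starRingEnd ℂ) (z₁ - z₀) / ‖z₁‖)
      (by rw [norm_div, Complex.norm_conj, hz₀, Complex.norm_real, norm_norm, div_self hz₁n.ne'])
      (by
        rw [div_mul_eq_mul_div, mul_comm, Complex.mul_conj, Complex.normSq_eq_norm_sq, hz₀,
          ← Complex.ofReal_div, Complex.ofReal_mem_slitPlane]
        positivity)
    set ρ := min (min η₂ η₃) (ε - ‖z₁‖) with hρ
    have hρ0 : 0 < ρ := lt_min (lt_min hη₂ hη₃) (by linarith)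
    have hnn : ∀ z ∈ ball z₁ ρ, ‖z‖ = ‖z - z₀‖ := fun z hz => by
      have k1 := hEd z (hw (ball_subset_ball ((min_le_left _ _).trans (min_le_left _ _)) hz))
      rw [h3 z (ball_subset_ball ((min_le_left _ _).trans (min_le_right _ _)) hz),
        hc'.dist_apex ⟨norm_nonneg _, ?_⟩] at k1
      · exact k1.symm
      · have k2 := norm_add_le (z - z₁) (z₁ - z₀)
        rw [sub_add_sub_cancel, hz₀] at k2
        have k3 := ball_subset_ball (min_le_right _ _) hz
        rw [mem_ball, dist_eq_norm] at k3
        linarith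
    by_contra hne0
    have hz₀n := norm_pos_iff.2 hne0
    have hexp : ∀ z : ℂ, ‖z - z₀‖ ^ 2 = ‖z‖ ^ 2 - 2 * inner ℝ z z₀ + ‖z₀‖ ^ 2 := fun z =>
      norm_sub_sq_real z z₀
    have k1 := hexp z₁
    rw [← hnn z₁ (mem_ball_self hρ0)] at k1
    set τ := ρ / 2 / ‖z₀‖ with hτ
    have hτ0 : 0 < τ := by positivity
    have k2 := hexp (z₁ + τ • z₀)
    rw [← hnn (z₁ + τ • z₀) (by
      rw [mem_ball, dist_eq_norm, add_sub_cancel_left, norm_smul, Real.norm_of_nonneg hτ0.le, hτ,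
        div_mul_cancel₀ _ hz₀n.ne']
      linarith), inner_add_left, real_inner_smul_left, real_inner_self_eq_norm_sq] at k2
    have : 0 < τ * ‖z₀‖ ^ 2 := by positivity
    linarith
  subst hz₀0
  have hslit : ∀ z ∈ U, 1 * (z - 0) ∈ Complex.slitPlane := fun z hz => by
    rw [one_mul, sub_zero]; exact Or.inr (ne_of_gt hz.1.1)
  obtain ⟨c', hc', hcc, b, η₃, hη₃, h3⟩ := hpol 1 norm_one (hslit z₁ hz₁)
  have key := hEiso.eqOn_of_starShaped ((hc'.locIsoOn_polar b 1 norm_one 0).mono fun z hz =>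
    ⟨by rw [sub_zero]; exact mem_ball_zero_iff.1 hz.2, hslit z hz⟩) hEreg
    (fun z hz => hUc.segment_subset hz₁ hz) hη₃ fun z hz => h3 z hz.2
  rcases hcc with rfl | rfl
  · refine ⟨b, 1, Or.inl rfl, fun z h1 h2 h3 => ?_⟩
    have := key ⟨⟨h1, h2⟩, mem_ball_zero_iff.2 h3⟩
    simpa only [sub_zero, one_mul] using this
  · refine ⟨-b, -1, Or.inr rfl, fun z h1 h2 h3 => ?_⟩
    have := key ⟨⟨h1, h2⟩, mem_ball_zero_iff.2 h3⟩
    simp only [sub_zero, one_mul] at this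
    change T.pos e z.re z.im = _ at this
    rw [this]
    congr 1
    ring

end GeodesicTriangulation

namespace GeodesicTriangulation

variable {M : Type*} [MetricSpace M] {T : GeodesicTriangulation M} {r : singularSet M → ℝ}
  {c : ℝ → ℝ → M} {α ε : ℝ}

/-- The arc of directions that starts at `b` and has length `γ`, in the sense of rotation `σ`. -/
def arc (b σ γ : ℝ) : Set ℝ := (fun t => b + σ * t) '' Ioo 0 γ

theorem arc_one (b γ : ℝ) : arc b 1 γ = Ioo b (b + γ) := by
  simp only [arc, one_mul, image_const_add_Ioo, add_zero]

theorem arc_neg_one (b γ : ℝ) : arc b (-1) γ = Ioo (b - γ) b := by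
  simp only [arc, neg_one_mul, ← sub_eq_add_neg, image_const_sub_Ioo, sub_zero]

theorem isOpen_arc {b σ γ : ℝ} (hσ : σ = 1 ∨ σ = -1) : IsOpen (arc b σ γ) := by
  rcases hσ with rfl | rfl
  · rw [arc_one]; exact isOpen_Ioo
  · rw [arc_neg_one]; exact isOpen_Ioo

theorem integral_arc {b σ γ : ℝ} (hσ : σ = 1 ∨ σ = -1) (hγ : 0 ≤ γ) (F : ℝ → ℝ) :
    ∫ x in arc b σ γ, F x = ∫ t in (0 : ℝ)..γ, F (b + σ * t) := by
  rcases hσ with rfl | rfl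
  · simp only [arc_one, one_mul]
    rw [intervalIntegral.integral_comp_add_left, add_zero, intervalIntegral.integral_of_le (by linarith),
      MeasureTheory.integral_Ioc_eq_integral_Ioo]
  · simp only [arc_neg_one, neg_one_mul, ← sub_eq_add_neg]
    rw [intervalIntegral.integral_comp_sub_left, sub_zero, intervalIntegral.integral_of_le (by linarith),
      MeasureTheory.integral_Ioc_eq_integral_Ioo]

theorem integrableOn_arc {b σ γ : ℝ} (hσ : σ = 1 ∨ σ = -1) {F G : ℝ → ℝ} (hG : Continuous G)
    (h : EqOn F G (arc b σ γ)) : MeasureTheory.IntegrableOn F (arc b σ γ) := by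
  rw [MeasureTheory.integrableOn_congr_fun h (isOpen_arc hσ).measurableSet]
  rcases hσ with rfl | rfl
  · rw [arc_one]
    exact (hG.integrableOn_Icc).mono_set Ioo_subset_Icc_self
  · rw [arc_neg_one]
    exact (hG.integrableOn_Icc).mono_set Ioo_subset_Icc_self

/-- Arc length density of the link of a vertex, seen from the side edge, in terms of the squared
distance `Q` to the apex at distance `s` from the vertex; `ρ` is the length of the side edge. -/
noncomputable def linkDensity (Q : M → ℝ) (c : ℝ → ℝ → M) (ρ s a : ℝ) : ℝ :=
  √(ρ ^ 2 - ((s ^ 2 + ρ ^ 2 - Q (c s a)) / (2 * s)) ^ 2 -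
    (deriv (fun a => (s ^ 2 + ρ ^ 2 - Q (c s a)) / (2 * s)) a) ^ 2) * ρ /
    (ρ ^ 2 - ((s ^ 2 + ρ ^ 2 - Q (c s a)) / (2 * s)) ^ 2)

/-- By the law of cosines (s² + r² − q) / (2s) on the circle of radius s is X cos t + D sin t,
independently of s. Subtracting its square and that of its derivative from r² leaves the squared
height; the sense of rotation σ disappears on squaring. -/
theorem linkDensity_eq (hs : T.IsSmallRadius ε) {e : T.OrientedEdge} {s : ℝ} (hsε : s ∈ Ioo 0 ε)
    {b σ : ℝ} (hσ : σ = 1 ∨ σ = -1)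
    (h : ∀ z : ℂ, 0 < z.im → 0 < z.re * T.cy e - z.im * T.cx e → ‖z‖ < ε →
      T.pos e z.re z.im = c ‖z‖ (b + σ * z.arg)) {t : ℝ} (ht : t ∈ Ioo 0 (T.cornerAngle e)) :
    linkDensity (T.q r) c (r (T.src e)) s (b + σ * t) = √(T.hsq r e) * r (T.src e) /
      (r (T.src e) ^ 2 - (T.edgeX r e * Real.cos t + T.edgeD r e * Real.sin t) ^ 2) := by
  have hs0 := hsε.1
  have hp : ∀ t ∈ Ioo 0 (T.cornerAngle e),
      (s ^ 2 + r (T.src e) ^ 2 - T.q r (c s (b + σ * t))) / (2 * s) =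
      T.edgeX r e * Real.cos t + T.edgeD r e * Real.sin t := fun t ht => by
    have hγ := T.cornerAngle_mem e
    set z : ℂ := s * (Complex.cos t + Complex.sin t * Complex.I) with hz
    have hre : z.re = s * Real.cos t := by
      rw [hz]; simp [Complex.cos_ofReal_re, Complex.sin_ofReal_im]
    have him : z.im = s * Real.sin t := by
      rw [hz]; simp [Complex.cos_ofReal_im, Complex.sin_ofReal_re]
    have hn : ‖z‖ = s := by
      rw [hz, norm_mul, Complex.norm_cos_add_sin_mul_I, mul_one, Complex.norm_real,
        Real.norm_of_nonneg hs0.le]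
    have harg : z.arg = t :=
      Complex.arg_mul_cos_add_sin_mul_I hs0 ⟨by linarith [ht.1, Real.pi_pos], by linarith [ht.2, hγ.2]⟩
    have h1 : 0 < z.im := by
      rw [him]; exact mul_pos hs0 (Real.sin_pos_of_pos_of_lt_pi ht.1 (ht.2.trans hγ.2))
    have h2 : 0 < z.re * T.cy e - z.im * T.cx e := by
      rw [hre, him, T.polar_cornerAngle]
      exact mul_pos (mul_pos hs0 (T.len_pos _)) (Real.sin_pos_of_pos_of_lt_pi (by linarith [ht.2])
        (by linarith [ht.1, hγ.2]))
    have h3 : ‖z‖ < ε := by rw [hn]; exact hsε.2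
    have h4 := h z h1 h2 h3
    rw [hn, harg] at h4
    rw [← h4, pos, T.q_toSurface r (interior_subset (hs.mem_interior e h1 h2 h3)), T.faceQ_fr, hre, him]
    field_simp
    linear_combination (-s ^ 2) * Real.sin_sq_add_cos_sq t
  have hσ2 : σ * σ = 1 := by rcases hσ with rfl | rfl <;> norm_num
  have hd : HasDerivAt (fun a => (s ^ 2 + r (T.src e) ^ 2 - T.q r (c s a)) / (2 * s))
      (σ * (T.edgeD r e * Real.cos t - T.edgeX r e * Real.sin t)) (b + σ * t) := by
    have h1 : HasDerivAt (fun a => T.edgeX r e * Real.cos (σ * (a - b)) +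
        T.edgeD r e * Real.sin (σ * (a - b)))
        (σ * (T.edgeD r e * Real.cos t - T.edgeX r e * Real.sin t)) (b + σ * t) := by
      have h2 : HasDerivAt (fun a => σ * (a - b)) σ (b + σ * t) := by
        simpa using ((hasDerivAt_id (b + σ * t)).sub_const b).const_mul σ
      have h3 : σ * (b + σ * t - b) = t := by rw [add_sub_cancel_left, ← mul_assoc, hσ2, one_mul]
      have := ((h2.cos).const_mul (T.edgeX r e)).add ((h2.sin).const_mul (T.edgeD r e))
      refine this.congr_deriv ?_
      rw [h3]; ring
    refine h1.congr_of_eventuallyEq ?_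
    filter_upwards [(isOpen_arc (b := b) (γ := T.cornerAngle e) hσ).mem_nhds ⟨t, ht, rfl⟩] with a ha
    obtain ⟨t', ht', rfl⟩ := ha
    simp only
    rw [hp t' ht', add_sub_cancel_left, ← mul_assoc, hσ2, one_mul]
  rw [linkDensity, hd.deriv, hp t ht]
  congr 3
  rw [hsq, edgeP]
  have hσ3 : σ ^ 2 = 1 := by rw [sq, hσ2]
  rw [mul_pow, hσ3]
  linear_combination (-(T.edgeX r e ^ 2 + T.edgeD r e ^ 2)) * Real.sin_sq_add_cos_sq t

theorem IsGeneralizedPolytope.integral_linkDensity (h : T.IsGeneralizedPolytope r)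
    (e : T.OrientedEdge) : ∫ t in (0 : ℝ)..T.cornerAngle e, √(T.hsq r e) * r (T.src e) /
      (r (T.src e) ^ 2 - (T.edgeX r e * Real.cos t + T.edgeD r e * Real.sin t) ^ 2) =
      T.omega r e := by
  have hh := h.hsq_pos e
  rw [hsq, edgeP] at hh
  have h1 := integral_link (h.1 (T.src e)) hh (T.cornerAngle_mem e)
  have hm := (T.len_pos (T.prev e)).ne'
  have hcos : T.cx e / T.len (T.prev e) = Real.cos (T.cornerAngle e) := by
    rw [← T.cos_cornerAngle]; field_simp
  have hX' : T.edgeX' r e = T.edgeX r e * Real.cos (T.cornerAngle e) +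
      T.edgeD r e * Real.sin (T.cornerAngle e) := by
    rw [edgeX', ← T.cos_cornerAngle, ← T.sin_cornerAngle]; field_simp
  rw [hsq, edgeP, h1, h.omega_eq, hcos, edgeP_prev, hX', edgeP]

theorem mem_edgesFrom {i : singularSet M} {e : T.OrientedEdge} :
    e ∈ T.edgesFrom i ↔ T.src e = i := by
  simp [edgesFrom]

/-- The sum of the dihedral angles at a side edge is determined by the distance to the apex. -/
theorem IsGeneralizedPolytope.sum_omega_eq (h : T.IsGeneralizedPolytope r) {i : singularSet M}
    (hc : IsConeChart c (i : M) α ε) (hv : T.IsVertexRadius i ε) (hs : T.IsSmallRadius ε) {s : ℝ}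
    (hsε : s ∈ Ioo 0 ε) :
    ∑ e ∈ T.edgesFrom i, T.omega r e =
      ∫ a in Ioc 0 (0 + α), linkDensity (T.q r) c (r i) s a := by
  have hs0 := hsε.1
  have hsε' : s ∈ Ico 0 ε := ⟨hs0.le, hsε.2⟩
  have hex : ∀ e : T.OrientedEdge, ∃ b σ : ℝ, (σ = 1 ∨ σ = -1) ∧ (T.src e = i →
      ∀ z : ℂ, 0 < z.im → 0 < z.re * T.cy e - z.im * T.cx e → ‖z‖ < ε →
      T.pos e z.re z.im = c ‖z‖ (b + σ * z.arg)) := fun e => by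
    by_cases he : T.src e = i
    · subst he
      obtain ⟨b, σ, h1, h2⟩ := exists_sector_polar hc hv hs
      exact ⟨b, σ, h1, fun _ => h2⟩
    · exact ⟨0, 1, Or.inl rfl, fun h => absurd h he⟩
  choose b σ hσ hb using hex
  -- a direction in an arc comes from a point of the corresponding sector
  have hpt : ∀ e, T.src e = i → ∀ a ∈ arc (b e) (σ e) (T.cornerAngle e), ∃ z : ℂ, ‖z‖ = s ∧
      T.fr e z.re z.im ∈ interior (T.tri e.1) ∧ T.pos e z.re z.im = c s a ∧ a = b e + σ e * z.arg := by
    rintro e he _ ⟨t, ht, rfl⟩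
    have hγ := T.cornerAngle_mem e
    refine ⟨s * (Complex.cos t + Complex.sin t * Complex.I), ?_⟩
    set z : ℂ := s * (Complex.cos t + Complex.sin t * Complex.I) with hz
    have hre : z.re = s * Real.cos t := by
      rw [hz]; simp [Complex.cos_ofReal_re, Complex.sin_ofReal_im]
    have him : z.im = s * Real.sin t := by
      rw [hz]; simp [Complex.cos_ofReal_im, Complex.sin_ofReal_re]
    have hn : ‖z‖ = s := by
      rw [hz, norm_mul, Complex.norm_cos_add_sin_mul_I, mul_one, Complex.norm_real,
        Real.norm_of_nonneg hs0.le]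
    have harg : z.arg = t :=
      Complex.arg_mul_cos_add_sin_mul_I hs0 ⟨by linarith [ht.1, Real.pi_pos], by linarith [ht.2, hγ.2]⟩
    have h1 : 0 < z.im := by
      rw [him]; exact mul_pos hs0 (Real.sin_pos_of_pos_of_lt_pi ht.1 (ht.2.trans hγ.2))
    have h2 : 0 < z.re * T.cy e - z.im * T.cx e := by
      rw [hre, him, T.polar_cornerAngle]
      exact mul_pos (mul_pos hs0 (T.len_pos _)) (Real.sin_pos_of_pos_of_lt_pi (by linarith [ht.2])
        (by linarith [ht.1, hγ.2]))
    have h3 : ‖z‖ < ε := by rw [hn]; exact hsε.2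
    have h4 := hb e he z h1 h2 h3
    rw [hn, harg] at h4
    exact ⟨hn, hs.mem_interior e h1 h2 h3, h4, by rw [harg]⟩
  -- different directions in arcs give different points
  have hinj : ∀ e e' a a', T.src e = i → T.src e' = i → a ∈ arc (b e) (σ e) (T.cornerAngle e) →
      a' ∈ arc (b e') (σ e') (T.cornerAngle e') → c s a = c s a' → e = e' ∧ a = a' := by
    intro e e' a a' he he' ha ha' haa
    obtain ⟨z, hz1, hz2, hz3, rfl⟩ := hpt e he a ha
    obtain ⟨z', hz1', hz2', hz3', rfl⟩ := hpt e' he' a' ha'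
    rw [← hz3, ← hz3'] at haa
    obtain ⟨k1, k2⟩ := T.interior_inj e.1 e'.1 _ hz2 _ (interior_subset hz2') haa
    have hee : e = e' := by
      refine Prod.ext k1 ?_
      by_contra hne
      have d1 := T.dist_fr_corner e z
      have d2 := T.dist_fr_corner e' z'
      -- Distinct corners of a face are at least 2ε apart, so no point is at distance s < ε from
      -- both.
      have d3 : 2 * ε ≤ dist (T.corner e.1 e.2) (T.corner e.1 e'.2) := by
        have key : ∀ k k' : Fin 3, k ≠ k' → k' = k + 1 ∨ k = k' + 1 := by decide
        rcases key _ _ hne with hk | hk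
        · rw [hk]; exact (hs e).2
        · rw [hk, dist_comm]; exact (hs (e.1, e'.2)).2
      have d4 := dist_triangle_left (T.corner e.1 e.2) (T.corner e.1 e'.2) (T.fr e z.re z.im)
      rw [d1, k2, k1, d2, hz1, hz1'] at d4
      rw [k1] at d3
      linarith [hsε.2]
    subst hee
    obtain ⟨k3, k4⟩ := T.fr_injective e k2
    rw [Complex.ext k3 k4]
    exact ⟨rfl, rfl⟩
  -- The arcs of the corners at i form a fundamental domain for translations by α: the sectors fill
  -- the circle of radius s up to points on sides, and they are disjoint because face interiors are.
  -- As the density is α-periodic, the arcs may replace an interval of length α.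
  have hdom : MeasureTheory.IsAddFundamentalDomain (AddSubgroup.zmultiples α)
      (⋃ e ∈ T.edgesFrom i, arc (b e) (σ e) (T.cornerAngle e)) := by
    constructor
    · exact (MeasurableSet.biUnion (Finset.countable_toSet _) fun e _ =>
        (isOpen_arc (hσ e)).measurableSet).nullMeasurableSet
    -- The exceptional directions: for each oriented edge, those of its point at parameter s form at
    -- most one orbit of the translations.
    · have hN : (⋃ e : T.OrientedEdge, {a | c s a = T.pos e s 0}).Countable := by
        refine countable_iUnion fun e => ?_
        rcases eq_empty_or_nonempty {a | c s a = T.pos e s 0} with h0 | ⟨a₀, ha₀⟩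
        · rw [h0]; exact countable_empty
        · refine (countable_range fun n : ℤ => a₀ + n * α).mono fun a ha => ?_
          obtain ⟨n, hn⟩ := hc.exists_int_of_eq hsε (a := a) (b := a₀) (ha.trans ha₀.symm)
          exact ⟨n, by simp only; linarith⟩
      filter_upwards [hN.ae_notMem MeasureTheory.volume] with a ha
      obtain ⟨f, x, hx, hxa⟩ := T.covers (c s a)
      have hda : dist (T.toSurface f x) i = s := by rw [hxa, hc.dist_apex hsε']
      obtain ⟨k, hk, hxk⟩ := hv.exists_corner f x hx (by rw [hda]; exact hsε.2)
      rw [hda] at hxk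
      set e : T.OrientedEdge := (f, k) with he
      obtain ⟨u, v, huv⟩ := T.exists_fr e x
      set z : ℂ := ⟨u, v⟩ with hz
      have hzn : ‖z‖ = s := by
        rw [← hxk, huv]
        exact (T.dist_fr_corner e z).symm
      have hmem := (T.fr_mem_tri e u v).1 (huv ▸ hx)
      have hv0 : 0 < v := by
        refine lt_of_le_of_ne hmem.1 fun hv0 => ha (mem_iUnion.2 ⟨e, ?_⟩)
        change c s a = T.pos e s 0
        rw [← hxa, huv, GeodesicTriangulation.pos, ← hv0]
        have h1 := hmem.2.1
        rw [← hv0, zero_mul, sub_zero] at h1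
        have h2 : 0 ≤ u := nonneg_of_mul_nonneg_left h1 (T.cy_pos e)
        have h3 : u = s := by
          rw [← hzn, hz, Complex.norm_def, Complex.normSq_mk, ← hv0, mul_zero, add_zero,
            Real.sqrt_mul_self h2]
        rw [h3]
      have huv0 : 0 < u * T.cy e - v * T.cx e := by
        -- In the case of equality the point lies on the preceding side, which starts at i when it
        -- is traversed backwards.
        refine lt_of_le_of_ne hmem.2.1 fun h0 => ha (mem_iUnion.2 ⟨T.opp (T.prev e), ?_⟩)
        change c s a = T.pos (T.opp (T.prev e)) s 0
        have hm := T.len_pos (T.prev e)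
        have h1 : (⟨u, v⟩ : ℝ × ℝ) = (s / T.len (T.prev e) * T.cx e, s / T.len (T.prev e) * T.cy e) := by
          have hc0 := T.cy_pos e
          have hu : u = v / T.cy e * T.cx e := by field_simp; linarith
          have h2 : v / T.cy e * T.len (T.prev e) = s := by
            rw [← hzn, ← T.norm_cx_cy e]
            have h3 : z = ((v / T.cy e : ℝ) : ℂ) * ⟨T.cx e, T.cy e⟩ := by
              apply Complex.ext
              · rw [Complex.re_ofReal_mul]; exact hu
              · rw [Complex.im_ofReal_mul]; change v = _; field_simp
            rw [h3, norm_mul, Complex.norm_real, Real.norm_of_nonneg (by positivity)]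
          have h4 : v / T.cy e = s / T.len (T.prev e) := by rw [← h2]; field_simp
          rw [← h4, ← hu]
          congr 1
          field_simp
        obtain ⟨h2, h3⟩ := Prod.mk.inj h1
        have h5 : s ≤ T.len (T.prev e) := by
          have := (hs (T.prev e)).2
          linarith [hsε.2]
        have hle : T.len (T.prev e) - s ∈ Icc 0 (T.len (T.prev e)) := ⟨by linarith, by linarith⟩
        have h6 := T.pos_opp (T.prev e) hle
        rw [sub_sub_cancel] at h6
        rw [← h6, ← hxa, huv, GeodesicTriangulation.pos]
        change _ = T.toSurface e.1 _
        congr 1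
        have h7 : T.fr (T.prev e) (T.len (T.prev e) - s) 0 = T.corner e.1 (e.2 + 2) +
            ((T.len (T.prev e) - s) / T.len (T.prev e)) • (T.corner e.1 e.2 - T.corner e.1 (e.2 + 2)) := by
          have hk2 : e.2 + 2 + 1 = e.2 := by generalize e.2 = k; revert k; decide
          simp only [fr, dir, zero_smul, add_zero, prev, smul_smul, hk2]
          rw [div_eq_mul_inv]
        have h8 : T.corner e.1 (e.2 + 2) - T.corner e.1 e.2 = T.cx e • T.dir e + T.cy e • T.nrm e := by
          rw [T.corner_two, fr, add_sub_cancel_left]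
        rw [h7, ← neg_sub (T.corner e.1 (e.2 + 2)), fr, h2, h3]
        have h9 : (s / T.len (T.prev e) * T.cx e) • T.dir e + (s / T.len (T.prev e) * T.cy e) • T.nrm e =
            (s / T.len (T.prev e)) • (T.corner e.1 (e.2 + 2) - T.corner e.1 e.2) := by
          rw [h8]; module
        rw [h9, sub_div, div_self hm.ne']
        module
      have hpos := hb e hk z hv0 huv0 (by rw [hzn]; exact hsε.2)
      rw [hzn] at hpos
      have hca : c s a = c s (b e + σ e * z.arg) := by
        rw [← hpos, ← hxa, huv]; rfl
      obtain ⟨n, hn⟩ := hc.exists_int_of_eq hsε hca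
      refine ⟨⟨-(n * α), AddSubgroup.neg_mem _ ⟨n, by simp⟩⟩, mem_iUnion₂.2 ⟨e, mem_edgesFrom.2 hk, ?_⟩⟩
      refine ⟨z.arg, T.arg_lt_cornerAngle e hv0 huv0, ?_⟩
      simp only [AddSubgroup.vadd_def, vadd_eq_add]
      linarith
    · rintro ⟨g, n, rfl⟩ ⟨g', n', rfl⟩ hne
      refine Disjoint.aedisjoint (Set.disjoint_left.2 ?_)
      rintro x ⟨y, hy, hyx⟩ ⟨y', hy', hyx'⟩
      simp only [AddSubgroup.vadd_def, vadd_eq_add, zsmul_eq_mul] at hyx hyx'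
      obtain ⟨e, he, hye⟩ := mem_iUnion₂.1 hy
      obtain ⟨e', he', hye'⟩ := mem_iUnion₂.1 hy'
      have h1 : c s y = c s y' := by
        rw [← hc.eq_add_int_mul hsε' y n, ← hc.eq_add_int_mul hsε' y' n']
        congr 1
        linarith
      obtain ⟨-, h2⟩ := hinj e e' y y' (mem_edgesFrom.1 he) (mem_edgesFrom.1 he') hye hye' h1
      apply hne
      apply Subtype.ext
      simp only [zsmul_eq_mul]
      linarith
  have hper : ∀ (g : AddSubgroup.zmultiples α) (a : ℝ),
      linkDensity (T.q r) c (r i) s (g +ᵥ a) = linkDensity (T.q r) c (r i) s a := by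
    rintro ⟨_, n, rfl⟩ a
    have h1 : ∀ a, c s (a + n * α) = c s a := fun a => hc.eq_add_int_mul hsε' a n
    have h2 : ∀ F : ℝ → ℝ, (∀ a, F (a + n * α) = F a) → deriv F (a + n * α) = deriv F a := by
      intro F hF
      have := deriv_comp_add_const F (n * α) a
      rw [← this]
      congr 1
      funext a
      exact hF a
    simp only [AddSubgroup.vadd_def, vadd_eq_add, zsmul_eq_mul]
    rw [add_comm, linkDensity, linkDensity, h1, h2 _ fun a => by simp only [h1]]
  rw [← hdom.setIntegral_eq (isAddFundamentalDomain_Ioc hc.angle_pos 0) hper]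
  have hden : ∀ e ∈ T.edgesFrom i, ∀ t ∈ Ioo 0 (T.cornerAngle e),
      linkDensity (T.q r) c (r i) s (b e + σ e * t) = √(T.hsq r e) * r (T.src e) /
      (r (T.src e) ^ 2 - (T.edgeX r e * Real.cos t + T.edgeD r e * Real.sin t) ^ 2) := fun e he t ht => by
    have he' := mem_edgesFrom.1 he
    have := linkDensity_eq (r := r) hs hsε (hσ e) (hb e he') ht
    rwa [he'] at this ⊢
  rw [MeasureTheory.integral_biUnion_finset _ (fun e _ => (isOpen_arc (hσ e)).measurableSet)]
  · refine Finset.sum_congr rfl fun e he => ?_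
    rw [integral_arc (hσ e) (T.cornerAngle_mem e).1.le, ← h.integral_linkDensity e]
    rw [intervalIntegral.integral_of_le (T.cornerAngle_mem e).1.le,
      intervalIntegral.integral_of_le (T.cornerAngle_mem e).1.le,
      MeasureTheory.integral_Ioc_eq_integral_Ioo, MeasureTheory.integral_Ioc_eq_integral_Ioo]
    exact MeasureTheory.setIntegral_congr_fun measurableSet_Ioo fun t ht => (hden e he t ht).symm
  · intro e he e' he' hne
    refine Set.disjoint_left.2 fun a ha ha' => hne ?_
    exact (hinj e e' a a (mem_edgesFrom.1 he) (mem_edgesFrom.1 he') ha ha' rfl).1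
  · intro e he
    have hσ2 : σ e * σ e = 1 := by rcases hσ e with h | h <;> rw [h] <;> norm_num
    have hP : ∀ t, r (T.src e) ^ 2 -
        (T.edgeX r e * Real.cos t + T.edgeD r e * Real.sin t) ^ 2 ≠ 0 := fun t => by
      have h1 := h.hsq_pos e
      rw [hsq, edgeP] at h1
      have h2 : (T.edgeX r e * Real.cos t + T.edgeD r e * Real.sin t) ^ 2 +
        (T.edgeD r e * Real.cos t - T.edgeX r e * Real.sin t) ^ 2 =
        T.edgeX r e ^ 2 + T.edgeD r e ^ 2 := by
        linear_combination (T.edgeX r e ^ 2 + T.edgeD r e ^ 2) * Real.sin_sq_add_cos_sq t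
      nlinarith [sq_nonneg (T.edgeD r e * Real.cos t - T.edgeX r e * Real.sin t)]
    have hGc : Continuous fun t => √(T.hsq r e) * r (T.src e) /
        (r (T.src e) ^ 2 - (T.edgeX r e * Real.cos t + T.edgeD r e * Real.sin t) ^ 2) :=
      continuous_const.div (by fun_prop) hP
    refine integrableOn_arc (hσ e)
      (hGc.comp (show Continuous fun a => σ e * (a - b e) by fun_prop)) ?_
    rintro _ ⟨t, ht, rfl⟩
    rw [Function.comp_apply, add_sub_cancel_left, ← mul_assoc, hσ2, one_mul]
    exact hden e he t ht

/-- The curvatures of a convex polytope do not depend on the triangulation. -/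
theorem curvature_eq_curvature (hM : IsEuclideanPolyhedral M) {T T' : GeodesicTriangulation M}
    (h : T.IsGeneralizedPolytope r) (h' : T'.IsGeneralizedPolytope r) (hq : T.q r = T'.q r)
    (i : singularSet M) : T.curvature r i = T'.curvature r i := by
  obtain ⟨α, ε₀, c, hc⟩ := hM.exists_coneChart i
  obtain ⟨ε₁, h1⟩ := T.exists_isVertexRadius hM i
  obtain ⟨ε₂, h2⟩ := T'.exists_isVertexRadius hM i
  obtain ⟨ε₃, h3, h3'⟩ := T.exists_isSmallRadius
  obtain ⟨ε₄, h4, h4'⟩ := T'.exists_isSmallRadius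
  set ε := min ε₀ (min (min ε₁ ε₂) (min ε₃ ε₄)) with hε
  have hε0 : 0 < ε := lt_min hc.pos (lt_min (lt_min h1.pos h2.pos) (lt_min h3 h4))
  have l0 : ε ≤ ε₀ := min_le_left _ _
  have l1 : ε ≤ ε₁ := (min_le_right _ _).trans ((min_le_left _ _).trans (min_le_left _ _))
  have l2 : ε ≤ ε₂ := (min_le_right _ _).trans ((min_le_left _ _).trans (min_le_right _ _))
  have l3 : ε ≤ ε₃ := (min_le_right _ _).trans ((min_le_right _ _).trans (min_le_left _ _))
  have l4 : ε ≤ ε₄ := (min_le_right _ _).trans ((min_le_right _ _).trans (min_le_right _ _))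
  have hs : ε / 2 ∈ Ioo 0 ε := ⟨by positivity, by linarith⟩
  rw [curvature, curvature,
    h.sum_omega_eq (hc.mono hε0 l0) (h1.mono hε0 l1) (h3'.mono l3) hs,
    h'.sum_omega_eq (hc.mono hε0 l0) (h2.mono hε0 l2) (h4'.mono l4) hs, hq]

end GeodesicTriangulation

/-! ### Finitely many triangulations suffice -/

namespace GeodesicTriangulation

variable {M : Type*} [MetricSpace M] {T : GeodesicTriangulation M} {r : singularSet M → ℝ}

theorem eq_of_pos_eq {e e' : T.OrientedEdge}
    (h : ∀ s ∈ Icc 0 (T.len e), T.pos e s 0 = T.pos e' s 0) (hlen : T.len e = T.len e') :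
    e = e' := by
  have hl := T.len_pos e
  -- A third and not a half: the midpoint of an edge is fixed by reversal and could not distinguish
  -- e' from `opp e`.
  have hs : T.len e / 3 ∈ Ioo 0 (T.len e) := ⟨by positivity, by linarith⟩
  have hs' : T.len e / 3 ∈ Icc 0 (T.len e') := ⟨hs.1.le, hlen ▸ hs.2.le⟩
  obtain ⟨f, k⟩ := e
  obtain ⟨g, k'⟩ := e'
  rcases T.preimage_edge hs (T.edge_mem_tri (g, k') hs') (h _ ⟨hs.1.le, hs.2.le⟩).symm with
    ⟨h1, h2⟩ | ⟨h1, h2⟩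
  · simp only at h1
    subst h1
    obtain ⟨rfl, -⟩ := T.edge_point_inj (hlen ▸ hs) hs h2
    rfl
  · set o := T.opp (f, k) with ho
    have hol : T.len o = T.len (f, k) := T.len_opp _
    obtain ⟨f', k''⟩ := o
    simp only at h1
    subst h1
    obtain ⟨-, h4⟩ := T.edge_point_inj (hlen ▸ hs) (by rw [hol]; exact ⟨by linarith, by linarith⟩) h2
    linarith

/-- The oriented edges of a triangulation, three for each face, are told apart by initial vertex and
direction, and only finitely many such pairs occur for edges of length at most L. -/
theorem exists_card_bound [CompactSpace M] [Finite (singularSet M)] (hM : IsEuclideanPolyhedral M)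
    (L : ℝ) : ∃ N : ℕ, ∀ T : GeodesicTriangulation M, (∀ e, T.len e ≤ L) → T.faceCount ≤ N := by
  have hch := fun i : singularSet M => hM.exists_coneChart i
  choose α ε c hc using hch
  set D : Set (singularSet M × ℝ) := ⋃ i : singularSet M, (fun a => (i, a)) '' {a | a ∈ Icc 0 (α i) ∧
    ∃ T : GeodesicTriangulation M, ∃ e, T.src e = i ∧ T.len e ≤ L ∧ T.HasDirection (c i) e a} with hD
  have hDf : D.Finite := Set.finite_iUnion fun i => (finite_directions hM (hc i) L).image _
  refine ⟨D.ncard, fun T hT => ?_⟩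
  have hdir : ∀ e : T.OrientedEdge, ∃ a ∈ Ico 0 (α (T.src e)), T.HasDirection (c (T.src e)) e a :=
    fun e => exists_hasDirection hM T (hc (T.src e))
  choose a ha hda using hdir
  have hinj : Function.Injective fun e : T.OrientedEdge => (T.src e, a e) := by
    intro e e' hee
    obtain ⟨h1, h2⟩ := Prod.mk.inj hee
    have h3 := hda e'
    rw [← h1, ← h2] at h3
    obtain ⟨h4, h5⟩ := (hda e).pos_eq h3
    exact eq_of_pos_eq h5 h4
  have h1 := Set.ncard_le_ncard_of_injOn (s := univ) (t := D) (fun e : T.OrientedEdge => (T.src e, a e))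
    (fun e _ => mem_iUnion.2 ⟨T.src e, a e, ⟨Ico_subset_Icc_self (ha e), T, e, rfl, hT e, hda e⟩, rfl⟩)
    hinj.injOn hDf
  rw [Set.ncard_univ, Nat.card_eq_fintype_card, Fintype.card_prod, Fintype.card_fin,
    Fintype.card_fin] at h1
  omega

/-- Combinatorial and metric data of a triangulation. -/
abbrev Code (S : Type*) : Type _ := Σ n : ℕ,
  (Fin n × Fin 3 → S) × (Fin n × Fin 3 → ℝ) × (Fin n × Fin 3 → Fin n × Fin 3)

/-- The data of a given triangulation. -/
noncomputable def code (T : GeodesicTriangulation M) : Code (singularSet M) :=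
  ⟨T.faceCount, T.src, T.len, T.opp⟩

namespace Code

variable {S : Type*} (C : Code S) (r : S → ℝ)

/-- The coordinate `cx` in terms of lengths. -/
noncomputable def cx (e : Fin C.1 × Fin 3) : ℝ :=
  (C.2.2.1 e ^ 2 + C.2.2.1 (e.1, e.2 + 2) ^ 2 - C.2.2.1 (e.1, e.2 + 1) ^ 2) / (2 * C.2.2.1 e)

/-- The coordinate `cy` in terms of lengths. -/
noncomputable def cy (e : Fin C.1 × Fin 3) : ℝ := √(C.2.2.1 (e.1, e.2 + 2) ^ 2 - C.cx e ^ 2)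

/-- The coordinate `edgeX` in terms of the data. -/
noncomputable def edgeX (e : Fin C.1 × Fin 3) : ℝ :=
  (r (C.2.1 e) ^ 2 - r (C.2.1 (e.1, e.2 + 1)) ^ 2 + C.2.2.1 e ^ 2) / (2 * C.2.2.1 e)

/-- The coordinate `edgeD` in terms of the data. -/
noncomputable def edgeD (e : Fin C.1 × Fin 3) : ℝ :=
  (C.cx e ^ 2 + C.cy e ^ 2 - 2 * C.edgeX r e * C.cx e - r (C.2.1 (e.1, e.2 + 2)) ^ 2 +
    r (C.2.1 e) ^ 2) / (2 * C.cy e)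

/-- Convexity in terms of the data. -/
def IsConvex : Prop := (∀ i, 0 < r i) ∧
  (∀ e, 0 < r (C.2.1 e) ^ 2 - C.edgeX r e ^ 2 - C.edgeD r e ^ 2) ∧
  ∀ e, 0 ≤ C.edgeD r e + C.edgeD r (C.2.2.2 e)

end Code

theorem code_cx (T : GeodesicTriangulation M) (e : T.OrientedEdge) : T.code.cx e = T.cx e := by
  have h1 := T.cx_sq_add_cy_sq e
  have h2 := T.len_next_sq e
  have h3 := (T.len_pos e).ne'
  have h4 : T.prev (T.prev e) = (e.1, e.2 + 1) := by
    simp only [prev]; congr 1; generalize e.2 = k; revert k; decide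
  rw [h4] at h2
  change (T.len e ^ 2 + T.len (T.prev e) ^ 2 - T.len (e.1, e.2 + 1) ^ 2) / (2 * T.len e) = _
  rw [← h1, ← h2]
  field_simp
  ring

theorem code_cy (T : GeodesicTriangulation M) (e : T.OrientedEdge) : T.code.cy e = T.cy e := by
  have h1 := T.cx_sq_add_cy_sq e
  change √(T.len (T.prev e) ^ 2 - T.code.cx e ^ 2) = _
  rw [code_cx, ← h1, add_sub_cancel_left, Real.sqrt_sq (T.cy_pos e).le]

theorem code_edgeD (T : GeodesicTriangulation M) (r : singularSet M → ℝ) (e : T.OrientedEdge) :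
    T.code.edgeD r e = T.edgeD r e := by
  change (T.code.cx e ^ 2 + T.code.cy e ^ 2 - 2 * T.edgeX r e * T.code.cx e -
    r (T.src (T.prev e)) ^ 2 + r (T.src e) ^ 2) / (2 * T.code.cy e) = _
  rw [code_cx, code_cy]; rfl

/-- Convexity depends on a triangulation only through its code. One representative for each code is
therefore enough, although there are infinitely many ways to place the faces in the plane. -/
theorem isConvex_code_iff (T : GeodesicTriangulation M) (r : singularSet M → ℝ) :
    T.code.IsConvex r ↔ T.IsConvexPolytope r := by
  rw [isConvexPolytope_iff]
  have h1 : ∀ e : T.OrientedEdge, r (T.src e) ^ 2 - T.code.edgeX r e ^ 2 - T.code.edgeD r e ^ 2 =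
      T.hsq r e := fun e => by rw [code_edgeD]; rfl
  have h2 : ∀ e : T.OrientedEdge, T.code.edgeD r e + T.code.edgeD r (T.opp e) =
      T.edgeD r e + T.edgeD r (T.opp e) := fun e => by rw [code_edgeD, code_edgeD]
  constructor
  · rintro ⟨a, b, d⟩
    exact ⟨a, fun e => (h1 e) ▸ b e, fun e => (h2 e) ▸ d e⟩
  · rintro ⟨a, b, d⟩
    exact ⟨a, fun e => (h1 e).symm ▸ b e, fun e => (h2 e).symm ▸ d e⟩

/-- The number of faces is bounded, the lengths lie in a finite set, and what remains are maps
between finite sets. -/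
theorem finite_code [CompactSpace M] [Finite (singularSet M)] (hM : IsEuclideanPolyhedral M)
    (L : ℝ) : {C | ∃ T : GeodesicTriangulation M, (∀ e, T.len e ≤ L) ∧ T.code = C}.Finite := by
  obtain ⟨N, hN⟩ := exists_card_bound hM L
  have hl := finite_len hM L
  set Λ : Set ℝ := {l | l ≤ L ∧ ∃ T : GeodesicTriangulation M, ∃ e, T.len e = l} with hΛ
  have h1 : ∀ n : ℕ, {x : (Fin n × Fin 3 → singularSet M) × (Fin n × Fin 3 → ℝ) ×
      (Fin n × Fin 3 → Fin n × Fin 3) | ∀ e, x.2.1 e ∈ Λ}.Finite := fun n => by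
    have h2 : {l : Fin n × Fin 3 → ℝ | ∀ e, l e ∈ Λ}.Finite := Set.Finite.pi' fun _ => hl
    refine ((toFinite (univ : Set (Fin n × Fin 3 → singularSet M))).prod
      (h2.prod (toFinite (univ : Set (Fin n × Fin 3 → Fin n × Fin 3))))).subset fun x hx => ?_
    exact ⟨mem_univ _, hx, mem_univ _⟩
  refine (Set.Finite.biUnion (finite_Iic N) fun n _ => (h1 n).image fun x =>
    (⟨n, x⟩ : Code (singularSet M))).subset ?_
  rintro _ ⟨T, hT, rfl⟩
  exact mem_iUnion₂.2 ⟨T.faceCount, hN T hT, ⟨(T.src, T.len, T.opp), fun e => ⟨hT e, T, e, rfl⟩, rfl⟩⟩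

/-- The foot of the perpendicular from the apex to the edge line has signed distances X and `len` −
X to the ends, each smaller than the corresponding radius. -/
theorem IsGeneralizedPolytope.len_lt (h : T.IsGeneralizedPolytope r) (e : T.OrientedEdge) :
    T.len e < r (T.src e) + r (T.tgt e) := by
  have h1 := h.edgeP_pos e
  have h2 := h.edgeP_pos (T.opp e)
  rw [edgeP] at h1 h2
  rw [T.src_opp, T.edgeX_opp] at h2
  have h3 := abs_lt_of_sq_lt_sq (by linarith : T.edgeX r e ^ 2 < r (T.src e) ^ 2) (h.1 _).le
  have h4 := abs_lt_of_sq_lt_sq (by linarith : (T.len e - T.edgeX r e) ^ 2 < r (T.tgt e) ^ 2) (h.1 _).le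
  linarith [(abs_lt.1 h3).2, (abs_lt.1 h4).2]

/-- Finitely many triangulations represent all convex polytopes with bounded radii. -/
theorem exists_finite_family [CompactSpace M] [Finite (singularSet M)]
    (hM : IsEuclideanPolyhedral M) (L : ℝ) : ∃ F : Set (GeodesicTriangulation M), F.Finite ∧
      ∀ r ∈ polytopeSpace M, (∀ i, r i < L) → ∃ T ∈ F, T.IsConvexPolytope r := by
  have hf := finite_code hM (L + L)
  set K := {C | ∃ T : GeodesicTriangulation M, (∀ e, T.len e ≤ L + L) ∧ T.code = C} with hK
  have hex : ∀ C : K, ∃ T : GeodesicTriangulation M, T.code = C.1 := fun C => by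
    obtain ⟨T, -, h⟩ := C.2; exact ⟨T, h⟩
  choose τ hτ using hex
  have := hf.to_subtype
  refine ⟨range τ, finite_range τ, ?_⟩
  rintro r ⟨T, hT⟩ hr
  have hC : T.code ∈ K := ⟨T, fun e => by
    linarith [hT.1.len_lt e, hr (T.src e), hr (T.tgt e)], rfl⟩
  refine ⟨_, ⟨⟨T.code, hC⟩, rfl⟩, ?_⟩
  rw [← isConvex_code_iff, hτ, isConvex_code_iff]
  exact hT

end GeodesicTriangulation

/-! ### Derivatives of the angles -/

theorem DifferentiableAt.div_real {E : Type*} [NormedAddCommGroup E] [NormedSpace ℝ E] {f g : E → ℝ}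
    {x : E} (hf : DifferentiableAt ℝ f x) (hg : DifferentiableAt ℝ g x) (h : g x ≠ 0) :
    DifferentiableAt ℝ (fun y => f y / g y) x := by
  have h1 : DifferentiableAt ℝ (fun y => (g y)⁻¹) x := by
    have := (hasDerivAt_inv h).comp_hasFDerivAt x hg.hasFDerivAt
    exact this.differentiableAt
  simp only [div_eq_mul_inv]
  exact hf.mul h1

theorem DifferentiableAt.arccos_real {E : Type*} [NormedAddCommGroup E] [NormedSpace ℝ E] {f : E → ℝ}
    {x : E} (hf : DifferentiableAt ℝ f x) (h : f x ∈ Ioo (-1) 1) :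
    DifferentiableAt ℝ (fun y => Real.arccos (f y)) x :=
  ((Real.hasDerivAt_arccos h.1.ne' h.2.ne).comp_hasFDerivAt x hf.hasFDerivAt).differentiableAt

/-- Once differentiability is known, the differential may be computed on lines; all the formulas
below are thus derivatives in one variable. -/
theorem hasFDerivAt_of_lines {E : Type*} [NormedAddCommGroup E] [NormedSpace ℝ E] {G : E → ℝ} {x : E}
    (hd : DifferentiableAt ℝ G x) {L : E →L[ℝ] ℝ}
    (h : ∀ v, HasDerivAt (fun t : ℝ => G (x + t • v)) (L v) 0) : HasFDerivAt G L x := by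
  have : fderiv ℝ G x = L := by
    ext v
    have h1 := hd.hasFDerivAt.hasLineDerivAt v
    exact h1.unique (h v)
  exact this ▸ hd.hasFDerivAt

/-- Derivative of a dihedral angle at a side edge, with respect to the position of the apex. -/
theorem hasDerivAt_arccos_link {R X Y : ℝ → ℝ} {R₁ X₁ Y₁ C S D : ℝ} {t : ℝ}
    (hR : HasDerivAt R R₁ t) (hX : HasDerivAt X X₁ t) (hY : HasDerivAt Y Y₁ t)
    (hCS : S ^ 2 + C ^ 2 = 1) (hS : 0 < S) (hR0 : 0 < R t) (hYt : Y t = C * X t + S * D)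
    (hP : 0 < R t ^ 2 - X t ^ 2) (hQ : 0 < R t ^ 2 - Y t ^ 2)
    (hh : 0 < R t ^ 2 - X t ^ 2 - D ^ 2) :
    (C * R t ^ 2 - X t * Y t) / (√(R t ^ 2 - X t ^ 2) * √(R t ^ 2 - Y t ^ 2)) ∈ Ioo (-1) 1 ∧
    HasDerivAt (fun t => Real.arccos ((C * R t ^ 2 - X t * Y t) /
      (√(R t ^ 2 - X t ^ 2) * √(R t ^ 2 - Y t ^ 2))))
      (-(D / √(R t ^ 2 - X t ^ 2 - D ^ 2) * ((X t * R₁ - R t * X₁) / (R t ^ 2 - X t ^ 2))) -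
        (S * X t - C * D) / √(R t ^ 2 - X t ^ 2 - D ^ 2) *
          ((Y t * R₁ - R t * Y₁) / (R t ^ 2 - Y t ^ 2))) t := by
  set P := R t ^ 2 - X t ^ 2 with hPdef
  set Q := R t ^ 2 - Y t ^ 2 with hQdef
  set p := √P with hp
  set q := √Q with hq
  set h := √(P - D ^ 2) with hhdef
  have hp0 : 0 < p := Real.sqrt_pos.2 hP
  have hq0 : 0 < q := Real.sqrt_pos.2 hQ
  have hh0 : 0 < h := Real.sqrt_pos.2 hh
  have hp2 : p ^ 2 = P := Real.sq_sqrt hP.le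
  have hq2 : q ^ 2 = Q := Real.sq_sqrt hQ.le
  have hh2 : h ^ 2 = P - D ^ 2 := Real.sq_sqrt hh.le
  set N := C * R t ^ 2 - X t * Y t with hN
  -- The sine of the dihedral angle, positive because the pyramid is non-degenerate.
  have hsq : 1 - (N / (p * q)) ^ 2 = (R t * h * S / (p * q)) ^ 2 := by
    have key : P * Q - N ^ 2 = (R t * h * S) ^ 2 := by
      rw [mul_pow, mul_pow, hh2, hPdef, hQdef, hN, hYt]
      linear_combination (-(R t ^ 4) + R t ^ 2 * X t ^ 2 ) * hCS
    have : p ^ 2 * q ^ 2 - N ^ 2 = (R t * h * S) ^ 2 := by rw [hp2, hq2, key]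
    rw [div_pow (R t * h * S), ← this]
    field_simp
  have hpos : 0 < R t * h * S / (p * q) := by positivity
  have hu : N / (p * q) ∈ Ioo (-1) 1 := by
    have h1 : (N / (p * q)) ^ 2 < 1 := by
      have : 0 < (R t * h * S / (p * q)) ^ 2 := by positivity
      linarith
    exact abs_lt.1 (abs_lt_of_sq_lt_sq (by simpa using h1) zero_le_one)
  refine ⟨hu, ?_⟩
  have dN : HasDerivAt (fun t => C * R t ^ 2 - X t * Y t)
      (2 * C * R t * R₁ - (X₁ * Y t + X t * Y₁)) t := by
    have := ((hR.pow 2).const_mul C).sub (hX.mul hY)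
    refine this.congr_deriv ?_
    simp; ring
  have dp : HasDerivAt (fun t => √(R t ^ 2 - X t ^ 2)) ((R t * R₁ - X t * X₁) / p) t := by
    have := ((hR.pow 2).sub (hX.pow 2)).sqrt hP.ne'
    refine this.congr_deriv ?_
    change _ / (2 * p) = _
    simp; field_simp
  have dq : HasDerivAt (fun t => √(R t ^ 2 - Y t ^ 2)) ((R t * R₁ - Y t * Y₁) / q) t := by
    have := ((hR.pow 2).sub (hY.pow 2)).sqrt hQ.ne'
    refine this.congr_deriv ?_
    change _ / (2 * q) = _
    simp; field_simp
  have du := dN.div (dp.mul dq) (mul_pos hp0 hq0).ne'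
  have hfin := (Real.hasDerivAt_arccos hu.1.ne' hu.2.ne).comp t du
  refine hfin.congr_deriv ?_
  simp only [Pi.mul_apply]
  change -(1 / √(1 - (N / (p * q)) ^ 2)) * (((2 * C * R t * R₁ - (X₁ * Y t + X t * Y₁)) * (p * q) -
    N * ((R t * R₁ - X t * X₁) / p * q + p * ((R t * R₁ - Y t * Y₁) / q))) / (p * q) ^ 2) = _
  rw [hsq, Real.sqrt_sq hpos.le]
  -- With C and S the cosine and sine of the corner angle, D and S X − C D are the signed distances
  -- from the foot to the two sides. These identities separate the contributions of the two sides.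
  have i1 : C * P - N = X t * S * D := by rw [hN, hPdef, hYt]; ring
  have i2 : C * Q - N = Y t * S * (S * X t - C * D) := by
    rw [hN, hQdef, hYt]; linear_combination (-(C * X t + S * D) * X t) * hCS
  have i3 : -Y t * P + N * X t = -(R t ^ 2 * S * D) := by rw [hN, hPdef, hYt]; ring
  have i4 : -X t * Q + N * Y t = -(R t ^ 2 * S * (S * X t - C * D)) := by
    rw [hN, hQdef, hYt]; linear_combination (R t ^ 2 * X t) * hCS
  have key : (2 * C * R t * R₁ - (X₁ * Y t + X t * Y₁)) * (P * Q) -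
      N * ((R t * R₁ - X t * X₁) * Q + P * (R t * R₁ - Y t * Y₁)) =
      R t * S * (D * (X t * R₁ - R t * X₁) * Q + (S * X t - C * D) * (Y t * R₁ - R t * Y₁) * P) := by
    linear_combination (Q * X₁) * i3 + (P * Y₁) * i4 + (R t * Q * R₁) * i1 + (R t * P * R₁) * i2
  have e1 : ((2 * C * R t * R₁ - (X₁ * Y t + X t * Y₁)) * (p * q) -
      N * ((R t * R₁ - X t * X₁) / p * q + p * ((R t * R₁ - Y t * Y₁) / q))) / (p * q) ^ 2 =
      ((2 * C * R t * R₁ - (X₁ * Y t + X t * Y₁)) * (P * Q) -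
      N * ((R t * R₁ - X t * X₁) * Q + P * (R t * R₁ - Y t * Y₁))) / (p * q * (P * Q)) := by
    rw [← hp2, ← hq2]
    field_simp
  rw [e1, key]
  have := hP.ne'
  have := hQ.ne'
  field_simp
  ring

namespace GeodesicTriangulation

variable {M : Type*} [MetricSpace M] {T : GeodesicTriangulation M} {r : singularSet M → ℝ}

/-- Derivative of `edgeX` at `r` in the direction `v`. -/
noncomputable def dX (T : GeodesicTriangulation M) (r v : singularSet M → ℝ) (e : T.OrientedEdge) : ℝ :=
  (r (T.src e) * v (T.src e) - r (T.tgt e) * v (T.tgt e)) / T.len e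

/-- Derivative of `edgeD` at `r` in the direction `v`. -/
noncomputable def dD (T : GeodesicTriangulation M) (r v : singularSet M → ℝ) (e : T.OrientedEdge) : ℝ :=
  (-(T.cx e * T.dX r v e) - r (T.src (T.prev e)) * v (T.src (T.prev e)) +
    r (T.src e) * v (T.src e)) / T.cy e

/-- Derivative of `rho` at `r` in the direction `v`. -/
noncomputable def dRho (T : GeodesicTriangulation M) (r v : singularSet M → ℝ) (e : T.OrientedEdge) :
    ℝ := (T.edgeX r e * v (T.src e) / r (T.src e) - T.dX r v e) / √(T.edgeP r e)

theorem hasDerivAt_coord (r v : singularSet M → ℝ) (i : singularSet M) :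
    HasDerivAt (fun t : ℝ => (r + t • v) i) (v i) 0 := by
  simpa using ((hasDerivAt_id (0 : ℝ)).mul_const (v i)).const_add (r i)

theorem hasDerivAt_edgeX (r v : singularSet M → ℝ) (e : T.OrientedEdge) :
    HasDerivAt (fun t : ℝ => T.edgeX (r + t • v) e) (T.dX r v e) 0 := by
  have h1 := (hasDerivAt_coord r v (T.src e)).pow 2
  have h2 := (hasDerivAt_coord r v (T.tgt e)).pow 2
  refine (((h1.sub h2).add_const (T.len e ^ 2)).div_const (2 * T.len e)).congr_deriv ?_
  have := (T.len_pos e).ne'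
  simp [dX]
  field_simp

theorem hasDerivAt_edgeD (r v : singularSet M → ℝ) (e : T.OrientedEdge) :
    HasDerivAt (fun t : ℝ => T.edgeD (r + t • v) e) (T.dD r v e) 0 := by
  have h1 := (hasDerivAt_coord r v (T.src e)).pow 2
  have h2 := (hasDerivAt_coord r v (T.src (T.prev e))).pow 2
  have h3 := ((hasDerivAt_edgeX r v e).const_mul 2).mul_const (T.cx e)
  refine ((((h3.const_sub (T.cx e ^ 2 + T.cy e ^ 2)).sub h2).add h1).div_const
    (2 * T.cy e)).congr_deriv ?_
  have := (T.cy_pos e).ne'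
  simp [dD]
  field_simp

theorem IsGeneralizedPolytope.sin_rho (h : T.IsGeneralizedPolytope r) (e : T.OrientedEdge) :
    Real.sin (T.rho r e) = √(T.edgeP r e) / r (T.src e) := by
  have hr := h.1 (T.src e)
  rw [h.rho_eq, Real.sin_arccos, div_pow, one_sub_div (by positivity), Real.sqrt_div' _ (by positivity),
    Real.sqrt_sq hr.le, edgeP]

theorem IsGeneralizedPolytope.sin_alpha (h : T.IsGeneralizedPolytope r) (e : T.OrientedEdge) :
    Real.sin (T.alpha r e) = √(T.hsq r e) / √(T.edgeP r e) := by
  have hP := h.edgeP_pos e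
  rw [h.alpha_eq, Real.sin_arccos, div_pow, Real.sq_sqrt hP.le, one_sub_div hP.ne',
    Real.sqrt_div' _ hP.le, hsq]

theorem IsGeneralizedPolytope.cos_alpha (h : T.IsGeneralizedPolytope r) (e : T.OrientedEdge) :
    Real.cos (T.alpha r e) = T.edgeD r e / √(T.edgeP r e) := by
  rw [h.alpha_eq, Real.cos_arccos (h.edgeD_div_mem e).1.le (h.edgeD_div_mem e).2.le]

theorem IsGeneralizedPolytope.cot_alpha (h : T.IsGeneralizedPolytope r) (e : T.OrientedEdge) :
    Real.cot (T.alpha r e) = T.edgeD r e / √(T.hsq r e) := by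
  have hP := Real.sqrt_pos.2 (h.edgeP_pos e)
  rw [Real.cot_eq_cos_div_sin, h.cos_alpha, h.sin_alpha, div_div_div_cancel_right₀ hP.ne']

theorem IsGeneralizedPolytope.cos_phi (h : T.IsGeneralizedPolytope r) (e : T.OrientedEdge) :
    Real.cos (T.phi r e) = (r (T.src e) ^ 2 + r (T.tgt e) ^ 2 - T.len e ^ 2) /
      (2 * r (T.src e) * r (T.tgt e)) := by
  rw [h.phi_eq, Real.cos_arccos]
  · have hr := h.1 (T.src e)
    have hr' := h.1 (T.tgt e)
    have := h.len_lt e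
    have := T.len_pos e
    rw [le_div_iff₀ (by positivity)]
    nlinarith
  · have hr := h.1 (T.src e)
    have hr' := h.1 (T.tgt e)
    have h1 := h.edgeP_pos e
    have h2 := T.sq_tgt r e
    rw [edgeP] at h1
    rw [div_le_one (by positivity)]
    have h3 := T.len_pos e
    have h4 : (r (T.src e) - r (T.tgt e)) ^ 2 ≤ T.len e ^ 2 := by
      have h5 : (r (T.src e) ^ 2 - T.len e * T.edgeX r e) ^ 2 ≤ r (T.src e) ^ 2 * r (T.tgt e) ^ 2 := by
        rw [h2]; nlinarith [sq_nonneg (T.len e), mul_pos h3 h3]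
      have h6 := abs_le_of_sq_le_sq (a := r (T.src e) ^ 2 - T.len e * T.edgeX r e)
        (b := r (T.src e) * r (T.tgt e)) (by rw [mul_pow]; exact h5) (by positivity)
      have h7 := (abs_le.1 h6).2
      nlinarith
    nlinarith

variable [Fintype (singularSet M)]

theorem differentiable_edgeX (e : T.OrientedEdge) : Differentiable ℝ fun r => T.edgeX r e := by
  simp only [edgeX, div_eq_mul_inv]
  fun_prop

theorem differentiable_edgeD (e : T.OrientedEdge) : Differentiable ℝ fun r => T.edgeD r e := by
  have := T.differentiable_edgeX e
  simp only [edgeD, div_eq_mul_inv]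
  fun_prop

theorem differentiable_edgeP (e : T.OrientedEdge) : Differentiable ℝ fun r => T.edgeP r e := by
  have := T.differentiable_edgeX e
  simp only [edgeP]
  fun_prop

theorem differentiable_hsq (e : T.OrientedEdge) : Differentiable ℝ fun r => T.hsq r e := by
  have := T.differentiable_edgeP e
  have := T.differentiable_edgeD e
  simp only [hsq]
  fun_prop

theorem isOpen_isGeneralizedPolytope (T : GeodesicTriangulation M) :
    IsOpen {r | T.IsGeneralizedPolytope r} := by
  simp only [isGeneralizedPolytope_iff, ofPred_and, ofPred_forall]
  exact (isOpen_iInter_of_finite fun i => isOpen_lt continuous_const (continuous_apply i)).inter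
    (isOpen_iInter_of_finite fun e => isOpen_lt continuous_const (T.differentiable_hsq e).continuous)

theorem IsGeneralizedPolytope.eventually (h : T.IsGeneralizedPolytope r) :
    ∀ᶠ r in 𝓝 r, T.IsGeneralizedPolytope r := T.isOpen_isGeneralizedPolytope.mem_nhds h

theorem IsGeneralizedPolytope.eventually_line (h : T.IsGeneralizedPolytope r)
    (v : singularSet M → ℝ) : ∀ᶠ t in 𝓝 (0 : ℝ), T.IsGeneralizedPolytope (r + t • v) := by
  have h1 : ContinuousAt (fun t : ℝ => r + t • v) 0 := by fun_prop
  have h2 : (fun t : ℝ => r + t • v) 0 = r := by simp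
  exact h1.eventually (by rw [h2]; exact h.eventually)

theorem IsGeneralizedPolytope.differentiableAt_alpha (h : T.IsGeneralizedPolytope r)
    (e : T.OrientedEdge) : DifferentiableAt ℝ (fun r => T.alpha r e) r := by
  have hP := h.edgeP_pos e
  have h1 : DifferentiableAt ℝ (fun r => Real.arccos (T.edgeD r e / √(T.edgeP r e))) r :=
    DifferentiableAt.arccos_real ((T.differentiable_edgeD e r).div_real
      ((T.differentiable_edgeP e r).sqrt hP.ne') (Real.sqrt_pos.2 hP).ne') (h.edgeD_div_mem e)
  exact h1.congr_of_eventuallyEq (h.eventually.mono fun r hr => hr.alpha_eq e)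

theorem IsGeneralizedPolytope.hasDerivAt_alpha (h : T.IsGeneralizedPolytope r)
    (v : singularSet M → ℝ) (e : T.OrientedEdge) :
    HasDerivAt (fun t : ℝ => T.alpha (r + t • v) e)
      (-((T.dD r v e - T.edgeD r e * (r (T.src e) * v (T.src e) - T.edgeX r e * T.dX r v e) /
        T.edgeP r e) / √(T.hsq r e))) 0 := by
  have hP := h.edgeP_pos e
  have hh := h.hsq_pos e
  have hP0 := Real.sqrt_pos.2 hP
  have hh0 := Real.sqrt_pos.2 hh
  have hP2 := Real.sq_sqrt hP.le
  have hz : r + (0 : ℝ) • v = r := by simp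
  have d1 := hasDerivAt_edgeD (T := T) r v e
  have d2 : HasDerivAt (fun t : ℝ => T.edgeP (r + t • v) e)
      (2 * (r (T.src e) * v (T.src e) - T.edgeX r e * T.dX r v e)) 0 := by
    refine (((hasDerivAt_coord r v (T.src e)).pow 2).sub ((hasDerivAt_edgeX r v e).pow 2)).congr_deriv ?_
    simp
    ring
  have d3 := d2.sqrt (by rw [hz]; exact hP.ne')
  have d4 := d1.div d3 (by rw [hz]; exact hP0.ne')
  have hm := h.edgeD_div_mem e
  have d5 := (Real.hasDerivAt_arccos (x := T.edgeD r e / √(T.edgeP r e)) hm.1.ne' hm.2.ne)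
  have d6 := HasDerivAt.comp (0 : ℝ) (h₂ := Real.arccos)
    (h := fun t : ℝ => T.edgeD (r + t • v) e / √(T.edgeP (r + t • v) e)) (by rw [hz]; exact d5) d4
  refine (d6.congr_of_eventuallyEq ((h.eventually_line v).mono fun t ht => ht.alpha_eq e)).congr_deriv ?_
  have hs : √(1 - (T.edgeD r e / √(T.edgeP r e)) ^ 2) = √(T.hsq r e) / √(T.edgeP r e) := by
    rw [← h.sin_alpha, h.alpha_eq, Real.sin_arccos]
  rw [hs]
  simp only [hz]
  rw [← hP2]
  rw [hP2]
  field_simp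
  rw [hP2]
  ring

/-- ω is an angle of the spherical triangle at the vertex, whose side opposite to ω, the angle of
the face, is constant. So dω is the sum of −(cot α / sin ρ) dρ over the two boundary edges at that
corner. The first component excludes the values ±1, where arccos is not differentiable. -/
theorem IsGeneralizedPolytope.omega_facts (h : T.IsGeneralizedPolytope r)
    (v : singularSet M → ℝ) (e : T.OrientedEdge) :
    (T.cx e / T.len (T.prev e) * r (T.src e) ^ 2 -
      T.edgeX r e * T.edgeX' r e) / (√(T.edgeP r e) * √(T.edgeP r (T.prev e))) ∈ Ioo (-1) 1 ∧
    HasDerivAt (fun t : ℝ => T.omega (r + t • v) e)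
      (-(Real.cot (T.alpha r e) / Real.sin (T.rho r e) * T.dRho r v e) -
        Real.cot (T.alpha r (T.prev e)) / Real.sin (T.rho r (T.opp (T.prev e))) *
          T.dRho r v (T.opp (T.prev e))) 0 := by
  have hz : r + (0 : ℝ) • v = r := by simp
  have hm := T.len_pos (T.prev e)
  have hP := h.edgeP_pos e
  have hQ := h.edgeP_pos (T.prev e)
  have hh := h.hsq_pos e
  have hr := h.1 (T.src e)
  have hX' : ∀ r : singularSet M → ℝ, T.edgeX' r e = T.cx e / T.len (T.prev e) * T.edgeX r e +
      T.cy e / T.len (T.prev e) * T.edgeD r e := fun r => by rw [edgeX']; field_simp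
  have hYd := hasDerivAt_edgeX (T := T) r v (T.opp (T.prev e))
  simp only [T.edgeX_opp_prev] at hYd
  have hCS : (T.cy e / T.len (T.prev e)) ^ 2 + (T.cx e / T.len (T.prev e)) ^ 2 = 1 := by
    rw [div_pow, div_pow, ← add_div, add_comm, T.cx_sq_add_cy_sq, div_self (by positivity)]
  have key := hasDerivAt_arccos_link (C := T.cx e / T.len (T.prev e)) (S := T.cy e / T.len (T.prev e))
    (D := T.edgeD r e) (hasDerivAt_coord r v (T.src e)) (hasDerivAt_edgeX (T := T) r v e) hYd hCS
    (div_pos (T.cy_pos e) hm) (by rw [hz]; exact hr) (by rw [hz]; exact hX' r)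
    (by rw [hz]; rw [edgeP] at hP; exact hP)
    (by rw [hz]; rw [edgeP_prev] at hQ; exact hQ)
    (by rw [hz]; rw [hsq, edgeP] at hh; exact hh)
  obtain ⟨k1, k2⟩ := key
  simp only [hz] at k1
  rw [edgeP_prev, edgeP]
  refine ⟨k1, ?_⟩
  refine (k2.congr_of_eventuallyEq ((h.eventually_line v).mono fun t ht => ?_)).congr_deriv ?_
  · simp only
    rw [ht.omega_eq e, edgeP_prev, edgeP]
  · simp only [hz]
    have e1 : r (T.src e) ^ 2 - T.edgeX r e ^ 2 = T.edgeP r e := rfl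
    have e2 : r (T.src e) ^ 2 - T.edgeX' r e ^ 2 = T.edgeP r (T.prev e) := (T.edgeP_prev r e).symm
    have e3 : T.edgeP r e - T.edgeD r e ^ 2 = T.hsq r e := rfl
    have e4 : T.cy e / T.len (T.prev e) * T.edgeX r e - T.cx e / T.len (T.prev e) * T.edgeD r e =
        T.edgeD r (T.prev e) := by rw [T.edgeD_prev]; field_simp
    rw [e1, e2, e3, e4, h.cot_alpha, h.cot_alpha, h.sin_rho, h.sin_rho, h.hsq_prev, dRho, dRho,
      edgeP_opp, T.edgeX_opp_prev, T.src_opp, T.tgt_prev]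
    have aux : ∀ {A X w d P : ℝ}, 0 < P → A * ((X * w - r (T.src e) * d) / P) =
        A / (√P / r (T.src e)) * ((X * w / r (T.src e) - d) / √P) := fun {A X w d P} hP => by
      have := Real.sqrt_pos.2 hP
      nth_rewrite 1 [← Real.mul_self_sqrt hP.le]
      field_simp
    rw [aux hP, aux hQ]

theorem IsGeneralizedPolytope.differentiableAt_omega (h : T.IsGeneralizedPolytope r)
    (e : T.OrientedEdge) : DifferentiableAt ℝ (fun r => T.omega r e) r := by
  have hP := h.edgeP_pos e
  have hQ := h.edgeP_pos (T.prev e)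
  have hX' : Differentiable ℝ fun r => T.edgeX' r e := by
    have := T.differentiable_edgeX (T.opp (T.prev e))
    simpa only [T.edgeX_opp_prev] using this
  have h1 : DifferentiableAt ℝ (fun r => Real.arccos ((T.cx e / T.len (T.prev e) * r (T.src e) ^ 2 -
      T.edgeX r e * T.edgeX' r e) / (√(T.edgeP r e) * √(T.edgeP r (T.prev e))))) r := by
    refine DifferentiableAt.arccos_real (DifferentiableAt.div_real ?_ ?_
      (mul_pos (Real.sqrt_pos.2 hP) (Real.sqrt_pos.2 hQ)).ne') (h.omega_facts 0 e).1
    · have := T.differentiable_edgeX e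
      fun_prop
    · exact ((T.differentiable_edgeP e r).sqrt hP.ne').mul
        ((T.differentiable_edgeP (T.prev e) r).sqrt hQ.ne')
  exact h1.congr_of_eventuallyEq (h.eventually.mono fun r hr => hr.omega_eq e)

end GeodesicTriangulation

/-! ### Derivatives of the curvatures, and Schläfli's formula -/

namespace GeodesicTriangulation

variable {M : Type*} [MetricSpace M] {T : GeodesicTriangulation M} {r : singularSet M → ℝ}

theorem src_prev_prev_opp (e : T.OrientedEdge) : T.src (T.prev (T.prev (T.opp e))) = T.src e := by
  rw [src_prev_prev, tgt_opp]

/-- Passing to the preceding side, as a permutation of the oriented edges. -/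
def prevEquiv (T : GeodesicTriangulation M) : T.OrientedEdge ≃ T.OrientedEdge where
  toFun := T.prev
  invFun e := T.prev (T.prev e)
  left_inv := T.prev_prev_prev
  right_inv := T.prev_prev_prev

/-- Reversal, as a permutation of the oriented edges. -/
def oppEquiv (T : GeodesicTriangulation M) : T.OrientedEdge ≃ T.OrientedEdge where
  toFun := T.opp
  invFun := T.opp
  left_inv := T.opp_opp
  right_inv := T.opp_opp

theorem sum_opp (F : T.OrientedEdge → ℝ) : ∑ e, F (T.opp e) = ∑ e, F e := T.oppEquiv.sum_comp F

theorem sum_prev (F : T.OrientedEdge → ℝ) : ∑ e, F (T.prev e) = ∑ e, F e := T.prevEquiv.sum_comp F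

/-- Rotation around the vertex: e ↦ `opp (prev e)` permutes the edges that leave i. It brings
together the contributions of the two faces at an edge. -/
theorem sum_edgesFrom_opp_prev (i : singularSet M) (F : T.OrientedEdge → ℝ) :
    ∑ e ∈ T.edgesFrom i, F (T.opp (T.prev e)) = ∑ e ∈ T.edgesFrom i, F e := by
  refine Finset.sum_nbij' (fun e => T.opp (T.prev e)) (fun e => T.prev (T.prev (T.opp e))) ?_ ?_ ?_ ?_
    (fun _ _ => rfl)
  · intro e he
    rw [mem_edgesFrom] at *
    rw [src_opp, tgt_prev, he]
  · intro e he
    rw [mem_edgesFrom] at *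
    rw [src_prev_prev_opp, he]
  · intro e _
    simp only [opp_opp, prev_prev_prev]
  · intro e _
    simp only [opp_opp, prev_prev_prev]

theorem sum_sum_edgesFrom [Fintype (singularSet M)] (F : T.OrientedEdge → ℝ) :
    ∑ i, ∑ e ∈ T.edgesFrom i, F e = ∑ e, F e := by
  classical
  rw [← Finset.sum_fiberwise (s := Finset.univ) (g := T.src) (f := F)]
  refine Finset.sum_congr rfl fun i _ => Finset.sum_congr ?_ fun _ _ => rfl
  ext e
  simp [mem_edgesFrom]

open scoped Classical in
-- ρ depends on the radii at both ends, and the two partial derivatives add. For a loop X = ℓ/2, the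
-- terms ∓ r/ℓ cancel, and ℓ / (2 r² sin ρ) remains.
theorem IsGeneralizedPolytope.rhoDeriv_eq (h : T.IsGeneralizedPolytope r) (e : T.OrientedEdge)
    (j : singularSet M) : T.rhoDeriv r e j =
      (T.edgeX r e / r (T.src e) - r (T.src e) / T.len e) / √(T.edgeP r e) *
        (if T.src e = j then 1 else 0) +
      r (T.tgt e) / T.len e / √(T.edgeP r e) * (if T.tgt e = j then 1 else 0) := by
  have hL := T.len_pos e
  have hP := Real.sqrt_pos.2 (h.edgeP_pos e)
  have hr := h.1 (T.src e)
  have hr' := h.1 (T.tgt e)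
  rw [rhoDeriv]
  split_ifs with h1 h2 h2
  · subst h1
    rw [h.sin_rho, edgeX, h2]
    field_simp
    ring
  · rw [h.cos_phi, h.sin_rho, edgeP_opp, src_opp, edgeX]
    field_simp
    ring
  · rw [h.sin_rho, edgeP_opp, src_opp]
    field_simp
    ring
  · ring

theorem len_prev_mul_dD_prev (r v : singularSet M → ℝ) (e : T.OrientedEdge) :
    T.len (T.prev e) * T.dD r v (T.prev e) = T.cy e * T.dX r v e - T.cx e * T.dD r v e := by
  have h1 := (hasDerivAt_edgeD (T := T) r v (T.prev e)).const_mul (T.len (T.prev e))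
  have h2 := ((hasDerivAt_edgeX (T := T) r v e).const_mul (T.cy e)).sub
    ((hasDerivAt_edgeD r v e).const_mul (T.cx e))
  refine h1.unique (h2.congr_of_eventuallyEq (Eventually.of_forall fun t => ?_))
  have := (T.len_pos (T.prev e)).ne'
  simp only [Pi.sub_apply, edgeD_prev]
  field_simp

theorem len_prev_mul_dX_prev (r v : singularSet M → ℝ) (e : T.OrientedEdge) :
    T.len (T.prev e) * T.dX r v (T.prev e) = -(T.cx e * T.dX r v e + T.cy e * T.dD r v e) := by
  have h1 := (hasDerivAt_edgeX (T := T) r v (T.prev e)).const_mul (T.len (T.prev e))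
  have h2 := (((hasDerivAt_edgeX (T := T) r v e).const_mul (T.cx e)).add
    ((hasDerivAt_edgeD r v e).const_mul (T.cy e))).const_sub (T.len (T.prev e) ^ 2)
  refine h1.unique (h2.congr_of_eventuallyEq (Eventually.of_forall fun t => ?_))
  have := (T.len_pos (T.prev e)).ne'
  simp only [Pi.add_apply, edgeX_prev]
  field_simp

/-- The signed areas of the triangles spanned by the foot of the altitude and the sides add up to
the constant area of the face; this is the differentiated identity. It is the geometric content of
Schläfli's formula here. -/
theorem sum_len_mul_dD (r v : singularSet M → ℝ) (e : T.OrientedEdge) :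
    T.len e * T.dD r v e + T.len (T.prev e) * T.dD r v (T.prev e) +
      T.len (T.prev (T.prev e)) * T.dD r v (T.prev (T.prev e)) = 0 := by
  have hm := (T.len_pos (T.prev e)).ne'
  have h1 := T.len_prev_mul_dD_prev r v e
  have h2 := T.len_prev_mul_dX_prev r v e
  have h3 := T.len_prev_mul_cx_prev e
  have h4 := T.len_prev_mul_cy_prev e
  have h5 := T.cx_sq_add_cy_sq e
  rw [len_prev_mul_dD_prev r v (T.prev e)]
  refine mul_left_cancel₀ (pow_ne_zero 2 hm) ?_
  have e1 : T.len (T.prev e) ^ 2 * (T.cy (T.prev e) * T.dX r v (T.prev e)) =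
      T.len e * T.cy e * -(T.cx e * T.dX r v e + T.cy e * T.dD r v e) := by
    rw [← h2, ← h4]; ring
  have e2 : T.len (T.prev e) ^ 2 * (T.cx (T.prev e) * T.dD r v (T.prev e)) =
      (T.len (T.prev e) ^ 2 - T.len e * T.cx e) * (T.cy e * T.dX r v e - T.cx e * T.dD r v e) := by
    rw [← h1, ← h3]; ring
  linear_combination e1 - e2 + T.len (T.prev e) ^ 2 * h1 - T.len e * T.dD r v e * h5

/-- The height √`hsq` is common to the sides of a face, so the sum vanishes face by face. Summing
the identity for a face over all oriented edges counts every term three times. -/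
theorem IsGeneralizedPolytope.sum_len_mul_dD_div (h : T.IsGeneralizedPolytope r)
    (v : singularSet M → ℝ) : ∑ e, T.len e * T.dD r v e / √(T.hsq r e) = 0 := by
  have h1 := T.sum_prev fun e => T.len e * T.dD r v e / √(T.hsq r e)
  have h2 := T.sum_prev fun e => T.len (T.prev e) * T.dD r v (T.prev e) / √(T.hsq r (T.prev e))
  have h3 : ∑ e, (T.len e * T.dD r v e / √(T.hsq r e) +
      T.len (T.prev e) * T.dD r v (T.prev e) / √(T.hsq r (T.prev e)) +
      T.len (T.prev (T.prev e)) * T.dD r v (T.prev (T.prev e)) / √(T.hsq r (T.prev (T.prev e)))) =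
      0 := by
    refine Finset.sum_eq_zero fun e _ => ?_
    rw [h.hsq_prev (T.prev e), h.hsq_prev e, ← add_div, ← add_div, sum_len_mul_dD, zero_div]
  rw [Finset.sum_add_distrib, Finset.sum_add_distrib, h2, h1] at h3
  linarith

variable [Fintype (singularSet M)]

theorem IsGeneralizedPolytope.sum_rhoDeriv_mul (h : T.IsGeneralizedPolytope r) (v : singularSet M → ℝ)
    (e : T.OrientedEdge) : ∑ j, T.rhoDeriv r e j * v j = T.dRho r v e := by
  classical
  simp only [h.rhoDeriv_eq, add_mul, Finset.sum_add_distrib, mul_assoc, ite_mul, one_mul, zero_mul,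
    ← Finset.mul_sum, Finset.sum_ite_eq, Finset.mem_univ, if_true]
  rw [dRho, dX]
  ring

/-- Derivative of `curvature` at `r` in the direction `v`. -/
noncomputable def dCurvature (T : GeodesicTriangulation M) (r v : singularSet M → ℝ)
    (i : singularSet M) : ℝ :=
  ∑ e ∈ T.edgesFrom i, (Real.cot (T.alpha r e) + Real.cot (T.alpha r (T.opp e))) /
    Real.sin (T.rho r e) * T.dRho r v e

theorem IsGeneralizedPolytope.sum_curvatureDeriv_mul (h : T.IsGeneralizedPolytope r)
    (v : singularSet M → ℝ) (i : singularSet M) :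
    ∑ j, T.curvatureDeriv r i j * v j = T.dCurvature r v i := by
  simp only [curvatureDeriv, Finset.sum_mul, dCurvature]
  rw [Finset.sum_comm]
  refine Finset.sum_congr rfl fun e _ => ?_
  rw [← h.sum_rhoDeriv_mul, Finset.mul_sum]
  exact Finset.sum_congr rfl fun j _ => mul_assoc _ _ _

theorem IsGeneralizedPolytope.hasDerivAt_curvature (h : T.IsGeneralizedPolytope r)
    (v : singularSet M → ℝ) (i : singularSet M) :
    HasDerivAt (fun t : ℝ => T.curvature (r + t • v) i) (T.dCurvature r v i) 0 := by
  have h1 := (HasDerivAt.fun_sum (u := T.edgesFrom i) fun e _ => (h.omega_facts v e).2).const_sub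
    (2 * Real.pi)
  refine h1.congr_deriv ?_
  have h2 := T.sum_edgesFrom_opp_prev i fun e => Real.cot (T.alpha r (T.opp e)) /
    Real.sin (T.rho r e) * T.dRho r v e
  simp only [opp_opp] at h2
  rw [Finset.sum_sub_distrib, h2, dCurvature, Finset.sum_neg_distrib, neg_sub, sub_neg_eq_add,
    ← Finset.sum_add_distrib]
  refine Finset.sum_congr rfl fun e _ => ?_
  ring

theorem IsGeneralizedPolytope.hasFDerivAt_curvature (h : T.IsGeneralizedPolytope r)
    (i : singularSet M) : HasFDerivAt (fun r => T.curvature r i)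
      (∑ j, T.curvatureDeriv r i j •
        (ContinuousLinearMap.proj j : (singularSet M → ℝ) →L[ℝ] ℝ)) r := by
  refine hasFDerivAt_of_lines ?_ fun v => ?_
  · exact (DifferentiableAt.fun_sum fun e _ => h.differentiableAt_omega e).const_sub _
  · refine (h.hasDerivAt_curvature v i).congr_deriv ?_
    rw [← h.sum_curvatureDeriv_mul]
    simp

/-- Regroup by oriented edges and transfer each cot α_{−e} to the reversed edge: cot α_e is then
multiplied by r dρ / sin ρ from both ends of e, and these two terms combine over the common
denominator P. -/
theorem IsGeneralizedPolytope.sum_mul_dCurvature (h : T.IsGeneralizedPolytope r)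
    (v : singularSet M → ℝ) : ∑ i, r i * T.dCurvature r v i =
      ∑ e, Real.cot (T.alpha r e) * (T.len e * (r (T.src e) * v (T.src e) -
        T.edgeX r e * T.dX r v e) / T.edgeP r e) := by
  have h1 : ∑ i, r i * T.dCurvature r v i = ∑ e, (Real.cot (T.alpha r e) +
      Real.cot (T.alpha r (T.opp e))) * (r (T.src e) * T.dRho r v e / Real.sin (T.rho r e)) := by
    rw [← sum_sum_edgesFrom]
    refine Finset.sum_congr rfl fun i _ => ?_
    rw [dCurvature, Finset.mul_sum]
    refine Finset.sum_congr rfl fun e he => ?_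
    rw [← T.mem_edgesFrom.1 he]
    ring
  have h2 := T.sum_opp fun e => Real.cot (T.alpha r (T.opp e)) *
    (r (T.src e) * T.dRho r v e / Real.sin (T.rho r e))
  rw [h1]
  simp only [add_mul, Finset.sum_add_distrib]
  rw [← h2, ← Finset.sum_add_distrib]
  refine Finset.sum_congr rfl fun e _ => ?_
  have hP := h.edgeP_pos e
  have hP0 := Real.sqrt_pos.2 hP
  have hL := T.len_pos e
  have hr := h.1 (T.src e)
  have hr' := h.1 (T.tgt e)
  have aux : ∀ {x X w d : ℝ}, 0 < x → x * ((X * w / x - d) / √(T.edgeP r e)) / (√(T.edgeP r e) / x) =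
      (X * (x * w) - x ^ 2 * d) / T.edgeP r e := fun {x X w d} hx => by
    nth_rewrite 3 [← Real.mul_self_sqrt hP.le]
    field_simp
  have hd : T.dX r v (T.opp e) = -T.dX r v e := by
    simp only [dX, src_opp, tgt_opp, len_opp]; ring
  rw [opp_opp, ← mul_add, h.sin_rho, h.sin_rho, dRho, dRho, edgeP_opp, src_opp, aux hr, aux hr', hd,
    edgeX_opp, ← add_div]
  congr 2
  have h3 : T.len e * T.dX r v e = r (T.src e) * v (T.src e) - r (T.tgt e) * v (T.tgt e) := by
    rw [dX]; field_simp
  have h4 := T.sq_tgt r e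
  linear_combination (T.len e - T.edgeX r e) * h3 + T.dX r v e * h4

/-- By the product rule dH = Σ κ_i dr_i + Σ r_i dκ_i − Σ ℓ_e dθ_e. In the last two sums the parts
with cot α_e cancel edge by edge, and `sum_len_mul_dD_div` disposes of the rest. -/
theorem IsGeneralizedPolytope.hasFDerivAt_totalScalarCurvature (h : T.IsGeneralizedPolytope r) :
    HasFDerivAt (fun r => T.totalScalarCurvature r) (∑ i, T.curvature r i •
      (ContinuousLinearMap.proj i : (singularSet M → ℝ) →L[ℝ] ℝ)) r := by
  have hz : ∀ v : singularSet M → ℝ, r + (0 : ℝ) • v = r := by simp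
  refine hasFDerivAt_of_lines ?_ fun v => ?_
  · have h1 : ∀ i, DifferentiableAt ℝ (fun r => T.curvature r i) r := fun i =>
      (h.hasFDerivAt_curvature i).differentiableAt
    have h2 : ∀ e, DifferentiableAt ℝ (fun r => T.theta r e) r := fun e =>
      (h.differentiableAt_alpha e).add (h.differentiableAt_alpha (T.opp e))
    have h3 : DifferentiableAt ℝ (fun r => ∑ i, r i * T.curvature r i) r :=
      DifferentiableAt.fun_sum fun i _ => (by fun_prop : DifferentiableAt ℝ (fun r => r i) r).mul (h1 i)
    have h4 : DifferentiableAt ℝ (fun r => ∑ e : T.OrientedEdge, T.len e * (Real.pi - T.theta r e)) r :=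
      DifferentiableAt.fun_sum fun e _ => ((h2 e).const_sub _).const_mul _
    exact h3.add (h4.const_mul _)
  · have h1 := HasDerivAt.fun_sum (u := Finset.univ) fun i _ =>
      (hasDerivAt_coord r v i).mul (h.hasDerivAt_curvature v i)
    have h2 := HasDerivAt.fun_sum (u := Finset.univ) fun e _ =>
      (((h.hasDerivAt_alpha v e).add (h.hasDerivAt_alpha v (T.opp e))).const_sub
        Real.pi).const_mul (T.len e)
    refine (h1.add (h2.const_mul (1 / 2))).congr_deriv ?_
    simp only [hz, sum_apply, smul_apply,
      ContinuousLinearMap.proj_apply, smul_eq_mul, Finset.sum_add_distrib, h.sum_mul_dCurvature]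
    set A : T.OrientedEdge → ℝ := fun e => -((T.dD r v e - T.edgeD r e *
      (r (T.src e) * v (T.src e) - T.edgeX r e * T.dX r v e) / T.edgeP r e) / √(T.hsq r e)) with hA
    have h3 := T.sum_opp fun e => T.len e * A e
    have h4 : ∑ e, T.len e * -(A e + A (T.opp e)) = -(2 * ∑ e, T.len e * A e) := by
      simp only [T.len_opp] at h3
      simp only [mul_neg, mul_add, Finset.sum_neg_distrib, Finset.sum_add_distrib, h3]
      ring
    have h5 : ∑ e, Real.cot (T.alpha r e) * (T.len e * (r (T.src e) * v (T.src e) -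
        T.edgeX r e * T.dX r v e) / T.edgeP r e) - ∑ e, T.len e * A e = 0 := by
      rw [← h.sum_len_mul_dD_div v, ← Finset.sum_sub_distrib]
      refine Finset.sum_congr rfl fun e _ => ?_
      rw [h.cot_alpha, hA]
      ring
    have h6 : ∑ i, T.curvature r i * v i = ∑ i, v i * T.curvature r i :=
      Finset.sum_congr rfl fun i _ => mul_comm _ _
    change _ + 1 / 2 * ∑ e, T.len e * -(A e + A (T.opp e)) = _
    rw [h4, h6]
    linarith

/-- Near r the formula is an expression in r, `edgeX`, `edgeD` and the square roots of `edgeP` and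
`hsq`, with denominators that do not vanish. -/
theorem IsGeneralizedPolytope.continuousAt_curvatureDeriv (h : T.IsGeneralizedPolytope r)
    (i j : singularSet M) : ContinuousAt (fun r => T.curvatureDeriv r i j) r := by
  classical
  have cX := fun e => (T.differentiable_edgeX e).continuous.continuousAt (x := r)
  have cD := fun e => (T.differentiable_edgeD e).continuous.continuousAt (x := r)
  have cP := fun e => (T.differentiable_edgeP e).continuous.continuousAt (x := r)
  have ch := fun e => (T.differentiable_hsq e).continuous.continuousAt (x := r)
  have sP := fun e => (Real.sqrt_pos.2 (h.edgeP_pos e)).ne'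
  have sh := fun e => (Real.sqrt_pos.2 (h.hsq_pos e)).ne'
  have cr : ∀ i, ContinuousAt (fun r : singularSet M → ℝ => r i) r := fun i =>
    (continuous_apply i).continuousAt
  have key : ∀ e, ContinuousAt (fun r => (Real.cot (T.alpha r e) + Real.cot (T.alpha r (T.opp e))) /
      Real.sin (T.rho r e) * T.rhoDeriv r e j) r := by
    intro e
    have c1 : ContinuousAt (fun r => (T.edgeD r e / √(T.hsq r e) +
        T.edgeD r (T.opp e) / √(T.hsq r (T.opp e))) / (√(T.edgeP r e) / r (T.src e)) *
        ((T.edgeX r e / r (T.src e) - r (T.src e) / T.len e) / √(T.edgeP r e) *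
        (if T.src e = j then 1 else 0) +
      r (T.tgt e) / T.len e / √(T.edgeP r e) * (if T.tgt e = j then 1 else 0))) r :=
      ((((cD e).div (ch e).sqrt (sh e)).add ((cD _).div (ch _).sqrt (sh _))).div
        ((cP e).sqrt.div (cr _) (h.1 _).ne') (div_ne_zero (sP e) (h.1 _).ne')).mul
      ((((((cX e).div (cr _) (h.1 _).ne').sub ((cr _).div_const _)).div (cP e).sqrt (sP e)).mul_const
        _).add ((((cr _).div_const _).div (cP e).sqrt (sP e)).mul_const _))
    refine c1.congr (h.eventually.mono fun r hr => ?_)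
    simp only
    rw [hr.cot_alpha, hr.cot_alpha, hr.sin_rho, hr.rhoDeriv_eq]
  exact tendsto_finsetSum _ fun e _ => key e

end GeodesicTriangulation

/-! ### Creases are common to all convex triangulations -/

namespace GeodesicTriangulation

variable {M : Type*} [MetricSpace M] {T T' : GeodesicTriangulation M} {r : singularSet M → ℝ}

/-- Edges, possibly of different triangulations, with a common germ are equal as paths. -/
theorem pos_eq_of_shift {e : T.OrientedEdge} {e' : T'.OrientedEdge} {s s' δ : ℝ} (hδ : 0 < δ)
    (hs : s ∈ Ioo 0 (T.len e)) (hs' : s' ∈ Ioo 0 (T'.len e'))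
    (h : ∀ a ∈ Ioo (-δ) δ, T.pos e (s + a) 0 = T'.pos e' (s' + a) 0) :
    T.len e = T'.len e' ∧ ∀ t ∈ Icc 0 (T.len e), T.pos e t 0 = T'.pos e' t 0 := by
  have key : ∀ (T T' : GeodesicTriangulation M) (e : T.OrientedEdge) (e' : T'.OrientedEdge) (s s' : ℝ),
      s ∈ Ioo 0 (T.len e) → s' ∈ Ioo 0 (T'.len e') →
      (∀ a ∈ Ioo (-δ) δ, T.pos e (s + a) 0 = T'.pos e' (s' + a) 0) → s ≤ s' →
      T.len e = T'.len e' ∧ ∀ t ∈ Icc 0 (T.len e), T.pos e t 0 = T'.pos e' t 0 := by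
    intro T T' e e' s s' hs hs' h hle
    set c := s' - s with hc
    set m := min (T.len e) (T'.len e' - c) with hm
    have m1 : m ≤ T.len e := min_le_left _ _
    have m2 : m ≤ T'.len e' - c := min_le_right _ _
    have hsm : s < m := lt_min hs.2 (by linarith [hs'.2])
    have hm0 : 0 < m := hs.1.trans hsm
    have h2 : LocIsoOn (fun t => T'.pos e' (t + c) 0) (Ioo 0 m) :=
      (T'.locIsoOn_pos e').comp (g := fun t => t + c) (fun x y => by simp)
        fun t ht => ⟨by linarith [ht.1], by linarith [ht.2]⟩
    have h1 := geodesic_unique ((T.locIsoOn_pos e).mono (Ioo_subset_Ioo_right m1)) h2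
      (fun t ht => T.pos_regular e ⟨ht.1, ht.2.trans_le m1⟩) ⟨hs.1, hsm⟩ (by
        filter_upwards [isOpen_Ioo.mem_nhds (show s ∈ Ioo (s - δ) (s + δ) from
          ⟨by linarith, by linarith⟩)] with t ht
        have := h (t - s) ⟨by linarith [ht.1], by linarith [ht.2]⟩
        rwa [show s + (t - s) = t by ring, show s' + (t - s) = t + c by rw [hc]; ring] at this)
    have h3 : EqOn (fun t => T.pos e t 0) (fun t => T'.pos e' (t + c) 0) (Icc 0 m) :=
      EqOn.of_subset_closure (s := Ioo 0 m) h1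
        ((T.continuousOn_pos e).mono (Icc_subset_Icc_right m1))
        ((T'.continuousOn_pos e').comp (by fun_prop) fun t ht =>
          ⟨by linarith [ht.1], by linarith [ht.2]⟩) Ioo_subset_Icc_self
        (by rw [closure_Ioo hm0.ne])
    -- With a positive offset the initial vertex of e would be an interior and hence regular point
    -- of e'.
    have hc0 : c = 0 := by
      by_contra hne
      have hcpos : 0 < c := lt_of_le_of_ne (by linarith) (Ne.symm hne)
      have h4 := T'.pos_regular e' (s := c) ⟨hcpos, by linarith [hs'.2, hs.1]⟩
      have h5 := h3 ⟨le_rfl, hm0.le⟩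
      simp only [zero_add] at h5
      rw [← h5, T.pos_zero] at h4
      exact (T.src e).2 h4
    refine pos_eq_of_eventuallyEq hm0 fun t ht => ?_
    have := h3 ⟨ht.1.le, ht.2.le⟩
    simpa [hc0] using this
  rcases le_total s s' with hle | hle
  · exact key T T' e e' s s' hs hs' h hle
  · obtain ⟨h1, h2⟩ := key T' T e' e s' s hs' hs (fun a ha => (h a ha).symm) hle
    exact ⟨h1.symm, fun t ht => (h2 t (h1 ▸ ht)).symm⟩

/-- Edges of two triangulations which coincide in `M`, and at which the function `q` has the same
one-sided behaviour. -/
def Corresponds (r : singularSet M → ℝ) (e : T.OrientedEdge) (e' : T'.OrientedEdge) : Prop :=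
  T.len e = T'.len e' ∧ (∀ t ∈ Icc 0 (T.len e), T.pos e t 0 = T'.pos e' t 0) ∧
    ((T.edgeD r e = T'.edgeD r e' ∧ T.edgeD r (T.opp e) = T'.edgeD r (T'.opp e')) ∨
     (T.edgeD r e = T'.edgeD r (T'.opp e') ∧ T.edgeD r (T.opp e) = T'.edgeD r e'))

/-- The function `q` in a chart around an interior point of an edge, together with the edge. -/
theorem exists_q_edge_form_pos (r : singularSet M → ℝ) (e : T.OrientedEdge) {s : ℝ}
    (hs : s ∈ Ioo 0 (T.len e)) {ψ : Plane → M} {ε : ℝ} (hψ : IsPlaneChart ψ (T.pos e s 0) ε) :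
    ∃ ε', 0 < ε' ∧ ε' ≤ ε ∧ ∃ U N : Plane, ‖U‖ = 1 ∧ ‖N‖ = 1 ∧ inner ℝ U N = 0 ∧
      (∀ a ∈ Ioo (-ε') ε', T.pos e (s + a) 0 = ψ (a • U)) ∧
      ∀ a b : ℝ, a ^ 2 + b ^ 2 < ε' ^ 2 → T.q r (ψ (a • U + b • N)) =
        (s + a) ^ 2 + b ^ 2 + r (T.src e) ^ 2 - 2 * T.edgeX r e * (s + a)
          - 2 * T.edgeD r e * max b 0 - 2 * T.edgeD r (T.opp e) * max (-b) 0 := by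
  obtain ⟨ε', h0, h1, U, N, hU, hN, hUN, h⟩ := T.exists_edge_form e hs hψ
  refine ⟨ε', h0, h1, U, N, hU, hN, hUN, fun a ha => ?_, fun a b hab => ?_⟩
  · have := ((h a 0 (by rw [zero_pow two_ne_zero, add_zero]; exact sq_lt_sq' ha.1 ha.2)).1
      le_rfl).2.2
    simpa using this
  rcases le_total 0 b with hb | hb
  · obtain ⟨k1, -, k2⟩ := (h a b hab).1 hb
    rw [← k2, pos, T.q_toSurface r k1, faceQ_fr, max_eq_left hb, max_eq_right (by linarith)]
    ring
  · obtain ⟨k1, -, k2⟩ := (h a b hab).2 hb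
    rw [← k2, pos, T.q_toSurface r k1, show T.len e - s - a = T.len e - (s + a) by ring,
      faceQ_opp, max_eq_right hb, max_eq_left (by linarith)]
    ring

/-- At an interior point of a face, the function `q` is a quadratic polynomial in a chart. -/
theorem q_chart_add_of_interior (r : singularSet M → ℝ) {f : Fin T.faceCount} {x : Plane}
    (hx : x ∈ interior (T.tri f)) {ψ : Plane → M} {ε : ℝ} (hψ : IsPlaneChart ψ (T.toSurface f x) ε) :
    ∃ ε', 0 < ε' ∧ ∀ u : Plane, ‖u‖ < ε' →
      T.q r (ψ u) + T.q r (ψ (-u)) = 2 * T.q r (ψ 0) + 2 * ‖u‖ ^ 2 := by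
  obtain ⟨ε', h0, -, G, hG⟩ := T.exists_interior_form hx hψ
  refine ⟨ε', h0, fun u hu => ?_⟩
  have key : ∀ u : Plane, ‖u‖ < ε' → T.q r (ψ u) = T.faceQ r f (x + G.symm u) := fun u hu => by
    obtain ⟨k1, k2⟩ := hG (G.symm u) (by rwa [G.symm.norm_map])
    rw [G.apply_symm_apply] at k2
    rw [← k2, T.q_toSurface r (interior_subset k1)]
  rw [key u hu, key (-u) (by rwa [norm_neg]), key 0 (by simpa using h0), map_neg, map_zero, add_zero,
    ← sub_eq_add_neg, add_comm, faceQ_add_sub, G.symm.norm_map]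

theorem abs_eq_max_add_max (b : ℝ) : |b| = max b 0 + max (-b) 0 := by
  rcases le_total 0 b with hb | hb
  · rw [abs_of_nonneg hb, max_eq_left hb, max_eq_right (by linarith), add_zero]
  · rw [abs_of_nonpos hb, max_eq_right hb, max_eq_left (by linarith), zero_add]

/-- An edge at which `q` is not smooth is an edge of every triangulation with the same `q`. -/
theorem exists_corresponds (hq : T.q r = T'.q r) {e : T.OrientedEdge}
    (he : 0 < T.edgeD r e + T.edgeD r (T.opp e)) : ∃ e' : T'.OrientedEdge, Corresponds r e e' := by
  have hL := T.len_pos e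
  have hs : T.len e / 2 ∈ Ioo 0 (T.len e) := ⟨by linarith, by linarith⟩
  set s := T.len e / 2
  obtain ⟨ε, ψ, hψ⟩ := (T.pos_regular e hs).exists_chart
  obtain ⟨ε₁, h0, h1, U, N, hU, hN, hUN, hp, hf⟩ := T.exists_q_edge_form_pos r e hs hψ
  rcases T'.regular_cases (T.pos_regular e hs) with ⟨f, x, hx, hxy⟩ | ⟨e', s', hs', hxy⟩
  -- Inside a face of T' the second difference of q is that of ‖x‖², which contradicts the crease in
  -- the normal direction N.
  · obtain ⟨ε₂, h2, hg⟩ := T'.q_chart_add_of_interior r hx (hxy ▸ hψ)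
    set b := min ε₁ ε₂ / 2 with hb
    have hm : 0 < min ε₁ ε₂ := lt_min h0 h2
    have hb0 : 0 < b := by positivity
    have b1 : b < ε₁ := by linarith [min_le_left ε₁ ε₂]
    have b2 : b < ε₂ := by linarith [min_le_right ε₁ ε₂]
    have hbn : ‖b • N‖ = b := by rw [norm_smul, hN, mul_one, Real.norm_of_nonneg hb0.le]
    have k := hg (b • N) (by rwa [hbn])
    have hlt : b ^ 2 < ε₁ ^ 2 := by nlinarith
    have k1 := hf 0 b (by simpa using hlt)
    have k2 := hf 0 (-b) (by simpa using hlt)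
    have k3 := hf 0 0 (by simpa using pow_pos h0 2)
    rw [hbn, ← hq] at k
    simp only [zero_smul, zero_add, neg_smul, add_zero, max_self, neg_zero] at k1 k2 k3
    rw [max_eq_left hb0.le, max_eq_right (by linarith)] at k1
    rw [neg_neg, max_eq_left hb0.le, max_eq_right (by linarith)] at k2
    rw [k1, k2, k3] at k
    nlinarith
  · have main : ∀ (e' : T'.OrientedEdge) (s' : ℝ) (_ : s' ∈ Ioo 0 (T'.len e'))
        (_ : T'.pos e' s' 0 = T.pos e s 0) (ε₂ : ℝ) (_ : 0 < ε₂) (U' N' : Plane) (_ : ‖U'‖ = 1)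
        (_ : ‖N'‖ = 1) (_ : inner ℝ U' N' = 0) (_ : ∀ a ∈ Ioo (-ε₂) ε₂, T'.pos e' (s' + a) 0 =
          ψ (a • U')) (_ : ∀ a b : ℝ, a ^ 2 + b ^ 2 < ε₂ ^ 2 → T'.q r (ψ (a • U' + b • N')) =
        (s' + a) ^ 2 + b ^ 2 + r (T'.src e') ^ 2 - 2 * T'.edgeX r e' * (s' + a)
          - 2 * T'.edgeD r e' * max b 0 - 2 * T'.edgeD r (T'.opp e') * max (-b) 0),
        ((T.edgeD r e = T'.edgeD r e' ∧ T.edgeD r (T.opp e) = T'.edgeD r (T'.opp e')) ∨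
        (T.edgeD r e = T'.edgeD r (T'.opp e') ∧ T.edgeD r (T.opp e) = T'.edgeD r e')) ∧
        (U' = U ∨ U' = -U) := by
      intro e' s' hs' hxy ε₂ h2 U' N' hU' hN' hUN' hp' hf'
      set ε₀ := min ε₁ ε₂ / 2 with hε
      have hm : 0 < min ε₁ ε₂ := lt_min h0 h2
      have he0 : 0 < ε₀ := by positivity
      have e1 : ε₀ < ε₁ := by linarith [min_le_left ε₁ ε₂]
      have e2 : ε₀ < ε₂ := by linarith [min_le_right ε₁ ε₂]
      have hlt1 : ε₀ ^ 2 < ε₁ ^ 2 := by nlinarith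
      have hlt2 : ε₀ ^ 2 < ε₂ ^ 2 := by nlinarith
      -- Second differences of q in the direction v compare the creases K |⟨N, v⟩| and K' |⟨N', v⟩|.
      -- Taking v along N gives K' ≠ 0, and v along U then gives N' ⊥ U, so the two edges are
      -- tangent.
      have hdiff : ∀ v : Plane, ‖v‖ = ε₀ →
          (T.edgeD r e + T.edgeD r (T.opp e)) * |inner ℝ N v| =
          (T'.edgeD r e' + T'.edgeD r (T'.opp e')) * |inner ℝ N' v| := by
        have aux : ∀ (T : GeodesicTriangulation M) (e : T.OrientedEdge) (s ε₁ : ℝ) (U N : Plane),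
            ‖U‖ = 1 → ‖N‖ = 1 → inner ℝ U N = 0 → ε₀ ^ 2 < ε₁ ^ 2 →
            (∀ a b : ℝ, a ^ 2 + b ^ 2 < ε₁ ^ 2 → T.q r (ψ (a • U + b • N)) =
            (s + a) ^ 2 + b ^ 2 + r (T.src e) ^ 2 - 2 * T.edgeX r e * (s + a)
            - 2 * T.edgeD r e * max b 0 - 2 * T.edgeD r (T.opp e) * max (-b) 0) →
            ∀ v : Plane, ‖v‖ = ε₀ → T.q r (ψ v) + T.q r (ψ (-v)) - 2 * T.q r (ψ 0) =
              2 * ‖v‖ ^ 2 - 2 * ((T.edgeD r e + T.edgeD r (T.opp e)) * |inner ℝ N v|) := by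
          intro T e s ε₁ U N hU hN hUN hlt hf v hv
          have hd := Plane.decomp_of_orthonormal hU hN hUN v
          set a := inner ℝ U v
          set b := inner ℝ N v
          have hn : ‖v‖ ^ 2 = a ^ 2 + b ^ 2 := by rw [hd, norm_frame_of_orthonormal hU hN hUN]
          have k1 := hf a b (by rw [← hn, hv]; exact hlt)
          have k2 := hf (-a) (-b) (by rw [neg_sq, neg_sq, ← hn, hv]; exact hlt)
          have k3 := hf 0 0 (by simpa using (sq_nonneg ε₀).trans_lt hlt)
          rw [← hd] at k1
          rw [neg_smul, neg_smul, ← neg_add, ← hd] at k2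
          rw [zero_smul, zero_smul, add_zero, neg_zero, max_self] at k3
          rw [k1, k2, k3, hn, abs_eq_max_add_max, neg_neg]
          ring
        intro v hv
        have k1 := aux T e s ε₁ U N hU hN hUN hlt1 hf v hv
        have k2 := aux T' e' s' ε₂ U' N' hU' hN' hUN' hlt2 hf' v hv
        rw [hq, k2] at k1
        linarith
      have hnu : ‖ε₀ • U‖ = ε₀ := by rw [norm_smul, hU, mul_one, Real.norm_of_nonneg he0.le]
      have hnn : ‖ε₀ • N‖ = ε₀ := by rw [norm_smul, hN, mul_one, Real.norm_of_nonneg he0.le]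
      have d1 := hdiff (ε₀ • U) hnu
      have d2 := hdiff (ε₀ • N) hnn
      rw [inner_smul_right, inner_smul_right, real_inner_comm, hUN, mul_zero, abs_zero, mul_zero,
        abs_mul, abs_of_pos he0] at d1
      rw [inner_smul_right, inner_smul_right, real_inner_self_eq_norm_sq, hN, abs_mul, abs_mul,
        abs_of_pos he0] at d2
      have d3 : T.edgeD r e + T.edgeD r (T.opp e) =
          (T'.edgeD r e' + T'.edgeD r (T'.opp e')) * |inner ℝ N' N| := by
        refine mul_left_cancel₀ he0.ne' ?_
        simp only [one_pow, abs_one] at d2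
        linarith
      have hK : T'.edgeD r e' + T'.edgeD r (T'.opp e') ≠ 0 := by
        intro h; rw [h, zero_mul] at d3; linarith
      have d4 : inner ℝ N' U = 0 := by
        rcases mul_eq_zero.1 d1.symm with h | h
        · exact absurd h hK
        · rcases mul_eq_zero.1 h with h | h
          · exact absurd h he0.ne'
          · exact abs_eq_zero.1 h
      have hNd := Plane.decomp_of_orthonormal hU hN hUN N'
      have hUd := Plane.decomp_of_orthonormal hU' hN' hUN' U
      rw [real_inner_comm, d4, zero_smul, zero_add, real_inner_comm] at hNd
      rw [d4, zero_smul, add_zero] at hUd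
      have hN1 : |inner ℝ N' N| = 1 := by
        have := congrArg norm hNd
        rw [norm_smul, hN, hN', mul_one, Real.norm_eq_abs] at this
        exact this.symm
      have hU1 : |inner ℝ U' U| = 1 := by
        have := congrArg norm hUd
        rw [norm_smul, hU, hU', mul_one, Real.norm_eq_abs] at this
        exact this.symm
      -- The values of q on the normal line give `edgeD` on each side separately; the sign σ decides
      -- whether the sides are exchanged.
      have hside : ∀ σ : ℝ, |σ| = 1 → N' = σ • N → ∀ b : ℝ, |b| = ε₀ →
          T.edgeD r e * max (σ * b) 0 + T.edgeD r (T.opp e) * max (-(σ * b)) 0 =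
            T'.edgeD r e' * max b 0 + T'.edgeD r (T'.opp e') * max (-b) 0 := by
        intro σ hσ hN' b hb
        have hb2 : b ^ 2 = ε₀ ^ 2 := by rw [← hb, sq_abs]
        have hσ2 : σ ^ 2 = 1 := by rw [← sq_abs, hσ, one_pow]
        have k1 := hf 0 (σ * b) (by rw [mul_pow, hσ2, hb2]; simpa using hlt1)
        have k2 := hf' 0 b (by rw [hb2]; simpa using hlt2)
        have k3 := hf 0 0 (by simpa using pow_pos h0 2)
        have k4 := hf' 0 0 (by simpa using pow_pos h2 2)
        simp only [zero_smul, zero_add, add_zero, neg_zero, max_self] at k1 k2 k3 k4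
        rw [hN', smul_smul, mul_comm b σ, ← hq, k1, mul_pow, hσ2] at k2
        rw [← hq, k3] at k4
        linarith
      have hab : |ε₀| = ε₀ := abs_of_pos he0
      refine ⟨?_, ?_⟩
      · rcases eq_or_eq_neg_of_abs_eq hN1 with h | h
        · left
          rw [h] at hNd
          have k1 := hside 1 abs_one hNd ε₀ hab
          have k2 := hside 1 abs_one hNd (-ε₀) (by rw [abs_neg, hab])
          rw [one_mul, max_eq_left he0.le, max_eq_right (by linarith)] at k1
          rw [one_mul, neg_neg, max_eq_left he0.le, max_eq_right (by linarith)] at k2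
          exact ⟨mul_right_cancel₀ he0.ne' (by linarith), mul_right_cancel₀ he0.ne' (by linarith)⟩
        · right
          rw [h] at hNd
          have k1 := hside (-1) (by simp) hNd ε₀ hab
          have k2 := hside (-1) (by simp) hNd (-ε₀) (by rw [abs_neg, hab])
          rw [neg_one_mul, neg_neg, max_eq_left he0.le, max_eq_right (by linarith)] at k1
          rw [neg_one_mul, neg_neg, max_eq_left he0.le, max_eq_right (by linarith)] at k2
          exact ⟨mul_right_cancel₀ he0.ne' (by linarith), mul_right_cancel₀ he0.ne' (by linarith)⟩
      · rcases eq_or_eq_neg_of_abs_eq hU1 with h | h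
        · left; rw [hUd, h, one_smul]
        · right; rw [hUd, h, neg_one_smul, neg_neg]
    obtain ⟨ε₂, h2, h3, U', N', hU', hN', hUN', hp', hf'⟩ :=
      T'.exists_q_edge_form_pos r e' hs' (ψ := ψ) (ε := ε) (by rw [hxy]; exact hψ)
    obtain ⟨hD, hUU⟩ := main e' s' hs' hxy ε₂ h2 U' N' hU' hN' hUN' hp' hf'
    have hlen' := T'.len_opp e'
    set δ := min (min ε₁ ε₂) (min s' (T'.len e' - s')) with hδ
    have hδ0 : 0 < δ := lt_min (lt_min h0 h2) (lt_min hs'.1 (by linarith [hs'.2]))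
    have l1 : δ ≤ ε₁ := (min_le_left _ _).trans (min_le_left _ _)
    have l2 : δ ≤ ε₂ := (min_le_left _ _).trans (min_le_right _ _)
    have l3 : δ ≤ s' := (min_le_right _ _).trans (min_le_left _ _)
    have l4 : δ ≤ T'.len e' - s' := (min_le_right _ _).trans (min_le_right _ _)
    rcases hUU with rfl | rfl
    · obtain ⟨k1, k2⟩ := pos_eq_of_shift (e := e) (e' := e') hδ0 hs hs' fun a ha => by
        rw [hp a ⟨by linarith [ha.1], by linarith [ha.2]⟩,
          hp' a ⟨by linarith [ha.1], by linarith [ha.2]⟩]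
      exact ⟨e', k1, k2, hD⟩
    -- Opposite tangents: e is then matched with the reverse of e', at the complementary parameter.
    · obtain ⟨k1, k2⟩ := pos_eq_of_shift (e := e) (e' := T'.opp e') (s' := T'.len e' - s') hδ0 hs
        (by rw [hlen']; exact ⟨by linarith [hs'.2], by linarith [hs'.1]⟩) fun a ha => by
        have k := hp' (-a) ⟨by linarith [ha.2], by linarith [ha.1]⟩
        rw [hp a ⟨by linarith [ha.1], by linarith [ha.2]⟩, show T'.len e' - s' + a =
          T'.len e' - (s' + -a) by ring, ← T'.pos_opp e' ⟨by linarith [ha.2], by linarith [ha.1]⟩, k,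
          smul_neg, neg_smul, neg_neg]
      refine ⟨T'.opp e', k1, k2, ?_⟩
      rw [T'.opp_opp]
      exact hD.symm

end GeodesicTriangulation

namespace GeodesicTriangulation

variable {M : Type*} [MetricSpace M] {T T' : GeodesicTriangulation M} {r : singularSet M → ℝ}

namespace Corresponds

variable {e : T.OrientedEdge} {e' : T'.OrientedEdge}

theorem src_eq (h : Corresponds r e e') : T.src e = T'.src e' := by
  have := h.2.1 0 ⟨le_rfl, (T.len_pos e).le⟩
  rw [pos_zero, pos_zero] at this
  exact Subtype.ext this

theorem tgt_eq (h : Corresponds r e e') : T.tgt e = T'.tgt e' := by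
  have := h.2.1 (T.len e) ⟨(T.len_pos e).le, le_rfl⟩
  rw [pos_len, h.1, pos_len] at this
  exact Subtype.ext this

theorem edgeX_eq (h : Corresponds r e e') : T.edgeX r e = T'.edgeX r e' := by
  rw [edgeX, edgeX, h.src_eq, h.tgt_eq, h.1]

theorem edgeP_eq (h : Corresponds r e e') : T.edgeP r e = T'.edgeP r e' := by
  rw [edgeP, edgeP, h.src_eq, h.edgeX_eq]

theorem edgeD_add_eq (h : Corresponds r e e') :
    T.edgeD r e + T.edgeD r (T.opp e) = T'.edgeD r e' + T'.edgeD r (T'.opp e') := by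
  rcases h.2.2 with ⟨h3, h4⟩ | ⟨h3, h4⟩
  · rw [h3, h4]
  · rw [h3, h4, add_comm]

theorem theta_eq (h : Corresponds r e e') (hT : T.IsGeneralizedPolytope r)
    (hT' : T'.IsGeneralizedPolytope r) : T.theta r e = T'.theta r e' := by
  rw [theta, theta, hT.alpha_eq, hT.alpha_eq, hT'.alpha_eq, hT'.alpha_eq, edgeP_opp, edgeP_opp,
    h.edgeP_eq]
  rcases h.2.2 with ⟨h3, h4⟩ | ⟨h3, h4⟩
  · rw [h3, h4]
  · rw [h3, h4, add_comm]

theorem cot_add_cot_eq (h : Corresponds r e e') (hT : T.IsGeneralizedPolytope r)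
    (hT' : T'.IsGeneralizedPolytope r) :
    Real.cot (T.alpha r e) + Real.cot (T.alpha r (T.opp e)) =
      Real.cot (T'.alpha r e') + Real.cot (T'.alpha r (T'.opp e')) := by
  rw [hT.cot_alpha, hT.cot_alpha, hT'.cot_alpha, hT'.cot_alpha, hsq, hsq, hsq, hsq, edgeP_opp,
    edgeP_opp, h.edgeP_eq]
  rcases h.2.2 with ⟨h3, h4⟩ | ⟨h3, h4⟩
  · rw [h3, h4]
  · rw [h3, h4, add_comm]

theorem sin_rho_eq (h : Corresponds r e e') (hT : T.IsGeneralizedPolytope r)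
    (hT' : T'.IsGeneralizedPolytope r) : Real.sin (T.rho r e) = Real.sin (T'.rho r e') := by
  rw [hT.sin_rho, hT'.sin_rho, h.edgeP_eq, h.src_eq]

theorem rhoDeriv_eq (h : Corresponds r e e') (hT : T.IsGeneralizedPolytope r)
    (hT' : T'.IsGeneralizedPolytope r) (j : singularSet M) :
    T.rhoDeriv r e j = T'.rhoDeriv r e' j := by
  rw [hT.rhoDeriv_eq, hT'.rhoDeriv_eq, h.edgeP_eq, h.src_eq, h.tgt_eq, h.edgeX_eq, h.1]

end Corresponds

/-- Two triangulations with the same function `q` have the same edges, apart from flat ones. -/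
theorem sum_eq_sum_of_corresponds (hc : T.IsLocallyConvex r) (hc' : T'.IsLocallyConvex r)
    {g : T.OrientedEdge → ℝ} {g' : T'.OrientedEdge → ℝ}
    (hg : ∀ e, T.edgeD r e + T.edgeD r (T.opp e) = 0 → g e = 0)
    (hg' : ∀ e, T'.edgeD r e + T'.edgeD r (T'.opp e) = 0 → g' e = 0)
    (h : ∀ e e', Corresponds r e e' → g e = g' e') : ∑ e, g e = ∑ e, g' e := by
  classical
  have hq : T.q r = T'.q r := funext (q_eq_q r hc hc')
  have h1 : ∀ e : T.OrientedEdge, ∃ e' : T'.OrientedEdge,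
      0 < T.edgeD r e + T.edgeD r (T.opp e) → Corresponds r e e' := fun e => by
    by_cases he : 0 < T.edgeD r e + T.edgeD r (T.opp e)
    · exact (exists_corresponds hq he).imp fun _ h _ => h
    -- A flat edge only needs an arbitrary value; T' has a face because its faces cover M.
    · obtain ⟨f, -⟩ := T'.covers (T.src e)
      exact ⟨(f, 0), fun h => absurd h he⟩
  have h2 : ∀ e : T'.OrientedEdge, ∃ e' : T.OrientedEdge,
      0 < T'.edgeD r e + T'.edgeD r (T'.opp e) → Corresponds r e e' := fun e => by
    by_cases he : 0 < T'.edgeD r e + T'.edgeD r (T'.opp e)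
    · exact (exists_corresponds hq.symm he).imp fun _ h _ => h
    · obtain ⟨f, -⟩ := T.covers (T'.src e)
      exact ⟨(f, 0), fun h => absurd h he⟩
  choose φ hφ using h1
  choose φ' hφ' using h2
  have uniq : ∀ {T T' : GeodesicTriangulation M} {e e₁ : T.OrientedEdge} {e' : T'.OrientedEdge},
      Corresponds r e e' → Corresponds r e' e₁ → e₁ = e := fun {T T' e e₁ e'} a b =>
    (T.eq_of_pos_eq (fun s hs => (a.2.1 s hs).trans (b.2.1 s (a.1 ▸ hs))) (a.1.trans b.1)).symm
  -- Flat edges drop out. On the others the correspondences in the two directions are mutually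
  -- inverse, since an oriented edge is determined by its path.
  rw [← Finset.sum_filter_of_ne (p := fun e => 0 < T.edgeD r e + T.edgeD r (T.opp e))
      fun e _ hne => (hc e).lt_of_ne fun h => hne (hg e h.symm),
    ← Finset.sum_filter_of_ne (p := fun e => 0 < T'.edgeD r e + T'.edgeD r (T'.opp e))
      fun e _ hne => (hc' e).lt_of_ne fun h => hne (hg' e h.symm)]
  refine Finset.sum_nbij' φ φ' ?_ ?_ ?_ ?_ ?_
  · intro e he
    simp only [Finset.mem_filter, Finset.mem_univ, true_and] at *
    rw [← (hφ e he).edgeD_add_eq]; exact he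
  · intro e he
    simp only [Finset.mem_filter, Finset.mem_univ, true_and] at *
    rw [← (hφ' e he).edgeD_add_eq]; exact he
  · intro e he
    simp only [Finset.mem_filter, Finset.mem_univ, true_and] at he
    have k := hφ e he
    exact uniq k (hφ' _ (by rw [← k.edgeD_add_eq]; exact he))
  · intro e he
    simp only [Finset.mem_filter, Finset.mem_univ, true_and] at he
    have k := hφ' e he
    exact uniq k (hφ _ (by rw [← k.edgeD_add_eq]; exact he))
  · intro e he
    simp only [Finset.mem_filter, Finset.mem_univ, true_and] at he
    exact h e _ (hφ e he)

theorem IsGeneralizedPolytope.theta_of_flat (hT : T.IsGeneralizedPolytope r) {e : T.OrientedEdge}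
    (he : T.edgeD r e + T.edgeD r (T.opp e) = 0) : T.theta r e = Real.pi := by
  rw [theta, hT.alpha_eq, hT.alpha_eq, edgeP_opp, show T.edgeD r (T.opp e) = -T.edgeD r e by linarith,
    neg_div, Real.arccos_neg]
  ring

theorem IsGeneralizedPolytope.cot_of_flat (hT : T.IsGeneralizedPolytope r) {e : T.OrientedEdge}
    (he : T.edgeD r e + T.edgeD r (T.opp e) = 0) :
    Real.cot (T.alpha r e) + Real.cot (T.alpha r (T.opp e)) = 0 := by
  rw [hT.cot_alpha, hT.cot_alpha, hsq, hsq, edgeP_opp,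
    show T.edgeD r (T.opp e) = -T.edgeD r e by linarith, neg_sq]
  ring

theorem IsConvexPolytope.isLocallyConvex (h : T.IsConvexPolytope r) : T.IsLocallyConvex r :=
  (T.isConvexPolytope_iff.1 h).2.2

/-- The factor cot α_e + cot α_{−e} vanishes at flat edges and is symmetric in the two sides, so an
exchange of sides between corresponding edges does no harm. -/
theorem curvatureDeriv_eq_curvatureDeriv (h : T.IsConvexPolytope r) (h' : T'.IsConvexPolytope r)
    (i j : singularSet M) : T.curvatureDeriv r i j = T'.curvatureDeriv r i j := by
  classical
  have hs : ∀ T : GeodesicTriangulation M, T.curvatureDeriv r i j = ∑ e : T.OrientedEdge,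
      if T.src e = i then (Real.cot (T.alpha r e) + Real.cot (T.alpha r (T.opp e))) /
        Real.sin (T.rho r e) * T.rhoDeriv r e j else 0 := fun T => by
    rw [curvatureDeriv, ← Finset.sum_filter]
    refine Finset.sum_congr ?_ fun _ _ => rfl
    ext e
    simp [mem_edgesFrom]
  rw [hs T, hs T']
  refine sum_eq_sum_of_corresponds h.isLocallyConvex h'.isLocallyConvex (fun e he => ?_)
    (fun e he => ?_) fun e e' hee => ?_
  · rw [h.1.cot_of_flat he]; simp
  · rw [h'.1.cot_of_flat he]; simp
  · rw [hee.src_eq, hee.cot_add_cot_eq h.1 h'.1, hee.sin_rho_eq h.1 h'.1, hee.rhoDeriv_eq h.1 h'.1]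

theorem IsConvexPolytope.curvature_eq (hM : IsEuclideanPolyhedral M) (h : T.IsConvexPolytope r)
    (h' : T'.IsConvexPolytope r) (i : singularSet M) : T.curvature r i = T'.curvature r i :=
  curvature_eq_curvature hM h.1 h'.1 (funext (q_eq_q r h.isLocallyConvex h'.isLocallyConvex)) i

theorem totalScalarCurvature_eq_totalScalarCurvature [Fintype (singularSet M)]
    (hM : IsEuclideanPolyhedral M) (h : T.IsConvexPolytope r) (h' : T'.IsConvexPolytope r) :
    T.totalScalarCurvature r = T'.totalScalarCurvature r := by
  rw [totalScalarCurvature, totalScalarCurvature]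
  congr 1
  · exact Finset.sum_congr rfl fun i _ => by rw [h.curvature_eq hM h']
  · congr 1
    refine sum_eq_sum_of_corresponds h.isLocallyConvex h'.isLocallyConvex (fun e he => ?_)
      (fun e he => ?_) fun e e' hee => ?_
    · rw [h.1.theta_of_flat he, sub_self, mul_zero]
    · rw [h'.1.theta_of_flat he, sub_self, mul_zero]
    · rw [hee.1, hee.theta_eq h.1 h'.1]

/-! ### The set of radii admitted by a triangulation -/

/-- Pythagoras. The squared height is the constant left after completing the square, so it can be
recovered from q near a single point. -/
theorem faceQ_eq_norm_sq (r : singularSet M → ℝ) (e : T.OrientedEdge) (z : Plane) :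
    T.faceQ r e.1 z = ‖z - T.fr e (T.edgeX r e) (T.edgeD r e)‖ ^ 2 + T.hsq r e := by
  obtain ⟨a, b, rfl⟩ := T.exists_fr e z
  rw [faceQ_fr, ← dist_eq_norm, dist_fr, Real.sq_sqrt (by positivity), hsq, edgeP]
  ring

/-- The leading parts cancel; testing with a small multiple of w − w₀ shows that the linear parts
agree, and evaluation at 0 gives the constants. -/
theorem eq_of_quadratic_eq {w w₀ : Plane} {h h₀ ε : ℝ} (hε : 0 < ε)
    (H : ∀ u : Plane, ‖u‖ < ε → ‖u + w‖ ^ 2 + h = ‖u + w₀‖ ^ 2 + h₀) : h = h₀ := by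
  have h0 := H 0 (by simpa using hε)
  rw [zero_add, zero_add] at h0
  have hw : w = w₀ := by
    set d := w - w₀ with hd
    have hn := norm_nonneg d
    set t := ε / (2 * (‖d‖ + 1)) with ht
    have ht0 : 0 < t := by positivity
    have h1 := H (t • d) (by
      rw [norm_smul, Real.norm_of_nonneg ht0.le, ht, div_mul_eq_mul_div, div_lt_iff₀ (by positivity)]
      nlinarith)
    rw [norm_add_sq_real, norm_add_sq_real] at h1
    have h2 : inner ℝ (t • d) w - inner ℝ (t • d) w₀ = t * ‖d‖ ^ 2 := by
      rw [← inner_sub_right, ← hd, real_inner_smul_left, real_inner_self_eq_norm_sq]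
    have h3 : t * ‖d‖ ^ 2 = 0 := by linarith
    have h4 : ‖d‖ = 0 := by
      rcases mul_eq_zero.1 h3 with h | h
      · exact absurd h ht0.ne'
      · exact pow_eq_zero_iff two_ne_zero |>.1 h
    exact sub_eq_zero.1 (norm_eq_zero.1 h4)
  rw [hw] at h0
  linarith

/-- An interior point of f may lie on an edge of T'; a small step along the normal of that edge
leads into a face of T' without leaving f. -/
theorem exists_interior_eq (T' : GeodesicTriangulation M) (f : Fin T.faceCount) :
    ∃ x ∈ interior (T.tri f), ∃ f', ∃ x' ∈ interior (T'.tri f'),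
      T.toSurface f x = T'.toSurface f' x' := by
  have hne : (interior (T.tri f)).Nonempty := by
    rw [tri, interior_convexHull_nonempty_iff_affineSpan_eq_top]
    exact (T.bary f).tot
  obtain ⟨x, hx⟩ := hne
  have hreg := T.regular_of_mem (T.interior_sub_corners hx)
  obtain ⟨ε, ψ, hψ⟩ := hreg.exists_chart
  rcases T'.regular_cases hreg with ⟨f', x', hx', h⟩ | ⟨e, s, hs, h⟩
  · exact ⟨x, hx, f', x', hx', h.symm⟩
  · obtain ⟨ε₁, h0, -, G, hG⟩ := T.exists_interior_form hx hψ
    obtain ⟨ε₂, h2, -, U, N, hU, hN, hUN, hf⟩ := T'.exists_edge_form e hs (h ▸ hψ)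
    set b := min ε₁ ε₂ / 2 with hb
    have hm : 0 < min ε₁ ε₂ := lt_min h0 h2
    have hb0 : 0 < b := by positivity
    have b1 : b < ε₁ := by linarith [min_le_left ε₁ ε₂]
    have b2 : b < ε₂ := by linarith [min_le_right ε₁ ε₂]
    obtain ⟨-, k2, k3⟩ := (hf 0 b (by nlinarith)).1 hb0.le
    obtain ⟨k4, k5⟩ := hG (G.symm (b • N)) (by
      rw [G.symm.norm_map, norm_smul, hN, mul_one, Real.norm_of_nonneg hb0.le]; exact b1)
    rw [G.apply_symm_apply] at k5
    refine ⟨_, k4, e.1, _, k2 hb0, ?_⟩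
    rw [k5]
    simpa [pos] using k3.symm

/-- A triangulation that is locally convex at the radii of a convex polytope supports it. -/
theorem IsConvexPolytope.of_isLocallyConvex (h : T.IsConvexPolytope r) (h' : T'.IsLocallyConvex r) :
    T'.IsConvexPolytope r := by
  refine T'.isConvexPolytope_iff.2 ⟨h.1.1, fun e' => ?_, h'⟩
  -- Near a point interior to a face of each triangulation the two quadratic polynomials are the
  -- same function q, so the squared heights coincide and positivity passes from T to T'.
  obtain ⟨x', hx', f, x, hx, hxx⟩ := exists_interior_eq T e'.1
  have hq : T.q r = T'.q r := funext (q_eq_q r h.isLocallyConvex h')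
  obtain ⟨ε, ψ, hψ⟩ := (T.regular_of_mem (T.interior_sub_corners hx)).exists_chart
  obtain ⟨ε₁, h1, -, G, hG⟩ := T.exists_interior_form hx hψ
  obtain ⟨ε₂, h2, -, G', hG'⟩ := T'.exists_interior_form hx' (hxx ▸ hψ)
  have aux : ∀ (T : GeodesicTriangulation M) (e : T.OrientedEdge) (x : Plane) (ε₁ : ℝ)
      (G : Plane ≃ₗᵢ[ℝ] Plane), (∀ v : Plane, ‖v‖ < ε₁ →
      x + v ∈ interior (T.tri e.1) ∧ T.toSurface e.1 (x + v) = ψ (G v)) → ∀ u : Plane, ‖u‖ < ε₁ →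
      T.q r (ψ u) = ‖u + G (x - T.fr e (T.edgeX r e) (T.edgeD r e))‖ ^ 2 + T.hsq r e := by
    intro T e x ε₁ G hG u hu
    obtain ⟨k1, k2⟩ := hG (G.symm u) (by rwa [G.symm.norm_map])
    rw [G.apply_symm_apply] at k2
    rw [← k2, T.q_toSurface r (interior_subset k1), faceQ_eq_norm_sq]
    congr 2
    rw [← G.norm_map, add_sub_right_comm, map_add, G.apply_symm_apply, add_comm]
  have k1 := aux T (f, 0) x ε₁ G hG
  have k2 := aux T' e' x' ε₂ G' hG'
  have := eq_of_quadratic_eq (lt_min h1 h2) fun u hu =>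
    (k1 u (hu.trans_le (min_le_left _ _))).symm.trans
      ((congrFun hq _).trans (k2 u (hu.trans_le (min_le_right _ _))))
  rw [← this]
  exact h.1.hsq_pos _

variable [Fintype (singularSet M)]

theorem isClosed_isLocallyConvex (T : GeodesicTriangulation M) : IsClosed {r | T.IsLocallyConvex r} := by
  simp only [IsLocallyConvex, ofPred_forall]
  exact isClosed_iInter fun e => isClosed_le continuous_const
    ((T.differentiable_edgeD e).continuous.add (T.differentiable_edgeD (T.opp e)).continuous)

/-- Near a convex polytope, the space of convex polytopes is a finite union of sets on each of which
the triangulation is fixed. -/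
theorem exists_finite_cover [CompactSpace M] (hM : IsEuclideanPolyhedral M)
    (hr : r ∈ polytopeSpace M) : ∃ F : Set (GeodesicTriangulation M), F.Finite ∧
      (∀ T ∈ F, T.IsConvexPolytope r) ∧
      (⋃ T ∈ F, {s | T.IsConvexPolytope s}) ∈ 𝓝[polytopeSpace M] r := by
  obtain ⟨T₀, h₀⟩ := hr
  obtain ⟨L, hL⟩ : ∃ L, ∀ i, r i < L := by
    obtain ⟨L, hL⟩ := (Set.finite_range r).bddAbove
    exact ⟨L + 1, fun i => by linarith [hL (mem_range_self i)]⟩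
  obtain ⟨F, hF, hF'⟩ := exists_finite_family hM L
  refine ⟨{T ∈ F | T.IsConvexPolytope r}, hF.subset (sep_subset _ _), fun T hT => hT.2, ?_⟩
  have e1 : ∀ᶠ s in 𝓝 r, ∀ i, s i < L :=
    eventually_all.2 fun i => (continuous_apply i).continuousAt.eventually_lt continuousAt_const (hL i)
  -- A triangulation not convex at r cannot be locally convex there, by `of_isLocallyConvex`. It
  -- thus violates a closed condition at r, and so also near r.
  have e2 : ∀ᶠ s in 𝓝 r, ∀ T ∈ F, ¬ T.IsConvexPolytope r → ¬ T.IsConvexPolytope s := by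
    refine (eventually_all_finite hF).2 fun T _ => ?_
    by_cases hc : T.IsLocallyConvex r
    · exact Eventually.of_forall fun s h => absurd (h₀.of_isLocallyConvex hc) h
    · filter_upwards [T.isClosed_isLocallyConvex.isOpen_compl.mem_nhds hc] with s hs _ h
      exact hs h.isLocallyConvex
  rw [mem_nhdsWithin_iff_eventually]
  filter_upwards [e1, e2] with s h1 h2 hs
  obtain ⟨T, hT, hTs⟩ := hF' s hs h1
  refine mem_biUnion (x := T) ⟨hT, ?_⟩ hTs
  by_contra hn
  exact h2 T hT hn hTs

end GeodesicTriangulation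

/-! ### Triangulations without loops and multiple edges -/

namespace GeodesicTriangulation

variable {M : Type*} [MetricSpace M] {T : GeodesicTriangulation M} {r : singularSet M → ℝ}

theorem IsSimple.curvatureDeriv_src_tgt (hT : T.IsSimple) (r : singularSet M → ℝ)
    (e : T.OrientedEdge) : T.curvatureDeriv r (T.src e) (T.tgt e) =
      (Real.cot (T.alpha r e) + Real.cot (T.alpha r (T.opp e))) /
        (T.len e * Real.sin (T.rho r e) * Real.sin (T.rho r (T.opp e))) := by
  rw [curvatureDeriv, Finset.sum_eq_single e]
  · rw [rhoDeriv, if_neg (hT.1 e), if_pos rfl, div_mul_div_comm, mul_one]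
    congr 1
    ring
  · intro e' he' hne
    rw [mem_edgesFrom] at he'
    rw [rhoDeriv, he', if_neg (hT.1 e), if_neg fun h => hne (hT.2 e' e he' h), mul_zero]
  · exact fun h => absurd (T.mem_edgesFrom.2 rfl) h

theorem curvatureDeriv_eq_zero (r : singularSet M → ℝ) {i j : singularSet M} (hij : i ≠ j)
    (h : ∀ e : T.OrientedEdge, ¬ (T.src e = i ∧ T.tgt e = j)) : T.curvatureDeriv r i j = 0 := by
  refine Finset.sum_eq_zero fun e he => ?_
  rw [mem_edgesFrom] at he
  rw [rhoDeriv, he, if_neg hij, if_neg fun h' => h e ⟨he, h'⟩, mul_zero]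

theorem IsSimple.curvatureDeriv_self (hT : T.IsSimple) (r : singularSet M → ℝ) (i : singularSet M) :
    T.curvatureDeriv r i i =
      -∑ e ∈ T.edgesFrom i, Real.cos (T.phi r e) * T.curvatureDeriv r i (T.tgt e) := by
  rw [curvatureDeriv, ← Finset.sum_neg_distrib]
  refine Finset.sum_congr rfl fun e he => ?_
  rw [mem_edgesFrom] at he
  subst he
  rw [hT.curvatureDeriv_src_tgt, rhoDeriv, if_pos rfl, if_neg (hT.1 e).symm, mul_neg,
    div_mul_div_comm, ← mul_div_assoc]
  congr 2 <;> ring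

end GeodesicTriangulation

open GeodesicTriangulation

/-! ### The curvatures and H as functions on the space of polytopes -/

section

variable {M : Type*} [MetricSpace M] {r : singularSet M → ℝ}

theorem polytopeCurvature_eq (hM : IsEuclideanPolyhedral M) {T : GeodesicTriangulation M}
    (h : T.IsConvexPolytope r) (i : singularSet M) : polytopeCurvature M i r = T.curvature r i := by
  have hr : r ∈ polytopeSpace M := ⟨T, h⟩
  rw [polytopeCurvature, dif_pos hr]
  exact hr.choose_spec.curvature_eq hM h i

open scoped Classical in
/-- The partial derivatives of the curvatures as functions on `P(M)` (zero outside). -/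
noncomputable def polytopeCurvatureDeriv (M : Type*) [MetricSpace M] (i j : singularSet M)
    (r : singularSet M → ℝ) : ℝ :=
  if h : r ∈ polytopeSpace M then h.choose.curvatureDeriv r i j else 0

theorem polytopeCurvatureDeriv_eq {T : GeodesicTriangulation M} (h : T.IsConvexPolytope r)
    (i j : singularSet M) : polytopeCurvatureDeriv M i j r = T.curvatureDeriv r i j := by
  have hr : r ∈ polytopeSpace M := ⟨T, h⟩
  rw [polytopeCurvatureDeriv, dif_pos hr]
  exact curvatureDeriv_eq_curvatureDeriv hr.choose_spec h i j

variable [Fintype (singularSet M)]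

theorem polytopeTotalCurvature_eq (hM : IsEuclideanPolyhedral M) {T : GeodesicTriangulation M}
    (h : T.IsConvexPolytope r) : polytopeTotalCurvature M r = T.totalScalarCurvature r := by
  have hr : r ∈ polytopeSpace M := ⟨T, h⟩
  rw [polytopeTotalCurvature, dif_pos hr]
  exact totalScalarCurvature_eq_totalScalarCurvature hM hr.choose_spec h

theorem HasFDerivWithinAt.biUnion {ι E F : Type*} [NormedAddCommGroup E] [NormedSpace ℝ E]
    [NormedAddCommGroup F] [NormedSpace ℝ F] {f : E → F} {f' : E →L[ℝ] F} {x : E} {I : Set ι}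
    (hI : I.Finite) {s : ι → Set E} (h : ∀ i ∈ I, HasFDerivWithinAt f f' (s i) x) :
    HasFDerivWithinAt f f' (⋃ i ∈ I, s i) x := by
  induction I, hI using Set.Finite.induction_on with
  | empty => simp
  | insert _ _ ih =>
    rw [biUnion_insert]
    exact (h _ (mem_insert _ _)).union (ih fun i hi => h i (mem_insert_of_mem _ hi))

/-- Near r the space P(M) is a finite union of pieces through r, on each of which f is one of the
smooth functions g T. As all of these have the same differential at r, it is the differential of f
relative to the union. -/
theorem hasFDerivWithinAt_polytopeSpace [CompactSpace M] (hM : IsEuclideanPolyhedral M)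
    (hr : r ∈ polytopeSpace M) {F : Type*} [NormedAddCommGroup F] [NormedSpace ℝ F]
    {f : (singularSet M → ℝ) → F} {f' : (singularSet M → ℝ) →L[ℝ] F}
    {g : GeodesicTriangulation M → (singularSet M → ℝ) → F}
    (hfg : ∀ T s, T.IsConvexPolytope s → f s = g T s)
    (hg : ∀ T, T.IsConvexPolytope r → HasFDerivAt (g T) f' r) :
    HasFDerivWithinAt f f' (polytopeSpace M) r := by
  obtain ⟨I, hI, hI', hmem⟩ := exists_finite_cover hM hr
  refine (HasFDerivWithinAt.biUnion hI fun T hT => ?_).mono_of_mem_nhdsWithin hmem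
  exact (hg T (hI' T hT)).hasFDerivWithinAt.congr (fun s hs => hfg T s hs) (hfg T r (hI' T hT))

theorem hasFDerivWithinAt_polytopeCurvature [CompactSpace M] (hM : IsEuclideanPolyhedral M)
    {T : GeodesicTriangulation M} (h : T.IsConvexPolytope r) (i : singularSet M) :
    HasFDerivWithinAt (polytopeCurvature M i) (∑ j, T.curvatureDeriv r i j •
      (ContinuousLinearMap.proj j : (singularSet M → ℝ) →L[ℝ] ℝ)) (polytopeSpace M) r := by
  refine hasFDerivWithinAt_polytopeSpace hM ⟨T, h⟩ (g := fun T r => T.curvature r i)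
    (fun T s hs => polytopeCurvature_eq hM hs i) fun T' h' => ?_
  simp only [curvatureDeriv_eq_curvatureDeriv h h']
  exact h'.1.hasFDerivAt_curvature i

theorem hasFDerivWithinAt_polytopeTotalCurvature [CompactSpace M] (hM : IsEuclideanPolyhedral M)
    (hr : r ∈ polytopeSpace M) :
    HasFDerivWithinAt (polytopeTotalCurvature M) (∑ i, polytopeCurvature M i r •
      (ContinuousLinearMap.proj i : (singularSet M → ℝ) →L[ℝ] ℝ)) (polytopeSpace M) r := by
  refine hasFDerivWithinAt_polytopeSpace hM hr (g := fun T r => T.totalScalarCurvature r)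
    (fun T s hs => polytopeTotalCurvature_eq hM hs) fun T' h' => ?_
  simp only [polytopeCurvature_eq hM h']
  exact h'.1.hasFDerivAt_totalScalarCurvature

theorem continuousOn_polytopeCurvatureDeriv [CompactSpace M] (hM : IsEuclideanPolyhedral M)
    (i j : singularSet M) : ContinuousOn (polytopeCurvatureDeriv M i j) (polytopeSpace M) := by
  intro r hr
  obtain ⟨I, hI, hI', hmem⟩ := exists_finite_cover hM hr
  refine ContinuousWithinAt.mono_of_mem_nhdsWithin ?_ hmem
  simp only [ContinuousWithinAt, nhdsWithin_biUnion hI, tendsto_iSup]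
  intro T hT
  exact (hI' T hT).1.continuousAt_curvatureDeriv i j |>.continuousWithinAt.congr
    (fun s hs => polytopeCurvatureDeriv_eq hs i j) (polytopeCurvatureDeriv_eq (hI' T hT) i j)

/-- Neither openness of P(M) nor uniqueness of derivatives relative to it is assumed; regularity is
shown by exhibiting a derivative within P(M) that is continuous there. -/
theorem contDiffOn_polytopeCurvature [CompactSpace M] (hM : IsEuclideanPolyhedral M)
    (i : singularSet M) : ContDiffOn ℝ 1 (polytopeCurvature M i) (polytopeSpace M) := by
  rw [show (1 : WithTop ℕ∞) = 0 + 1 by norm_num, contDiffOn_succ_iff_hasFDerivWithinAt (by simp)]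
  intro r hr
  refine ⟨polytopeSpace M, by rw [insert_eq_of_mem hr]; exact self_mem_nhdsWithin, by simp,
    fun r => ∑ j, polytopeCurvatureDeriv M i j r •
      (ContinuousLinearMap.proj j : (singularSet M → ℝ) →L[ℝ] ℝ), ?_, ?_⟩
  · rintro r ⟨T, h⟩
    simp only [polytopeCurvatureDeriv_eq h]
    exact hasFDerivWithinAt_polytopeCurvature hM h i
  · rw [contDiffOn_zero]
    exact continuousOn_finsetSum _ fun j _ =>
      (continuousOn_polytopeCurvatureDeriv hM i j).smul continuousOn_const

theorem contDiffOn_polytopeTotalCurvature [CompactSpace M] (hM : IsEuclideanPolyhedral M) :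
    ContDiffOn ℝ 2 (polytopeTotalCurvature M) (polytopeSpace M) := by
  rw [show (2 : WithTop ℕ∞) = 1 + 1 by norm_num, contDiffOn_succ_iff_hasFDerivWithinAt (by simp)]
  intro r hr
  refine ⟨polytopeSpace M, by rw [insert_eq_of_mem hr]; exact self_mem_nhdsWithin, by simp,
    fun r => ∑ j, polytopeCurvature M j r •
      (ContinuousLinearMap.proj j : (singularSet M → ℝ) →L[ℝ] ℝ), ?_, ?_⟩
  · exact fun r hr => hasFDerivWithinAt_polytopeTotalCurvature hM hr
  · exact ContDiffOn.sum fun j _ => (contDiffOn_polytopeCurvature hM j).smul contDiffOn_const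

end

theorem mainTheorem11 (M : Type*) [MetricSpace M] [Fintype (singularSet M)]
    (hsphere : Nonempty (M ≃ₜ Metric.sphere (0 : Space) 1))
    (hM : IsEuclideanPolyhedral M) :
    -- `H` and the `κ_i` do not depend on the triangulation that represents the polytope
    (∀ (T : GeodesicTriangulation M) (r : singularSet M → ℝ), T.IsConvexPolytope r →
      polytopeTotalCurvature M r = T.totalScalarCurvature r ∧
      ∀ i, polytopeCurvature M i r = T.curvature r i) ∧
    -- `H` is of class `C²`
    ContDiffOn ℝ 2 (polytopeTotalCurvature M) (polytopeSpace M) ∧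
    -- `∂H/∂r_i = κ_i`
    (∀ r ∈ polytopeSpace M,
      HasFDerivWithinAt (polytopeTotalCurvature M)
        (∑ i, polytopeCurvature M i r •
          (ContinuousLinearMap.proj i : (singularSet M → ℝ) →L[ℝ] ℝ))
        (polytopeSpace M) r) ∧
    ∀ (T : GeodesicTriangulation M) (r : singularSet M → ℝ), T.IsConvexPolytope r →
      -- the derivatives of the `κ_i` for an arbitrary triangulation
      (∀ i, HasFDerivWithinAt (polytopeCurvature M i)
        (∑ j, T.curvatureDeriv r i j •
          (ContinuousLinearMap.proj j : (singularSet M → ℝ) →L[ℝ] ℝ))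
        (polytopeSpace M) r) ∧
      -- the same derivatives if there are neither loops nor multiple edges
      (T.IsSimple →
        (∀ e : T.OrientedEdge, T.curvatureDeriv r (T.src e) (T.tgt e) =
          (Real.cot (T.alpha r e) + Real.cot (T.alpha r (T.opp e))) /
            (T.len e * Real.sin (T.rho r e) * Real.sin (T.rho r (T.opp e)))) ∧
        (∀ i j, i ≠ j → (∀ e : T.OrientedEdge, ¬ (T.src e = i ∧ T.tgt e = j)) →
          T.curvatureDeriv r i j = 0) ∧
        (∀ i, T.curvatureDeriv r i i =
          -∑ e ∈ T.edgesFrom i,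
            Real.cos (T.phi r e) * T.curvatureDeriv r i (T.tgt e))) := by

  obtain ⟨φ⟩ := hsphere
  -- The homeomorphism with the sphere enters only through compactness.
  have : CompactSpace M := φ.symm.compactSpace
  exact ⟨fun T r h => ⟨polytopeTotalCurvature_eq hM h, polytopeCurvature_eq hM h⟩,
    contDiffOn_polytopeTotalCurvature hM,
    fun r hr => hasFDerivWithinAt_polytopeTotalCurvature hM hr,
    fun T r h => ⟨hasFDerivWithinAt_polytopeCurvature hM h, fun hT =>
      ⟨hT.curvatureDeriv_src_tgt r, fun i j hij he => curvatureDeriv_eq_zero r hij he,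
        hT.curvatureDeriv_self r⟩⟩⟩
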